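/- All functions are real-valued. Write points of $\mathbb{R}^2$ as $(x,z)$ and let $\hat\eta(k)=\frac1{2\pi}\int_{\mathbb{R}^2}\eta(x,z)e^{-\mathrm{i}(k_1x+k_3z)}\,\mathrm{d}x\,\mathrm{d}z$, $k=(k_1,k_3)$. Let $\|\cdot\|_s$ be the usual norm of $H^s$, let $\Sigma=\{(x,y,z)\colon y<0\}$ and fix $\delta\in(0,\frac15)$. Put $B=B_\delta(1,0)\cup B_\delta(-1,0)\subset\mathbb{R}^2$, write $\eta=\eta_1+\eta_2$ with $\hat\eta_1=\chi_B\hat\eta$, $\hat\eta_2=(1-\chi_B)\hat\eta$, and let $$\mathcal{Z}=\{\eta\in\mathcal{S}'(\mathbb{R}^2)\colon \|\eta\|_{\mathcal Z}:=\|\hat\eta_1\|_{L^1(\mathbb{R}^2)}+\|\eta_2\|_3<\infty\}.$$ Let $H^3_\star(\Sigma)$ be the completion, with respect to $\|u\|_{3,\star}^2=\|u_x\|_2^2+\|u_y\|_2^2+\|u_z\|_2^2$ (norms of $H^2(\Sigma)$), of the space of functions $u\in C^\infty(\overline\Sigma)$ with $\|u\|_{3,\star}<\infty$ for which $|(x,z)|^m\,|\partial_x^{\alpha_1}\partial_y^{\alpha_2}\partial_z^{\alpha_3}u|$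 is bounded for all $m,\alpha_1,\alpha_2,\alpha_3\in\mathbb{N}_0$; its elements are determined up to additive constants by their gradients. For $\eta\in\mathcal{Z}$ and $\xi\in H^{5/2}(\mathbb{R}^2)$ consider the boundary-value problem $$\varphi_{xx}+\varphi_{yy}+\varphi_{zz}=0\ \ (y<\eta),\qquad \varphi_y\to0\ \ (y\to-\infty),\qquad \varphi_y-\eta_x\varphi_x-\eta_z\varphi_z=\xi_x\ \ (y=\eta)\tag{1}$$ and its flattened version for $u(x,y,z)=\varphi(x,y+\eta(x,z),z)$, $$u_{xx}+u_{yy}+u_{zz}=\partial_xF_1+\partial_yF_2+\partial_zF_3\ \ (y<0),\qquad u_y\to0\ \ (y\to-\infty),\qquad u_y=F_2+\xi_x\ \ (y=0),\tag{2}$$ where $F_1=\eta_xu_y$, $F_2=\eta_xu_x+\eta_zu_z-(\eta_x^2+\eta_z^2)u_y$, $F_3=\eta_zu_y$. The equations hold in the sense of distributions, the boundary conditions in the sense of traces. There exists $M>0$ such that the following statements hold. (i) For each $\eta\in\mathcal{Z}$ with $\|\eta\|_{\mathcal Z}<M$ and each $\xi\in H^{5/2}(\mathbb{R}^2)$, problem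 (2) has a unique solution $u\in H^3_\star(\Sigma)$; moreover $\varphi(x,y,z)=u(x,y-\eta(x,z),z)$ is the unique solution (up to an additive constant) of (1) whose flattened version belongs to $H^3_\star(\Sigma)$. The mapping $\eta\mapsto(\xi\mapsto u)$ takes values in $\mathcal{L}(H^{5/2}(\mathbb{R}^2),H^3_\star(\Sigma))$ and is analytic at the origin of $\mathcal{Z}$. (ii) The formulae $$K(\eta)\xi=-(\varphi|_{y=\eta})_x=-u_x|_{y=0},\qquad L(\eta)\xi=-(\varphi|_{y=\eta})_z=-u_z|_{y=0}$$ define mappings $\eta\mapsto K(\eta)$, $\eta\mapsto L(\eta)$ from $\{\|\eta\|_{\mathcal Z}<M\}\subset\mathcal{Z}$ to $\mathcal{L}(H^{5/2}(\mathbb{R}^2),H^{3/2}(\mathbb{R}^2))$ which are analytic at the origin. (iii) $H^3(\mathbb{R}^2)$ is continuously embedded in $\mathcal{Z}$, and with $U=\{\eta\in H^3(\mathbb{R}^2)\colon\|\eta\|_{\mathcal Z}<M\}$ the formulae $$\mathcal{K}'(\eta)=\eta-\left[\frac{\eta_x}{\sqrt{1+\eta_x^2+\eta_z^2}}\right]_x-\left[\frac{\eta_z}{\sqrt{1+\eta_x^2+\eta_z^2}}\right]_z,$$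 $$\mathcal{L}'(\eta)=-\tfrac12(K(\eta)\eta)^2-\tfrac12(L(\eta)\eta)^2+\frac{(\eta_x-\eta_xK(\eta)\eta-\eta_zL(\eta)\eta)^2}{2(1+\eta_x^2+\eta_z^2)}+K(\eta)\eta$$ define functions $U\to H^1(\mathbb{R}^2)$ which are analytic at the origin and satisfy $\mathcal{K}'(0)=\mathcal{L}'(0)=0$. -/

import Mathlib

open MeasureTheory FourierTransform
open scoped NNReal ENNReal ContDiff

noncomputable section

namespace WaterWave

/-! ## Ambient spaces

`Plane` is `ℝ²` with the horizontal coordinates `(x, z)`; a point of `Space` is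
`((x, z), y)` with the vertical coordinate last. Partial derivatives in `Space` are indexed by
`0 = x`, `1 = y`, `2 = z`, those in `Plane` by `0 = x`, `1 = z`. -/

abbrev Plane : Type := EuclideanSpace ℝ (Fin 2)

abbrev Space : Type := Plane × ℝ

/-- The unit vectors `e_x`, `e_z` of the plane. -/
def planeDir (i : Fin 2) : Plane := EuclideanSpace.single i 1

/-- The unit vectors `e_x`, `e_y`, `e_z` of the space. -/
def spaceDir : Fin 3 → Space := ![(planeDir 0, 0), (0, 1), (planeDir 1, 0)]

/-- Classical partial derivatives in the plane (`0 = x`, `1 = z`). -/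
def planeDeriv (i : Fin 2) (f : Plane → ℝ) : Plane → ℝ := fun q => fderiv ℝ f q (planeDir i)

/-- Classical partial derivatives in space (`0 = x`, `1 = y`, `2 = z`). -/
def spaceDeriv (i : Fin 3) (f : Space → ℝ) : Space → ℝ := fun p => fderiv ℝ f p (spaceDir i)

/-- `∂_x^{α₀} ∂_y^{α₁} ∂_z^{α₂} f`. -/
def spaceMultiDeriv (α : Fin 3 → ℕ) (f : Space → ℝ) : Space → ℝ :=
  (spaceDeriv 0)^[α 0] ((spaceDeriv 1)^[α 1] ((spaceDeriv 2)^[α 2] f))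

/-- `{y < η(x, z)}`, the fluid domain below the graph of `η`. -/
def fluidDomain (η : Plane → ℝ) : Set Space := {p | p.2 < η p.1}

/-- The lower half-space `Σ = {y < 0}`. -/
def halfSpace : Set Space := {p | p.2 < 0}

/-- Lebesgue measure on the half-space. -/
abbrev halfVol : Measure Space := (volume : Measure Space).restrict halfSpace

/-- Real-valued test functions `ψ ∈ C_c^∞(Ω)`. -/
def IsTest {E : Type*} [NormedAddCommGroup E] [NormedSpace ℝ E] (Ω : Set E) (ψ : E → ℝ) : Prop :=
  ContDiff ℝ ∞ ψ ∧ HasCompactSupport ψ ∧ tsupport ψ ⊆ Ω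

/-- `d` is the weak partial derivative `∂_i f` of `f` on `ℝ²`. -/
def HasWeakPartial (i : Fin 2) (f d : Plane → ℝ) : Prop :=
  LocallyIntegrable f ∧ LocallyIntegrable d ∧
    ∀ ψ : Plane → ℝ, IsTest Set.univ ψ → ∫ q, d q * ψ q = -∫ q, f q * planeDeriv i ψ q

/-! ## The Sobolev spaces `H^s(ℝ²)`, `s ≥ 0`, of real-valued functions

Mathlib's Fourier transform is `𝓕 f w = ∫ f(v) e^{-2πi⟨v, w⟩} dv`, so the wave vector is
`k = 2πw`. -/

/-- `(1 + |k|²)^{s/2}` with `k = 2πw`. -/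
def weight (s : ℝ) (w : Plane) : ℝ := (1 + ‖(2 * Real.pi) • w‖ ^ 2) ^ (s / 2)

theorem weight_pos (s : ℝ) (w : Plane) : 0 < weight s w := by
  unfold weight; positivity

theorem continuous_weight (s : ℝ) : Continuous (weight s) := by
  unfold weight
  refine Continuous.rpow_const (by fun_prop) fun w => Or.inl ?_
  positivity

theorem weight_mono {t s : ℝ} (h : t ≤ s) (w : Plane) : weight t w ≤ weight s w := by
  unfold weight
  refine Real.rpow_le_rpow_of_exponent_le ?_ (by linarith)
  nlinarith [sq_nonneg ‖(2 * Real.pi) • w‖]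

/-- The (`L²`-)Fourier transform of a real-valued `L²` function. -/
def fourierReal (f : Lp ℝ 2 (volume : Measure Plane)) : Lp ℂ 2 (volume : Measure Plane) :=
  𝓕 (Complex.ofRealCLM.compLpL 2 volume f)

theorem fourierReal_add (f g : Lp ℝ 2 (volume : Measure Plane)) :
    fourierReal (f + g) = fourierReal f + fourierReal g := by
  unfold fourierReal
  rw [map_add, FourierAdd.fourier_add]

theorem fourierReal_smul (c : ℝ) (f : Lp ℝ 2 (volume : Measure Plane)) :
    fourierReal (c • f) = c • fourierReal f := by
  unfold fourierReal
  rw [map_smul]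
  exact (Lp.fourierTransformₗᵢ Plane ℂ).toLinearMap.map_smul_of_tower c _

theorem fourierReal_injective : Function.Injective fourierReal := by
  intro f g h
  unfold fourierReal at h
  have h1 := (Lp.fourierTransformₗᵢ Plane ℂ).injective h
  apply Lp.ext
  have hf := Complex.ofRealCLM.coeFn_compLpL (p := 2) (μ := (volume : Measure Plane)) f
  have hg := Complex.ofRealCLM.coeFn_compLpL (p := 2) (μ := (volume : Measure Plane)) g
  rw [h1] at hf
  filter_upwards [hf, hg] with x h2 h3
  rw [h2] at h3
  simpa using h3

/-- The set of `f ∈ L²(ℝ²; ℝ)` with `(1 + |k|²)^{s/2} f̂ ∈ L²`. -/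
def sobolevSubmodule (s : ℝ≥0) : Submodule ℝ (Lp ℝ 2 (volume : Measure Plane)) where
  carrier := {f | MemLp (fun w => weight s w • fourierReal f w) 2 volume}
  zero_mem' := by
    have h : fourierReal 0 = 0 := by simpa using fourierReal_smul 0 0
    refine (MemLp.zero (p := 2) (μ := (volume : Measure Plane)) (ε := ℂ)).ae_eq ?_
    rw [h]
    filter_upwards [Lp.coeFn_zero ℂ 2 (volume : Measure Plane)] with w hw
    rw [hw]
    exact (smul_zero _).symm
  add_mem' := by
    intro f g hf hg
    refine (MemLp.add hf hg).ae_eq ?_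
    rw [fourierReal_add]
    filter_upwards [Lp.coeFn_add (fourierReal f) (fourierReal g)] with w hw
    rw [hw]
    exact (smul_add _ _ _).symm
  smul_mem' := by
    intro c f hf
    refine (MemLp.const_smul hf c).ae_eq ?_
    rw [fourierReal_smul]
    filter_upwards [Lp.coeFn_smul c (fourierReal f)] with w hw
    simp only [Pi.smul_apply, hw]
    rw [smul_comm]

/-- The Sobolev space `H^s(ℝ²)` of real-valued functions. -/
def Sobolev (s : ℝ≥0) : Type := sobolevSubmodule s

namespace Sobolev

instance (s : ℝ≥0) : AddCommGroup (Sobolev s) := inferInstanceAs (AddCommGroup (sobolevSubmodule s))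

instance (s : ℝ≥0) : Module ℝ (Sobolev s) := inferInstanceAs (Module ℝ (sobolevSubmodule s))

/-- The underlying `L²` function. -/
def toL2 {s : ℝ≥0} : Sobolev s →ₗ[ℝ] Lp ℝ 2 (volume : Measure Plane) :=
  (sobolevSubmodule s).subtype

instance (s : ℝ≥0) : CoeFun (Sobolev s) (fun _ => Plane → ℝ) := ⟨fun f => toL2 f⟩

/-- `f ↦ (1 + |k|²)^{s/2} f̂`, which defines the norm of `H^s(ℝ²)`. -/
def weightedFourier (s : ℝ≥0) : Sobolev s →ₗ[ℝ] Lp ℂ 2 (volume : Measure Plane) where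
  toFun f := MemLp.toLp _ (show MemLp (fun w => weight s w • fourierReal (toL2 f) w) 2 volume
    from f.2)
  map_add' f g := by
    rw [← MemLp.toLp_add]
    apply MemLp.toLp_congr
    rw [map_add, fourierReal_add]
    filter_upwards [Lp.coeFn_add (fourierReal (toL2 f)) (fourierReal (toL2 g))] with w hw
    rw [hw]
    exact smul_add _ _ _
  map_smul' c f := by
    rw [RingHom.id_apply, ← MemLp.toLp_const_smul]
    apply MemLp.toLp_congr
    rw [map_smul, fourierReal_smul]
    filter_upwards [Lp.coeFn_smul c (fourierReal (toL2 f))] with w hw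
    simp only [Pi.smul_apply, hw]
    rw [smul_comm]

theorem weightedFourier_injective (s : ℝ≥0) : Function.Injective (weightedFourier s) := by
  intro f g h
  apply Subtype.ext
  apply fourierReal_injective
  have h1 := (MemLp.toLp_eq_toLp_iff (show MemLp (fun w => weight s w • fourierReal (toL2 f) w)
    2 volume from f.2) (show MemLp (fun w => weight s w • fourierReal (toL2 g) w)
    2 volume from g.2)).1 h
  apply Lp.ext
  filter_upwards [h1] with w hw
  exact smul_right_injective ℂ (weight_pos s w).ne' hw

instance (s : ℝ≥0) : NormedAddCommGroup (Sobolev s) :=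
  NormedAddCommGroup.induced (Sobolev s) _ (weightedFourier s) (weightedFourier_injective s)

instance (s : ℝ≥0) : NormedSpace ℝ (Sobolev s) :=
  NormedSpace.induced ℝ (Sobolev s) _ (weightedFourier s)

/-- `‖f‖_s = ‖(1 + |k|²)^{s/2} f̂‖_{L²}`. -/
theorem norm_def {s : ℝ≥0} (f : Sobolev s) :
    ‖f‖ = (eLpNorm (fun w => weight s w • fourierReal (toL2 f) w) 2 volume).toReal :=
  Lp.norm_toLp _ (show MemLp (fun w => weight s w • fourierReal (toL2 f) w) 2 volume from f.2)

/-- The inclusion `H^s(ℝ²) ⊆ H^t(ℝ²)` for `t ≤ s`. -/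
def incl {t s : ℝ≥0} (h : t ≤ s) : Sobolev s →ₗ[ℝ] Sobolev t :=
  Submodule.inclusion (p := sobolevSubmodule s) (p' := sobolevSubmodule t) (by
    intro f hf
    refine MemLp.mono hf ?_ (Filter.Eventually.of_forall fun w => ?_)
    · exact ((continuous_weight t).aestronglyMeasurable).smul (Lp.aestronglyMeasurable _)
    · rw [norm_smul, norm_smul, Real.norm_of_nonneg (weight_pos t w).le,
        Real.norm_of_nonneg (weight_pos s w).le]
      exact mul_le_mul_of_nonneg_right (weight_mono (by exact_mod_cast h) w) (norm_nonneg _))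

end Sobolev

/-! ## The space `𝒵`

With `B = B_r(1,0) ∪ B_r(-1,0)` and `η̂₁ = 1_B η̂`, `η̂₂ = (1 - 1_B) η̂`, the space `𝒵` consists of
the real `η` with `‖η‖_𝒵 = ‖η̂₁‖_{L¹} + ‖η₂‖_{H³} < ∞`. Finiteness of this norm forces `η̂` to be
integrable, so `η` is a continuous function, recovered from `η̂` by the Fourier inversion integral.
An element of `𝒵` is stored as the pair `(η, 𝓕 η)`. -/

/-- The set `B`, expressed in Mathlib's frequency variable `w = k / 2π`. -/
def freqSet (r : ℝ) : Set Plane :=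
  {w | (2 * Real.pi) • w ∈ Metric.ball (planeDir 0) r ∪ Metric.ball (-planeDir 0) r}

theorem measurableSet_freqSet (r : ℝ) : MeasurableSet (freqSet r) := by
  have h : IsOpen (freqSet r) :=
    (Metric.isOpen_ball.union Metric.isOpen_ball).preimage (continuous_const_smul (2 * Real.pi))
  exact h.measurableSet

/-- The pairs `(η, g)` with `η` real-valued, `g ∈ L¹`, `η = 𝓕⁻ g` and
`(1 + |k|²)^{3/2} g ∈ L²(Bᶜ)`. -/
def zSubmodule (r : ℝ) :
    Submodule ℝ ((Plane → ℝ) × Lp ℂ 1 (volume : Measure Plane)) where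
  carrier := {a | (∀ q, (a.1 q : ℂ) = 𝓕⁻ (a.2 : Plane → ℂ) q) ∧
    MemLp (fun w => weight 3 w • a.2 w) 2 (volume.restrict (freqSet r)ᶜ)}
  zero_mem' := by
    constructor
    · intro q
      have h := Lp.coeFn_zero ℂ 1 (volume : Measure Plane)
      simp only [Prod.fst_zero, Prod.snd_zero, Pi.zero_apply, Complex.ofReal_zero]
      rw [Real.fourierInv_eq, integral_congr_ae (g := fun _ => (0 : ℂ)), integral_zero]
      filter_upwards [h] with w hw
      rw [hw]
      exact smul_zero _
    · refine (MemLp.zero (p := 2) (ε := ℂ)).ae_eq ?_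
      filter_upwards [ae_restrict_of_ae (Lp.coeFn_zero ℂ 1 (volume : Measure Plane))] with w hw
      exact (by rw [hw]; simp : weight 3 w • (0 : Lp ℂ 1 (volume : Measure Plane)) w = 0).symm
  add_mem' := by
    rintro ⟨a, g⟩ ⟨b, h⟩ ⟨ha, hg⟩ ⟨hb, hh⟩
    have e := Lp.coeFn_add g h
    constructor
    · intro q
      have ig := (Real.fourierIntegral_convergent_iff (-q)).2 (L1.integrable_coeFn g)
      have ih := (Real.fourierIntegral_convergent_iff (-q)).2 (L1.integrable_coeFn h)
      simp only [inner_neg_right, neg_neg] at ig ih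
      simp only [Prod.fst_add, Prod.snd_add, Pi.add_apply, Complex.ofReal_add]
      rw [ha q, hb q, Real.fourierInv_eq, Real.fourierInv_eq, Real.fourierInv_eq,
        ← integral_add ig ih]
      refine integral_congr_ae ?_
      filter_upwards [e] with w hw
      rw [hw, Pi.add_apply, smul_add]
    · refine (MemLp.add hg hh).ae_eq ?_
      filter_upwards [ae_restrict_of_ae e] with w hw
      exact (by rw [hw]; exact smul_add _ _ _ :
        weight 3 w • (g + h : Lp ℂ 1 (volume : Measure Plane)) w =
          weight 3 w • g w + weight 3 w • h w).symm
  smul_mem' := by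
    rintro c ⟨a, g⟩ ⟨ha, hg⟩
    have e := Lp.coeFn_smul c g
    constructor
    · intro q
      simp only [Prod.smul_fst, Prod.smul_snd, Pi.smul_apply, smul_eq_mul, Complex.ofReal_mul]
      rw [ha q, Real.fourierInv_eq, Real.fourierInv_eq, ← integral_const_mul]
      refine integral_congr_ae ?_
      filter_upwards [e] with w hw
      rw [hw, Pi.smul_apply, smul_comm, Complex.real_smul]
    · refine (MemLp.const_smul hg c).ae_eq ?_
      filter_upwards [ae_restrict_of_ae e] with w hw
      exact (by rw [hw]; exact smul_comm (weight 3 w) c (g w) :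
        weight 3 w • (c • g : Lp ℂ 1 (volume : Measure Plane)) w =
          c • weight 3 w • g w).symm

/-- The space `𝒵`. -/
def ZSpace (r : ℝ) : Type := zSubmodule r

namespace ZSpace

instance (r : ℝ) : AddCommGroup (ZSpace r) := inferInstanceAs (AddCommGroup (zSubmodule r))

instance (r : ℝ) : Module ℝ (ZSpace r) := inferInstanceAs (Module ℝ (zSubmodule r))

variable {r : ℝ}

/-- The function `η`. -/
def toFun (η : ZSpace r) : Plane → ℝ := η.1.1

instance : CoeFun (ZSpace r) (fun _ => Plane → ℝ) := ⟨toFun⟩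

/-- The Fourier transform of `η` (in Mathlib's normalization). -/
def transform : ZSpace r →ₗ[ℝ] Lp ℂ 1 (volume : Measure Plane) :=
  (LinearMap.snd ℝ (Plane → ℝ) (Lp ℂ 1 (volume : Measure Plane))).comp (zSubmodule r).subtype

theorem memLp_low (η : ZSpace r) :
    MemLp (fun w => (2 * Real.pi) • transform η w) 1 (volume.restrict (freqSet r)) :=
  ((Lp.memLp (transform η)).restrict _).const_smul (2 * Real.pi)

theorem memLp_high (η : ZSpace r) :
    MemLp (fun w => weight 3 w • transform η w) 2 (volume.restrict (freqSet r)ᶜ) := η.2.2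

/-- `η ↦ (η̂₁, (1 + |k|²)^{3/2} η̂₂)`, which defines the norm of `𝒵`. The factor `2π` turns the
`L¹` norm in `w` of Mathlib's transform into the `L¹` norm in `k = 2πw` of
`η̂(k) = (2π)⁻¹ ∫ η(q) e^{-i⟨k, q⟩} dq`. -/
def normMap (r : ℝ) : ZSpace r →ₗ[ℝ]
    WithLp 1 (Lp ℂ 1 ((volume : Measure Plane).restrict (freqSet r)) ×
      Lp ℂ 2 ((volume : Measure Plane).restrict (freqSet r)ᶜ)) where
  toFun η := WithLp.toLp 1 ((memLp_low η).toLp _, (memLp_high η).toLp _)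
  map_add' η ζ := by
    have e := Lp.coeFn_add (transform η) (transform ζ)
    rw [← WithLp.toLp_add, Prod.mk_add_mk, ← MemLp.toLp_add, ← MemLp.toLp_add]
    congr 2 <;> apply MemLp.toLp_congr <;> rw [map_add] <;>
      filter_upwards [ae_restrict_of_ae e] with w hw <;> rw [hw] <;>
      exact smul_add _ _ _
  map_smul' c η := by
    have e := Lp.coeFn_smul c (transform η)
    rw [RingHom.id_apply, ← WithLp.toLp_smul, Prod.smul_mk, ← MemLp.toLp_const_smul,
      ← MemLp.toLp_const_smul]
    congr 2 <;> apply MemLp.toLp_congr <;> rw [map_smul] <;>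
      filter_upwards [ae_restrict_of_ae e] with w hw <;>
      simp only [Pi.smul_apply, hw] <;> rw [smul_comm]

theorem normMap_injective (r : ℝ) : Function.Injective (normMap r) := by
  intro η ζ h
  have h0 := congrArg WithLp.ofLp h
  have h1 := (MemLp.toLp_eq_toLp_iff (memLp_low η) (memLp_low ζ)).1 (congrArg Prod.fst h0)
  have h2 := (MemLp.toLp_eq_toLp_iff (memLp_high η) (memLp_high ζ)).1 (congrArg Prod.snd h0)
  have h3 : transform η = transform ζ := by
    apply Lp.ext
    refine ae_of_ae_restrict_of_ae_restrict_compl (freqSet r) ?_ ?_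
    · filter_upwards [h1] with w hw
      exact smul_right_injective ℂ (by positivity : (2 * Real.pi) ≠ 0) hw
    · filter_upwards [h2] with w hw
      exact smul_right_injective ℂ (weight_pos 3 w).ne' hw
  have h3' : η.1.2 = ζ.1.2 := h3
  apply Subtype.ext
  refine Prod.ext ?_ h3'
  funext q
  apply Complex.ofReal_injective
  rw [η.2.1 q, ζ.2.1 q, h3']

instance : NormedAddCommGroup (ZSpace r) :=
  NormedAddCommGroup.induced (ZSpace r) _ (normMap r) (normMap_injective r)

instance : NormedSpace ℝ (ZSpace r) := NormedSpace.induced ℝ (ZSpace r) _ (normMap r)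

/-- `‖η‖_𝒵 = ‖η̂₁‖_{L¹} + ‖η₂‖₃`. -/
theorem norm_def (η : ZSpace r) :
    ‖η‖ = (eLpNorm (fun w => (2 * Real.pi) • transform η w) 1
        (volume.restrict (freqSet r))).toReal +
      (eLpNorm (fun w => weight 3 w • transform η w) 2
        (volume.restrict (freqSet r)ᶜ)).toReal := by
  change ‖normMap r η‖ = _
  rw [WithLp.prod_norm_eq_of_nat 1 Nat.cast_one.symm]
  simp [normMap, Lp.norm_toLp]

end ZSpace

/-! ## The space `H_⋆^{n+1}(Σ)`

The completion of the space of functions `u` that are smooth up to the boundary of `Σ`, with all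
derivatives rapidly decreasing in `(x, z)` and with `‖∇u‖_n < ∞`, in the norm
`‖u‖_{n+1,⋆}² = ‖u_x‖_n² + ‖u_y‖_n² + ‖u_z‖_n²`, `‖f‖_n² = ∑_{|α| ≤ n} ‖∂^α f‖_{L²(Σ)}²`.
The map `u ↦ (∂^α ∂_i u)_{i, α}` is an isometry for this norm into a finite `ℓ²`-sum of copies of
`L²(Σ)`, so the completion is the closure of its range. Elements are thus determined by their
gradients: functions that differ by a constant are identified. -/

/-- Multi-indices `α` with `|α| ≤ n`. -/
abbrev MultiIdx (n : ℕ) : Type := {α : Fin 3 → Fin (n + 1) // ∑ i, (α i : ℕ) ≤ n}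

/-- The multi-index `0`. -/
def MultiIdx.zero (n : ℕ) : MultiIdx n := ⟨fun _ => 0, by simp⟩

/-- Smooth functions up to the boundary of `Σ` (restrictions to `Σ` of smooth functions on `ℝ³`)
all of whose derivatives decay rapidly in `(x, z)`. -/
def IsSchwartzOnHalfSpace (u : Space → ℝ) : Prop :=
  ContDiff ℝ ∞ u ∧ ∀ (m : ℕ) (α : Fin 3 → ℕ), ∃ C : ℝ, ∀ p ∈ halfSpace,
    ‖p.1‖ ^ m * |spaceMultiDeriv α u p| ≤ C

abbrev JetSpace (n : ℕ) : Type := PiLp 2 (fun _ : Fin 3 × MultiIdx n => Lp ℝ 2 halfVol)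

theorem spaceDeriv_contDiff {u : Space → ℝ} (hu : ContDiff ℝ ∞ u) (i : Fin 3) :
    ContDiff ℝ ∞ (spaceDeriv i u) :=
  (hu.fderiv_right (m := ∞) (by simp)).clm_apply contDiff_const

theorem spaceDeriv_iterate_contDiff {u : Space → ℝ} (hu : ContDiff ℝ ∞ u) (i : Fin 3) (k : ℕ) :
    ContDiff ℝ ∞ ((spaceDeriv i)^[k] u) := by
  induction k with
  | zero => exact hu
  | succ k ih => rw [Function.iterate_succ_apply']; exact spaceDeriv_contDiff ih i

theorem spaceDeriv_lin {u v : Space → ℝ} (hu : ContDiff ℝ ∞ u) (hv : ContDiff ℝ ∞ v) (a b : ℝ)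
    (i : Fin 3) :
    spaceDeriv i (a • u + b • v) = a • spaceDeriv i u + b • spaceDeriv i v := by
  funext p
  have h1 : DifferentiableAt ℝ u p := hu.differentiable (by simp) p
  have h2 : DifferentiableAt ℝ v p := hv.differentiable (by simp) p
  simp only [spaceDeriv, Pi.add_apply, Pi.smul_apply]
  rw [fderiv_add (h1.const_smul a) (h2.const_smul b), fderiv_const_smul h1, fderiv_const_smul h2]
  simp

theorem spaceDeriv_iterate_lin {u v : Space → ℝ} (hu : ContDiff ℝ ∞ u) (hv : ContDiff ℝ ∞ v)
    (a b : ℝ) (i : Fin 3) (k : ℕ) :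
    (spaceDeriv i)^[k] (a • u + b • v) =
      a • (spaceDeriv i)^[k] u + b • (spaceDeriv i)^[k] v := by
  induction k with
  | zero => rfl
  | succ k ih =>
    rw [Function.iterate_succ_apply', Function.iterate_succ_apply', Function.iterate_succ_apply',
      ih, spaceDeriv_lin (spaceDeriv_iterate_contDiff hu i k) (spaceDeriv_iterate_contDiff hv i k)]

theorem spaceMultiDeriv_lin {u v : Space → ℝ} (hu : ContDiff ℝ ∞ u) (hv : ContDiff ℝ ∞ v)
    (a b : ℝ) (α : Fin 3 → ℕ) :
    spaceMultiDeriv α (a • u + b • v) = a • spaceMultiDeriv α u + b • spaceMultiDeriv α v := by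
  have hu2 := spaceDeriv_iterate_contDiff hu 2 (α 2)
  have hv2 := spaceDeriv_iterate_contDiff hv 2 (α 2)
  unfold spaceMultiDeriv
  rw [spaceDeriv_iterate_lin hu hv, spaceDeriv_iterate_lin hu2 hv2,
    spaceDeriv_iterate_lin (spaceDeriv_iterate_contDiff hu2 1 _)
      (spaceDeriv_iterate_contDiff hv2 1 _)]

theorem IsSchwartzOnHalfSpace.lin {u v : Space → ℝ} (hu : IsSchwartzOnHalfSpace u)
    (hv : IsSchwartzOnHalfSpace v) (a b : ℝ) : IsSchwartzOnHalfSpace (a • u + b • v) := by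
  refine ⟨(hu.1.const_smul a).add (hv.1.const_smul b), fun m α => ?_⟩
  obtain ⟨C, hC⟩ := hu.2 m α
  obtain ⟨D, hD⟩ := hv.2 m α
  refine ⟨|a| * C + |b| * D, fun p hp => ?_⟩
  rw [spaceMultiDeriv_lin hu.1 hv.1]
  simp only [Pi.add_apply, Pi.smul_apply, smul_eq_mul]
  have h1 := mul_le_mul_of_nonneg_left (hC p hp) (abs_nonneg a)
  have h2 := mul_le_mul_of_nonneg_left (hD p hp) (abs_nonneg b)
  have h3 := mul_le_mul_of_nonneg_left
    (abs_add_le (a * spaceMultiDeriv α u p) (b * spaceMultiDeriv α v p))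
    (pow_nonneg (norm_nonneg p.1) m)
  rw [abs_mul, abs_mul] at h3
  nlinarith

/-- `w` is the family `(∂^α ∂_i u)_{i, |α| ≤ n}` of derivatives of `u` on `Σ`. -/
def IsJetOf {n : ℕ} (w : JetSpace n) (u : Space → ℝ) : Prop :=
  ∀ (i : Fin 3) (α : MultiIdx n),
    w (i, α) =ᵐ[halfVol] spaceMultiDeriv (fun j => (α.1 j : ℕ)) (spaceDeriv i u)

theorem IsJetOf.lin {n : ℕ} {w w' : JetSpace n} {u v : Space → ℝ} (hu : IsSchwartzOnHalfSpace u)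
    (hv : IsSchwartzOnHalfSpace v) (hw : IsJetOf w u) (hw' : IsJetOf w' v) (a b : ℝ) :
    IsJetOf (a • w + b • w') (a • u + b • v) := by
  intro i α
  rw [spaceDeriv_lin hu.1 hv.1,
    spaceMultiDeriv_lin (spaceDeriv_contDiff hu.1 i) (spaceDeriv_contDiff hv.1 i)]
  simp only [PiLp.add_apply, PiLp.smul_apply]
  filter_upwards [hw i α, hw' i α, Lp.coeFn_add (a • w (i, α)) (b • w' (i, α)),
    Lp.coeFn_smul a (w (i, α)), Lp.coeFn_smul b (w' (i, α))] with p h1 h2 h3 h4 h5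
  rw [h3, Pi.add_apply, h4, h5]
  simp only [Pi.add_apply, Pi.smul_apply, h1, h2]

theorem spaceMultiDeriv_zero (α : Fin 3 → ℕ) : spaceMultiDeriv α (0 : Space → ℝ) = 0 := by
  have h := spaceMultiDeriv_lin (u := 0) (v := 0) contDiff_const contDiff_const 0 0 α
  simpa using h

/-- The derivatives of the functions in the dense class. -/
def smoothJets (n : ℕ) : Submodule ℝ (JetSpace n) where
  carrier := {w | ∃ u, IsSchwartzOnHalfSpace u ∧ IsJetOf w u}
  zero_mem' := by
    refine ⟨0, ⟨contDiff_const, fun m α => ⟨0, fun p _ => ?_⟩⟩, fun i α => ?_⟩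
    · simp [spaceMultiDeriv_zero]
    · have h : spaceDeriv i (0 : Space → ℝ) = 0 := by
        have h := spaceDeriv_lin (u := 0) (v := 0) contDiff_const contDiff_const 0 0 i
        simpa using h
      rw [h, spaceMultiDeriv_zero]
      exact Lp.coeFn_zero ℝ 2 halfVol
  add_mem' := by
    rintro w w' ⟨u, hu, hw⟩ ⟨v, hv, hw'⟩
    refine ⟨_, hu.lin hv 1 1, ?_⟩
    simpa using IsJetOf.lin hu hv hw hw' 1 1
  smul_mem' := by
    rintro c w ⟨u, hu, hw⟩
    refine ⟨_, hu.lin hu c 0, ?_⟩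
    simpa using IsJetOf.lin hu hu hw hw c 0

/-- The space `H_⋆^{n+1}(Σ)`. -/
abbrev HStar (n : ℕ) : Type := (smoothJets n).topologicalClosure

/-- The partial derivatives `u_x`, `u_y`, `u_z` of `u ∈ H_⋆^{n+1}(Σ)`. -/
def HStar.grad {n : ℕ} (u : HStar n) (i : Fin 3) : Lp ℝ 2 halfVol :=
  (u : JetSpace n) (i, MultiIdx.zero n)

/-! ## Boundary behaviour -/

/-- `g` is the trace at `y = 0` of a function `f` on `Σ` with weak `y`-derivative `f'` in
`L²(Σ)`, characterized by integration by parts against functions in `C_c^∞(ℝ³)`. -/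
def HasTrace (f : Space → ℝ) (g : Plane → ℝ) : Prop :=
  MemLp f 2 halfVol ∧ MemLp g 2 volume ∧ ∃ f' : Space → ℝ, MemLp f' 2 halfVol ∧
    ∀ ψ : Space → ℝ, IsTest Set.univ ψ →
      ∫ p in halfSpace, f' p * ψ p =
        -(∫ p in halfSpace, f p * spaceDeriv 1 ψ p) + ∫ q, g q * ψ (q, 0)

/-- `f → 0` as `y → -∞`, uniformly (up to null sets), for `f` defined on `Ω`. -/
def TendsToZeroBelow (Ω : Set Space) (f : Space → ℝ) : Prop :=
  ∀ ε > 0, ∃ R : ℝ, ∀ᵐ p ∂(volume.restrict Ω), p.2 < -R → |f p| ≤ ε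

/-! ## The boundary-value problems -/

/-- `F₁ = η_x u_y`, `F₂ = η_x u_x + η_z u_z - (η_x² + η_z²) u_y`, `F₃ = η_z u_y`. -/
def flatForcing (η : Plane → ℝ) (u : HStar 2) : Fin 3 → Space → ℝ :=
  ![fun p => planeDeriv 0 η p.1 * u.grad 1 p,
    fun p => planeDeriv 0 η p.1 * u.grad 0 p + planeDeriv 1 η p.1 * u.grad 2 p
      - (planeDeriv 0 η p.1 ^ 2 + planeDeriv 1 η p.1 ^ 2) * u.grad 1 p,
    fun p => planeDeriv 1 η p.1 * u.grad 1 p]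

/-- `u` solves the problem on the half-space:
`u_xx + u_yy + u_zz = ∂_x F₁ + ∂_y F₂ + ∂_z F₃` in `Σ` (in the sense of distributions),
`u_y → 0` as `y → -∞`, and `u_y = F₂ + ξ_x` at `y = 0` (in the sense of traces). -/
def SolvesFlat (η : Plane → ℝ) (ξ : Plane → ℝ) (u : HStar 2) : Prop :=
  (∀ ψ : Space → ℝ, IsTest halfSpace ψ →
    ∫ p in halfSpace, ∑ i, u.grad i p * spaceDeriv i ψ p =
      ∫ p in halfSpace, ∑ i, flatForcing η u i p * spaceDeriv i ψ p) ∧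
  TendsToZeroBelow halfSpace (u.grad 1) ∧
  ∃ a b c : Plane → ℝ,
    HasTrace (u.grad 0) a ∧ HasTrace (u.grad 1) b ∧ HasTrace (u.grad 2) c ∧
    HasWeakPartial 0 ξ fun q => b q - (planeDeriv 0 η q * a q + planeDeriv 1 η q * c q
      - (planeDeriv 0 η q ^ 2 + planeDeriv 1 η q ^ 2) * b q)

/-- The gradient `(φ_x, φ_y, φ_z)` of `φ(x, y, z) = u(x, y - η(x, z), z)`, a function on
`{y < η}`. -/
def fluidGrad (η : Plane → ℝ) (u : HStar 2) : Fin 3 → Space → ℝ :=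
  ![fun p => u.grad 0 (p.1, p.2 - η p.1) - planeDeriv 0 η p.1 * u.grad 1 (p.1, p.2 - η p.1),
    fun p => u.grad 1 (p.1, p.2 - η p.1),
    fun p => u.grad 2 (p.1, p.2 - η p.1) - planeDeriv 1 η p.1 * u.grad 1 (p.1, p.2 - η p.1)]

/-- `g` is the boundary value at `y = η` of a function `f` on `{y < η}`. -/
def HasTraceAtSurface (η : Plane → ℝ) (f : Space → ℝ) (g : Plane → ℝ) : Prop :=
  HasTrace (fun p => f (p.1, p.2 + η p.1)) g

/-- `φ(x, y, z) = u(x, y - η(x, z), z)` solves the problem in the fluid domain: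
`φ_xx + φ_yy + φ_zz = 0` for `y < η` (in the sense of distributions), `φ_y → 0` as `y → -∞`, and
`φ_y - η_x φ_x - η_z φ_z = ξ_x` at `y = η` (in the sense of traces). -/
def SolvesFluid (η : Plane → ℝ) (ξ : Plane → ℝ) (u : HStar 2) : Prop :=
  (∀ ψ : Space → ℝ, IsTest (fluidDomain η) ψ →
    ∫ p in fluidDomain η, ∑ i, fluidGrad η u i p * spaceDeriv i ψ p = 0) ∧
  TendsToZeroBelow (fluidDomain η) (fluidGrad η u 1) ∧
  ∃ a b c : Plane → ℝ,
    HasTraceAtSurface η (fluidGrad η u 0) a ∧ HasTraceAtSurface η (fluidGrad η u 1) b ∧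
    HasTraceAtSurface η (fluidGrad η u 2) c ∧
    HasWeakPartial 0 ξ fun q => b q - planeDeriv 0 η q * a q - planeDeriv 1 η q * c q

/-! ## The nonlinear functions `𝒦'` and `ℒ'` -/

/-- `κ = η - [η_x / √(1 + η_x² + η_z²)]_x - [η_z / √(1 + η_x² + η_z²)]_z`. -/
def IsKPrime (η κ : Plane → ℝ) : Prop :=
  ∃ d e : Plane → ℝ,
    HasWeakPartial 0 (fun q => planeDeriv 0 η q /
      Real.sqrt (1 + planeDeriv 0 η q ^ 2 + planeDeriv 1 η q ^ 2)) d ∧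
    HasWeakPartial 1 (fun q => planeDeriv 1 η q /
      Real.sqrt (1 + planeDeriv 0 η q ^ 2 + planeDeriv 1 η q ^ 2)) e ∧
    κ =ᵐ[volume] fun q => η q - d q - e q

/-- `-½ k² - ½ l² + (η_x - η_x k - η_z l)² / (2 (1 + η_x² + η_z²)) + k`, where `k = K(η)η` and
`l = L(η)η`. -/
def lPrimeFormula (η k l : Plane → ℝ) : Plane → ℝ := fun q =>
  -(1 / 2) * k q ^ 2 - (1 / 2) * l q ^ 2
    + (planeDeriv 0 η q - planeDeriv 0 η q * k q - planeDeriv 1 η q * l q) ^ 2 /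
        (2 * (1 + planeDeriv 0 η q ^ 2 + planeDeriv 1 η q ^ 2))
    + k q

theorem five_halves_le_three : (5 / 2 : ℝ≥0) ≤ 3 := by
  rw [← NNReal.coe_le_coe]
  norm_num

end WaterWave

end

/-!
The problem is solved in terms of gradient fields. The space `H_⋆³(Σ)` is identified, through
`u ↦ ∇u`, with the fields in the `L²` closure of gradients of test functions whose components have
weak derivatives up to order two in `L²(Σ)` (`gradField_injective`, `exists_hstar_of_hasWeakOrder`);
the approximation by smooth functions uses mollification with kernels that look only into `Σ`.
In this space the flattened problem has the weak form `⟨∇u - F, ∇ψ⟩ = -∫ ξ ψ_x(·, 0)` for all test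
functions `ψ` on the closed half-space (`solvesFlat_iff`), and the flattening map, which preserves the
measure, makes it equivalent to the problem in the fluid domain (`solvesFluid_iff`).

For `η = 0` and a forcing `F` the solution is the orthogonal projection of `F` onto the gradient fields.
It is as regular as `F` (`hasWeakOrder_gradProj`): the projection commutes with horizontal translations,
which gives horizontal derivatives, and the vertical ones follow from the equation. The inhomogeneous
datum `ξ_x` is treated with the Riesz representation theorem, the boundary functional being estimated by
the Dirichlet norm with the Fourier transform in the horizontal variables (`exists_neumannSolution`).

The forcing involves products of `∇u` with the slopes `η_x`, `η_z`. Multiplication by these preserves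
`H^s(ℝ²)` for `0 ≤ s ≤ 2` (`ZSpace.exists_mulOp`): the low-frequency part of `η` has an integrable
transform with bounded support and the high-frequency part lies in `H³`, so that a Peetre-type
inequality for the weights and the estimate `L¹ * L² ⊆ L²` for convolutions suffice. Applied to
horizontal slices, this shows that the forcing is as regular as `∇u` (`HStar.hasWeakOrder_halfMul`). The
problem is therefore a fixed-point equation `u = T(η) u + G ξ` in `H_⋆³(Σ)`, where `T` is a quadratic
polynomial with `T(0) = 0`. For small `η` it is solved by a Neumann series, which gives existence,
uniqueness and analyticity (`exists_fixedPoint_operator`, `exists_solutionOperator`).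

No norm estimate is needed for the operators on the smaller spaces: an operator that is bounded into
a larger space, and maps into a smaller one that is continuously and injectively embedded in it, is
bounded into the smaller one by the closed graph theorem. The same holds for families of operators that
depend linearly on a parameter (`exists_lift_of_range_subset`, `exists_lift_family`).

The operators `K`, `L` are the solution operator followed by the traces of the horizontal derivatives,
which are bounded from `H_⋆³(Σ)` to `H^{3/2}(ℝ²)` (`exists_traceOp`). The powers of `1 + η_x² + η_z²` in
the formulae for `𝒦'` and `ℒ'` are binomial series in the algebra of bounded operators on `H²(ℝ²)`
or `H¹(ℝ²)` (`exists_rpowOp`), and the products in `ℒ'` are bounded from `H^{3/2} × H^{3/2}` to `H¹`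
(`Sobolev.exists_mulOp`), from which the claims about these functionals follow (`exists_kPrime`,
`exists_lPrime`).
-/

namespace WaterWave

open Filter Topology
open scoped BoundedContinuousFunction

/-! ### Lifting through injective operators -/

/-- A bounded operator whose values lie in the range of an injective bounded operator `π` factors
through `π` by a bounded operator: this is the closed graph theorem. -/
theorem exists_lift_of_range_subset {A B C : Type*} [NormedAddCommGroup A] [NormedSpace ℝ A]
    [CompleteSpace A] [NormedAddCommGroup B] [NormedSpace ℝ B] [CompleteSpace B]
    [NormedAddCommGroup C] [NormedSpace ℝ C] (π : B →L[ℝ] C) (hπ : Function.Injective π)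
    (T : A →L[ℝ] C) (h : ∀ a, ∃ b, π b = T a) : ∃ L : A →L[ℝ] B, ∀ a, π (L a) = T a := by
  choose g hg using h
  let g' : A →ₗ[ℝ] B :=
    { toFun := g
      map_add' := fun a b => hπ (by rw [map_add, hg, hg, hg, map_add])
      map_smul' := fun c a => hπ (by rw [RingHom.id_apply, map_smul, hg, hg, map_smul]) }
  have hc : Continuous g' := by
    apply LinearMap.continuous_of_isClosed_graph
    have : (g'.graph : Set (A × B)) = {p | T p.1 = π p.2} := by
      ext p
      simp only [SetLike.mem_coe, LinearMap.mem_graph_iff, Set.mem_ofPred_eq]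
      constructor
      · intro h; rw [h]; exact (hg p.1).symm
      · intro h; exact hπ (by rw [← h]; exact (hg p.1).symm)
    rw [this]
    exact isClosed_eq (T.continuous.comp continuous_fst) (π.continuous.comp continuous_snd)
  exact ⟨⟨g', hc⟩, hg⟩

/-- The operator-valued version of `exists_lift_of_range_subset`. -/
theorem exists_lift_family {Z A B C : Type*} [NormedAddCommGroup Z] [NormedSpace ℝ Z]
    [CompleteSpace Z] [NormedAddCommGroup A] [NormedSpace ℝ A]
    [CompleteSpace A] [NormedAddCommGroup B] [NormedSpace ℝ B] [CompleteSpace B]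
    [NormedAddCommGroup C] [NormedSpace ℝ C] (π : B →L[ℝ] C) (hπ : Function.Injective π)
    (T : Z →L[ℝ] A →L[ℝ] C) (h : ∀ z a, ∃ b, π b = T z a) :
    ∃ L : Z →L[ℝ] A →L[ℝ] B, ∀ z a, π (L z a) = T z a := by
  obtain ⟨L, hL⟩ := exists_lift_of_range_subset
    (ContinuousLinearMap.compL ℝ A B C π) (fun x y hxy => by
      ext a
      exact hπ (by simpa using congrArg (fun f : A →L[ℝ] C => f a) hxy)) T (fun z => by
      obtain ⟨L, hL⟩ := exists_lift_of_range_subset π hπ (T z) (h z)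
      exact ⟨L, by ext a; simpa using hL a⟩)
  exact ⟨L, fun z a => by simpa using congrArg (fun f : A →L[ℝ] C => f a) (hL z)⟩

/-- The version of `exists_lift_of_range_subset` for bilinear families of operators. -/
theorem exists_lift_family₂ {Y Z A B C : Type*} [NormedAddCommGroup Y] [NormedSpace ℝ Y]
    [CompleteSpace Y] [NormedAddCommGroup Z] [NormedSpace ℝ Z]
    [CompleteSpace Z] [NormedAddCommGroup A] [NormedSpace ℝ A]
    [CompleteSpace A] [NormedAddCommGroup B] [NormedSpace ℝ B] [CompleteSpace B]
    [NormedAddCommGroup C] [NormedSpace ℝ C] (π : B →L[ℝ] C) (hπ : Function.Injective π)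
    (T : Y →L[ℝ] Z →L[ℝ] A →L[ℝ] C) (h : ∀ y z a, ∃ b, π b = T y z a) :
    ∃ L : Y →L[ℝ] Z →L[ℝ] A →L[ℝ] B, ∀ y z a, π (L y z a) = T y z a := by
  have h1 : Function.Injective (ContinuousLinearMap.compL ℝ A B C π) := fun x y hxy => by
    ext a
    exact hπ (by simpa using congrArg (fun f : A →L[ℝ] C => f a) hxy)
  obtain ⟨L, hL⟩ := exists_lift_family (ContinuousLinearMap.compL ℝ A B C π) h1 T (fun y z => by
      obtain ⟨L, hL⟩ := exists_lift_of_range_subset π hπ (T y z) (h y z)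
      exact ⟨L, by ext a; simpa using hL a⟩)
  exact ⟨L, fun y z a => by simpa using congrArg (fun f : A →L[ℝ] C => f a) (hL y z)⟩

/-! ### Multiplication by bounded functions on `L²` -/

/-- Multiplication by a bounded measurable function, as a bounded operator on `L²`. -/
theorem exists_smulL2 {α F : Type*} [MeasurableSpace α] [NormedAddCommGroup F] [NormedSpace ℝ F]
    {ν : Measure α} {μ : α → ℝ} {C : ℝ} (hC : 0 ≤ C) (hm : AEStronglyMeasurable μ ν)
    (hb : ∀ x, |μ x| ≤ C) :
    ∃ T : Lp F 2 ν →L[ℝ] Lp F 2 ν, ‖T‖ ≤ C ∧ ∀ f, T f =ᵐ[ν] fun x => μ x • f x := by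
  have key : ∀ f : Lp F 2 ν, MemLp (fun x => μ x • f x) 2 ν := fun f =>
    MemLp.of_le_mul (c := C) (Lp.memLp f) (hm.smul (Lp.aestronglyMeasurable f))
      (Eventually.of_forall fun x => by
        rw [norm_smul]; exact mul_le_mul_of_nonneg_right (hb x) (norm_nonneg _))
  let T : Lp F 2 ν →ₗ[ℝ] Lp F 2 ν :=
    { toFun := fun f => (key f).toLp _
      map_add' := fun f g => by
        rw [← MemLp.toLp_add]
        apply MemLp.toLp_congr
        filter_upwards [Lp.coeFn_add f g] with x hx
        rw [hx]; simp only [Pi.add_apply, smul_add]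
      map_smul' := fun c f => by
        rw [RingHom.id_apply, ← MemLp.toLp_const_smul]
        apply MemLp.toLp_congr
        filter_upwards [Lp.coeFn_smul c f] with x hx
        rw [hx]; simp only [Pi.smul_apply]; rw [smul_comm] }
  have hT : ∀ f, ‖T f‖ ≤ C * ‖f‖ := fun f => by
    refine Lp.norm_le_mul_norm_of_ae_le_mul ?_
    filter_upwards [(key f).coeFn_toLp] with x hx
    change ‖((key f).toLp _ : Lp F 2 ν) x‖ ≤ _
    rw [hx, norm_smul]
    exact mul_le_mul_of_nonneg_right (hb x) (norm_nonneg _)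
  exact ⟨T.mkContinuous C hT, LinearMap.mkContinuous_norm_le _ hC _, fun f => (key f).coeFn_toLp⟩

/-! ### Test functions and weak derivatives on the half-space -/

theorem IsTest.mono {E : Type*} [NormedAddCommGroup E] [NormedSpace ℝ E] {U V : Set E} {ψ : E → ℝ}
    (h : IsTest U ψ) (hUV : U ⊆ V) : IsTest V ψ := ⟨h.1, h.2.1, h.2.2.trans hUV⟩

theorem IsTest.univ {E : Type*} [NormedAddCommGroup E] [NormedSpace ℝ E] {U : Set E} {ψ : E → ℝ}
    (h : IsTest U ψ) : IsTest Set.univ ψ := h.mono (Set.subset_univ _)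

theorem isOpen_halfSpace : IsOpen halfSpace := isOpen_lt continuous_snd continuous_const

theorem measurableSet_halfSpace : MeasurableSet halfSpace := isOpen_halfSpace.measurableSet

theorem spaceDeriv_eq_zero_of_notMem {ψ : Space → ℝ} (i : Fin 3) {p : Space}
    (hp : p ∉ tsupport ψ) : spaceDeriv i ψ p = 0 := by
  have h := support_fderiv_subset ℝ (f := ψ)
  have : fderiv ℝ ψ p = 0 := by
    by_contra h'
    exact hp (h h')
  simp [spaceDeriv, this]

theorem tsupport_spaceDeriv_subset (i : Fin 3) (ψ : Space → ℝ) :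
    tsupport (spaceDeriv i ψ) ⊆ tsupport ψ :=
  closure_minimal (fun p hp => by
    by_contra h
    exact hp (spaceDeriv_eq_zero_of_notMem i h)) (isClosed_tsupport ψ)

theorem IsTest.spaceDeriv {U : Set Space} {ψ : Space → ℝ} (h : IsTest U ψ) (i : Fin 3) :
    IsTest U (spaceDeriv i ψ) :=
  ⟨spaceDeriv_contDiff h.1 i, h.2.1.mono' ((subset_tsupport _).trans
    (tsupport_spaceDeriv_subset i ψ)), (tsupport_spaceDeriv_subset i ψ).trans h.2.2⟩

theorem IsTest.spaceDeriv_iterate {U : Set Space} {ψ : Space → ℝ} (h : IsTest U ψ) (i : Fin 3)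
    (k : ℕ) : IsTest U ((WaterWave.spaceDeriv i)^[k] ψ) := by
  induction k with
  | zero => exact h
  | succ k ih => rw [Function.iterate_succ_apply']; exact ih.spaceDeriv i

theorem IsTest.spaceMultiDeriv {U : Set Space} {ψ : Space → ℝ} (h : IsTest U ψ) (α : Fin 3 → ℕ) :
    IsTest U (spaceMultiDeriv α ψ) :=
  ((h.spaceDeriv_iterate 2 _).spaceDeriv_iterate 1 _).spaceDeriv_iterate 0 _

theorem spaceDeriv_comm {u : Space → ℝ} (hu : ContDiff ℝ ∞ u) (i j : Fin 3) :
    spaceDeriv i (spaceDeriv j u) = spaceDeriv j (spaceDeriv i u) := by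
  funext p
  have hs : IsSymmSndFDerivAt ℝ u p := (hu.contDiffAt).isSymmSndFDerivAt (by
    rw [minSmoothness_of_isRCLikeNormedField]; exact WithTop.coe_le_coe.2 (le_top : (2 : ℕ∞) ≤ ⊤))
  have hd : DifferentiableAt ℝ (fderiv ℝ u) p :=
    (hu.fderiv_right (m := ∞) (by simp)).differentiable (by simp) p
  have h : ∀ a b : Fin 3, spaceDeriv a (spaceDeriv b u) p =
      fderiv ℝ (fderiv ℝ u) p (spaceDir a) (spaceDir b) := by
    intro a b
    change fderiv ℝ (fun q => fderiv ℝ u q (spaceDir b)) p (spaceDir a) = _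
    rw [fderiv_clm_apply hd (differentiableAt_const _)]
    simp
  rw [h, h, hs.eq]

theorem IsTest.memLp {U : Set Space} {ψ : Space → ℝ} (h : IsTest U ψ) : MemLp ψ 2 halfVol :=
  (h.1.continuous.memLp_of_hasCompactSupport h.2.1).restrict _

/-- `L²` functions on the half-space. -/
abbrev HalfL2 : Type := Lp ℝ 2 halfVol

/-- The class in `L²(Σ)` of a function; it is `0` if the function is not square integrable. -/
noncomputable def toHalfL2 (ψ : Space → ℝ) : HalfL2 :=
  open scoped Classical in if h : MemLp ψ 2 halfVol then h.toLp ψ else 0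

theorem coeFn_toHalfL2 {ψ : Space → ℝ} (h : MemLp ψ 2 halfVol) : toHalfL2 ψ =ᵐ[halfVol] ψ := by
  rw [toHalfL2, dif_pos h]; exact h.coeFn_toLp

theorem inner_toHalfL2 (f : HalfL2) {ψ : Space → ℝ} (h : MemLp ψ 2 halfVol) :
    inner ℝ f (toHalfL2 ψ) = ∫ p in halfSpace, f p * ψ p := by
  rw [L2.inner_def]
  refine integral_congr_ae ?_
  filter_upwards [coeFn_toHalfL2 h] with p hp
  simp [hp, mul_comm]

/-- Test functions in `Σ` separate the elements of `L²(Σ)`. -/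
theorem eq_zero_of_inner_test {f : HalfL2}
    (h : ∀ ψ, IsTest halfSpace ψ → inner ℝ f (toHalfL2 ψ) = 0) : f = 0 := by
  have h1 := isOpen_halfSpace.ae_eq_zero_of_integral_contDiff_smul_eq_zero (μ := volume)
    (f := (f : Space → ℝ)) (U := halfSpace) ?_ ?_
  · rw [← ae_restrict_iff' measurableSet_halfSpace] at h1
    exact (Lp.eq_zero_iff_ae_eq_zero).2 h1
  · have : LocallyIntegrable (f : Space → ℝ) halfVol :=
      (Lp.memLp f).locallyIntegrable one_le_two
    exact locallyIntegrableOn_of_locallyIntegrable_restrict this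
  · intro g hg hc hs
    -- A test function vanishes outside `Σ`, so the integral over `Σ` is the integral over the whole
    -- space.
    have h2 := h g ⟨hg, hc, hs⟩
    rw [inner_toHalfL2 _ (IsTest.memLp ⟨hg, hc, hs⟩)] at h2
    rw [← h2, setIntegral_eq_integral_of_forall_compl_eq_zero]
    · simp [mul_comm]
    · intro p hp
      have : p ∉ tsupport g := fun h => hp (hs h)
      simp [image_eq_zero_of_notMem_tsupport this]

theorem eq_of_inner_test {f g : HalfL2}
    (h : ∀ ψ, IsTest halfSpace ψ → inner ℝ f (toHalfL2 ψ) = inner ℝ g (toHalfL2 ψ)) : f = g := by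
  rw [← sub_eq_zero]
  refine eq_zero_of_inner_test fun ψ hψ => ?_
  rw [inner_sub_left, h ψ hψ, sub_self]

/-- `g` is the weak derivative `∂_i f` in `Σ`. -/
def WeakD (i : Fin 3) (f g : HalfL2) : Prop :=
  ∀ ψ, IsTest halfSpace ψ → inner ℝ g (toHalfL2 ψ) = -inner ℝ f (toHalfL2 (spaceDeriv i ψ))

/-- `f` belongs to `H^n(Σ)`. -/
def HasWeakOrder : ℕ → HalfL2 → Prop
  | 0, _ => True
  | n + 1, f => ∀ i, ∃ g, WeakD i f g ∧ HasWeakOrder n g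

theorem WeakD.lin {i : Fin 3} {f g f' g' : HalfL2} (h : WeakD i f g) (h' : WeakD i f' g')
    (a b : ℝ) : WeakD i (a • f + b • f') (a • g + b • g') := by
  intro ψ hψ
  simp only [inner_add_left, inner_smul_left, h ψ hψ, h' ψ hψ]
  simp only [RCLike.conj_to_real]
  ring

theorem WeakD.add {i : Fin 3} {f g f' g' : HalfL2} (h : WeakD i f g) (h' : WeakD i f' g') :
    WeakD i (f + f') (g + g') := by simpa using h.lin h' 1 1

theorem HasWeakOrder.add {n : ℕ} : ∀ {f g : HalfL2}, HasWeakOrder n f → HasWeakOrder n g →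
    HasWeakOrder n (f + g) := by
  induction n with
  | zero => intros; trivial
  | succ n ih =>
    intro f g hf hg i
    obtain ⟨f', h1, h2⟩ := hf i
    obtain ⟨g', h3, h4⟩ := hg i
    exact ⟨_, h1.add h3, ih h2 h4⟩

theorem HasWeakOrder.smul {n : ℕ} (c : ℝ) : ∀ {f : HalfL2}, HasWeakOrder n f →
    HasWeakOrder n (c • f) := by
  induction n with
  | zero => intros; trivial
  | succ n ih =>
    intro f hf i
    obtain ⟨f', h1, h2⟩ := hf i
    exact ⟨_, by simpa using h1.lin h1 c 0, ih h2⟩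

theorem HasWeakOrder.sub {n : ℕ} {f g : HalfL2} (hf : HasWeakOrder n f) (hg : HasWeakOrder n g) :
    HasWeakOrder n (f - g) := by
  rw [sub_eq_add_neg, ← neg_one_smul ℝ g]
  exact hf.add (hg.smul _)

/-! ### Horizontal translations -/

instance : (volume : Measure Space).IsAddHaarMeasure :=
  inferInstanceAs ((volume : Measure Plane).prod (volume : Measure ℝ)).IsAddHaarMeasure

/-- The horizontal translation `p ↦ p - a`. -/
def shiftMap (a : Plane) : C(Space, Space) where
  toFun p := (p.1 - a, p.2)
  continuous_toFun := by fun_prop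

theorem measurePreserving_shiftMap (a : Plane) :
    MeasurePreserving (shiftMap a) halfVol halfVol := by
  have h : MeasurePreserving (shiftMap a) (volume : Measure Space) volume := by
    have := (measurePreserving_add_right (volume : Measure Space) ((-a, 0) : Space))
    convert this using 1
    ext p
    · simp [shiftMap, sub_eq_add_neg]
    · simp [shiftMap]
  exact h.restrict_preimage measurableSet_halfSpace

/-- Translation of `L²(Σ)` by a horizontal vector. -/
noncomputable def shift (a : Plane) : HalfL2 →ₗᵢ[ℝ] HalfL2 :=
  Lp.compMeasurePreservingₗᵢ ℝ (shiftMap a) (measurePreserving_shiftMap a)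

theorem coeFn_shift (a : Plane) (f : HalfL2) : shift a f =ᵐ[halfVol] f ∘ shiftMap a :=
  Lp.coeFn_compMeasurePreserving f (measurePreserving_shiftMap a)

theorem shift_toHalfL2 (a : Plane) {ψ : Space → ℝ} (h : MemLp ψ 2 halfVol) :
    shift a (toHalfL2 ψ) = toHalfL2 (ψ ∘ shiftMap a) := by
  have h' : MemLp (ψ ∘ shiftMap a) 2 halfVol :=
    h.comp_measurePreserving (measurePreserving_shiftMap a)
  apply Lp.ext
  filter_upwards [coeFn_shift a (toHalfL2 ψ), coeFn_toHalfL2 h',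
    (measurePreserving_shiftMap a).quasiMeasurePreserving.ae (coeFn_toHalfL2 h)] with p h1 h2 h3
  rw [h1, h2, Function.comp, Function.comp, h3]

theorem shift_shift_neg (a : Plane) (f : HalfL2) : shift a (shift (-a) f) = f := by
  apply Lp.ext
  filter_upwards [coeFn_shift a (shift (-a) f),
    (measurePreserving_shiftMap a).quasiMeasurePreserving.ae (coeFn_shift (-a) f)] with p h1 h2
  rw [h1, Function.comp, h2]
  simp [shiftMap]

theorem inner_shift_right (a : Plane) (f g : HalfL2) :
    inner ℝ f (shift a g) = inner ℝ (shift (-a) f) g := by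
  conv_lhs => rw [← shift_shift_neg a f]
  exact (shift a).inner_map_map _ _

theorem continuous_shift {X : Type*} [TopologicalSpace X] {a : X → Plane} {f : X → HalfL2}
    (ha : Continuous a) (hf : Continuous f) : Continuous fun x => shift (a x) (f x) := by
  have hg : Continuous fun x => shiftMap (a x) := by
    refine ContinuousMap.continuous_of_continuous_uncurry _ ?_
    change Continuous fun q : X × Space => (q.2.1 - a q.1, q.2.2)
    fun_prop
  exact hf.compMeasurePreservingLp hg (fun x => measurePreserving_shiftMap (a x)) (by simp)

theorem IsTest.comp_shiftMap {ψ : Space → ℝ} {U : Set Space} (h : IsTest U ψ) (a : Plane)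
    (hU : ∀ p, shiftMap a p ∈ U → p ∈ U) : IsTest U (ψ ∘ shiftMap a) := by
  have e : (shiftMap a : Space → Space) = (Homeomorph.addRight ((-a, 0) : Space)) := by
    funext p
    apply Prod.ext <;> simp [shiftMap, sub_eq_add_neg]
  refine ⟨h.1.comp ?_, ?_, ?_⟩
  · change ContDiff ℝ ∞ fun p : Space => (p.1 - a, p.2)
    fun_prop
  · rw [e]; exact h.2.1.comp_homeomorph _
  · rw [e, tsupport_comp_eq_preimage, ← e]
    exact fun p hp => hU p (h.2.2 hp)

theorem spaceDeriv_comp_shiftMap (i : Fin 3) (ψ : Space → ℝ) (a : Plane) :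
    spaceDeriv i (ψ ∘ shiftMap a) = spaceDeriv i ψ ∘ shiftMap a := by
  funext p
  have e : (ψ ∘ shiftMap a) = fun q => ψ (q - (a, 0)) := by
    funext q
    simp only [Function.comp, shiftMap, ContinuousMap.coe_mk]
    congr 1
    exact Prod.ext rfl (by simp)
  have e2 : shiftMap a p = p - (a, 0) := Prod.ext rfl (by simp [shiftMap])
  simp only [spaceDeriv, e, Function.comp, e2]
  rw [fderiv_comp_sub]

/-- The pairing of a locally integrable function with a translated test function is
differentiable with respect to the translation. -/
theorem hasDerivAt_integral_translate {E : Type*} [NormedAddCommGroup E] [NormedSpace ℝ E]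
    [MeasurableSpace E] [BorelSpace E] {ν : Measure E} {f : E → ℝ}
    (hf : LocallyIntegrable f ν) {ψ : E → ℝ} (hψ : ContDiff ℝ 1 ψ) (hc : HasCompactSupport ψ)
    (b : E) (s₀ : ℝ) :
    HasDerivAt (fun s : ℝ => ∫ p, f p * ψ (p - s • b) ∂ν)
      (-∫ p, f p * fderiv ℝ ψ (p - s₀ • b) b ∂ν) s₀ := by
  set dψ : E → ℝ := fun p => fderiv ℝ ψ p b with hdψ
  have hd : Continuous dψ := (hψ.continuous_fderiv one_ne_zero).clm_apply continuous_const
  have hdc : HasCompactSupport dψ :=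
    (hc.fderiv (𝕜 := ℝ)).comp_left (g := fun L : E →L[ℝ] ℝ => L b) rfl
  rw [← integral_neg]
  obtain ⟨C, hC⟩ := hd.bounded_above_of_compact_support hdc
  -- all translates by bounded amounts are supported in one compact set
  set K : Set E := (fun q : E × ℝ => q.1 + q.2 • b) ''
    (tsupport dψ ×ˢ Metric.closedBall s₀ 1) with hK
  have hKc : IsCompact K := (hdc.isCompact.prod (isCompact_closedBall _ _)).image (by fun_prop)
  have hfi : IntegrableOn (fun p => C * |f p|) K ν :=
    ((hf.integrableOn_isCompact hKc).abs).const_mul C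
  have hmeas : ∀ g : E → ℝ, Continuous g → HasCompactSupport g → ∀ s : ℝ,
      Integrable (fun p => f p * g (p - s • b)) ν := fun g hg hgc s => by
    have h1 : HasCompactSupport fun p => g (p - s • b) :=
      hgc.comp_homeomorph (Homeomorph.subRight (s • b))
    simpa [mul_comm] using hf.integrable_smul_left_of_hasCompactSupport
      (hg.comp (by fun_prop : Continuous fun p : E => p - s • b)) h1
  refine (hasDerivAt_integral_of_dominated_loc_of_deriv_le
    (F := fun s p => f p * ψ (p - s • b))
    (F' := fun s p => -(f p * dψ (p - s • b)))
    (bound := K.indicator fun p => C * |f p|)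
    (Metric.ball_mem_nhds s₀ one_pos) ?_ ?_ ?_ ?_ ?_ ?_).2
  · exact Eventually.of_forall fun s => (hmeas ψ hψ.continuous hc s).aestronglyMeasurable
  · exact hmeas ψ hψ.continuous hc s₀
  · exact (hmeas dψ hd hdc s₀).aestronglyMeasurable.neg
  · refine Eventually.of_forall fun p s hs => ?_
    by_cases hp : p ∈ K
    · rw [Set.indicator_of_mem hp, norm_neg, norm_mul, mul_comm]
      exact mul_le_mul_of_nonneg_right (hC _) (norm_nonneg _)
    · rw [Set.indicator_of_notMem hp]
      have : p - s • b ∉ tsupport dψ := by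
        intro h
        exact hp ⟨(p - s • b, s), ⟨h, Metric.ball_subset_closedBall hs⟩, by simp⟩
      rw [image_eq_zero_of_notMem_tsupport this]
      simp
  · exact (integrable_indicator_iff hKc.measurableSet).2 hfi
  · refine Eventually.of_forall fun p s _ => ?_
    rw [← mul_neg]
    refine HasDerivAt.const_mul _ ?_
    have h1 : HasDerivAt (fun s : ℝ => p - s • b) (-b) s := by
      have h2 : HasDerivAt (fun s : ℝ => s • b) b s := by
        simpa using (hasDerivAt_id s).smul_const b
      exact h2.const_sub p
    have h2 := (hψ.differentiable one_ne_zero (p - s • b)).hasFDerivAt.comp_hasDerivAt s h1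
    rw [map_neg] at h2
    exact h2

theorem hasDerivAt_inner_shift (f : HalfL2) {ψ : Space → ℝ} (hψ : IsTest Set.univ ψ) (i : Fin 3)
    (a : Plane) (ha : spaceDir i = (a, 0)) (s₀ : ℝ) :
    HasDerivAt (fun s : ℝ => inner ℝ f (shift (s • a) (toHalfL2 ψ)))
      (-inner ℝ f (shift (s₀ • a) (toHalfL2 (spaceDeriv i ψ)))) s₀ := by
  have hs : ∀ (φ : Space → ℝ), IsTest Set.univ φ → ∀ s : ℝ,
      inner ℝ f (shift (s • a) (toHalfL2 φ)) = ∫ p in halfSpace, f p * φ (p - s • spaceDir i) := by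
    intro φ hφ s
    have h1 := hφ.comp_shiftMap (s • a) (fun _ _ => trivial)
    rw [shift_toHalfL2 _ hφ.memLp, inner_toHalfL2 _ h1.memLp, ha]
    refine integral_congr_ae (Eventually.of_forall fun p => ?_)
    simp only [Function.comp, shiftMap, ContinuousMap.coe_mk]
    congr 2
    exact Prod.ext rfl (by simp)
  rw [hs _ (hψ.spaceDeriv i)]
  simp_rw [hs _ hψ]
  exact hasDerivAt_integral_translate ((Lp.memLp f).locallyIntegrable one_le_two)
    (hψ.1.of_le (by exact_mod_cast le_top)) hψ.2.1 _ _

/-- The span of the test functions in `L²(Σ)` is dense. -/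
theorem dense_span_test :
    (Submodule.span ℝ {g | ∃ ψ, IsTest halfSpace ψ ∧ g = toHalfL2 ψ}).topologicalClosure = ⊤ := by
  rw [Submodule.topologicalClosure_eq_top_iff, Submodule.eq_bot_iff]
  intro f hf
  refine eq_zero_of_inner_test fun ψ hψ => ?_
  rw [real_inner_comm]
  exact (Submodule.mem_orthogonal _ _).1 hf _ (Submodule.subset_span ⟨ψ, hψ, rfl⟩)

theorem shift_zero (f : HalfL2) : shift 0 f = f := by
  apply Lp.ext
  filter_upwards [coeFn_shift 0 f] with p h1
  rw [h1]
  simp [shiftMap]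

/-- Fundamental theorem of calculus for a horizontally weakly differentiable function, tested
against an arbitrary `L²` function. -/
theorem WeakD.inner_shift_sub {i : Fin 3} {f f' : HalfL2} (h : WeakD i f f') (a : Plane)
    (ha : spaceDir i = (a, 0)) (Z : HalfL2) (t : ℝ) :
    inner ℝ f (shift (t • a) Z) - inner ℝ f Z = ∫ s in (0 : ℝ)..t, inner ℝ f' (shift (s • a) Z) := by
  -- Both sides are continuous and linear in `Z`, so that `Z` may be taken to be a test function.
  have hcont : ∀ g : HalfL2, Continuous fun q : HalfL2 × ℝ => inner ℝ g (shift (q.2 • a) q.1) :=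
    fun g => continuous_const.inner (continuous_shift (by fun_prop) continuous_fst)
  have hc1 : Continuous fun Z : HalfL2 => inner ℝ f (shift (t • a) Z) - inner ℝ f Z :=
    ((hcont f).comp (by fun_prop : Continuous fun Z : HalfL2 => (Z, t))).sub
      (continuous_const.inner continuous_id)
  have hc2 : Continuous fun Z : HalfL2 => ∫ s in (0 : ℝ)..t, inner ℝ f' (shift (s • a) Z) :=
    intervalIntegral.continuous_parametric_intervalIntegral_of_continuous' (hcont f') 0 t
  have hint : ∀ (g Z : HalfL2), IntervalIntegrable (fun s => inner ℝ g (shift (s • a) Z))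
      volume 0 t := fun g Z =>
    ((hcont g).comp (by fun_prop : Continuous fun s : ℝ => (Z, s))).intervalIntegrable _ _
  have hmem : Z ∈ (Submodule.span ℝ
      {g | ∃ ψ, IsTest halfSpace ψ ∧ g = toHalfL2 ψ}).topologicalClosure := by
    rw [dense_span_test]; trivial
  refine closure_minimal (s := (Submodule.span ℝ
      {g | ∃ ψ, IsTest halfSpace ψ ∧ g = toHalfL2 ψ} : Set HalfL2)) ?_ (isClosed_eq hc1 hc2) hmem
  intro Z hZ
  induction hZ using Submodule.span_induction with
  | mem g hg =>
    obtain ⟨ψ, hψ, rfl⟩ := hg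
    have h1 := intervalIntegral.integral_eq_sub_of_hasDerivAt (a := 0) (b := t)
      (fun s _ => hasDerivAt_inner_shift f hψ.univ i a ha s) (hint f _).neg
    -- A translate of a test function by a horizontal vector is again a test function in `Σ`.
    have h2 : ∀ s : ℝ, -inner ℝ f (shift (s • a) (toHalfL2 (spaceDeriv i ψ))) =
        inner ℝ f' (shift (s • a) (toHalfL2 ψ)) := by
      intro s
      have hs := hψ.comp_shiftMap (s • a) (fun p hp => hp)
      rw [shift_toHalfL2 _ hψ.memLp, h _ hs, spaceDeriv_comp_shiftMap i ψ,
        shift_toHalfL2 _ (hψ.spaceDeriv i).memLp]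
    simp_rw [h2] at h1
    rw [Set.mem_ofPred_eq, h1, zero_smul, shift_zero]
  | zero => simp
  | add x y _ _ hx hy =>
    simp only [Set.mem_ofPred_eq, map_add, inner_add_right] at hx hy ⊢
    rw [intervalIntegral.integral_add (hint _ _) (hint _ _), ← hx, ← hy]
    ring
  | smul c x _ hx =>
    simp only [Set.mem_ofPred_eq, map_smul, inner_smul_right] at hx ⊢
    rw [intervalIntegral.integral_const_mul, ← hx]
    ring

/-! ### Gradient fields and the projection onto them -/

/-- Square integrable vector fields on the half-space. -/
abbrev VField : Type := PiLp 2 (fun _ : Fin 3 => HalfL2)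

/-- The gradient on `Σ` of a function on `ℝ³`. -/
noncomputable def gradTest (ψ : Space → ℝ) : VField :=
  WithLp.toLp 2 fun i => toHalfL2 (spaceDeriv i ψ)

theorem toHalfL2_lin {f g : Space → ℝ} (hf : MemLp f 2 halfVol) (hg : MemLp g 2 halfVol)
    (a b : ℝ) : toHalfL2 (a • f + b • g) = a • toHalfL2 f + b • toHalfL2 g := by
  rw [toHalfL2, dif_pos ((hf.const_smul a).add (hg.const_smul b)), toHalfL2, dif_pos hf, toHalfL2,
    dif_pos hg]
  rfl

theorem IsTest.lin {E : Type*} [NormedAddCommGroup E] [NormedSpace ℝ E] {U : Set E}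
    {ψ φ : E → ℝ} (hψ : IsTest U ψ) (hφ : IsTest U φ) (a b : ℝ) : IsTest U (a • ψ + b • φ) := by
  refine ⟨(hψ.1.const_smul a).add (hφ.1.const_smul b), (hψ.2.1.smul_left (f := fun _ => a)).add
    (hφ.2.1.smul_left (f := fun _ => b)), ?_⟩
  refine (tsupport_add (a • ψ) (b • φ)).trans (Set.union_subset ?_ ?_)
  · exact (tsupport_smul_subset_right (fun _ => a) ψ).trans hψ.2.2
  · exact (tsupport_smul_subset_right (fun _ => b) φ).trans hφ.2.2

theorem gradTest_lin {ψ φ : Space → ℝ} (hψ : IsTest Set.univ ψ) (hφ : IsTest Set.univ φ)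
    (a b : ℝ) : gradTest (a • ψ + b • φ) = a • gradTest ψ + b • gradTest φ := by
  ext1 i
  change toHalfL2 _ = a • toHalfL2 _ + b • toHalfL2 _
  rw [spaceDeriv_lin hψ.1 hφ.1, toHalfL2_lin (hψ.spaceDeriv i).memLp (hφ.spaceDeriv i).memLp]

theorem isTest_zero {E : Type*} [NormedAddCommGroup E] [NormedSpace ℝ E] (U : Set E) :
    IsTest U (0 : E → ℝ) :=
  ⟨contDiff_const, HasCompactSupport.zero, by simp [tsupport]⟩

/-- The gradients of the functions in `C_c^∞(ℝ³)`, restricted to `Σ`. -/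
noncomputable def gradTests : Submodule ℝ VField where
  carrier := {v | ∃ ψ, IsTest Set.univ ψ ∧ v = gradTest ψ}
  zero_mem' := ⟨0, isTest_zero _, by
    have h := gradTest_lin (isTest_zero Set.univ) (isTest_zero Set.univ) 0 0
    simpa using h.symm⟩
  add_mem' := by
    rintro _ _ ⟨ψ, hψ, rfl⟩ ⟨φ, hφ, rfl⟩
    exact ⟨_, hψ.lin hφ 1 1, by rw [gradTest_lin hψ hφ]; simp⟩
  smul_mem' := by
    rintro c _ ⟨ψ, hψ, rfl⟩
    exact ⟨_, hψ.lin hψ c 0, by rw [gradTest_lin hψ hψ]; simp⟩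

/-- The closed subspace of gradient fields in `L²(Σ)³`. -/
noncomputable def gradSpace : Submodule ℝ VField := gradTests.topologicalClosure

noncomputable instance : CompleteSpace gradSpace :=
  gradTests.isClosed_topologicalClosure.completeSpace_coe

theorem gradTest_mem {ψ : Space → ℝ} (hψ : IsTest Set.univ ψ) : gradTest ψ ∈ gradSpace :=
  gradTests.le_topologicalClosure ⟨ψ, hψ, rfl⟩

/-- A closed condition that holds for gradients of test functions holds on all of `gradSpace`. -/
theorem gradSpace_induction {p : VField → Prop} (hp : IsClosed {v | p v})
    (h : ∀ ψ, IsTest Set.univ ψ → p (gradTest ψ)) {v : VField} (hv : v ∈ gradSpace) : p v :=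
  closure_minimal (s := (gradTests : Set VField)) (by rintro _ ⟨ψ, hψ, rfl⟩; exact h ψ hψ) hp hv

/-- Horizontal translation of vector fields. -/
noncomputable def vshift (a : Plane) (v : VField) : VField := WithLp.toLp 2 fun i => shift a (v i)

theorem inner_vfield (v w : VField) : inner ℝ v w = ∑ i, inner ℝ (v i) (w i) :=
  PiLp.inner_apply v w

theorem inner_vshift_right (a : Plane) (v w : VField) :
    inner ℝ v (vshift a w) = inner ℝ (vshift (-a) v) w := by
  simp only [inner_vfield]
  exact Finset.sum_congr rfl fun i _ => inner_shift_right a (v i) (w i)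

theorem continuous_vshift {X : Type*} [TopologicalSpace X] {a : X → Plane} {f : X → VField}
    (ha : Continuous a) (hf : Continuous f) : Continuous fun x => vshift (a x) (f x) :=
  (PiLp.continuous_toLp 2 _).comp (continuous_pi fun i =>
    continuous_shift ha ((PiLp.continuous_apply 2 _ i).comp hf))

theorem vshift_gradTest (a : Plane) {ψ : Space → ℝ} (hψ : IsTest Set.univ ψ) :
    vshift a (gradTest ψ) = gradTest (ψ ∘ shiftMap a) := by
  ext1 i
  change shift a (toHalfL2 _) = toHalfL2 _
  rw [shift_toHalfL2 _ (hψ.spaceDeriv i).memLp, spaceDeriv_comp_shiftMap i ψ]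

theorem vshift_mem {v : VField} (hv : v ∈ gradSpace) (a : Plane) : vshift a v ∈ gradSpace := by
  refine gradSpace_induction (p := fun v => vshift a v ∈ gradSpace) ?_ ?_ hv
  · exact gradTests.isClosed_topologicalClosure.preimage (continuous_vshift continuous_const
      continuous_id)
  · intro ψ hψ
    rw [vshift_gradTest a hψ]
    exact gradTest_mem (hψ.comp_shiftMap a fun _ _ => trivial)

/-- The orthogonal projection of `L²(Σ)³` onto the gradient fields. The projection `∇u` of `F` is
the weak solution of `Δu = div F` in `Σ`, `u_y = F₂` at `y = 0`. -/
noncomputable def gradProj : VField →L[ℝ] VField := gradSpace.starProjection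

theorem gradProj_mem (v : VField) : gradProj v ∈ gradSpace :=
  Submodule.starProjection_apply_mem _ _

theorem inner_gradProj (v : VField) {w : VField} (hw : w ∈ gradSpace) :
    inner ℝ (gradProj v) w = inner ℝ v w := by
  have := Submodule.starProjection_inner_eq_zero (K := gradSpace) v w hw
  rw [inner_sub_left, sub_eq_zero] at this
  exact this.symm

/-- If translation differences of `v` and `v'` in a horizontal direction, tested against gradient
fields, are related as those of a function and its derivative, then `v'` is the weak derivative of
`v`: projecting onto gradient fields commutes with horizontal translations. -/
theorem weakD_of_inner_vshift {i : Fin 3} (a : Plane) (ha : spaceDir i = (a, 0)) {v v' : VField}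
    (hv : v ∈ gradSpace) (hv' : v' ∈ gradSpace)
    (h : ∀ Z ∈ gradSpace, ∀ t : ℝ, inner ℝ v (vshift (t • a) Z) - inner ℝ v Z =
      ∫ s in (0 : ℝ)..t, inner ℝ v' (vshift (s • a) Z)) (j : Fin 3) : WeakD i (v j) (v' j) := by
  intro ψ hψ
  -- The field with the single component `ψ` is not a gradient, but it has the same products with
  -- gradient fields as its projection, and so have its translates.
  set Ψ : VField := WithLp.toLp 2 (Pi.single j (toHalfL2 ψ)) with hΨ
  have hin : ∀ (w : VField) (s : ℝ), inner ℝ w (vshift (s • a) Ψ) =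
      inner ℝ (w j) (shift (s • a) (toHalfL2 ψ)) := by
    intro w s
    rw [inner_vfield, Finset.sum_eq_single j]
    · simp [vshift, hΨ]
    · intro k _ hk
      simp [vshift, hΨ, hk]
    · simp
  have hproj : ∀ w ∈ gradSpace, ∀ s : ℝ, inner ℝ w (vshift (s • a) Ψ) =
      inner ℝ w (vshift (s • a) (gradProj Ψ)) := by
    intro w hw s
    rw [inner_vshift_right, inner_vshift_right, real_inner_comm, real_inner_comm (gradProj Ψ),
      inner_gradProj _ (vshift_mem hw _)]
  have h0 : ∀ w ∈ gradSpace, inner ℝ w (gradProj Ψ) = inner ℝ (w j) (toHalfL2 ψ) := by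
    intro w hw
    have h1 := hproj w hw 0
    rw [hin, zero_smul, shift_zero] at h1
    rw [h1]
    congr 1
    ext1 k
    exact (shift_zero _).symm
  have key : ∀ t : ℝ, inner ℝ (v j) (shift (t • a) (toHalfL2 ψ)) =
      inner ℝ (v j) (toHalfL2 ψ) +
        ∫ s in (0 : ℝ)..t, inner ℝ (v' j) (shift (s • a) (toHalfL2 ψ)) := by
    intro t
    have h1 := h _ (gradProj_mem Ψ) t
    simp_rw [← hproj v' hv', ← hproj v hv, hin, h0 v hv] at h1
    linarith
  have hc : Continuous fun s : ℝ => inner ℝ (v' j) (shift (s • a) (toHalfL2 ψ)) :=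
    continuous_const.inner (continuous_shift (by fun_prop) continuous_const)
  have h1 := hasDerivAt_inner_shift (v j) hψ.univ i a ha 0
  simp_rw [key] at h1
  have h2 := (intervalIntegral.integral_hasDerivAt_right (hc.intervalIntegrable 0 0)
    (hc.stronglyMeasurableAtFilter _ _) hc.continuousAt).const_add (inner ℝ (v j) (toHalfL2 ψ))
  have h3 := h2.unique h1
  simpa only [zero_smul, shift_zero] using h3

/-! ### Regularity of weak solutions -/

theorem setIntegral_mul_test {ψ : Space → ℝ} {U : Set Space} (hψ : tsupport ψ ⊆ U)
    (f : Space → ℝ) : ∫ p in U, f p * ψ p = ∫ p, f p * ψ p := by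
  rw [setIntegral_eq_integral_of_forall_compl_eq_zero]
  intro p hp
  rw [image_eq_zero_of_notMem_tsupport fun h => hp (hψ h), mul_zero]

theorem integral_spaceDeriv_mul_test (i : Fin 3) {φ ψ : Space → ℝ} (hφ : ContDiff ℝ ∞ φ)
    {U : Set Space} (hψ : IsTest U ψ) :
    ∫ p in U, spaceDeriv i φ p * ψ p = -∫ p in U, φ p * spaceDeriv i ψ p := by
  rw [setIntegral_mul_test hψ.2.2, setIntegral_mul_test (hψ.spaceDeriv i).2.2]
  have hc : ∀ {f g : Space → ℝ}, Continuous f → Continuous g → HasCompactSupport g →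
      Integrable (fun p => f p * g p) := fun hf hg h =>
    (hf.mul hg).integrable_of_hasCompactSupport h.mul_left
  have h := integral_mul_fderiv_eq_neg_fderiv_mul_of_integrable (𝕜 := ℝ) (f := φ) (g := ψ)
    (v := spaceDir i) (μ := volume)
    (hc (spaceDeriv_contDiff hφ i).continuous hψ.1.continuous hψ.2.1)
    (hc hφ.continuous (hψ.spaceDeriv i).1.continuous (hψ.spaceDeriv i).2.1)
    (hc hφ.continuous hψ.1.continuous hψ.2.1)
    (fun p _ => hφ.differentiable (by simp) p) (fun p _ => hψ.1.differentiable (by simp) p)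
  change _ = -∫ p, φ p * fderiv ℝ ψ p (spaceDir i)
  rw [h, neg_neg]
  rfl

theorem weakD_toHalfL2 (i : Fin 3) {φ : Space → ℝ} (hφ : ContDiff ℝ ∞ φ) (h1 : MemLp φ 2 halfVol)
    (h2 : MemLp (spaceDeriv i φ) 2 halfVol) :
    WeakD i (toHalfL2 φ) (toHalfL2 (spaceDeriv i φ)) := by
  intro ψ hψ
  rw [inner_toHalfL2 _ hψ.memLp, inner_toHalfL2 _ (hψ.spaceDeriv i).memLp]
  have h3 : ∫ p in halfSpace, toHalfL2 (spaceDeriv i φ) p * ψ p =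
      ∫ p in halfSpace, spaceDeriv i φ p * ψ p := by
    refine integral_congr_ae ?_
    filter_upwards [coeFn_toHalfL2 h2] with p hp
    rw [hp]
  have h4 : ∫ p in halfSpace, toHalfL2 φ p * spaceDeriv i ψ p =
      ∫ p in halfSpace, φ p * spaceDeriv i ψ p := by
    refine integral_congr_ae ?_
    filter_upwards [coeFn_toHalfL2 h1] with p hp
    rw [hp]
  rw [h3, h4]
  exact integral_spaceDeriv_mul_test i hφ hψ

/-- Gradient fields are curl-free. -/
theorem inner_spaceDeriv_comm {v : VField} (hv : v ∈ gradSpace) (i j : Fin 3) {ψ : Space → ℝ}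
    (hψ : IsTest halfSpace ψ) : inner ℝ (v i) (toHalfL2 (spaceDeriv j ψ)) =
      inner ℝ (v j) (toHalfL2 (spaceDeriv i ψ)) := by
  have hc : ∀ k : Fin 3, Continuous fun v : VField => v k := fun k => PiLp.continuous_apply 2 _ k
  refine gradSpace_induction (p := fun v => inner ℝ (v i) (toHalfL2 (spaceDeriv j ψ)) =
      inner ℝ (v j) (toHalfL2 (spaceDeriv i ψ)))
    (isClosed_eq ((hc i).inner continuous_const) ((hc j).inner continuous_const)) ?_ hv
  intro φ hφ
  have h := fun k l => weakD_toHalfL2 k hφ.1 hφ.memLp (hφ.spaceDeriv k).memLp _ (hψ.spaceDeriv l)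
  change inner ℝ (toHalfL2 (spaceDeriv i φ)) _ = inner ℝ (toHalfL2 (spaceDeriv j φ)) _
  rw [h i j, h j i, spaceDeriv_comm hψ.1]

/-- The components of a gradient field have the same mixed derivatives: `∂_i v_j = ∂_j v_i`. -/
theorem weakD_swap {v : VField} (hv : v ∈ gradSpace) {i j : Fin 3} {g : HalfL2}
    (h : WeakD i (v j) g) : WeakD j (v i) g := by
  intro ψ hψ
  rw [h ψ hψ, inner_spaceDeriv_comm hv i j hψ]

/-- `v` is a gradient field whose horizontal derivatives up to order `n` are square integrable
gradient fields. -/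
def HorizOrder : ℕ → VField → Prop
  | 0, v => v ∈ gradSpace
  | n + 1, v => v ∈ gradSpace ∧ ∀ i : Fin 3, i ≠ 1 →
      ∃ v' : VField, (∀ j, WeakD i (v j) (v' j)) ∧ HorizOrder n v'

theorem HorizOrder.mem {n : ℕ} {v : VField} (h : HorizOrder n v) : v ∈ gradSpace := by
  cases n with
  | zero => exact h
  | succ n => exact h.1

/-- `v - F` is divergence-free in `Σ`. -/
def SameDiv (v F : VField) : Prop :=
  ∀ ψ, IsTest halfSpace ψ → inner ℝ v (gradTest ψ) = inner ℝ F (gradTest ψ)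

/-- The relation `div v = div F` may be differentiated. -/
theorem SameDiv.weakD {i : Fin 3} {v F v' F' : VField} (h : SameDiv v F)
    (hv : ∀ j, WeakD i (v j) (v' j)) (hF : ∀ j, WeakD i (F j) (F' j)) : SameDiv v' F' := by
  intro ψ hψ
  have key : ∀ w w' : VField, (∀ j, WeakD i (w j) (w' j)) →
      inner ℝ w' (gradTest ψ) = -inner ℝ w (gradTest (spaceDeriv i ψ)) := by
    intro w w' hw
    rw [inner_vfield, inner_vfield, ← Finset.sum_neg_distrib]
    refine Finset.sum_congr rfl fun j _ => ?_
    change inner ℝ (w' j) (toHalfL2 _) = -inner ℝ (w j) (toHalfL2 _)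
    rw [hw j _ (hψ.spaceDeriv j), spaceDeriv_comm hψ.1]
  rw [key v v' hv, key F F' hF, h _ (hψ.spaceDeriv i)]

/-- A gradient field with the same divergence as a field of class `H^n` that is horizontally
regular of order `n` is of class `H^n`: vertical derivatives are recovered from the vanishing of
the curl and from the divergence. -/
theorem HorizOrder.hasWeakOrder {n : ℕ} : ∀ {v F : VField}, HorizOrder n v → SameDiv v F →
    (∀ j, HasWeakOrder n (F j)) → ∀ j, HasWeakOrder n (v j) := by
  induction n with
  | zero => intros; trivial
  | succ n ih =>
    intro v F hv hvF hF
    have hor : ∀ i : Fin 3, i ≠ 1 → ∃ v' : VField, (∀ j, WeakD i (v j) (v' j)) ∧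
        ∀ j, HasWeakOrder n (v' j) := by
      intro i hi
      obtain ⟨v', h1, h2⟩ := hv.2 i hi
      choose F' hF' hF'' using fun j => hF j i
      exact ⟨v', h1, ih (F := WithLp.toLp 2 F') h2 (hvF.weakD h1 hF') hF''⟩
    obtain ⟨a, ha, ha'⟩ := hor 0 (by decide)
    obtain ⟨c, hc, hc'⟩ := hor 2 (by decide)
    -- The vertical derivative of the vertical component is `∂_y v_y = div F - ∂_x v_x - ∂_z v_z`.
    have hver : ∃ g, WeakD 1 (v 1) g ∧ HasWeakOrder n g := by
      choose F' hF' hF'' using fun j => hF j j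
      refine ⟨F' 0 + F' 1 + F' 2 - a 0 - c 2, ?_, (((hF'' 0).add (hF'' 1)).add (hF'' 2)).sub
        (ha' 0) |>.sub (hc' 2)⟩
      intro ψ hψ
      have h1 := hvF ψ hψ
      simp only [inner_vfield, Fin.sum_univ_three] at h1
      change inner ℝ (v 0) (toHalfL2 _) + inner ℝ (v 1) (toHalfL2 _) + inner ℝ (v 2) (toHalfL2 _) =
        inner ℝ (F 0) (toHalfL2 _) + inner ℝ (F 1) (toHalfL2 _) + inner ℝ (F 2) (toHalfL2 _) at h1
      simp only [inner_add_left, inner_sub_left, ha 0 ψ hψ, hc 2 ψ hψ, hF' 0 ψ hψ, hF' 1 ψ hψ,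
        hF' 2 ψ hψ]
      linarith
    intro j i
    -- All other vertical derivatives are horizontal derivatives of the vertical component.
    by_cases hi : i = 1
    · subst hi
      by_cases hj : j = 1
      · subst hj; exact hver
      · obtain ⟨v', h1, h2⟩ := hor j hj
        exact ⟨v' 1, weakD_swap hv.mem (h1 1), h2 1⟩
    · obtain ⟨v', h1, h2⟩ := hor i hi
      exact ⟨v' j, h1 j, h2 j⟩

theorem exists_spaceDir_eq {i : Fin 3} (hi : i ≠ 1) : ∃ a : Plane, spaceDir i = (a, 0) := by
  fin_cases i
  · exact ⟨planeDir 0, rfl⟩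
  · exact absurd rfl hi
  · exact ⟨planeDir 1, rfl⟩

/-- Horizontal derivatives commute with the projection onto gradient fields. -/
theorem horizOrder_gradProj {n : ℕ} : ∀ {F : VField}, (∀ j, HasWeakOrder n (F j)) →
    HorizOrder n (gradProj F) := by
  induction n with
  | zero => intro F _; exact gradProj_mem F
  | succ n ih =>
    intro F hF
    refine ⟨gradProj_mem F, fun i hi => ?_⟩
    obtain ⟨a, ha⟩ := exists_spaceDir_eq hi
    choose F' hF' hF'' using fun j => hF j i
    refine ⟨gradProj (WithLp.toLp 2 F'), weakD_of_inner_vshift a ha (gradProj_mem _)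
      (gradProj_mem _) fun Z hZ t => ?_, ih hF''⟩
    rw [inner_gradProj _ (vshift_mem hZ _), inner_gradProj _ hZ]
    simp_rw [inner_gradProj _ (vshift_mem hZ _), inner_vfield]
    rw [intervalIntegral.integral_finsetSum fun j _ => ?_, ← Finset.sum_sub_distrib]
    · exact Finset.sum_congr rfl fun j _ => (hF' j).inner_shift_sub a ha (Z j) t
    · have : Continuous fun s : ℝ => inner ℝ (F' j) (shift (s • a) (Z j)) :=
        continuous_const.inner (continuous_shift (by fun_prop) continuous_const)
      exact this.intervalIntegrable _ _

theorem sameDiv_gradProj (F : VField) : SameDiv (gradProj F) F := fun _ hψ =>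
  inner_gradProj F (gradTest_mem hψ.univ)

/-- The projection onto gradient fields preserves the class `H^n`. -/
theorem hasWeakOrder_gradProj {n : ℕ} {F : VField} (hF : ∀ j, HasWeakOrder n (F j)) (j : Fin 3) :
    HasWeakOrder n (gradProj F j) :=
  (horizOrder_gradProj hF).hasWeakOrder (sameDiv_gradProj F) hF j

/-! ### Young's inequality and one-sided mollification -/

/-- The Cauchy-Schwarz inequality with weight `a`. -/
theorem lintegral_mul_sq_le {α : Type*} [MeasurableSpace α] {μ : Measure α} {a b : α → ℝ≥0∞}
    (ha : AEMeasurable a μ) (hb : AEMeasurable b μ) :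
    (∫⁻ x, a x * b x ∂μ) ^ 2 ≤ (∫⁻ x, a x ∂μ) * ∫⁻ x, a x * b x ^ 2 ∂μ := by
  have h := ENNReal.lintegral_mul_le_Lp_mul_Lq μ Real.HolderConjugate.two_two
    (f := fun x => a x ^ (1 / 2 : ℝ)) (g := fun x => a x ^ (1 / 2 : ℝ) * b x)
    (ha.pow_const _) ((ha.pow_const _).mul hb)
  have h2 : ∀ x, a x ^ (1 / 2 : ℝ) * a x ^ (1 / 2 : ℝ) = a x := fun x => by
    rw [← ENNReal.rpow_add_of_nonneg _ _ (by norm_num) (by norm_num)]; norm_num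
  have h3 : ∀ x, (a x ^ (1 / 2 : ℝ)) ^ (2 : ℝ) = a x := fun x => by
    rw [← ENNReal.rpow_mul]; norm_num
  simp only [Pi.mul_apply, ← mul_assoc, h2, h3, ENNReal.mul_rpow_of_nonneg _ _ zero_le_two] at h
  simp only [ENNReal.rpow_two] at h
  calc _ ≤ ((∫⁻ x, a x ∂μ) ^ (1 / 2 : ℝ) * (∫⁻ x, a x * b x ^ 2 ∂μ) ^ (1 / 2 : ℝ)) ^ 2 := by gcongr
    _ = _ := by
      rw [mul_pow, ← ENNReal.rpow_two, ← ENNReal.rpow_two, ← ENNReal.rpow_mul, ← ENNReal.rpow_mul]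
      norm_num

/-- Young's inequality `‖a * b‖_{L²} ≤ ‖a‖_{L¹} ‖b‖_{L²}`. -/
theorem lintegral_conv_sq_le {G : Type*} [NormedAddCommGroup G] [MeasurableSpace G] [BorelSpace G]
    [SecondCountableTopology G] {μ : Measure G} [SFinite μ] [μ.IsAddRightInvariant]
    {a b : G → ℝ≥0∞} (ha : Measurable a) (hb : Measurable b) :
    ∫⁻ x, (∫⁻ y, a y * b (x - y) ∂μ) ^ 2 ∂μ ≤ (∫⁻ y, a y ∂μ) ^ 2 * ∫⁻ x, b x ^ 2 ∂μ := by
  calc ∫⁻ x, (∫⁻ y, a y * b (x - y) ∂μ) ^ 2 ∂μ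
      ≤ ∫⁻ x, (∫⁻ y, a y ∂μ) * ∫⁻ y, a y * b (x - y) ^ 2 ∂μ ∂μ := by
        refine lintegral_mono fun x => lintegral_mul_sq_le ha.aemeasurable ?_
        exact (hb.comp (by fun_prop)).aemeasurable
    _ = (∫⁻ y, a y ∂μ) * ∫⁻ x, ∫⁻ y, a y * b (x - y) ^ 2 ∂μ ∂μ := by
        refine lintegral_const_mul _ (Measurable.lintegral_prod_right' (f := fun q : G × G =>
          a q.2 * b (q.1 - q.2) ^ 2) ?_)
        fun_prop
    _ = (∫⁻ y, a y ∂μ) * ∫⁻ y, ∫⁻ x, a y * b (x - y) ^ 2 ∂μ ∂μ := by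
        rw [lintegral_lintegral_swap]
        exact (by fun_prop : Measurable fun q : G × G => a q.2 * b (q.1 - q.2) ^ 2).aemeasurable
    _ = (∫⁻ y, a y ∂μ) * ∫⁻ y, a y * ∫⁻ x, b x ^ 2 ∂μ ∂μ := by
        congr 1
        refine lintegral_congr fun y => ?_
        rw [lintegral_const_mul _ (by fun_prop), lintegral_sub_right_eq_self (fun x => b x ^ 2) y]
    _ = _ := by rw [lintegral_mul_const _ ha, sq, mul_assoc]

/-- The convolution on `Σ` of (the extension by zero of) `f` with a kernel `k`. -/
noncomputable def convHalf (k : Space → ℝ) (f : HalfL2) (p : Space) : ℝ :=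
  ∫ q in halfSpace, f q * k (p - q)

theorem eLpNorm_two_sq {α E : Type*} [MeasurableSpace α] [NormedAddCommGroup E] (μ : Measure α)
    (f : α → E) : eLpNorm f 2 μ ^ 2 = ∫⁻ x, ‖f x‖ₑ ^ 2 ∂μ := by
  have := eLpNorm_nnreal_pow_eq_lintegral (f := f) (μ := μ) (p := 2) (by norm_num)
  simpa using this

theorem convHalf_eq_convolution (k : Space → ℝ) (f : HalfL2) :
    convHalf k f = convolution (halfSpace.indicator f) k (ContinuousLinearMap.lsmul ℝ ℝ) volume := by
  funext p
  rw [convHalf, convolution, ← integral_indicator measurableSet_halfSpace]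
  refine integral_congr_ae (Eventually.of_forall fun q => ?_)
  by_cases hq : q ∈ halfSpace <;> simp [hq]

theorem locallyIntegrable_indicator (f : HalfL2) :
    LocallyIntegrable (halfSpace.indicator f) (volume : Measure Space) :=
  ((memLp_indicator_iff_restrict measurableSet_halfSpace).2 (Lp.memLp f)).locallyIntegrable
    one_le_two

theorem continuous_convHalf {k : Space → ℝ} (hk : Continuous k) (hc : HasCompactSupport k)
    (f : HalfL2) : Continuous (convHalf k f) := by
  rw [convHalf_eq_convolution]
  exact hc.continuous_convolution_right _ (locallyIntegrable_indicator f) hk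

/-- Young's inequality for the convolution on `Σ`. -/
theorem eLpNorm_convHalf_le {k : Space → ℝ} (hk : Continuous k) (f : HalfL2) :
    eLpNorm (convHalf k f) 2 halfVol ≤ (∫⁻ p, ‖k p‖ₑ) * eLpNorm f 2 halfVol := by
  rw [← ENNReal.pow_le_pow_left_iff two_ne_zero, mul_pow, eLpNorm_two_sq, eLpNorm_two_sq]
  set b : Space → ℝ≥0∞ := halfSpace.indicator fun q => ‖f q‖ₑ with hb
  have hbm : Measurable b := (Lp.stronglyMeasurable f).measurable.enorm.indicator
    measurableSet_halfSpace
  have hkm : Measurable fun p => ‖k p‖ₑ := hk.measurable.enorm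
  have h1 : ∀ p, ‖convHalf k f p‖ₑ ≤ ∫⁻ q, ‖k q‖ₑ * b (p - q) := by
    intro p
    have h2 : ∫⁻ q, ‖k q‖ₑ * b (p - q) = ∫⁻ q, ‖k (p - q)‖ₑ * b q := by
      rw [← lintegral_sub_left_eq_self (fun q => ‖k (p - q)‖ₑ * b q) p]
      simp
    rw [h2]
    refine (enorm_integral_le_lintegral_enorm _).trans ?_
    rw [← lintegral_indicator measurableSet_halfSpace]
    refine lintegral_mono fun q => ?_
    by_cases hq : q ∈ halfSpace
    · simp [hb, hq, mul_comm]
    · simp [hq]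
  calc ∫⁻ p in halfSpace, ‖convHalf k f p‖ₑ ^ 2
      ≤ ∫⁻ p, (∫⁻ q, ‖k q‖ₑ * b (p - q)) ^ 2 :=
        (setLIntegral_le_lintegral _ _).trans (lintegral_mono fun p => by gcongr; exact h1 p)
    _ ≤ (∫⁻ q, ‖k q‖ₑ) ^ 2 * ∫⁻ q, b q ^ 2 := lintegral_conv_sq_le hkm hbm
    _ = _ := by
        congr 1
        rw [← lintegral_indicator measurableSet_halfSpace]
        refine lintegral_congr fun q => ?_
        by_cases hq : q ∈ halfSpace <;> simp [hb, hq]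

/-- Convolution with a continuous compactly supported kernel as an operator on `L²(Σ)`. -/
theorem exists_convHalf {k : Space → ℝ} (hk : Continuous k) (hc : HasCompactSupport k) :
    ∃ T : HalfL2 →L[ℝ] HalfL2, (∀ f, ‖T f‖ ≤ (∫ p, |k p|) * ‖f‖) ∧
      ∀ f, T f =ᵐ[halfVol] convHalf k f := by
  have hki : Integrable k := hk.integrable_of_hasCompactSupport hc
  have hfin : (∫⁻ p, ‖k p‖ₑ) = ENNReal.ofReal (∫ p, |k p|) :=
    (ofReal_integral_norm_eq_lintegral_enorm hki).symm
  have hmem : ∀ f : HalfL2, MemLp (convHalf k f) 2 halfVol := fun f =>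
    ⟨(continuous_convHalf hk hc f).aestronglyMeasurable,
      (eLpNorm_convHalf_le hk f).trans_lt (ENNReal.mul_lt_top (hfin ▸ ENNReal.ofReal_lt_top)
        (Lp.memLp f).2)⟩
  have hint : ∀ (f : HalfL2) (p : Space), Integrable (fun q => f q * k (p - q)) halfVol := by
    intro f p
    have h1 : MemLp (fun q => k (p - q)) 2 halfVol := by
      refine MemLp.restrict _ (Continuous.memLp_of_hasCompactSupport (by fun_prop) ?_)
      exact hc.comp_homeomorph (Homeomorph.subLeft p)
    exact (Lp.memLp f).integrable_mul h1
  let T : HalfL2 →ₗ[ℝ] HalfL2 :=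
    { toFun := fun f => (hmem f).toLp _
      map_add' := fun f g => by
        rw [← MemLp.toLp_add]
        apply MemLp.toLp_congr
        refine Eventually.of_forall fun p => ?_
        rw [Pi.add_apply, convHalf, convHalf, convHalf, ← integral_add (hint f p) (hint g p)]
        refine integral_congr_ae ?_
        filter_upwards [Lp.coeFn_add f g] with q hq
        rw [hq, Pi.add_apply, add_mul]
      map_smul' := fun c f => by
        rw [RingHom.id_apply, ← MemLp.toLp_const_smul]
        apply MemLp.toLp_congr
        refine Eventually.of_forall fun p => ?_
        rw [Pi.smul_apply, convHalf, convHalf, smul_eq_mul, ← integral_const_mul]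
        refine integral_congr_ae ?_
        filter_upwards [Lp.coeFn_smul c f] with q hq
        rw [hq, Pi.smul_apply, smul_eq_mul, mul_assoc] }
  have hT : ∀ f, ‖T f‖ ≤ (∫ p, |k p|) * ‖f‖ := by
    intro f
    change ‖(hmem f).toLp _‖ ≤ _
    rw [Lp.norm_toLp, Lp.norm_def, ← ENNReal.toReal_ofReal (integral_nonneg fun p => abs_nonneg (k p)),
      ← ENNReal.toReal_mul, ← hfin]
    exact ENNReal.toReal_mono (ENNReal.mul_ne_top (hfin ▸ ENNReal.ofReal_ne_top) (Lp.memLp f).2.ne)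
      (eLpNorm_convHalf_le hk f)
  exact ⟨T.mkContinuous _ hT, hT, fun f => (hmem f).coeFn_toLp⟩

theorem isTest_univ_of {ψ : Space → ℝ} (h : ContDiff ℝ ∞ ψ) (hc : HasCompactSupport ψ) :
    IsTest Set.univ ψ := ⟨h, hc, Set.subset_univ _⟩

theorem spaceDeriv_comp_sub (i : Fin 3) {k : Space → ℝ} (hk : ContDiff ℝ ∞ k) (p : Space) (c : ℝ) :
    spaceDeriv i (fun q => c * k (p - q)) = fun q => (-c) * spaceDeriv i k (p - q) := by
  funext q
  have h1 := (hk.differentiable (by simp) (p - q)).hasFDerivAt.comp q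
    ((hasFDerivAt_id q).const_sub p)
  have h2 : HasFDerivAt (fun q => c * k (p - q)) (c • ((fderiv ℝ k (p - q)).comp
    (-ContinuousLinearMap.id ℝ Space))) q := h1.const_mul c
  simp only [spaceDeriv, h2.fderiv]
  simp

theorem spaceDeriv_iterate_comp_sub (i : Fin 3) {k : Space → ℝ} (hk : ContDiff ℝ ∞ k) (p : Space)
    (n : ℕ) (c : ℝ) : (spaceDeriv i)^[n] (fun q => c * k (p - q)) =
      fun q => c * (-1) ^ n * (spaceDeriv i)^[n] k (p - q) := by
  induction n generalizing k c with
  | zero => simp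
  | succ n ih =>
    rw [Function.iterate_succ_apply, spaceDeriv_comp_sub i hk, ih (spaceDeriv_contDiff hk i),
      Function.iterate_succ_apply]
    funext q
    ring

theorem spaceMultiDeriv_comp_sub (α : Fin 3 → ℕ) {k : Space → ℝ} (hk : ContDiff ℝ ∞ k)
    (p : Space) :
    spaceMultiDeriv α (fun q => k (p - q)) =
      fun q => (-1) ^ (α 0 + α 1 + α 2) * spaceMultiDeriv α k (p - q) := by
  unfold spaceMultiDeriv
  have h2 := spaceDeriv_iterate_contDiff hk 2 (α 2)
  have h := spaceDeriv_iterate_comp_sub 2 hk p (α 2) 1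
  simp only [one_mul] at h
  rw [h, spaceDeriv_iterate_comp_sub 1 h2,
    spaceDeriv_iterate_comp_sub 0 (spaceDeriv_iterate_contDiff h2 1 _)]
  funext q
  ring

/-- `g` is the weak derivative `∂^α f` in `Σ`. -/
def WeakMulti (α : Fin 3 → ℕ) (f g : HalfL2) : Prop :=
  ∀ ψ, IsTest halfSpace ψ → inner ℝ g (toHalfL2 ψ) =
    (-1) ^ (α 0 + α 1 + α 2) * inner ℝ f (toHalfL2 (spaceMultiDeriv α ψ))

theorem WeakMulti.unique {α : Fin 3 → ℕ} {f g h : HalfL2} (hg : WeakMulti α f g)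
    (hh : WeakMulti α f h) : g = h :=
  eq_of_inner_test fun ψ hψ => by rw [hg ψ hψ, hh ψ hψ]

theorem HasWeakOrder.mono {m n : ℕ} (h : m ≤ n) : ∀ {f : HalfL2}, HasWeakOrder n f →
    HasWeakOrder m f := by
  induction m generalizing n with
  | zero => intros; trivial
  | succ m ih =>
    intro f hf i
    obtain ⟨n, rfl⟩ : ∃ n', n = n' + 1 := ⟨n - 1, by omega⟩
    obtain ⟨g, h1, h2⟩ := hf i
    exact ⟨g, h1, ih (by omega) h2⟩

theorem HasWeakOrder.exists_iterate {n : ℕ} (i : Fin 3) (k : ℕ) : ∀ {f : HalfL2},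
    HasWeakOrder (n + k) f → ∃ g, HasWeakOrder n g ∧ ∀ ψ, IsTest halfSpace ψ →
      inner ℝ g (toHalfL2 ψ) = (-1) ^ k * inner ℝ f (toHalfL2 ((spaceDeriv i)^[k] ψ)) := by
  induction k with
  | zero => intro f hf; exact ⟨f, hf, fun ψ _ => by simp⟩
  | succ k ih =>
    intro f hf
    obtain ⟨g, h1, h2⟩ := hf i
    obtain ⟨h, h3, h4⟩ := ih h2
    refine ⟨h, h3, fun ψ hψ => ?_⟩
    rw [h4 ψ hψ, h1 _ (hψ.spaceDeriv_iterate i k), Function.iterate_succ_apply']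
    ring

theorem HasWeakOrder.exists_weakMulti {n : ℕ} {f : HalfL2} (hf : HasWeakOrder n f)
    (α : Fin 3 → ℕ) (hα : α 0 + α 1 + α 2 ≤ n) : ∃ g, WeakMulti α f g := by
  have hf' : HasWeakOrder (α 2 + α 1 + α 0) f := hf.mono (by omega)
  obtain ⟨g, h1, h2⟩ := hf'.exists_iterate 0 (α 0)
  obtain ⟨h, h3, h4⟩ := h1.exists_iterate 1 (α 1)
  obtain ⟨l, -, h6⟩ := (h3.mono (by omega : 0 + α 2 ≤ α 2)).exists_iterate 2 (α 2)
  refine ⟨l, fun ψ hψ => ?_⟩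
  rw [h6 ψ hψ, h4 _ (hψ.spaceDeriv_iterate _ _),
    h2 _ ((hψ.spaceDeriv_iterate _ _).spaceDeriv_iterate _ _)]
  unfold spaceMultiDeriv
  ring

/-- Convolution with a kernel supported in `{y > 0}` commutes with weak derivatives in `Σ`. -/
theorem WeakMulti.convHalf {α : Fin 3 → ℕ} {f g : HalfL2} (h : WeakMulti α f g) {k : Space → ℝ}
    (hk : IsTest {p | 0 < p.2} k) {p : Space} (hp : p ∈ halfSpace) :
    convHalf k g p = convHalf (spaceMultiDeriv α k) f p := by
  -- For `p ∈ Σ` the function `q ↦ k (p - q)` is supported in `Σ`, so it may be used as a test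
  -- function; this is where the support of `k` matters.
  have ht : IsTest halfSpace fun q => k (p - q) := by
    refine ⟨hk.1.comp (by fun_prop), hk.2.1.comp_homeomorph (Homeomorph.subLeft p), ?_⟩
    have : (fun q => k (p - q)) = k ∘ (Homeomorph.subLeft p) := rfl
    rw [this, tsupport_comp_eq_preimage]
    intro q hq
    have h1 : 0 < p.2 - q.2 := hk.2.2 hq
    have h2 : p.2 < 0 := hp
    change q.2 < 0
    linarith
  have h1 := h _ ht
  rw [inner_toHalfL2 _ ht.memLp, spaceMultiDeriv_comp_sub α hk.1, inner_toHalfL2] at h1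
  · rw [WaterWave.convHalf, h1, WaterWave.convHalf, ← integral_const_mul]
    refine integral_congr_ae (Eventually.of_forall fun q => ?_)
    have : ((-1 : ℝ) ^ (α 0 + α 1 + α 2)) * (-1) ^ (α 0 + α 1 + α 2) = 1 := by
      rw [← mul_pow]; norm_num
    linear_combination (f q * spaceMultiDeriv α k (p - q)) * this
  · have := (ht.spaceMultiDeriv α).memLp
    rwa [spaceMultiDeriv_comp_sub α hk.1] at this

/-- A sequence of mollifiers supported in `{y > 0}`. -/
noncomputable def upBump (n : ℕ) : ContDiffBump ((0, 2 / (4 * ((n : ℝ) + 1))) : Space) where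
  rIn := 1 / (8 * ((n : ℝ) + 1))
  rOut := 1 / (4 * ((n : ℝ) + 1))
  rIn_pos := by positivity
  rIn_lt_rOut := by
    apply one_div_lt_one_div_of_lt <;> nlinarith [(Nat.cast_nonneg n : (0 : ℝ) ≤ n)]

/-- The normalized mollifiers supported in `{y > 0}`. -/
noncomputable def upMollifier (n : ℕ) : Space → ℝ := (upBump n).normed volume

theorem isTest_upMollifier (n : ℕ) : IsTest {p | 0 < p.2} (upMollifier n) := by
  refine ⟨(upBump n).contDiff_normed, (upBump n).hasCompactSupport_normed, ?_⟩
  rw [upMollifier, (upBump n).tsupport_normed_eq]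
  intro p hp
  have h1 : |p.2 - 2 / (4 * ((n : ℝ) + 1))| ≤ 1 / (4 * ((n : ℝ) + 1)) := by
    rw [Metric.mem_closedBall, Prod.dist_eq] at hp
    exact (le_max_right _ _).trans hp
  have h2 : (0 : ℝ) < 1 / (4 * ((n : ℝ) + 1)) := by positivity
  have h3 : 2 / (4 * ((n : ℝ) + 1)) = 2 * (1 / (4 * ((n : ℝ) + 1))) := by ring
  rw [h3] at h1
  change 0 < p.2
  linarith [(abs_le.1 h1).1]

theorem support_upMollifier_subset (n : ℕ) :
    Function.support (upMollifier n) ⊆ Metric.ball 0 (1 / ((n : ℝ) + 1)) := by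
  rw [upMollifier, (upBump n).support_normed_eq]
  refine Metric.ball_subset_ball' ?_
  have h : dist ((0, 2 / (4 * ((n : ℝ) + 1))) : Space) 0 = 2 / (4 * ((n : ℝ) + 1)) := by
    rw [dist_zero_right, Prod.norm_mk, norm_zero, Real.norm_of_nonneg (by positivity)]
    exact max_eq_right (by positivity)
  rw [h]
  change 1 / (4 * ((n : ℝ) + 1)) + _ ≤ _
  rw [← add_div, div_le_div_iff₀ (by positivity) (by positivity)]
  nlinarith [(Nat.cast_nonneg n : (0 : ℝ) ≤ n)]

/-- For a kernel supported in `{y > 0}` the values in `Σ` of the convolution depend only on the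
values in `Σ` of the function, which therefore need not be extended by zero. -/
theorem convHalf_toHalfL2 {U : Set Space} {φ : Space → ℝ} (hφ : IsTest U φ) {k : Space → ℝ}
    (hk : IsTest {p | 0 < p.2} k) {p : Space} (hp : p ∈ halfSpace) :
    convHalf k (toHalfL2 φ) p = convolution φ k (ContinuousLinearMap.lsmul ℝ ℝ) volume p := by
  have h1 : convHalf k (toHalfL2 φ) p = ∫ q in halfSpace, φ q * k (p - q) := by
    refine integral_congr_ae ?_
    filter_upwards [coeFn_toHalfL2 hφ.memLp] with q hq
    rw [hq]
  rw [h1, convolution, setIntegral_eq_integral_of_forall_compl_eq_zero]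
  · rfl
  · intro q hq
    have : p - q ∉ tsupport k := by
      intro h
      have h2 : 0 < p.2 - q.2 := hk.2.2 h
      have h3 : p.2 < 0 := hp
      exact hq (by change q.2 < 0; linarith)
    rw [image_eq_zero_of_notMem_tsupport this, mul_zero]

theorem convolution_smul_comm (φ k : Space → ℝ) :
    convolution φ k (ContinuousLinearMap.lsmul ℝ ℝ) volume =
      convolution k φ (ContinuousLinearMap.lsmul ℝ ℝ) volume := by
  funext p
  rw [convolution, convolution, ← integral_sub_left_eq_self _ volume p]
  refine integral_congr_ae (Eventually.of_forall fun q => ?_)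
  simp [mul_comm]

/-- The one-sided mollifications converge in `L²(Σ)`. -/
theorem exists_mollify : ∃ T : ℕ → HalfL2 →L[ℝ] HalfL2,
    (∀ n f, T n f =ᵐ[halfVol] convHalf (upMollifier n) f) ∧
      ∀ f, Tendsto (fun n => T n f) atTop (𝓝 f) := by
  choose T hT1 hT2 using fun n => exists_convHalf (isTest_upMollifier n).1.continuous
    (isTest_upMollifier n).2.1
  have hone : ∀ n, ∫ p, |upMollifier n p| = 1 := by
    intro n
    rw [← (upBump n).integral_normed (μ := volume)]
    exact integral_congr_ae (Eventually.of_forall fun p =>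
      abs_of_nonneg ((upBump n).nonneg_normed p))
  have hle : ∀ n f, ‖T n f‖ ≤ ‖f‖ := fun n f => by simpa [hone] using hT1 n f
  refine ⟨T, hT2, ?_⟩
  -- For a test function the convergence is uniform with supports in a fixed compact set `K`.
  have htest : ∀ φ, IsTest halfSpace φ →
      Tendsto (fun n => T n (toHalfL2 φ)) atTop (𝓝 (toHalfL2 φ)) := by
    intro φ hφ
    set K := Metric.cthickening 1 (tsupport φ) with hK
    have hKc : IsCompact K := hφ.2.1.isCompact.cthickening
    have hKfin : halfVol K < ⊤ := (Measure.restrict_apply_le _ _).trans_lt hKc.measure_lt_top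
    rw [tendsto_iff_norm_sub_tendsto_zero]
    have hB : Tendsto (fun c : ℝ => c * (halfVol K ^ (1 / 2 : ℝ)).toReal) (𝓝 0) (𝓝 0) := by
      have : Continuous fun c : ℝ => c * (halfVol K ^ (1 / 2 : ℝ)).toReal := by fun_prop
      simpa using this.tendsto 0
    rw [Metric.tendsto_atTop]
    intro ε hε
    obtain ⟨c, hc0, hc⟩ : ∃ c : ℝ, 0 < c ∧ c * (halfVol K ^ (1 / 2 : ℝ)).toReal < ε := by
      have h1 : ∀ᶠ c in 𝓝[>] (0 : ℝ), c * (halfVol K ^ (1 / 2 : ℝ)).toReal < ε :=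
        (hB.mono_left nhdsWithin_le_nhds).eventually (gt_mem_nhds hε)
      obtain ⟨c, h2, h3⟩ := (h1.and self_mem_nhdsWithin).exists
      exact ⟨c, h3, h2⟩
    obtain ⟨δ, hδ, hδ'⟩ := Metric.uniformContinuous_iff.1
      (hφ.2.1.uniformContinuous_of_continuous hφ.1.continuous) c hc0
    obtain ⟨N, hN⟩ := exists_nat_one_div_lt hδ
    refine ⟨N, fun n hn => ?_⟩
    have hr : 1 / ((n : ℝ) + 1) ≤ 1 / ((N : ℝ) + 1) :=
      one_div_le_one_div_of_le (by positivity) (by exact_mod_cast Nat.succ_le_succ hn)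
    have hr1 : 1 / ((n : ℝ) + 1) ≤ 1 := by
      rw [div_le_one (by positivity)]; linarith [(Nat.cast_nonneg n : (0 : ℝ) ≤ n)]
    have hdist : ∀ p ∈ halfSpace, dist (convHalf (upMollifier n) (toHalfL2 φ) p) (φ p) ≤
        K.indicator (fun _ => c) p := by
      intro p hp
      have h1 := convHalf_toHalfL2 hφ (isTest_upMollifier n) hp
      have hgen : ∀ ε' : ℝ, 0 ≤ ε' → (∀ q ∈ Metric.ball p (1 / ((n : ℝ) + 1)),
          dist (φ q) (φ p) ≤ ε') →
          dist (convHalf (upMollifier n) (toHalfL2 φ) p) (φ p) ≤ ε' := by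
        intro ε' hε' h
        rw [h1, convolution_smul_comm]
        exact dist_convolution_le hε' (support_upMollifier_subset n)
          (upBump n).nonneg_normed (upBump n).integral_normed
          hφ.1.continuous.aestronglyMeasurable h
      by_cases hpK : p ∈ K
      · rw [Set.indicator_of_mem hpK]
        exact hgen c hc0.le fun q hq => (hδ' ((Metric.mem_ball.1 hq).trans_le hr |>.trans hN)).le
      · rw [Set.indicator_of_notMem hpK]
        refine hgen 0 le_rfl fun q hq => ?_
        have h2 : ∀ q, dist q p < 1 → φ q = 0 := by
          intro q hq
          refine image_eq_zero_of_notMem_tsupport fun h => hpK ?_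
          exact Metric.mem_cthickening_of_dist_le p q 1 _ h (by rw [dist_comm]; exact hq.le)
        rw [h2 q ((Metric.mem_ball.1 hq).trans_le hr1), h2 p (by simp), dist_self]
    have hnorm : ‖T n (toHalfL2 φ) - toHalfL2 φ‖ ≤ c * (halfVol K ^ (1 / 2 : ℝ)).toReal := by
      rw [Lp.norm_def]
      have h2 : eLpNorm (T n (toHalfL2 φ) - toHalfL2 φ : HalfL2) 2 halfVol ≤
          ENNReal.ofReal c * halfVol K ^ (1 / 2 : ℝ) := by
        calc eLpNorm (T n (toHalfL2 φ) - toHalfL2 φ : HalfL2) 2 halfVol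
            ≤ eLpNorm (K.indicator fun _ => c) 2 halfVol := by
              refine eLpNorm_mono_ae_real ?_
              filter_upwards [hT2 n (toHalfL2 φ), coeFn_toHalfL2 hφ.memLp, Lp.coeFn_sub
                (T n (toHalfL2 φ)) (toHalfL2 φ), ae_restrict_mem measurableSet_halfSpace]
                with p h1 h2 h3 h4
              rw [h3, Pi.sub_apply, h1, h2, ← dist_eq_norm]
              exact hdist p h4
          _ = _ := by
              rw [eLpNorm_indicator_const hKc.isClosed.measurableSet two_ne_zero (by simp),
                Real.enorm_of_nonneg hc0.le]
              norm_num
      refine (ENNReal.toReal_mono (by finiteness) h2).trans ?_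
      rw [ENNReal.toReal_mul, ENNReal.toReal_ofReal hc0.le]
    rw [dist_zero_right, norm_norm]
    exact hnorm.trans_lt hc
  intro f
  have hmem : f ∈ (Submodule.span ℝ
      {g | ∃ ψ, IsTest halfSpace ψ ∧ g = toHalfL2 ψ}).topologicalClosure := by
    rw [dense_span_test]; trivial
  -- The operators are contractions, so convergence on a dense set suffices.
  have hspan : ∀ g ∈ Submodule.span ℝ {g | ∃ ψ, IsTest halfSpace ψ ∧ g = toHalfL2 ψ},
      Tendsto (fun n => T n g) atTop (𝓝 g) := by
    intro g hg
    induction hg using Submodule.span_induction with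
    | mem g hg => obtain ⟨ψ, hψ, rfl⟩ := hg; exact htest ψ hψ
    | zero => simp
    | add x y _ _ hx hy => simpa using hx.add hy
    | smul c x _ hx => simpa using hx.const_smul c
  rw [Metric.tendsto_atTop]
  intro ε hε
  obtain ⟨g, hg, hgf⟩ := Metric.mem_closure_iff.1 hmem (ε / 3) (by positivity)
  obtain ⟨N, hN⟩ := Metric.tendsto_atTop.1 (hspan g hg) (ε / 3) (by positivity)
  refine ⟨N, fun n hn => ?_⟩
  have h1 : dist (T n f) (T n g) ≤ dist f g := by
    rw [dist_eq_norm, ← map_sub, dist_eq_norm]; exact hle n _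
  calc dist (T n f) f ≤ dist (T n f) (T n g) + dist (T n g) g + dist g f := dist_triangle4 _ _ _ _
    _ < ε / 3 + ε / 3 + ε / 3 := by
        rw [dist_comm g f]
        linarith [hN n hn]
    _ = ε := by ring

/-! ### Regular gradient fields are elements of `H_⋆³(Σ)` -/

/-- The jets of the functions in `C_c^∞(ℝ³)`. -/
def testJets (n : ℕ) : Set (JetSpace n) := {w | ∃ ψ, IsTest Set.univ ψ ∧ IsJetOf w ψ}

theorem convolution_smul_spaceDeriv_left (i : Fin 3) {φ k : Space → ℝ} (hφ : IsTest Set.univ φ)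
    (hk : IsTest Set.univ k) :
    spaceDeriv i (convolution φ k (ContinuousLinearMap.lsmul ℝ ℝ) volume) =
      convolution (spaceDeriv i φ) k (ContinuousLinearMap.lsmul ℝ ℝ) volume := by
  funext p
  have h := hφ.2.1.hasFDerivAt_convolution_left (ContinuousLinearMap.lsmul ℝ ℝ)
    (hφ.1.of_le (by simp)) (hk.1.continuous.locallyIntegrable) (μ := (volume : Measure Space)) p
  rw [spaceDeriv, h.fderiv]
  rw [convolution, convolution]
  rw [ContinuousLinearMap.integral_apply]
  · rfl
  · have : ConvolutionExistsAt (fderiv ℝ φ) k p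
        ((ContinuousLinearMap.lsmul ℝ ℝ).precompL Space) (volume : Measure Space) :=
      HasCompactSupport.convolutionExists_left _ (hφ.2.1.fderiv ℝ)
        (hφ.1.continuous_fderiv (by simp)) hk.1.continuous.locallyIntegrable p
    exact this

theorem isTest_convolution {φ k : Space → ℝ} (hφ : IsTest Set.univ φ) (hk : IsTest Set.univ k) :
    IsTest Set.univ (convolution φ k (ContinuousLinearMap.lsmul ℝ ℝ) volume) :=
  ⟨hk.2.1.contDiff_convolution_right (ContinuousLinearMap.lsmul ℝ ℝ) (n := ⊤)
      hφ.1.continuous.locallyIntegrable hk.1,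
    hφ.2.1.convolution (ContinuousLinearMap.lsmul ℝ ℝ) hk.2.1, Set.subset_univ _⟩

theorem convolution_smul_spaceMultiDeriv_right (α : Fin 3 → ℕ) {φ k : Space → ℝ}
    (hφ : IsTest Set.univ φ) (hk : IsTest Set.univ k) :
    spaceMultiDeriv α (convolution φ k (ContinuousLinearMap.lsmul ℝ ℝ) volume) =
      convolution φ (spaceMultiDeriv α k) (ContinuousLinearMap.lsmul ℝ ℝ) volume := by
  have h : ∀ (i : Fin 3) (n : ℕ) (k : Space → ℝ), IsTest Set.univ k →
      (spaceDeriv i)^[n] (convolution φ k (ContinuousLinearMap.lsmul ℝ ℝ) volume) =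
        convolution φ ((spaceDeriv i)^[n] k) (ContinuousLinearMap.lsmul ℝ ℝ) volume := by
    intro i n k hk
    induction n with
    | zero => rfl
    | succ n ih =>
      rw [Function.iterate_succ_apply', ih, convolution_smul_comm,
        convolution_smul_spaceDeriv_left i (hk.spaceDeriv_iterate i n) hφ, convolution_smul_comm,
        Function.iterate_succ_apply']
  unfold spaceMultiDeriv
  rw [h _ _ _ hk, h _ _ _ (hk.spaceDeriv_iterate 2 _),
    h _ _ _ ((hk.spaceDeriv_iterate 2 _).spaceDeriv_iterate 1 _)]

/-- A gradient field of class `H^n` is the gradient of an element of the closure of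
`C_c^∞(ℝ³)`. One-sided mollification reduces this to mollified fields, for which
approximation of the field in `L²` already gives approximation of all derivatives. -/
theorem exists_jet_of_hasWeakOrder {n : ℕ} {v : VField} (hv : v ∈ gradSpace)
    (h : ∀ i, HasWeakOrder n (v i)) :
    ∃ w ∈ closure (testJets n), ∀ i, w (i, MultiIdx.zero n) = v i := by
  have hα : ∀ α : MultiIdx n, (α.1 0 : ℕ) + α.1 1 + α.1 2 ≤ n := fun α => by
    have := α.2
    rwa [Fin.sum_univ_three] at this
  choose g hg using fun (a : Fin 3 × MultiIdx n) =>
    (h a.1).exists_weakMulti (fun j => (a.2.1 j : ℕ)) (hα a.2)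
  set w : JetSpace n := WithLp.toLp 2 g with hw
  obtain ⟨T, hT, hT'⟩ := exists_mollify
  have hk : ∀ (m : ℕ) (α : MultiIdx n),
      IsTest {p | 0 < p.2} (spaceMultiDeriv (fun j => (α.1 j : ℕ)) (upMollifier m)) := fun m α =>
    (isTest_upMollifier m).spaceMultiDeriv _
  choose S hS1 hS2 using fun (m : ℕ) (α : MultiIdx n) =>
    exists_convHalf (hk m α).1.continuous (hk m α).2.1
  -- `J m v` is the jet of the mollification of a potential of `v`
  let J : ℕ → VField → JetSpace n := fun m v => WithLp.toLp 2 fun a => S m a.2 (v a.1)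
  have hJc : ∀ m, Continuous (J m) := fun m =>
    (PiLp.continuous_toLp 2 _).comp (continuous_pi fun a =>
      (S m a.2).continuous.comp (PiLp.continuous_apply 2 _ a.1))
  have hJmem : ∀ m, J m v ∈ closure (testJets n) := by
    intro m
    refine gradSpace_induction (p := fun v => J m v ∈ closure (testJets n))
      (isClosed_closure.preimage (hJc m)) (fun ψ hψ => subset_closure ?_) hv
    have hm := isTest_upMollifier m
    refine ⟨_, isTest_convolution hψ hm.univ, fun i α => ?_⟩
    rw [convolution_smul_spaceDeriv_left i hψ hm.univ,
      convolution_smul_spaceMultiDeriv_right _ (hψ.spaceDeriv i) hm.univ]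
    filter_upwards [hS2 m α (toHalfL2 (spaceDeriv i ψ)),
      ae_restrict_mem measurableSet_halfSpace] with p h1 h2
    change S m α (toHalfL2 (spaceDeriv i ψ)) p = _
    rw [h1, convHalf_toHalfL2 (hψ.spaceDeriv i) (hk m α) h2]
  -- Derivatives falling on the kernel may be moved to `v`.
  have hJeq : ∀ m a, S m a.2 (v a.1) = T m (g a) := by
    intro m a
    apply Lp.ext
    filter_upwards [hS2 m a.2 (v a.1), hT m (g a), ae_restrict_mem measurableSet_halfSpace]
      with p h1 h2 h3
    rw [h1, h2, (hg a).convHalf (isTest_upMollifier m) h3]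
  have hlim : Tendsto (fun m => J m v) atTop (𝓝 w) := by
    refine ((PiLp.continuous_toLp 2 _).tendsto g).comp (tendsto_pi_nhds.2 fun a => ?_)
    simp_rw [hJeq]
    exact hT' (g a)
  refine ⟨w, isClosed_closure.mem_of_tendsto hlim (Eventually.of_forall hJmem), fun i => ?_⟩
  have h0 := hg (i, MultiIdx.zero n)
  refine eq_of_inner_test fun ψ hψ => ?_
  have := h0 ψ hψ
  simpa [MultiIdx.zero, spaceMultiDeriv] using this

/-! ### Structure of `H_⋆^{n+1}(Σ)` -/

/-- Dominated convergence in `L²(Σ)`. -/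
theorem tendsto_toHalfL2 {f : ℕ → Space → ℝ} {g : Space → ℝ} (hf : ∀ n, MemLp (f n) 2 halfVol)
    (hg : MemLp g 2 halfVol) {b : Space → ℝ} (hb : Integrable b halfVol)
    (hle : ∀ n, ∀ p ∈ halfSpace, (f n p - g p) ^ 2 ≤ b p)
    (hlim : ∀ p ∈ halfSpace, Tendsto (fun n => f n p) atTop (𝓝 (g p))) :
    Tendsto (fun n => toHalfL2 (f n)) atTop (𝓝 (toHalfL2 g)) := by
  rw [tendsto_iff_norm_sub_tendsto_zero]
  have h1 : ∀ n, ‖toHalfL2 (f n) - toHalfL2 g‖ ^ 2 = ∫ p in halfSpace, (f n p - g p) ^ 2 := by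
    intro n
    rw [← real_inner_self_eq_norm_sq, L2.inner_def]
    refine integral_congr_ae ?_
    filter_upwards [Lp.coeFn_sub (toHalfL2 (f n)) (toHalfL2 g), coeFn_toHalfL2 (hf n),
      coeFn_toHalfL2 hg] with p h2 h3 h4
    rw [h2, Pi.sub_apply, h3, h4]
    simp [sq]
  have h2 : Tendsto (fun n => ∫ p in halfSpace, (f n p - g p) ^ 2) atTop (𝓝 0) := by
    have := tendsto_integral_of_dominated_convergence (μ := halfVol) (F := fun n p => (f n p - g p) ^ 2)
      (f := fun _ => (0 : ℝ)) b (fun n => (((hf n).1.sub hg.1).pow 2)) hb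
      (fun n => ((ae_restrict_mem measurableSet_halfSpace).mono fun p hp => by
        rw [Real.norm_of_nonneg (sq_nonneg _)]; exact hle n p hp))
      ((ae_restrict_mem measurableSet_halfSpace).mono fun p hp => by
        have := ((hlim p hp).sub_const (g p)).pow 2
        simpa using this)
    simpa using this
  simp_rw [← h1] at h2
  have h3 := h2.sqrt
  simpa using h3

/-- The gradient of an element of `H_⋆^{n+1}(Σ)`, as a vector field. -/
noncomputable def gradField (n : ℕ) : HStar n →L[ℝ] VField :=
  (PiLp.continuousLinearEquiv 2 ℝ (fun _ : Fin 3 => HalfL2)).symm.toContinuousLinearMap ∘L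
    ContinuousLinearMap.pi (fun i => (PiLp.proj 2 (fun _ : Fin 3 × MultiIdx n => HalfL2)
      (i, MultiIdx.zero n) : JetSpace n →L[ℝ] HalfL2) ∘L (smoothJets n).topologicalClosure.subtypeL)

theorem gradField_apply {n : ℕ} (u : HStar n) (i : Fin 3) : gradField n u i = u.grad i := rfl

theorem IsTest.isSchwartzOnHalfSpace {ψ : Space → ℝ} (h : IsTest Set.univ ψ) :
    IsSchwartzOnHalfSpace ψ := by
  refine ⟨h.1, fun m α => ?_⟩
  have h1 := h.spaceMultiDeriv α
  have hc : Continuous fun p : Space => ‖p.1‖ ^ m * WaterWave.spaceMultiDeriv α ψ p :=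
    (by fun_prop : Continuous fun p : Space => ‖p.1‖ ^ m).mul h1.1.continuous
  obtain ⟨C, hC⟩ := hc.bounded_above_of_compact_support
    (HasCompactSupport.mul_left h1.2.1)
  refine ⟨C, fun p _ => ?_⟩
  have := hC p
  rwa [norm_mul, Real.norm_of_nonneg (by positivity), Real.norm_eq_abs] at this

theorem testJets_subset (n : ℕ) : testJets n ⊆ smoothJets n := by
  rintro w ⟨ψ, hψ, hw⟩
  exact ⟨ψ, hψ.isSchwartzOnHalfSpace, hw⟩

/-- The gradients of elements of `H_⋆^{n+1}(Σ)` include all gradient fields of class `H^n`. -/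
theorem exists_hstar_of_hasWeakOrder {n : ℕ} {v : VField} (hv : v ∈ gradSpace)
    (h : ∀ i, HasWeakOrder n (v i)) : ∃ u : HStar n, gradField n u = v := by
  obtain ⟨w, hw, hw'⟩ := exists_jet_of_hasWeakOrder hv h
  refine ⟨⟨w, closure_mono (testJets_subset n) hw⟩, ?_⟩
  ext1 i
  exact hw' i

theorem spaceDeriv_iterate_comm {u : Space → ℝ} (hu : ContDiff ℝ ∞ u) (i j : Fin 3) (k : ℕ) :
    spaceDeriv j ((spaceDeriv i)^[k] u) = (spaceDeriv i)^[k] (spaceDeriv j u) := by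
  induction k with
  | zero => rfl
  | succ k ih =>
    rw [Function.iterate_succ_apply', spaceDeriv_comm (spaceDeriv_iterate_contDiff hu i k), ih,
      Function.iterate_succ_apply']

theorem spaceDeriv_spaceMultiDeriv {u : Space → ℝ} (hu : ContDiff ℝ ∞ u) (j : Fin 3)
    (α : Fin 3 → ℕ) :
    spaceDeriv j (spaceMultiDeriv α u) = spaceMultiDeriv (α + Pi.single j 1) u := by
  have h2 := spaceDeriv_iterate_contDiff hu 2 (α 2)
  have h1 := spaceDeriv_iterate_contDiff h2 1 (α 1)
  unfold spaceMultiDeriv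
  fin_cases j
  · simp only [Fin.zero_eta, Fin.isValue, Pi.add_apply, Pi.single_eq_same, ne_eq, Fin.reduceEq,
      not_false_eq_true, Pi.single_eq_of_ne, add_zero]
    rw [← Function.iterate_succ_apply' (spaceDeriv 0)]
  · simp only [Fin.mk_one, Fin.isValue, Pi.add_apply, Pi.single_eq_same, ne_eq, Fin.reduceEq,
      not_false_eq_true, Pi.single_eq_of_ne, add_zero]
    rw [spaceDeriv_iterate_comm h1, ← Function.iterate_succ_apply' (spaceDeriv 1)]
  · simp only [Fin.reduceFinMk, Fin.isValue, Pi.add_apply, Pi.single_eq_same, ne_eq, Fin.reduceEq,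
      not_false_eq_true, Pi.single_eq_of_ne, add_zero]
    rw [spaceDeriv_iterate_comm h1, spaceDeriv_iterate_comm h2,
      ← Function.iterate_succ_apply' (spaceDeriv 2)]

theorem spaceMultiDeriv_contDiff {u : Space → ℝ} (hu : ContDiff ℝ ∞ u) (α : Fin 3 → ℕ) :
    ContDiff ℝ ∞ (spaceMultiDeriv α u) :=
  spaceDeriv_iterate_contDiff (spaceDeriv_iterate_contDiff (spaceDeriv_iterate_contDiff hu 2 _)
    1 _) 0 _

theorem IsJetOf.memLp {n : ℕ} {w : JetSpace n} {u : Space → ℝ} (h : IsJetOf w u) (i : Fin 3)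
    (α : MultiIdx n) :
    MemLp (spaceMultiDeriv (fun j => (α.1 j : ℕ)) (spaceDeriv i u)) 2 halfVol :=
  (Lp.memLp (w (i, α))).ae_eq (h i α)

theorem IsJetOf.eq {n : ℕ} {w : JetSpace n} {u : Space → ℝ} (h : IsJetOf w u) (i : Fin 3)
    (α : MultiIdx n) :
    w (i, α) = toHalfL2 (spaceMultiDeriv (fun j => (α.1 j : ℕ)) (spaceDeriv i u)) :=
  Lp.ext ((h i α).trans (coeFn_toHalfL2 (h.memLp i α)).symm)

/-- A closed condition that holds for jets of smooth functions holds on `H_⋆^{n+1}(Σ)`. -/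
theorem HStar.induction {n : ℕ} {p : JetSpace n → Prop} (hp : IsClosed {w | p w})
    (h : ∀ w u, IsSchwartzOnHalfSpace u → IsJetOf w u → p w) (u : HStar n) : p u :=
  closure_minimal (s := (smoothJets n : Set (JetSpace n)))
    (by rintro w ⟨u, hu, hw⟩; exact h w u hu hw) hp u.2

/-- The entries of a jet are weak derivatives of one another. -/
theorem HStar.weakD {n : ℕ} (u : HStar n) (i j : Fin 3) {α β : MultiIdx n}
    (hβ : ∀ k, (β.1 k : ℕ) = α.1 k + Pi.single (M := fun _ => ℕ) j 1 k) :
    WeakD j (u.1 (i, α)) (u.1 (i, β)) := by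
  intro ψ hψ
  have hc : ∀ a, Continuous fun w : JetSpace n => w a := fun a => PiLp.continuous_apply 2 _ a
  refine HStar.induction (p := fun w => inner ℝ (w (i, β)) (toHalfL2 ψ) =
    -inner ℝ (w (i, α)) (toHalfL2 (spaceDeriv j ψ))) (isClosed_eq
    ((hc _).inner continuous_const) ((hc _).inner continuous_const).neg) (fun w u hu hw => ?_) u
  have e : spaceMultiDeriv (fun k => (β.1 k : ℕ)) (spaceDeriv i u) =
      spaceDeriv j (spaceMultiDeriv (fun k => (α.1 k : ℕ)) (spaceDeriv i u)) := by
    rw [spaceDeriv_spaceMultiDeriv (spaceDeriv_contDiff hu.1 i)]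
    congr 1
    funext k
    exact hβ k
  have hm := hw.memLp i β
  rw [e] at hm
  rw [hw.eq, hw.eq, e]
  exact weakD_toHalfL2 j (spaceMultiDeriv_contDiff (spaceDeriv_contDiff hu.1 i) _) (hw.memLp i α)
    hm ψ hψ

theorem HStar.hasWeakOrder_jet {n : ℕ} (u : HStar n) (i : Fin 3) : ∀ (m : ℕ) (α : MultiIdx n),
    (∑ k, (α.1 k : ℕ)) + m ≤ n → HasWeakOrder m (u.1 (i, α)) := by
  intro m
  induction m with
  | zero => intros; trivial
  | succ m ih =>
    intro α hα j
    have hsum : ∑ k, ((α.1 k : ℕ) + Pi.single (M := fun _ => ℕ) j 1 k) =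
        (∑ k, (α.1 k : ℕ)) + 1 := by
      rw [Finset.sum_add_distrib, Finset.sum_pi_single']
      simp
    let β : MultiIdx n := ⟨fun k => ⟨α.1 k + Pi.single (M := fun _ => ℕ) j 1 k, by
      have h1 : (α.1 k : ℕ) + Pi.single (M := fun _ => ℕ) j 1 k ≤
          ∑ k, ((α.1 k : ℕ) + Pi.single (M := fun _ => ℕ) j 1 k) :=
        Finset.single_le_sum (f := fun k => (α.1 k : ℕ) + Pi.single (M := fun _ => ℕ) j 1 k)
          (fun _ _ => Nat.zero_le _) (Finset.mem_univ k)
      omega⟩, by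
      change ∑ k, ((α.1 k : ℕ) + Pi.single (M := fun _ => ℕ) j 1 k) ≤ n
      omega⟩
    refine ⟨u.1 (i, β), u.weakD i j fun k => rfl, ih β ?_⟩
    change (∑ k, ((α.1 k : ℕ) + Pi.single (M := fun _ => ℕ) j 1 k)) + m ≤ n
    omega

theorem HStar.hasWeakOrder_grad {n : ℕ} (u : HStar n) (i : Fin 3) : HasWeakOrder n (u.grad i) :=
  u.hasWeakOrder_jet i n _ (by simp [MultiIdx.zero])

/-- The jet of an element of `H_⋆^{n+1}(Σ)` consists of the weak derivatives of its gradient. -/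
theorem HStar.weakMulti {n : ℕ} (u : HStar n) (i : Fin 3) (α : MultiIdx n) :
    WeakMulti (fun k => (α.1 k : ℕ)) (u.grad i) (u.1 (i, α)) := by
  intro ψ hψ
  have hc : ∀ a, Continuous fun w : JetSpace n => w a := fun a => PiLp.continuous_apply 2 _ a
  refine HStar.induction (p := fun w => inner ℝ (w (i, α)) (toHalfL2 ψ) =
    (-1) ^ ((α.1 0 : ℕ) + α.1 1 + α.1 2) * inner ℝ (w (i, MultiIdx.zero n))
      (toHalfL2 (spaceMultiDeriv (fun k => (α.1 k : ℕ)) ψ))) (isClosed_eq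
    ((hc _).inner continuous_const) (((hc _).inner continuous_const).const_mul _))
    (fun w u hu hw => ?_) u
  have h1 := fun (f ψ : Space → ℝ) (i : Fin 3) (hf : ContDiff ℝ ∞ f) (hψ : IsTest halfSpace ψ) =>
    integral_spaceDeriv_mul_test i hf hψ
  have h2 : ∀ (i : Fin 3) (k : ℕ) (f ψ : Space → ℝ), ContDiff ℝ ∞ f → IsTest halfSpace ψ →
      ∫ p in halfSpace, (spaceDeriv i)^[k] f p * ψ p =
        (-1) ^ k * ∫ p in halfSpace, f p * (spaceDeriv i)^[k] ψ p := by
    intro i k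
    induction k with
    | zero => intros; simp
    | succ k ih =>
      intro f ψ hf hψ
      rw [Function.iterate_succ_apply', h1 _ _ _ (spaceDeriv_iterate_contDiff hf i k) hψ,
        ih _ _ hf (hψ.spaceDeriv i), ← Function.iterate_succ_apply]
      ring
  have hz : spaceMultiDeriv (fun k => ((MultiIdx.zero n).1 k : ℕ)) (spaceDeriv i u) =
      spaceDeriv i u := by simp [spaceMultiDeriv, MultiIdx.zero]
  have hu1 := spaceDeriv_contDiff hu.1 i
  have hu2 := spaceDeriv_iterate_contDiff hu1 2 (α.1 2)
  have e1 : ∀ (β : MultiIdx n) (φ : Space → ℝ), IsTest halfSpace φ →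
      inner ℝ (w (i, β)) (toHalfL2 φ) =
        ∫ p in halfSpace, spaceMultiDeriv (fun k => (β.1 k : ℕ)) (spaceDeriv i u) p * φ p := by
    intro β φ hφ
    rw [inner_toHalfL2 _ hφ.memLp]
    refine integral_congr_ae ?_
    filter_upwards [hw i β] with p hp
    rw [hp]
  rw [e1 _ _ hψ, e1 _ _ (hψ.spaceMultiDeriv _), hz]
  have hψ0 := hψ.spaceDeriv_iterate 0 (α.1 0)
  have hψ1 := hψ0.spaceDeriv_iterate 1 (α.1 1)
  have hcomm : ∀ (i j : Fin 3) (k l : ℕ) (f : Space → ℝ), ContDiff ℝ ∞ f →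
      (spaceDeriv i)^[k] ((spaceDeriv j)^[l] f) = (spaceDeriv j)^[l] ((spaceDeriv i)^[k] f) := by
    intro i j k l f hf
    induction k with
    | zero => rfl
    | succ k ih =>
      rw [Function.iterate_succ_apply', ih,
        spaceDeriv_iterate_comm (spaceDeriv_iterate_contDiff hf i k), Function.iterate_succ_apply']
  have hS : spaceMultiDeriv (fun k => (α.1 k : ℕ)) ψ = (spaceDeriv 2)^[(α.1 2 : ℕ)]
      ((spaceDeriv 1)^[(α.1 1 : ℕ)] ((spaceDeriv 0)^[(α.1 0 : ℕ)] ψ)) := by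
    unfold spaceMultiDeriv
    rw [hcomm 1 2 _ _ _ hψ.1, hcomm 0 2 _ _ _ (spaceDeriv_iterate_contDiff hψ.1 _ _),
      hcomm 0 1 _ _ _ hψ.1]
  rw [hS]
  unfold spaceMultiDeriv
  rw [h2 0 _ _ _ (spaceDeriv_iterate_contDiff hu2 1 _) hψ, h2 1 _ _ _ hu2 hψ0,
    h2 2 _ _ _ hu1 hψ1]
  ring

/-- Elements of `H_⋆^{n+1}(Σ)` are determined by their gradients. -/
theorem gradField_injective (n : ℕ) : Function.Injective (gradField n) := by
  intro u v h
  apply Subtype.ext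
  ext1 ⟨i, α⟩
  have h1 := congrArg (fun f : VField => f i) h
  have h2 := u.weakMulti i α
  rw [← gradField_apply, h] at h2
  exact h2.unique (v.weakMulti i α)

/-- The cut-off functions `χ(p / (n + 1))`. -/
noncomputable def cutoff (n : ℕ) (p : Space) : ℝ :=
  (⟨1, 2, one_pos, one_lt_two⟩ : ContDiffBump (0 : Space)) ((1 / ((n : ℝ) + 1)) • p)

theorem contDiff_cutoff (n : ℕ) : ContDiff ℝ ∞ (cutoff n) :=
  (ContDiffBump.contDiff _).comp (by fun_prop)

theorem hasCompactSupport_cutoff (n : ℕ) : HasCompactSupport (cutoff n) :=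
  (ContDiffBump.hasCompactSupport _).comp_homeomorph
    (Homeomorph.smulOfNeZero (1 / ((n : ℝ) + 1)) (by positivity))

theorem cutoff_bounds (n : ℕ) (p : Space) : 0 ≤ cutoff n p ∧ cutoff n p ≤ 1 :=
  ⟨ContDiffBump.nonneg _, ContDiffBump.le_one _⟩

theorem tendsto_cutoff (p : Space) : ∀ᶠ n in atTop, cutoff n p = 1 := by
  obtain ⟨N, hN⟩ := exists_nat_ge ‖p‖
  filter_upwards [eventually_ge_atTop N] with n hn
  refine ContDiffBump.one_of_mem_closedBall _ ?_
  rw [mem_closedBall_zero_iff, norm_smul, Real.norm_of_nonneg (by positivity), one_div,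
    inv_mul_le_iff₀ (by positivity), mul_one]
  have : (N : ℝ) ≤ n := by exact_mod_cast hn
  linarith

/-- The derivatives of the cut-off functions are `O(1 / n)` and supported in `|p| ≤ 2(n + 1)`,
hence bounded by `1 / (1 + |y|)` uniformly in `n`. -/
theorem exists_spaceDeriv_cutoff_bound : ∃ C : ℝ, 0 ≤ C ∧ ∀ (i : Fin 3) (n : ℕ) (p : Space),
    |spaceDeriv i (cutoff n) p| ≤ C / ((n : ℝ) + 1) ∧
      spaceDeriv i (cutoff n) p ^ 2 ≤ C * (1 + p.2 ^ 2)⁻¹ := by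
  set χ : ContDiffBump (0 : Space) := ⟨1, 2, one_pos, one_lt_two⟩ with hχ
  have hχt : IsTest Set.univ (χ : Space → ℝ) := isTest_univ_of χ.contDiff χ.hasCompactSupport
  have hder : ∀ (i : Fin 3) (n : ℕ) (p : Space), spaceDeriv i (cutoff n) p =
      (1 / ((n : ℝ) + 1)) * spaceDeriv i χ ((1 / ((n : ℝ) + 1)) • p) := by
    intro i n p
    have h1 := (hχt.1.differentiable (by simp) ((1 / ((n : ℝ) + 1)) • p)).hasFDerivAt.comp p
      ((hasFDerivAt_id p).const_smul (1 / ((n : ℝ) + 1)))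
    have h2 : HasFDerivAt (cutoff n) ((fderiv ℝ χ ((1 / ((n : ℝ) + 1)) • p)).comp
      ((1 / ((n : ℝ) + 1)) • ContinuousLinearMap.id ℝ Space)) p := h1
    simp only [spaceDeriv, h2.fderiv]
    simp
  choose C hC using fun i : Fin 3 => (hχt.spaceDeriv i).1.continuous.bounded_above_of_compact_support
    (hχt.spaceDeriv i).2.1
  set D := 1 + ∑ i, |C i| with hD
  have hD1 : 1 ≤ D := by
    have : 0 ≤ ∑ i, |C i| := Finset.sum_nonneg fun i _ => abs_nonneg _
    linarith
  have hCD : ∀ i p, |spaceDeriv i χ p| ≤ D := fun i p => by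
    have h1 : |C i| ≤ ∑ i, |C i| := Finset.single_le_sum (fun i _ => abs_nonneg (C i))
      (Finset.mem_univ i)
    have h2 := hC i p
    rw [Real.norm_eq_abs] at h2
    linarith [le_abs_self (C i)]
  have hb1 : ∀ (i : Fin 3) (n : ℕ) (p : Space), |spaceDeriv i (cutoff n) p| ≤ D / ((n : ℝ) + 1) := by
    intro i n p
    rw [hder, abs_mul, abs_of_nonneg (by positivity), div_eq_mul_one_div D, mul_comm D]
    exact mul_le_mul_of_nonneg_left (hCD i _) (by positivity)
  refine ⟨5 * D ^ 2, by positivity, fun i n p => ⟨(hb1 i n p).trans ?_, ?_⟩⟩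
  · refine div_le_div_of_nonneg_right ?_ (by positivity)
    nlinarith
  · by_cases hp : |p.2| ≤ 2 * ((n : ℝ) + 1)
    · have h1 : spaceDeriv i (cutoff n) p ^ 2 ≤ (D / ((n : ℝ) + 1)) ^ 2 := by
        rw [← sq_abs]; gcongr; exact hb1 i n p
      refine h1.trans ?_
      have h2 : p.2 ^ 2 ≤ (2 * ((n : ℝ) + 1)) ^ 2 := by rw [← sq_abs]; gcongr
      rw [div_pow, ← div_eq_mul_inv, div_le_div_iff₀ (by positivity) (by positivity)]
      have h3 : 1 + p.2 ^ 2 ≤ 5 * ((n : ℝ) + 1) ^ 2 := by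
        nlinarith [(Nat.cast_nonneg n : (0 : ℝ) ≤ n)]
      nlinarith [sq_nonneg D]
    · have h1 : (1 / ((n : ℝ) + 1)) • p ∉ tsupport (χ : Space → ℝ) := by
        rw [χ.tsupport_eq]
        intro h
        rw [mem_closedBall_zero_iff, norm_smul, Real.norm_of_nonneg (by positivity), one_div,
          inv_mul_le_iff₀ (by positivity)] at h
        have h2 : |p.2| ≤ ‖p‖ := by rw [Prod.norm_def]; exact le_max_right _ _
        have h3 : χ.rOut = 2 := rfl
        rw [h3] at h
        exact hp (by linarith)
      rw [hder, spaceDeriv_eq_zero_of_notMem i h1]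
      simp only [mul_zero, ne_eq, OfNat.ofNat_ne_zero, not_false_eq_true, zero_pow]
      positivity

theorem spaceDeriv_mul {f g : Space → ℝ} (hf : ContDiff ℝ ∞ f) (hg : ContDiff ℝ ∞ g) (i : Fin 3) :
    spaceDeriv i (fun p => f p * g p) = fun p => f p * spaceDeriv i g p + spaceDeriv i f p * g p := by
  funext p
  simp only [spaceDeriv]
  rw [fderiv_fun_mul (hf.differentiable (by simp) p) (hg.differentiable (by simp) p)]
  simp
  ring

/-- Cutting off shows that the gradients of the functions in the dense class are limits of
gradients of compactly supported functions. -/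
theorem IsSchwartzOnHalfSpace.gradTest_mem {u : Space → ℝ} (hu : IsSchwartzOnHalfSpace u)
    (h : ∀ i, MemLp (spaceDeriv i u) 2 halfVol) : gradTest u ∈ gradSpace := by
  obtain ⟨C, hC0, hC⟩ := exists_spaceDeriv_cutoff_bound
  obtain ⟨A, hA⟩ := hu.2 0 0
  obtain ⟨B, hB⟩ := hu.2 2 0
  -- Only decay in the horizontal variables is available; decay in `y` comes from the derivatives of
  -- the cut-off functions.
  have hdec : ∀ p ∈ halfSpace, u p ^ 2 ≤ (A + B) ^ 2 * (1 + ‖p.1‖ ^ 2) ^ (-(4 : ℝ) / 2) := by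
    intro p hp
    have h1 := hA p hp
    have h2 := hB p hp
    simp only [spaceMultiDeriv, Pi.zero_apply, Function.iterate_zero, id] at h1 h2
    have h3 : (1 + ‖p.1‖ ^ 2) * |u p| ≤ A + B := by linarith
    have h4 : (1 + ‖p.1‖ ^ 2) ^ (-(4 : ℝ) / 2) = ((1 + ‖p.1‖ ^ 2) ^ 2)⁻¹ := by
      rw [show (-(4 : ℝ) / 2) = -((2 : ℕ) : ℝ) by norm_num, Real.rpow_neg (by positivity),
        Real.rpow_natCast]
    rw [h4, ← div_eq_mul_inv, le_div_iff₀ (by positivity), ← sq_abs (u p), ← mul_pow, mul_comm]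
    gcongr
  have hψ : ∀ n, IsTest Set.univ fun p => cutoff n p * u p := fun n =>
    isTest_univ_of ((contDiff_cutoff n).mul hu.1) (hasCompactSupport_cutoff n).mul_right
  have hlim : Tendsto (fun n => gradTest fun p => cutoff n p * u p) atTop (𝓝 (gradTest u)) := by
    refine ((PiLp.continuous_toLp 2 _).tendsto _).comp (tendsto_pi_nhds.2 fun i => ?_)
    -- An integrable majorant for `|∂_i (χ u) - ∂_i u|²`.
    have hint : Integrable (fun p : Space => 2 * (spaceDeriv i u p) ^ 2 +
        2 * (C * (A + B) ^ 2) * ((1 + ‖p.1‖ ^ 2) ^ (-(4 : ℝ) / 2) * (1 + p.2 ^ 2)⁻¹)) halfVol := by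
      refine ((h i).integrable_sq.const_mul 2).add (Integrable.const_mul ?_ _)
      have h1 : Integrable (fun q : Plane => (1 + ‖q‖ ^ 2) ^ (-(4 : ℝ) / 2)) :=
        integrable_rpow_neg_one_add_norm_sq (by simp; norm_num)
      exact (h1.mul_prod integrable_inv_one_add_sq).restrict
    refine tendsto_toHalfL2 (fun n => ((hψ n).spaceDeriv i).memLp) (h i) hint
      (fun n p hp => ?_) (fun p hp => ?_)
    · rw [spaceDeriv_mul (contDiff_cutoff n) hu.1]
      obtain ⟨h1, h2⟩ := cutoff_bounds n p
      have h3 := (hC i n p).2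
      have h4 := hdec p hp
      have h5 : (spaceDeriv i (cutoff n) p * u p) ^ 2 ≤ (C * (1 + p.2 ^ 2)⁻¹) *
          ((A + B) ^ 2 * (1 + ‖p.1‖ ^ 2) ^ (-(4 : ℝ) / 2)) := by
        rw [mul_pow]; gcongr
      have h6 : ((1 - cutoff n p) * spaceDeriv i u p) ^ 2 ≤ spaceDeriv i u p ^ 2 := by
        rw [mul_pow]
        exact mul_le_of_le_one_left (sq_nonneg _) (by nlinarith)
      have h7 : (cutoff n p * spaceDeriv i u p + spaceDeriv i (cutoff n) p * u p -
          spaceDeriv i u p) ^ 2 ≤ 2 * (spaceDeriv i (cutoff n) p * u p) ^ 2 +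
          2 * ((1 - cutoff n p) * spaceDeriv i u p) ^ 2 := by
        nlinarith [sq_nonneg (spaceDeriv i (cutoff n) p * u p +
          (1 - cutoff n p) * spaceDeriv i u p)]
      refine h7.trans ?_
      linarith
    · rw [show (fun n => spaceDeriv i (fun p => cutoff n p * u p) p) = fun n =>
        cutoff n p * spaceDeriv i u p + spaceDeriv i (cutoff n) p * u p from
        funext fun n => congrFun (spaceDeriv_mul (contDiff_cutoff n) hu.1 i) p]
      have h1 : Tendsto (fun n => cutoff n p) atTop (𝓝 1) :=
        tendsto_const_nhds.congr' ((tendsto_cutoff p).mono fun n hn => hn.symm)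
      have h2 : Tendsto (fun n => spaceDeriv i (cutoff n) p) atTop (𝓝 0) :=
        squeeze_zero_norm (fun n => (hC i n p).1) (by
          simpa [div_eq_mul_inv] using
            (tendsto_one_div_add_atTop_nhds_zero_nat (𝕜 := ℝ)).const_mul C)
      simpa using (h1.mul_const (spaceDeriv i u p)).add (h2.mul_const (u p))
  exact gradTests.isClosed_topologicalClosure.mem_of_tendsto hlim
    (Eventually.of_forall fun n => WaterWave.gradTest_mem (hψ n))

/-- The gradients of elements of `H_⋆^{n+1}(Σ)` are gradient fields. -/
theorem gradField_mem {n : ℕ} (u : HStar n) : gradField n u ∈ gradSpace := by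
  have hc : ∀ a, Continuous fun w : JetSpace n => w a := fun a => PiLp.continuous_apply 2 _ a
  refine HStar.induction (p := fun w : JetSpace n =>
    (WithLp.toLp 2 fun i => w (i, MultiIdx.zero n) : VField) ∈ gradSpace)
    (gradTests.isClosed_topologicalClosure.preimage
      ((PiLp.continuous_toLp 2 _).comp (continuous_pi fun i => hc _))) (fun w u hu hw => ?_) u
  have hz : ∀ i, spaceMultiDeriv (fun k => ((MultiIdx.zero n).1 k : ℕ)) (spaceDeriv i u) =
      spaceDeriv i u := by simp [spaceMultiDeriv, MultiIdx.zero]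
  have h1 : ∀ i, MemLp (spaceDeriv i u) 2 halfVol := fun i => by
    have := hw.memLp i (MultiIdx.zero n)
    rwa [hz] at this
  convert hu.gradTest_mem h1 using 1
  ext1 i
  change w (i, MultiIdx.zero n) = toHalfL2 _
  rw [hw.eq, hz]

/-- The jets of the functions in `C_c^∞(ℝ³)` are dense in `H_⋆^{n+1}(Σ)`. -/
theorem HStar.mem_closure_testJets {n : ℕ} (u : HStar n) : (u : JetSpace n) ∈ closure (testJets n) := by
  obtain ⟨w, hw, hw'⟩ := exists_jet_of_hasWeakOrder (gradField_mem u) u.hasWeakOrder_grad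
  -- The element constructed from the gradient of `u` has the same gradient as `u`.
  have : u = ⟨w, closure_mono (testJets_subset n) hw⟩ := by
    apply gradField_injective n
    ext1 i
    exact (hw' i).symm
  rw [this]
  exact hw

/-- A closed condition that holds for jets of functions in `C_c^∞(ℝ³)` holds on
`H_⋆^{n+1}(Σ)`. -/
theorem HStar.test_induction {n : ℕ} {p : JetSpace n → Prop} (hp : IsClosed {w | p w})
    (h : ∀ w ψ, IsTest Set.univ ψ → IsJetOf w ψ → p w) (u : HStar n) : p u :=
  closure_minimal (by rintro w ⟨ψ, hψ, hw⟩; exact h w ψ hψ hw) hp u.mem_closure_testJets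

/-! ### The Fourier transform of real functions in the plane -/

/-- Real-valued functions in `L²(ℝ²)`. -/
abbrev PlaneL2 : Type := Lp ℝ 2 (volume : Measure Plane)

/-- Complex-valued functions in `L²(ℝ²)`. -/
abbrev PlaneL2C : Type := Lp ℂ 2 (volume : Measure Plane)

/-- A real test function in the plane as a complex Schwartz function. -/
noncomputable def testSchwartz {φ : Plane → ℝ} (hφ : IsTest Set.univ φ) : SchwartzMap Plane ℂ :=
  HasCompactSupport.toSchwartzMap (f := fun q => (φ q : ℂ))
    (hφ.2.1.comp_left Complex.ofReal_zero) (Complex.ofRealCLM.contDiff.comp hφ.1)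

theorem coe_testSchwartz {φ : Plane → ℝ} (hφ : IsTest Set.univ φ) :
    (testSchwartz hφ : Plane → ℂ) = fun q => (φ q : ℂ) := rfl

/-- The Fourier transform of a real test function. -/
noncomputable def testFourier (φ : Plane → ℝ) : Plane → ℂ := 𝓕 (fun q => (φ q : ℂ))

theorem testFourier_eq {φ : Plane → ℝ} (hφ : IsTest Set.univ φ) :
    testFourier φ = (𝓕 (testSchwartz hφ) : SchwartzMap Plane ℂ) := by
  rw [SchwartzMap.fourier_coe, coe_testSchwartz]; rfl

theorem integral_schwartz_mul_fourier (f : PlaneL2C) (φ : SchwartzMap Plane ℂ) :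
    ∫ w, φ w * (𝓕 f : PlaneL2C) w = ∫ x, (𝓕 φ : SchwartzMap Plane ℂ) x * f x := by
  have h := congrArg (fun T : TemperedDistribution Plane ℂ => T φ)
    (Lp.fourier_toTemperedDistribution_eq f)
  simp only [TemperedDistribution.fourier_apply, Lp.toTemperedDistribution_apply,
    smul_eq_mul] at h
  exact h.symm

theorem integral_test_mul_fourier (f : PlaneL2C) {φ : Plane → ℝ} (hφ : IsTest Set.univ φ) :
    ∫ w, φ w • (𝓕 f : PlaneL2C) w = ∫ x, testFourier φ x * f x := by
  rw [testFourier_eq hφ, ← integral_schwartz_mul_fourier]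
  rfl

/-- Two locally integrable functions that agree against real test functions are equal. -/
theorem ae_eq_of_integral_test {F : Type*} [NormedAddCommGroup F] [NormedSpace ℝ F]
    [CompleteSpace F] {f g : Plane → F}
    (hf : LocallyIntegrable f) (hg : LocallyIntegrable g)
    (h : ∀ φ : Plane → ℝ, IsTest Set.univ φ → ∫ w, φ w • f w = ∫ w, φ w • g w) : f =ᵐ[volume] g :=
  ae_eq_of_integral_contDiff_smul_eq hf hg fun φ h1 h2 => h φ ⟨h1, h2, Set.subset_univ _⟩

theorem locallyIntegrable_of_memLp {F : Type*} [NormedAddCommGroup F] {f : Plane → F}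
    (hf : MemLp f 2 volume) : LocallyIntegrable f :=
  hf.locallyIntegrable (by norm_num)

theorem fourier_ae_eq_of_integral (f : PlaneL2C) {c : Plane → ℂ} (hc : LocallyIntegrable c)
    (h : ∀ φ : Plane → ℝ, IsTest Set.univ φ →
      ∫ w, φ w • c w = ∫ x, testFourier φ x * f x) : (𝓕 f : PlaneL2C) =ᵐ[volume] c :=
  ae_eq_of_integral_test (locallyIntegrable_of_memLp (Lp.memLp _)) hc fun φ hφ => by
    rw [integral_test_mul_fourier f hφ, h φ hφ]

/-- The inclusion of real into complex functions. -/
noncomputable def ofRealL2 : PlaneL2 →L[ℝ] PlaneL2C := Complex.ofRealCLM.compLpL 2 volume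

theorem coeFn_ofRealL2 (f : PlaneL2) : ofRealL2 f =ᵐ[volume] fun x => (f x : ℂ) :=
  Complex.ofRealCLM.coeFn_compLpL f

theorem integral_test_mul_fourierReal (f : PlaneL2) {φ : Plane → ℝ} (hφ : IsTest Set.univ φ) :
    ∫ w, φ w • fourierReal f w = ∫ x, testFourier φ x * f x := by
  change ∫ w, φ w • (𝓕 (ofRealL2 f) : PlaneL2C) w = _
  rw [integral_test_mul_fourier _ hφ]
  refine integral_congr_ae ?_
  filter_upwards [coeFn_ofRealL2 f] with x hx
  rw [hx]

/-- A locally integrable function satisfying Parseval's relation against all test functions is the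
transform. -/
theorem fourierReal_ae_eq_of_integral (f : PlaneL2) {c : Plane → ℂ} (hc : LocallyIntegrable c)
    (h : ∀ φ : Plane → ℝ, IsTest Set.univ φ →
      ∫ w, φ w • c w = ∫ x, testFourier φ x * f x) : fourierReal f =ᵐ[volume] c :=
  ae_eq_of_integral_test (locallyIntegrable_of_memLp (Lp.memLp _)) hc fun φ hφ => by
    rw [integral_test_mul_fourierReal f hφ, h φ hφ]

theorem norm_fourierReal (f : PlaneL2) : ‖fourierReal f‖ = ‖f‖ := by
  change ‖(𝓕 (ofRealL2 f) : PlaneL2C)‖ = _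
  rw [Lp.norm_fourier_eq, Lp.norm_def, Lp.norm_def, eLpNorm_congr_ae (coeFn_ofRealL2 f)]
  congr 1
  refine eLpNorm_congr_norm_ae (ae_of_all _ fun x => ?_)
  simp

/-- The Fourier transform as a real-linear isometry. -/
noncomputable def fourierL : PlaneL2 →ₗᵢ[ℝ] PlaneL2C where
  toFun := fourierReal
  map_add' := fourierReal_add
  map_smul' := fourierReal_smul
  norm_map' := norm_fourierReal

theorem fourierL_apply (f : PlaneL2) : fourierL f = fourierReal f := rfl

theorem testFourier_neg (φ : Plane → ℝ) (x : Plane) :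
    testFourier (fun w => φ (-w)) x = (starRingEnd ℂ) (testFourier φ x) := by
  unfold testFourier
  rw [Real.fourier_eq, Real.fourier_eq, ← integral_conj, ← integral_neg_eq_self]
  refine integral_congr_ae (ae_of_all _ fun w => ?_)
  simp [Circle.smul_def]

theorem IsTest.comp_neg {φ : Plane → ℝ} (hφ : IsTest Set.univ φ) :
    IsTest Set.univ fun w => φ (-w) :=
  ⟨hφ.1.comp contDiff_neg, hφ.2.1.comp_homeomorph (Homeomorph.neg Plane), Set.subset_univ _⟩

/-- The transform of the conjugate. -/
theorem fourier_conj_ae_eq (f g : PlaneL2C) (h : g =ᵐ[volume] fun x => (starRingEnd ℂ) (f x)) :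
    (𝓕 g : PlaneL2C) =ᵐ[volume] fun w => (starRingEnd ℂ) ((𝓕 f : PlaneL2C) (-w)) := by
  have hm : MemLp (fun w => (starRingEnd ℂ) ((𝓕 f : PlaneL2C) (-w))) 2 volume := by
    have h1 := (Lp.memLp (𝓕 f : PlaneL2C)).comp_measurePreserving (Measure.measurePreserving_neg _)
    exact h1.star
  refine fourier_ae_eq_of_integral g (locallyIntegrable_of_memLp hm) fun φ hφ => ?_
  have h1 := congrArg (starRingEnd ℂ) (integral_test_mul_fourier f hφ.comp_neg)
  rw [← integral_conj, ← integral_conj, ← integral_neg_eq_self] at h1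
  have h2 : ∫ x, testFourier φ x * g x = ∫ x, testFourier φ x * (starRingEnd ℂ) (f x) :=
    integral_congr_ae (by filter_upwards [h] with x hx; rw [hx])
  rw [h2]
  simpa [testFourier_neg] using h1

/-- The Fourier transform of a real function has Hermitian symmetry. -/
theorem fourierReal_neg_ae (f : PlaneL2) :
    ∀ᵐ w : Plane, fourierReal f (-w) = (starRingEnd ℂ) (fourierReal f w) := by
  have h := fourier_conj_ae_eq (ofRealL2 f) (ofRealL2 f) (by
    filter_upwards [coeFn_ofRealL2 f] with x hx
    rw [hx, Complex.conj_ofReal])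
  filter_upwards [h] with w hw
  change _ = (starRingEnd ℂ) ((𝓕 (ofRealL2 f) : PlaneL2C) w)
  rw [hw, Complex.conj_conj]
  rfl

/-- A square integrable function with Hermitian symmetry is the transform of a real function. -/
theorem exists_fourierReal_eq {c : Plane → ℂ} (hc : MemLp c 2 volume)
    (h : ∀ᵐ w : Plane, c (-w) = (starRingEnd ℂ) (c w)) :
    ∃ f : PlaneL2, fourierReal f =ᵐ[volume] c := by
  set f : PlaneL2C := 𝓕⁻ (hc.toLp c) with hf
  have hF : (𝓕 f : PlaneL2C) = hc.toLp c := FourierInvPair.fourier_fourierInv_eq _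
  set g : PlaneL2C := (Lp.memLp f).star.toLp _ with hg
  have e := fourier_conj_ae_eq f g (Lp.memLp f).star.coeFn_toLp
  -- By the symmetry of `c`, the inverse transform `f` and its conjugate `g` have the same
  -- transform, so `f` is real.
  have e1 : (𝓕 g : PlaneL2C) = 𝓕 f := by
    apply Lp.ext
    rw [hF] at e ⊢
    have q := (Measure.measurePreserving_neg (volume : Measure Plane)).quasiMeasurePreserving
    filter_upwards [e, hc.coeFn_toLp, q.ae (hc.coeFn_toLp), h] with w h1 h2 h3 h4
    rw [h1, h3, h2, h4, Complex.conj_conj]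
  have e2 : g = f := (Lp.fourierTransformₗᵢ Plane ℂ).injective e1
  have hre : MemLp (fun x => (f x).re) 2 volume := (Lp.memLp f).re
  refine ⟨hre.toLp _, ?_⟩
  have e3 : ofRealL2 (hre.toLp _) = f := by
    apply Lp.ext
    have e4 : ∀ᵐ x : Plane, f x = (starRingEnd ℂ) (f x) := by
      have := (Lp.memLp f).star.coeFn_toLp
      rw [← hg, e2] at this
      exact this
    filter_upwards [coeFn_ofRealL2 (hre.toLp _), hre.coeFn_toLp, e4] with x h1 h2 h3
    rw [h1, h2]
    exact (Complex.conj_eq_iff_re.1 h3.symm)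
  have e5 : fourierReal (hre.toLp _) = hc.toLp c := by
    rw [← hF]; exact congrArg (fun g : PlaneL2C => (𝓕 g : PlaneL2C)) e3
  rw [e5]
  exact hc.coeFn_toLp

/-! ### Completeness of the Sobolev spaces -/

theorem measurable_weight (s : ℝ) : Measurable (weight s) := (continuous_weight s).measurable

theorem weight_mul (s t : ℝ) (w : Plane) : weight s w * weight t w = weight (s + t) w := by
  unfold weight
  rw [← Real.rpow_add (by positivity)]
  congr 1; ring

theorem weight_zero (w : Plane) : weight 0 w = 1 := by simp [weight]

theorem weight_neg_le_one {s : ℝ} (hs : s ≤ 0) (w : Plane) : weight s w ≤ 1 := by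
  rw [← weight_zero w]; exact weight_mono hs w

theorem one_le_weight {s : ℝ} (hs : 0 ≤ s) (w : Plane) : 1 ≤ weight s w := by
  rw [← weight_zero w]; exact weight_mono hs w

namespace Sobolev

variable {s : ℝ≥0}

theorem memLp_weight (f : Sobolev s) :
    MemLp (fun w => weight s w • fourierReal (toL2 f) w) 2 volume := f.2

theorem coeFn_weightedFourier (f : Sobolev s) :
    weightedFourier s f =ᵐ[volume] fun w => weight s w • fourierReal (toL2 f) w :=
  (memLp_weight f).coeFn_toLp

theorem norm_weightedFourier (f : Sobolev s) : ‖weightedFourier s f‖ = ‖f‖ := rfl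

theorem toL2_injective : Function.Injective (toL2 (s := s)) := Subtype.val_injective

theorem exists_toL2 {f : PlaneL2} (h : MemLp (fun w => weight s w • fourierReal f w) 2 volume) :
    ∃ g : Sobolev s, toL2 g = f := ⟨⟨f, h⟩, rfl⟩

theorem norm_toL2_le (f : Sobolev s) : ‖toL2 f‖ ≤ ‖f‖ := by
  rw [← norm_fourierReal, ← norm_weightedFourier f]
  refine Lp.norm_le_norm_of_ae_le ?_
  filter_upwards [coeFn_weightedFourier f] with w hw
  rw [hw, norm_smul, Real.norm_of_nonneg (weight_pos _ w).le]
  exact le_mul_of_one_le_left (norm_nonneg _) (one_le_weight s.coe_nonneg w)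

/-- The inclusion `H^s ⊆ L²` as a bounded operator. -/
noncomputable def toL2L (s : ℝ≥0) : Sobolev s →L[ℝ] PlaneL2 :=
  toL2.mkContinuous 1 fun f => by rw [one_mul]; exact norm_toL2_le f

@[simp] theorem toL2L_apply (f : Sobolev s) : toL2L s f = toL2 f := rfl

/-- `f ↦ (1 + |k|²)^{s/2} f̂` as an isometry. -/
noncomputable def weightedFourierL (s : ℝ≥0) : Sobolev s →ₗᵢ[ℝ] PlaneL2C where
  toLinearMap := weightedFourier s
  norm_map' := norm_weightedFourier

/-- Division by the weight `(1 + |k|²)^{s/2}`. -/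
theorem exists_unweight {s : ℝ} (hs : 0 ≤ s) :
    ∃ T : PlaneL2C →L[ℝ] PlaneL2C, ∀ f, T f =ᵐ[volume] fun w => weight (-s) w • f w := by
  obtain ⟨T, -, hT⟩ := exists_smulL2 (F := ℂ) (ν := (volume : Measure Plane)) (μ := weight (-s))
    (C := 1) zero_le_one
    (continuous_weight _).aestronglyMeasurable (fun w => by
      rw [abs_of_pos (weight_pos _ w)]; exact weight_neg_le_one (by linarith) w)
  exact ⟨T, hT⟩

theorem unweight_weightedFourier {T : PlaneL2C →L[ℝ] PlaneL2C}
    (hT : ∀ f, T f =ᵐ[volume] fun w => weight (-s) w • f w) (f : Sobolev s) :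
    T (weightedFourierL s f) = fourierReal (toL2 f) := by
  apply Lp.ext
  filter_upwards [hT (weightedFourierL s f), coeFn_weightedFourier f] with w h1 h2
  rw [h1]
  change weight (-s) w • (weightedFourier s f) w = _
  rw [h2, smul_smul, weight_mul, neg_add_cancel, weight_zero, one_smul]

instance (s : ℝ≥0) : CompleteSpace (Sobolev s) := by
  obtain ⟨T, hT⟩ := exists_unweight s.coe_nonneg
  have hcl : IsClosed (Set.range (weightedFourierL s)) := by
    -- The weighted transforms of elements of `H^s` are those functions that become transforms of
    -- real functions after division by the weight, a closed condition.
    have : Set.range (weightedFourierL s) = T ⁻¹' Set.range fourierL := by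
      ext h
      constructor
      · rintro ⟨f, rfl⟩
        exact ⟨toL2 f, (unweight_weightedFourier hT f).symm⟩
      · rintro ⟨f, hf⟩
        have e : h =ᵐ[volume] fun w => weight s w • fourierReal f w := by
          have := hT h
          rw [← hf] at this
          filter_upwards [this] with w hw
          rw [← fourierL_apply, hw, smul_smul, weight_mul, add_neg_cancel, weight_zero, one_smul]
        obtain ⟨g, hg⟩ := exists_toL2 (s := s) ((memLp_congr_ae e).1 (Lp.memLp h))
        refine ⟨g, ?_⟩
        apply Lp.ext
        refine (coeFn_weightedFourier g).trans ?_
        rw [hg]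
        exact e.symm
    rw [this]
    exact fourierL.isometry.isClosedEmbedding.isClosed_range.preimage T.continuous
  exact (completeSpace_iff_isComplete_range
    (weightedFourierL s).isometry.isUniformInducing).2 hcl.isComplete

end Sobolev

/-! ### Fourier multipliers and weak derivatives -/

/-- The symbol `i k_j = 2πi w_j` of `∂_j`. -/
noncomputable def dSymbol (j : Fin 2) (w : Plane) : ℂ := (2 * Real.pi * w j : ℝ) * Complex.I

theorem continuous_dSymbol (j : Fin 2) : Continuous (dSymbol j) := by
  unfold dSymbol; fun_prop

theorem norm_dSymbol (j : Fin 2) (w : Plane) : ‖dSymbol j w‖ = |2 * Real.pi * w j| := by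
  simp [dSymbol]

theorem norm_dSymbol_le_weight (j : Fin 2) (w : Plane) : ‖dSymbol j w‖ ≤ weight 1 w := by
  rw [norm_dSymbol]
  unfold weight
  rw [← Real.sqrt_eq_rpow]
  apply Real.le_sqrt_of_sq_le
  rw [sq_abs, norm_smul, EuclideanSpace.norm_eq, mul_pow, mul_pow _ (Real.sqrt _),
    Real.sq_sqrt (by positivity), Fin.sum_univ_two]
  simp only [Real.norm_eq_abs, sq_abs, mul_pow]
  fin_cases j <;> simp <;> nlinarith [sq_nonneg (Real.pi * w 0), sq_nonneg (Real.pi * w 1)]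

theorem dSymbol_neg (j : Fin 2) (w : Plane) :
    dSymbol j (-w) = (starRingEnd ℂ) (dSymbol j w) := by
  simp only [dSymbol, map_mul, Complex.conj_ofReal, Complex.conj_I, PiLp.neg_apply, mul_neg,
    Complex.ofReal_neg, neg_mul]

theorem Sobolev.toL2_eq_of_fourierReal {s : ℝ≥0} {f g : Sobolev s}
    (h : fourierReal (Sobolev.toL2 f) = fourierReal (Sobolev.toL2 g)) : f = g :=
  Sobolev.toL2_injective (fourierReal_injective h)

/-- Fourier multipliers of order `s - t` with Hermitian symmetry map `H^s` to `H^t`. -/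
theorem exists_multiplier (s t : ℝ≥0) {σ : Plane → ℂ} {C : ℝ} (hσ : Continuous σ)
    (hb : ∀ w, weight t w * ‖σ w‖ ≤ C * weight s w)
    (hh : ∀ w, σ (-w) = (starRingEnd ℂ) (σ w)) :
    ∃ D : Sobolev s →L[ℝ] Sobolev t, ∀ f : Sobolev s,
      fourierReal (Sobolev.toL2 (D f)) =ᵐ[volume]
        fun w => σ w * fourierReal (Sobolev.toL2 f) w := by
  have key : ∀ f : Sobolev s, ∃ g : Sobolev t, fourierReal (Sobolev.toL2 g) =ᵐ[volume]
      fun w => σ w * fourierReal (Sobolev.toL2 f) w := by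
    intro f
    have hm : MemLp (fun w => weight t w • (σ w * fourierReal (Sobolev.toL2 f) w)) 2 volume := by
      refine (Sobolev.memLp_weight f).of_le_mul (c := C)
        ((continuous_weight _).aestronglyMeasurable.smul
          (hσ.aestronglyMeasurable.mul (Lp.aestronglyMeasurable _)))
        (ae_of_all _ fun w => ?_)
      rw [norm_smul, norm_smul, norm_mul, Real.norm_of_nonneg (weight_pos _ _).le,
        Real.norm_of_nonneg (weight_pos _ _).le, ← mul_assoc, ← mul_assoc]
      exact mul_le_mul_of_nonneg_right (hb w) (norm_nonneg _)
    have hm' : MemLp (fun w => σ w * fourierReal (Sobolev.toL2 f) w) 2 volume := by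
      refine hm.mono (hσ.aestronglyMeasurable.mul (Lp.aestronglyMeasurable _))
        (ae_of_all _ fun w => ?_)
      rw [norm_smul, Real.norm_of_nonneg (weight_pos _ _).le]
      exact le_mul_of_one_le_left (norm_nonneg _) (one_le_weight t.coe_nonneg w)
    obtain ⟨g, hg⟩ := exists_fourierReal_eq hm' (by
      filter_upwards [fourierReal_neg_ae (Sobolev.toL2 f)] with w hw
      rw [hh, hw, map_mul])
    obtain ⟨g', rfl⟩ := Sobolev.exists_toL2 (s := t) (f := g) ((memLp_congr_ae (by
      filter_upwards [hg] with w hw; rw [hw])).1 hm)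
    exact ⟨g', hg⟩
  choose D hD using key
  refine ⟨LinearMap.mkContinuous
    { toFun := D
      map_add' := fun f g => ?_
      map_smul' := fun c f => ?_ } C fun f => ?_, hD⟩
  · apply Sobolev.toL2_eq_of_fourierReal
    rw [map_add, fourierReal_add]
    apply Lp.ext
    have h := hD (f + g)
    rw [map_add, fourierReal_add] at h
    filter_upwards [h, hD f, hD g, Lp.coeFn_add (fourierReal (Sobolev.toL2 (D f)))
      (fourierReal (Sobolev.toL2 (D g))), Lp.coeFn_add (fourierReal (Sobolev.toL2 f))
      (fourierReal (Sobolev.toL2 g))] with w h1 h2 h3 h4 h5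
    rw [h1, h4, Pi.add_apply, h2, h3, h5, Pi.add_apply, mul_add]
  · apply Sobolev.toL2_eq_of_fourierReal
    rw [RingHom.id_apply, map_smul, fourierReal_smul]
    apply Lp.ext
    have h := hD (c • f)
    rw [map_smul, fourierReal_smul] at h
    filter_upwards [h, hD f, Lp.coeFn_smul c (fourierReal (Sobolev.toL2 (D f))),
      Lp.coeFn_smul c (fourierReal (Sobolev.toL2 f))] with w h1 h2 h4 h5
    rw [h1, h4, Pi.smul_apply, h2, h5, Pi.smul_apply, mul_smul_comm]
  · change ‖D f‖ ≤ _
    rw [← Sobolev.norm_weightedFourier, ← Sobolev.norm_weightedFourier]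
    refine Lp.norm_le_mul_norm_of_ae_le_mul ?_
    filter_upwards [Sobolev.coeFn_weightedFourier f, Sobolev.coeFn_weightedFourier (D f), hD f]
      with w h1 h2 h3
    rw [h1, h2, h3, norm_smul, norm_smul, norm_mul, Real.norm_of_nonneg (weight_pos _ _).le,
        Real.norm_of_nonneg (weight_pos _ _).le, ← mul_assoc, ← mul_assoc]
    exact mul_le_mul_of_nonneg_right (hb w) (norm_nonneg _)

/-- The derivative `∂_j` as an operator from `H^s` to `H^t`. -/
theorem exists_partial (s t : ℝ≥0) (h : t + 1 ≤ s) (j : Fin 2) :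
    ∃ D : Sobolev s →L[ℝ] Sobolev t, ∀ f : Sobolev s,
      fourierReal (Sobolev.toL2 (D f)) =ᵐ[volume]
        fun w => dSymbol j w * fourierReal (Sobolev.toL2 f) w := by
  refine exists_multiplier s t (C := 1) (continuous_dSymbol j) (fun w => ?_) (dSymbol_neg j)
  rw [one_mul]
  calc weight t w * ‖dSymbol j w‖ ≤ weight t w * weight 1 w :=
        mul_le_mul_of_nonneg_left (norm_dSymbol_le_weight j w) (weight_pos _ _).le
    _ = weight (t + 1) w := weight_mul _ _ _
    _ ≤ weight s w := weight_mono (by exact_mod_cast h) w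

/-- The inclusion of `H^s` in `H^t` as a bounded operator. -/
theorem exists_incl (s t : ℝ≥0) (h : t ≤ s) :
    ∃ D : Sobolev s →L[ℝ] Sobolev t, ∀ f : Sobolev s, Sobolev.toL2 (D f) = Sobolev.toL2 f := by
  obtain ⟨D, hD⟩ := exists_multiplier s t (C := 1) (σ := fun _ => 1) continuous_const (fun w => by
    rw [norm_one, mul_one, one_mul]; exact weight_mono (by exact_mod_cast h) w) (by simp)
  refine ⟨D, fun f => fourierReal_injective (Lp.ext ?_)⟩
  filter_upwards [hD f] with w hw
  rw [hw, one_mul]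

/-- The inverse transform turns `∂_j` into a symbol; the sign of the symbol is that of the inverse
transform. -/
theorem planeDeriv_testFourierInv {φ : Plane → ℝ} (hφ : IsTest Set.univ φ) (j : Fin 2)
    (Φ : SchwartzMap Plane ℂ) (hΦ : Φ = 𝓕⁻ (testSchwartz hφ)) :
    ∃ Ψ : SchwartzMap Plane ℂ, (∀ w, Ψ w = -dSymbol j w * Φ w) ∧
      ∀ q, (𝓕 Ψ : SchwartzMap Plane ℂ) q = (planeDeriv j φ q : ℂ) := by
  have htg : (fun w : Plane => inner ℝ w (planeDir j)).HasTemperateGrowth := by fun_prop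
  refine ⟨-(2 * Real.pi * Complex.I) •
    SchwartzMap.smulLeftCLM ℂ (fun w : Plane => inner ℝ w (planeDir j)) Φ, fun w => ?_,
    fun q => ?_⟩
  · rw [_root_.smul_apply, SchwartzMap.smulLeftCLM_apply_apply htg]
    simp only [planeDir, EuclideanSpace.inner_single_right, one_mul, dSymbol,
      smul_eq_mul, Complex.real_smul]
    simp
    ring
  · rw [← SchwartzMap.lineDerivOp_fourier_eq, hΦ, FourierInvPair.fourier_fourierInv_eq,
      SchwartzMap.lineDerivOp_apply_eq_fderiv, coe_testSchwartz]
    have hd : DifferentiableAt ℝ φ q := hφ.1.differentiable (by simp) q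
    have := (Complex.ofRealCLM.hasFDerivAt.comp q hd.hasFDerivAt).fderiv
    unfold planeDeriv
    have e : (fun q => (φ q : ℂ)) = Complex.ofRealCLM ∘ φ := rfl
    rw [e, this]
    rfl

/-- Parseval's relation for real functions against test functions in physical space. -/
theorem integral_mul_test_eq (f : PlaneL2) {φ : Plane → ℝ} (Φ : SchwartzMap Plane ℂ)
    (h : ∀ q, (𝓕 Φ : SchwartzMap Plane ℂ) q = (φ q : ℂ)) :
    ((∫ q, f q * φ q : ℝ) : ℂ) = ∫ w, Φ w * fourierReal f w := by
  change _ = ∫ w, Φ w * (𝓕 (ofRealL2 f) : PlaneL2C) w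
  rw [integral_schwartz_mul_fourier, ← integral_complex_ofReal]
  refine integral_congr_ae ?_
  filter_upwards [coeFn_ofRealL2 f] with q hq
  rw [hq, h q]
  push_cast
  ring

/-- Multiplication of the transform by `i k_j` gives the weak derivative `∂_j`. -/
theorem hasWeakPartial_of_fourier {j : Fin 2} {f g : PlaneL2}
    (h : fourierReal g =ᵐ[volume] fun w => dSymbol j w * fourierReal f w) :
    HasWeakPartial j f g := by
  refine ⟨locallyIntegrable_of_memLp (Lp.memLp f), locallyIntegrable_of_memLp (Lp.memLp g),
    fun φ hφ => ?_⟩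
  obtain ⟨Ψ, h1, h2⟩ := planeDeriv_testFourierInv hφ j _ rfl
  have e1 := integral_mul_test_eq f Ψ h2
  have e2 := integral_mul_test_eq g (φ := φ) (𝓕⁻ (testSchwartz hφ)) (fun q => by
    rw [FourierInvPair.fourier_fourierInv_eq, coe_testSchwartz])
  apply Complex.ofReal_injective
  rw [Complex.ofReal_neg, e1, e2, ← integral_neg]
  refine integral_congr_ae ?_
  filter_upwards [h] with w hw
  rw [hw, h1]
  ring

/-! ### Fourier inversion -/

/-- Fourier inversion for `L²` functions with integrable transform. -/
theorem fourierInv_ae_eq (f : PlaneL2) (hf : Integrable (fourierReal f)) :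
    ∀ᵐ q : Plane, (f q : ℂ) = 𝓕⁻ (fourierReal f : Plane → ℂ) q := by
  have hc : Continuous (𝓕⁻ (fourierReal f : Plane → ℂ)) := by
    have := VectorFourier.fourierIntegral_continuous (e := Real.fourierChar) (μ := volume)
      (L := -innerₗ Plane) Real.continuous_fourierChar
      (by simp only [LinearMap.neg_apply, innerₗ_apply_apply]; fun_prop) hf
    exact this
  refine ae_eq_of_integral_test (f := fun q => (f q : ℂ)) ?_ hc.locallyIntegrable fun φ hφ => ?_
  · exact locallyIntegrable_of_memLp (Lp.memLp f).ofReal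
  · have e2 := integral_mul_test_eq f (φ := φ) (𝓕⁻ (testSchwartz hφ)) (fun q => by
      rw [FourierInvPair.fourier_fourierInv_eq, coe_testSchwartz])
    -- Parseval's relation for the inverse transform of the integrable function `f̂`.
    have e3 := VectorFourier.integral_fourierIntegral_smul_eq_flip (μ := (volume : Measure Plane))
      (ν := (volume : Measure Plane)) (e := Real.fourierChar)
      (L := -innerₗ Plane) (f := fun q => (φ q : ℂ)) (g := (fourierReal f : Plane → ℂ))
      Real.continuous_fourierChar
      (by simp only [LinearMap.neg_apply, innerₗ_apply_apply]; fun_prop)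
      ((hφ.1.continuous.integrable_of_hasCompactSupport hφ.2.1).ofReal) hf
    have e4 : (-innerₗ Plane).flip = -innerₗ Plane := by
      ext x y; simp [real_inner_comm]
    rw [e4] at e3
    calc ∫ q, φ q • (f q : ℂ) = ((∫ q, f q * φ q : ℝ) : ℂ) := by
          rw [← integral_complex_ofReal]
          congr 1; funext q; simp [mul_comm]
      _ = ∫ w, (𝓕⁻ (testSchwartz hφ) : SchwartzMap Plane ℂ) w * fourierReal f w := e2
      _ = ∫ w, 𝓕⁻ (fun q => (φ q : ℂ)) w • fourierReal f w := by
          rw [SchwartzMap.fourierInv_coe, coe_testSchwartz]; rfl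
      _ = ∫ q, (φ q : ℂ) • 𝓕⁻ (fourierReal f : Plane → ℂ) q := e3
      _ = _ := by congr 1

/-- `(1 + |k|²)^{-s/2}` is square integrable for `s > 1`. -/
theorem memLp_weight_neg {s : ℝ} (hs : 1 < s) : MemLp (weight (-s)) 2 volume := by
  rw [memLp_two_iff_integrable_sq (continuous_weight _).aestronglyMeasurable]
  have h := integrable_rpow_neg_one_add_norm_sq (E := Plane) (μ := volume) (r := 2 * s)
    (by simp; linarith)
  have h2 := h.comp_smul (R := 2 * Real.pi) (by positivity)
  refine h2.congr (ae_of_all _ fun w => ?_)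
  simp only [weight]
  rw [← Real.rpow_natCast (_ ^ (-s / 2)), ← Real.rpow_mul (by positivity)]
  congr 1
  push_cast; ring

/-- Division by the weight `(1 + |k|²)^{s/2}` maps `L²` to `L¹` if `s > 1`. -/
theorem exists_unweightL1 {s : ℝ} {ν : Measure Plane} (hs : MemLp (weight (-s)) 2 ν) :
    ∃ T : Lp ℂ 2 ν →L[ℝ] Lp ℂ 1 ν, ∀ f, T f =ᵐ[ν] fun w => weight (-s) w • f w := by
  have hm : MemLp (fun w => (weight (-s) w : ℂ)) 2 ν := hs.ofReal
  refine ⟨(((ContinuousLinearMap.mul ℂ ℂ).holderL ν 2 2 1)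
    (hm.toLp _)).restrictScalars ℝ, fun f => ?_⟩
  have h := (ContinuousLinearMap.mul ℂ ℂ).coeFn_holder (r := 1) (hm.toLp _) f
  filter_upwards [h, hm.coeFn_toLp] with w h1 h2
  refine h1.trans ?_
  rw [h2]
  simp

/-- For `s > 1` the Fourier transform maps `H^s` continuously to `L¹`. -/
theorem Sobolev.exists_transformL1 (s : ℝ≥0) (hs : 1 < s) :
    ∃ T : Sobolev s →L[ℝ] Lp ℂ 1 (volume : Measure Plane),
      ∀ f, T f =ᵐ[volume] fourierReal (toL2 f) := by
  obtain ⟨T, hT⟩ := exists_unweightL1 (memLp_weight_neg (s := s) (by exact_mod_cast hs))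
  refine ⟨T ∘L (weightedFourierL s).toContinuousLinearMap, fun f => ?_⟩
  filter_upwards [hT (weightedFourierL s f), coeFn_weightedFourier f] with w h1 h2
  refine h1.trans ?_
  change weight (-s) w • (weightedFourier s f) w = _
  rw [h2, smul_smul, weight_mul, neg_add_cancel, weight_zero, one_smul]

theorem Sobolev.integrable_fourier {s : ℝ≥0} (hs : 1 < s) (f : Sobolev s) :
    Integrable (fourierReal (toL2 f)) := by
  obtain ⟨T, hT⟩ := Sobolev.exists_transformL1 s hs
  exact (L1.integrable_coeFn (T f)).congr (hT f)

/-- The embedding of `H^s` into `L^∞` for `s > 1`. -/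
theorem Sobolev.exists_sup_bound (s : ℝ≥0) (hs : 1 < s) :
    ∃ C : ℝ, 0 ≤ C ∧ ∀ f : Sobolev s, ∀ᵐ q : Plane, |f q| ≤ C * ‖f‖ := by
  obtain ⟨T, hT⟩ := Sobolev.exists_transformL1 s hs
  refine ⟨‖T‖, norm_nonneg _, fun f => ?_⟩
  filter_upwards [fourierInv_ae_eq (toL2 f) (integrable_fourier hs f)] with q hq
  have h1 : |f q| = ‖𝓕⁻ (fourierReal (toL2 f) : Plane → ℂ) q‖ := by
    rw [← hq, Complex.norm_real, Real.norm_eq_abs]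
  rw [h1, ← Real.fourierInv_congr_ae (hT f) q, ← Real.Lp.fourierTransformInv_apply]
  calc _ ≤ ‖Real.Lp.fourierTransformInv (T f)‖ := BoundedContinuousFunction.norm_coe_le_norm _ _
    _ ≤ ‖T f‖ := by
      refine (BoundedContinuousFunction.norm_le (norm_nonneg _)).2 fun x => ?_
      rw [Real.Lp.fourierTransformInv_apply, Real.fourierInv_eq]
      apply (norm_integral_le_integral_norm _).trans
      simp_rw [Circle.norm_smul]
      exact (L1.norm_eq_integral_norm (T f)).symm.le
    _ ≤ _ := T.le_opNorm f

/-! ### The space `𝒵` -/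

/-- The set `B` lies in the disc `|k| < 1 + r`, on which symbols of order one are bounded. -/
theorem weight_one_le_of_mem_freqSet {r : ℝ} (hr : r < 1) {w : Plane} (hw : w ∈ freqSet r) :
    weight 1 w ≤ 3 := by
  have h1 : ‖(2 * Real.pi) • w‖ ≤ 2 := by
    have h0 : ‖planeDir 0‖ = 1 := by simp [planeDir]
    rcases hw with h | h
    · have h2 := norm_sub_norm_le ((2 * Real.pi) • w) (planeDir 0)
      rw [Metric.mem_ball, dist_eq_norm] at h
      linarith
    · have h2 := norm_sub_norm_le ((2 * Real.pi) • w) (-planeDir 0)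
      rw [Metric.mem_ball, dist_eq_norm] at h
      rw [norm_neg] at h2
      linarith
  unfold weight
  rw [← Real.sqrt_eq_rpow]
  apply Real.sqrt_le_iff.2 ⟨by norm_num, by nlinarith [norm_nonneg ((2 * Real.pi) • w)]⟩

namespace ZSpace

variable {r : ℝ}

/-- `η ↦ (η̂₁, (1 + |k|²)^{3/2} η̂₂)` as an isometry. -/
noncomputable def normMapL (r : ℝ) : ZSpace r →ₗᵢ[ℝ]
    WithLp 1 (Lp ℂ 1 ((volume : Measure Plane).restrict (freqSet r)) ×
      Lp ℂ 2 ((volume : Measure Plane).restrict (freqSet r)ᶜ)) where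
  toLinearMap := normMap r
  norm_map' _ := rfl

/-- The low-frequency part `2π η̂₁`. -/
noncomputable def lowL (r : ℝ) :
    ZSpace r →L[ℝ] Lp ℂ 1 ((volume : Measure Plane).restrict (freqSet r)) :=
  ContinuousLinearMap.fst ℝ _ _ ∘L
    (WithLp.prodContinuousLinearEquiv 1 ℝ _ _).toContinuousLinearMap ∘L (normMapL r).toContinuousLinearMap

/-- The weighted high-frequency part `(1 + |k|²)^{3/2} η̂₂`. -/
noncomputable def highL (r : ℝ) :
    ZSpace r →L[ℝ] Lp ℂ 2 ((volume : Measure Plane).restrict (freqSet r)ᶜ) :=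
  ContinuousLinearMap.snd ℝ _ _ ∘L
    (WithLp.prodContinuousLinearEquiv 1 ℝ _ _).toContinuousLinearMap ∘L (normMapL r).toContinuousLinearMap

theorem coeFn_lowL (η : ZSpace r) :
    lowL r η =ᵐ[volume.restrict (freqSet r)] fun w => (2 * Real.pi) • transform η w :=
  (memLp_low η).coeFn_toLp

theorem coeFn_highL (η : ZSpace r) :
    highL r η =ᵐ[volume.restrict (freqSet r)ᶜ] fun w => weight 3 w • transform η w :=
  (memLp_high η).coeFn_toLp

theorem norm_eq_low_add_high (η : ZSpace r) : ‖η‖ = ‖lowL r η‖ + ‖highL r η‖ := by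
  change ‖normMap r η‖ = _
  rw [WithLp.prod_norm_eq_of_nat 1 Nat.cast_one.symm]
  simp only [pow_one, div_one, Real.rpow_one, Nat.cast_one]
  rfl

/-- The transforms of the high-frequency parts are integrable. -/
theorem exists_unweight_high (r : ℝ) {s : ℝ} (hs : 1 < s) :
    ∃ T : Lp ℂ 2 ((volume : Measure Plane).restrict (freqSet r)ᶜ) →L[ℝ]
        Lp ℂ 1 ((volume : Measure Plane).restrict (freqSet r)ᶜ),
      ∀ f, T f =ᵐ[volume.restrict (freqSet r)ᶜ] fun w => weight (-s) w • f w :=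
  exists_unweightL1 ((memLp_weight_neg hs).restrict _)

/-- Multiplication of `η̂` by a symbol of order one maps `𝒵` to `L¹`. -/
theorem exists_symbolL1 (hr : r < 1) {σ : Plane → ℂ} (hσ : Continuous σ)
    (hb : ∀ w, ‖σ w‖ ≤ weight 1 w) :
    ∃ T : ZSpace r →L[ℝ] Lp ℂ 1 (volume : Measure Plane),
      ∀ η, T η =ᵐ[volume] fun w => σ w * transform η w := by
  obtain ⟨Q, hQ⟩ := exists_unweight_high r one_lt_two
  have hB := measurableSet_freqSet r
  have hmeas : ∀ η : ZSpace r, AEStronglyMeasurable (fun w => σ w * transform η w) volume :=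
    fun η => hσ.aestronglyMeasurable.mul (Lp.aestronglyMeasurable _)
  -- On `B` the symbol is bounded by `3`.
  have hlow : ∀ η : ZSpace r, ∀ᵐ w ∂(volume.restrict (freqSet r)),
      ‖σ w * transform η w‖ ≤ 3 * ‖lowL r η w‖ := by
    intro η
    filter_upwards [coeFn_lowL η, ae_restrict_mem hB] with w h1 h2
    rw [h1, norm_mul, norm_smul, Real.norm_of_nonneg (by positivity), ← mul_assoc]
    refine mul_le_mul_of_nonneg_right ?_ (norm_nonneg _)
    have := (hb w).trans (weight_one_le_of_mem_freqSet hr h2)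
    nlinarith [Real.pi_gt_three]
  -- Off `B` the decay of `η̂` compensates the symbol, with a square integrable factor `(1 +
  -- |k|²)⁻¹` left over.
  have hhigh : ∀ η : ZSpace r, ∀ᵐ w ∂(volume.restrict (freqSet r)ᶜ),
      ‖σ w * transform η w‖ ≤ ‖Q (highL r η) w‖ := by
    intro η
    filter_upwards [coeFn_highL η, hQ (highL r η)] with w h1 h2
    rw [h2, h1, smul_smul, weight_mul, norm_mul, norm_smul,
      Real.norm_of_nonneg (weight_pos _ _).le]
    norm_num
    exact mul_le_mul_of_nonneg_right (hb w) (norm_nonneg _)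
  have hint : ∀ η : ZSpace r, Integrable (fun w => σ w * transform η w) := by
    intro η
    rw [← integrableOn_univ, ← Set.union_compl_self (freqSet r), integrableOn_union]
    exact ⟨((L1.integrable_coeFn (lowL r η)).norm.const_mul 3).mono' (hmeas η).restrict (hlow η),
      (L1.integrable_coeFn (Q (highL r η))).norm.mono' (hmeas η).restrict (hhigh η)⟩
  refine ⟨LinearMap.mkContinuous
    { toFun := fun η => (hint η).toL1 _
      map_add' := fun η ζ => ?_
      map_smul' := fun c η => ?_ } (3 * ‖lowL r‖ + ‖Q‖ * ‖highL r‖) fun η => ?_,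
      fun η => (hint η).coeFn_toL1⟩
  · rw [← Integrable.toL1_add]
    apply (Integrable.toL1_eq_toL1_iff _ _ _ _).2
    rw [map_add]
    filter_upwards [Lp.coeFn_add (transform η) (transform ζ)] with w hw
    rw [hw, Pi.add_apply, Pi.add_apply, mul_add]
  · rw [RingHom.id_apply, ← Integrable.toL1_smul]
    apply (Integrable.toL1_eq_toL1_iff _ _ _ _).2
    rw [map_smul]
    filter_upwards [Lp.coeFn_smul c (transform η)] with w hw
    rw [hw, Pi.smul_apply, mul_smul_comm]
  · change ‖(hint η).toL1 _‖ ≤ _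
    rw [L1.norm_of_fun_eq_integral_norm, ← integral_add_compl hB (hint η).norm]
    have h1 : ∫ w in freqSet r, ‖σ w * transform η w‖ ≤ 3 * ‖lowL r η‖ := by
      rw [L1.norm_eq_integral_norm, ← integral_const_mul]
      exact integral_mono_ae (hint η).norm.restrict
        ((L1.integrable_coeFn (lowL r η)).norm.const_mul 3) (hlow η)
    have h2 : ∫ w in (freqSet r)ᶜ, ‖σ w * transform η w‖ ≤ ‖Q (highL r η)‖ := by
      rw [L1.norm_eq_integral_norm]
      exact integral_mono_ae (hint η).norm.restrict (L1.integrable_coeFn _).norm (hhigh η)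
    have h3 := (lowL r).le_opNorm η
    have h4 := Q.le_opNorm (highL r η)
    have h5 := mul_le_mul_of_nonneg_left ((highL r).le_opNorm η) (norm_nonneg Q)
    nlinarith

/-- The Fourier transform as a bounded operator from `𝒵` to `L¹`. -/
theorem exists_transformL (hr : r < 1) :
    ∃ T : ZSpace r →L[ℝ] Lp ℂ 1 (volume : Measure Plane), ∀ η, T η = transform η := by
  obtain ⟨T, hT⟩ := exists_symbolL1 hr (σ := fun _ => 1) continuous_const
    (fun w => by rw [norm_one]; exact one_le_weight zero_le_one w)
  refine ⟨T, fun η => Lp.ext ?_⟩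
  filter_upwards [hT η] with w hw
  rw [hw, one_mul]

theorem coe_eq (η : ZSpace r) (q : Plane) : (η q : ℂ) = 𝓕⁻ (transform η : Plane → ℂ) q := η.2.1 q

theorem transform_injective : Function.Injective (transform (r := r)) := by
  intro η ζ h
  apply Subtype.ext
  refine Prod.ext ?_ h
  funext q
  apply Complex.ofReal_injective
  exact (coe_eq η q).trans ((by rw [h] : _ = _).trans (coe_eq ζ q).symm)

/-- Integrable functions with the right decay whose inverse transforms are real belong to `𝒵`. -/
theorem exists_of_transform {g : Lp ℂ 1 (volume : Measure Plane)}
    (h1 : ∀ q, (𝓕⁻ (g : Plane → ℂ) q).im = 0)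
    (h2 : MemLp (fun w => weight 3 w • g w) 2 (volume.restrict (freqSet r)ᶜ)) :
    ∃ η : ZSpace r, transform η = g :=
  ⟨⟨(fun q => (𝓕⁻ (g : Plane → ℂ) q).re, g),
    fun q => Complex.ext (by simp) (by simp [h1 q]), h2⟩, rfl⟩

theorem completeSpace (hr : r < 1) : CompleteSpace (ZSpace r) := by
  obtain ⟨T, hT⟩ := exists_transformL hr
  obtain ⟨Q, hQ⟩ := exists_unweight_high r (s := 3) (by norm_num)
  refine Metric.complete_of_cauchySeq_tendsto fun u hu => ?_
  -- The transforms, the low-frequency parts and the weighted high-frequency parts converge in their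
  -- respective spaces.
  have c1 : CauchySeq fun n => T (u n) := hu.map T.uniformContinuous
  have c2 : CauchySeq fun n => lowL r (u n) := hu.map (lowL r).uniformContinuous
  have c3 : CauchySeq fun n => highL r (u n) := hu.map (highL r).uniformContinuous
  obtain ⟨g, hg⟩ := cauchySeq_tendsto_of_complete c1
  obtain ⟨h1, hh1⟩ := cauchySeq_tendsto_of_complete c2
  obtain ⟨h2, hh2⟩ := cauchySeq_tendsto_of_complete c3
  let R := fun S : Set Plane => LpToLpRestrictCLM Plane ℂ ℝ (volume : Measure Plane) 1 S
  have hR : ∀ S (f : Lp ℂ 1 (volume : Measure Plane)), R S f =ᵐ[volume.restrict S] f :=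
    fun S f => LpToLpRestrictCLM_coeFn ℝ S f
  -- The three limits are compatible with one another.
  have e1 : h1 = (2 * Real.pi) • R (freqSet r) g := by
    refine tendsto_nhds_unique hh1 (((((R (freqSet r)).continuous.tendsto g).comp
      hg).const_smul (2 * Real.pi)).congr fun n => ?_)
    apply Lp.ext
    filter_upwards [hR (freqSet r) (T (u n)), coeFn_lowL (u n),
      Lp.coeFn_smul (2 * Real.pi) (R (freqSet r) (T (u n)))] with w a b c
    rw [b, Function.comp_apply, c, Pi.smul_apply, a, hT]
  have e2 : R (freqSet r)ᶜ g = Q h2 := by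
    refine tendsto_nhds_unique (((R (freqSet r)ᶜ).continuous.tendsto g).comp hg)
      (((Q.continuous.tendsto h2).comp hh2).congr fun n => ?_)
    apply Lp.ext
    filter_upwards [hR (freqSet r)ᶜ (T (u n)), coeFn_highL (u n), hQ (highL r (u n))] with w a b c
    rw [Function.comp_apply, Function.comp_apply, c, a, b, smul_smul, weight_mul, hT,
      neg_add_cancel, weight_zero, one_smul]
  have e3 : h2 =ᵐ[volume.restrict (freqSet r)ᶜ] fun w => weight 3 w • g w := by
    have a := hQ h2
    rw [← e2] at a
    filter_upwards [a, hR (freqSet r)ᶜ g] with w b c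
    rw [← c, b, smul_smul, weight_mul, add_neg_cancel, weight_zero, one_smul]
  -- The inverse transform of the limit is real.
  have e4 : ∀ q, (𝓕⁻ (g : Plane → ℂ) q).im = 0 := by
    intro q
    have l1 : Tendsto (fun n => Real.Lp.fourierTransformInv (T (u n)) q) atTop
        (𝓝 (Real.Lp.fourierTransformInv g q)) :=
      ((continuous_eval_const q).tendsto _).comp
        (((Real.Lp.fourierTransformInvCLM Plane ℂ).continuous.tendsto g).comp hg)
    rw [← Real.Lp.fourierTransformInv_apply]
    refine tendsto_nhds_unique ((Complex.continuous_im.tendsto _).comp l1)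
      (tendsto_const_nhds.congr fun n => ?_)
    rw [Function.comp_apply, Real.Lp.fourierTransformInv_apply, hT, ← coe_eq, Complex.ofReal_im]
  obtain ⟨η, hη⟩ := exists_of_transform e4 ((memLp_congr_ae e3).1 (Lp.memLp h2))
  have e5 : lowL r η = h1 := by
    rw [e1]
    apply Lp.ext
    filter_upwards [hR (freqSet r) g, coeFn_lowL η,
      Lp.coeFn_smul (2 * Real.pi) (R (freqSet r) g)] with w a b c
    rw [b, c, Pi.smul_apply, a, hη]
  have e6 : highL r η = h2 := by
    apply Lp.ext
    filter_upwards [coeFn_highL η, e3] with w a b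
    rw [a, b, hη]
  refine ⟨η, tendsto_iff_norm_sub_tendsto_zero.2 ?_⟩
  simp only [norm_eq_low_add_high, map_sub, e5, e6]
  simpa using (tendsto_iff_norm_sub_tendsto_zero.1 hh1).add
    (tendsto_iff_norm_sub_tendsto_zero.1 hh2)

theorem ofReal_comp_eq (η : ZSpace r) :
    (fun q => (η q : ℂ)) = 𝓕 (fun w : Plane => transform η (-w)) := by
  funext q
  rw [coe_eq, Real.fourierInv_eq_fourier_comp_neg]

theorem integrable_transform_neg (η : ZSpace r) :
    Integrable (fun w : Plane => transform η (-w)) :=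
  (L1.integrable_coeFn (transform η)).comp_neg

theorem integrable_norm_transform_neg (hr : r < 1) (η : ZSpace r) :
    Integrable (fun w : Plane => ‖w‖ * ‖transform η (-w)‖) := by
  obtain ⟨T, hT⟩ := exists_symbolL1 hr (σ := fun w => (‖w‖ : ℂ)) (by fun_prop) (fun w => by
    rw [Complex.norm_real, norm_norm]
    unfold weight
    rw [← Real.sqrt_eq_rpow]
    apply Real.le_sqrt_of_sq_le
    rw [norm_smul, mul_pow, Real.norm_of_nonneg (by positivity)]
    nlinarith [Real.pi_gt_three, sq_nonneg ‖w‖, mul_nonneg (sq_nonneg ‖w‖) Real.pi_pos.le])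
  have h := ((L1.integrable_coeFn (T η)).congr (hT η)).norm.comp_neg
  simpa using h

/-- Since `(1 + |k|) η̂ ∈ L¹`, the elements of `𝒵` are continuously differentiable. -/
theorem contDiff_one (hr : r < 1) (η : ZSpace r) : ContDiff ℝ 1 η := by
  have h := Real.contDiff_fourier (N := 1) (f := fun w : Plane => transform η (-w)) (by
    intro n hn
    have hn' : n ≤ 1 := by exact_mod_cast hn
    interval_cases n
    · simpa using (integrable_transform_neg η).norm
    · simpa using integrable_norm_transform_neg hr η)
  rw [← ofReal_comp_eq] at h
  exact Complex.reCLM.contDiff.comp h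

/-- The first-order derivatives of `η ∈ 𝒵` are the Fourier integrals of `i k_j η̂ ∈ L¹`, so they are
bounded and continuous and depend continuously on `η`. -/
theorem exists_planeDerivL (hr : r < 1) (j : Fin 2) :
    ∃ T : ZSpace r →L[ℝ] Lp ℂ 1 (volume : Measure Plane),
      (∀ η, T η =ᵐ[volume] fun w => dSymbol j w * transform η w) ∧
      ∀ (η : ZSpace r) q, (planeDeriv j η q : ℂ) = 𝓕⁻ (T η : Plane → ℂ) q := by
  obtain ⟨T, hT⟩ := exists_symbolL1 hr (continuous_dSymbol j) (norm_dSymbol_le_weight j)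
  refine ⟨T, hT, fun η q => ?_⟩
  have h1 := Real.hasFDerivAt_fourier (integrable_transform_neg η)
    (integrable_norm_transform_neg hr η) q
  rw [← ofReal_comp_eq] at h1
  have h2 := Complex.ofRealCLM.hasFDerivAt.comp q
    ((contDiff_one hr η).differentiable one_ne_zero q).hasFDerivAt
  have h3 := congrArg (fun L : Plane →L[ℝ] ℂ => L (planeDir j)) (h2.unique h1)
  have hi : Integrable (VectorFourier.fourierSMulRight (innerSL ℝ)
      (fun w : Plane => transform η (-w))) := by
    refine ((integrable_norm_transform_neg hr η).const_mul (2 * Real.pi)).mono'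
      ((integrable_transform_neg η).1.fourierSMulRight) (ae_of_all _ fun w => ?_)
    rw [VectorFourier.norm_fourierSMulRight, innerSL_apply_norm, mul_assoc]
  have h4 := Real.fourierIntegral_continuousLinearMap_apply' (μ := (volume : Measure Plane))
    (L := innerSL ℝ) (a := planeDir j) (w := q) hi
  refine h3.trans (h4.trans ?_)
  rw [Real.fourierInv_congr_ae (hT η), Real.fourierInv_eq_fourier_comp_neg]
  refine congrArg (fun f : Plane → ℂ => 𝓕 f q) (funext fun w => ?_)
  rw [VectorFourier.fourierSMulRight_apply, innerSL_apply_apply]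
  simp [planeDir, dSymbol, EuclideanSpace.inner_single_right]
  ring

end ZSpace

/-! ### Multiplication operators -/

open BoundedContinuousFunction in
/-- Multiplication of square integrable functions by bounded continuous functions. -/
theorem exists_mulL2 {X Y : Type*} [MeasurableSpace X] [TopologicalSpace Y] [MeasurableSpace Y]
    [OpensMeasurableSpace Y] (ν : Measure X) {π : X → Y} (hπ : Measurable π) :
    ∃ T : (Y →ᵇ ℝ) →L[ℝ] Lp ℝ 2 ν →L[ℝ] Lp ℝ 2 ν,
      ∀ μ f, T μ f =ᵐ[ν] fun x => μ (π x) * f x := by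
  have hm : ∀ μ : Y →ᵇ ℝ, MemLp (fun x => μ (π x)) ∞ ν := fun μ =>
    memLp_top_of_bound ((μ.continuous.measurable.comp hπ).aestronglyMeasurable) ‖μ‖
      (ae_of_all _ fun x => μ.norm_coe_le_norm _)
  let J : (Y →ᵇ ℝ) →L[ℝ] Lp ℝ ∞ ν := LinearMap.mkContinuous
    { toFun := fun μ => (hm μ).toLp _
      map_add' := fun _ _ => rfl
      map_smul' := fun _ _ => rfl } 1 fun μ => by
    rw [one_mul]
    change ‖(hm μ).toLp _‖ ≤ _
    rw [Lp.norm_toLp]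
    refine ENNReal.toReal_le_of_le_ofReal (norm_nonneg _) ?_
    refine (eLpNorm_le_of_ae_bound (C := ‖μ‖) (ae_of_all _ fun x => μ.norm_coe_le_norm _)).trans ?_
    simp
  refine ⟨(ContinuousLinearMap.mul ℝ ℝ).holderL ν ∞ 2 2 ∘L J, fun μ f => ?_⟩
  have h := (ContinuousLinearMap.mul ℝ ℝ).coeFn_holder (r := 2) (J μ) f
  filter_upwards [h, (hm μ).coeFn_toLp] with x h1 h2
  refine h1.trans ?_
  have h3 : (J μ : X → ℝ) x = μ (π x) := h2
  rw [h3]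
  rfl

open BoundedContinuousFunction in
/-- The first-order derivatives of `η ∈ 𝒵` as bounded continuous functions. -/
theorem ZSpace.exists_planeDerivB {r : ℝ} (hr : r < 1) (j : Fin 2) :
    ∃ T : ZSpace r →L[ℝ] (Plane →ᵇ ℝ), ∀ (η : ZSpace r) q, T η q = planeDeriv j η q := by
  obtain ⟨T, -, hT⟩ := exists_planeDerivL hr j
  refine ⟨Complex.reCLM.compLeftContinuousBounded Plane ∘L
    ((Real.Lp.fourierTransformInvCLM Plane ℂ).restrictScalars ℝ) ∘L T, fun η q => ?_⟩
  have h := hT η q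
  rw [← Real.Lp.fourierTransformInv_apply] at h
  exact (congrArg Complex.re h).symm

theorem add_sq_le_four (a b : ℝ≥0∞) : (a + b) ^ 2 ≤ 4 * a ^ 2 + 4 * b ^ 2 := by
  rcases le_total a b with h | h
  · calc (a + b) ^ 2 ≤ (b + b) ^ 2 := by gcongr
      _ = 4 * b ^ 2 := by ring
      _ ≤ _ := le_add_self
  · calc (a + b) ^ 2 ≤ (a + a) ^ 2 := by gcongr
      _ = 4 * a ^ 2 := by ring
      _ ≤ _ := le_self_add

/-- Young's inequality `L¹ ⋆ L² + L² ⋆ L¹ ⊆ L²` in terms of a pointwise bound on the integrand. -/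
theorem memLp_conv {ρ : Plane → ℝ} {G F : Plane → ℂ} (hρ : Measurable ρ)
    (hG : StronglyMeasurable G) (hF : StronglyMeasurable F) {a b a' b' : Plane → ℝ≥0∞}
    (ha : Measurable a) (hb : Measurable b) (ha' : Measurable a') (hb' : Measurable b')
    (ia : ∫⁻ w, a w ≠ ⊤) (ib : ∫⁻ w, b w ^ 2 ≠ ⊤) (ia' : ∫⁻ w, a' w ^ 2 ≠ ⊤) (ib' : ∫⁻ w, b' w ≠ ⊤)
    (h : ∀ w l, ‖ρ (w + l)‖ₑ * (‖G w‖ₑ * ‖F l‖ₑ) ≤ a w * b l + a' w * b' l) :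
    ∫⁻ k, (‖ρ k‖ₑ * ∫⁻ w, ‖G w‖ₑ * ‖F (k - w)‖ₑ) ^ 2 ≠ ⊤ ∧
    MemLp (fun k => ρ k • ∫ w, G w * F (k - w)) 2 volume := by
  have key : ∫⁻ k, (‖ρ k‖ₑ * ∫⁻ w, ‖G w‖ₑ * ‖F (k - w)‖ₑ) ^ 2 ≠ ⊤ := by
    -- The second term is written as a convolution with the `L¹` factor first.
    have h1 : ∀ k, (‖ρ k‖ₑ * ∫⁻ w, ‖G w‖ₑ * ‖F (k - w)‖ₑ) ^ 2 ≤
        4 * (∫⁻ w, a w * b (k - w)) ^ 2 + 4 * (∫⁻ l, b' l * a' (k - l)) ^ 2 := by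
      intro k
      refine le_trans ?_ (add_sq_le_four _ _)
      gcongr
      rw [← lintegral_const_mul' _ _ enorm_ne_top]
      have e : ∫⁻ l, b' l * a' (k - l) = ∫⁻ w, a' w * b' (k - w) := by
        rw [← lintegral_sub_left_eq_self _ k]
        simp only [sub_sub_cancel, mul_comm]
      rw [e, ← lintegral_add_left (by fun_prop)]
      refine lintegral_mono fun w => ?_
      have := h w (k - w)
      rwa [add_sub_cancel] at this
    refine ne_top_of_le_ne_top ?_ (lintegral_mono h1)
    have m1 : Measurable fun k => ∫⁻ w, a w * b (k - w) := by fun_prop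
    rw [lintegral_add_left (by fun_prop), lintegral_const_mul' _ _ (by norm_num),
      lintegral_const_mul' _ _ (by norm_num)]
    refine ENNReal.add_ne_top.2 ⟨ENNReal.mul_ne_top (by norm_num) ?_,
      ENNReal.mul_ne_top (by norm_num) ?_⟩
    · exact ne_top_of_le_ne_top (ENNReal.mul_ne_top (ENNReal.pow_ne_top ia) ib)
        (lintegral_conv_sq_le ha hb)
    · exact ne_top_of_le_ne_top (ENNReal.mul_ne_top (ENNReal.pow_ne_top ib') ia')
        (lintegral_conv_sq_le hb' ha')
  refine ⟨key, ?_, ?_⟩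
  · refine hρ.aestronglyMeasurable.smul ?_
    refine StronglyMeasurable.aestronglyMeasurable ?_
    refine StronglyMeasurable.integral_prod_right (f := fun k w => G w * F (k - w)) ?_
    exact (hG.comp_measurable measurable_snd).mul
      (hF.comp_measurable (measurable_fst.sub measurable_snd))
  · have : eLpNorm (fun k => ρ k • ∫ w, G w * F (k - w)) 2 volume ^ 2 < ⊤ := by
      rw [eLpNorm_two_sq]
      refine lt_of_le_of_lt (lintegral_mono fun k => ?_) (lt_top_iff_ne_top.2 key)
      gcongr
      rw [enorm_smul]
      gcongr
      refine (enorm_integral_le_lintegral_enorm _).trans_eq ?_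
      simp only [enorm_mul]
    exact (ENNReal.pow_lt_top_iff.1 this).resolve_right two_ne_zero

theorem testFourier_comp_add (φ : Plane → ℝ) (w x : Plane) :
    testFourier (fun l => φ (l + w)) x = Real.fourierChar (inner ℝ w x) • testFourier φ x := by
  have h := congrFun (VectorFourier.fourierIntegral_comp_add_right Real.fourierChar
    (volume : Measure Plane) (innerₗ Plane) (fun q => (φ q : ℂ)) w) x
  exact h

theorem IsTest.comp_add_right {φ : Plane → ℝ} (hφ : IsTest Set.univ φ) (w : Plane) :
    IsTest Set.univ fun l => φ (l + w) :=
  ⟨hφ.1.comp (contDiff_id.add contDiff_const),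
    hφ.2.1.comp_homeomorph (Homeomorph.addRight w), Set.subset_univ _⟩

theorem integrable_testFourier_mul {φ : Plane → ℝ} (hφ : IsTest Set.univ φ) (f : PlaneL2) :
    Integrable fun x => testFourier φ x * (f x : ℂ) := by
  rw [testFourier_eq hφ]
  exact ((𝓕 (testSchwartz hφ) : SchwartzMap Plane ℂ).memLp 2 volume).integrable_mul
    (Lp.memLp f).ofReal

/-- The transform of a product is the convolution of the transforms. -/
theorem fourierReal_mul_ae_eq (G : Lp ℂ 1 (volume : Measure Plane)) {m : Plane → ℝ}
    (hm : ∀ᵐ q, (m q : ℂ) = 𝓕⁻ (G : Plane → ℂ) q) (f p : PlaneL2)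
    (hp : p =ᵐ[volume] fun q => m q * f q) :
    fourierReal p =ᵐ[volume] fun k => ∫ w, G w * fourierReal f (k - w) := by
  have hG := Lp.stronglyMeasurable G
  have hF := Lp.stronglyMeasurable (fourierReal f)
  have iG : ∫⁻ w, ‖G w‖ₑ ≠ ⊤ := (L1.integrable_coeFn G).2.ne
  have iF : ∫⁻ w, ‖fourierReal f w‖ₑ ^ 2 ≠ ⊤ := by
    rw [← eLpNorm_two_sq]
    exact ENNReal.pow_ne_top (Lp.memLp _).2.ne
  obtain ⟨k1, k2⟩ := memLp_conv (ρ := fun _ => 1) (a := fun w => ‖G w‖ₑ)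
    (b := fun w => ‖fourierReal f w‖ₑ) (a' := 0) (b' := 0) measurable_const hG hF
    hG.measurable.enorm hF.measurable.enorm measurable_zero measurable_zero iG iF (by simp)
    (by simp) (fun w l => by simp)
  simp only [enorm_one, one_mul] at k1
  simp only [one_smul] at k2
  -- It suffices to test Parseval's relation, in which the convolution is resolved by Fubini's
  -- theorem.
  refine fourierReal_ae_eq_of_integral p (locallyIntegrable_of_memLp k2) fun φ hφ => ?_
  have hφm : Measurable φ := hφ.1.continuous.measurable
  have hφ2 : ∫⁻ k, ‖φ k‖ₑ ^ 2 ≠ ⊤ := by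
    rw [← eLpNorm_two_sq]
    exact ENNReal.pow_ne_top
      (hφ.1.continuous.memLp_of_hasCompactSupport hφ.2.1).2.ne
  -- Fubini's theorem applies on the Fourier side by Young's inequality
  have int1 : Integrable (fun z : Plane × Plane => φ z.1 • (G z.2 * fourierReal f (z.1 - z.2)))
      (volume.prod volume) := by
    have sm : StronglyMeasurable
        (fun z : Plane × Plane => φ z.1 • (G z.2 * fourierReal f (z.1 - z.2))) :=
      (hφm.comp measurable_fst).stronglyMeasurable.smul ((hG.comp_measurable measurable_snd).mul
        (hF.comp_measurable (measurable_fst.sub measurable_snd)))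
    refine ⟨sm.aestronglyMeasurable, ?_⟩
    rw [hasFiniteIntegral_iff_enorm, lintegral_prod _ sm.measurable.enorm.aemeasurable]
    have hle : ∀ k, ∫⁻ w, ‖φ k • (G w * fourierReal f (k - w))‖ₑ ≤
        ‖φ k‖ₑ ^ 2 + (∫⁻ w, ‖G w‖ₑ * ‖fourierReal f (k - w)‖ₑ) ^ 2 := by
      intro k
      simp only [enorm_smul, enorm_mul]
      rw [lintegral_const_mul' _ _ enorm_ne_top]
      rcases le_total ‖φ k‖ₑ (∫⁻ w, ‖G w‖ₑ * ‖fourierReal f (k - w)‖ₑ) with h | h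
      · exact (mul_le_mul_left h _).trans ((sq _).ge.trans le_add_self)
      · exact (mul_le_mul_right h _).trans ((sq _).ge.trans le_self_add)
    refine lt_of_le_of_lt (lintegral_mono hle) ?_
    rw [lintegral_add_left (by fun_prop)]
    exact ENNReal.add_lt_top.2 ⟨lt_top_iff_ne_top.2 hφ2, lt_top_iff_ne_top.2 k1⟩
  have int2 : Integrable (fun z : Plane × Plane => G z.1 *
      (Real.fourierChar (inner ℝ z.1 z.2) • (testFourier φ z.2 * (f z.2 : ℂ))))
      (volume.prod volume) := by
    have h := (L1.integrable_coeFn G).mul_prod (integrable_testFourier_mul hφ f)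
    refine h.mono ?_ (ae_of_all _ fun z => ?_)
    · refine (hG.aestronglyMeasurable.comp_fst).mul ?_
      refine AEStronglyMeasurable.fun_smul (Continuous.aestronglyMeasurable ?_)
        (integrable_testFourier_mul hφ f).1.comp_snd
      exact Real.continuous_fourierChar.comp (by fun_prop)
    · rw [norm_mul, norm_mul, Circle.norm_smul]
  calc ∫ k, φ k • ∫ w, G w * fourierReal f (k - w)
      = ∫ k, ∫ w, φ k • (G w * fourierReal f (k - w)) := by simp only [integral_smul]
    _ = ∫ w, ∫ k, φ k • (G w * fourierReal f (k - w)) := integral_integral_swap int1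
    _ = ∫ w, G w * ∫ l, φ (l + w) • fourierReal f l := by
        refine integral_congr_ae (ae_of_all _ fun w => ?_)
        dsimp only
        rw [← integral_const_mul, ← integral_add_right_eq_self _ w]
        refine integral_congr_ae (ae_of_all _ fun l => ?_)
        simp only [add_sub_cancel_right, mul_smul_comm]
    _ = ∫ w, ∫ x, G w * (Real.fourierChar (inner ℝ w x) • (testFourier φ x * (f x : ℂ))) := by
        refine integral_congr_ae (ae_of_all _ fun w => ?_)
        dsimp only
        rw [integral_test_mul_fourierReal f (hφ.comp_add_right w), integral_const_mul]
        congr 2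
        funext x
        rw [testFourier_comp_add, smul_mul_assoc]
    _ = ∫ x, ∫ w, G w * (Real.fourierChar (inner ℝ w x) • (testFourier φ x * (f x : ℂ))) :=
        integral_integral_swap int2
    _ = ∫ x, testFourier φ x * (p x : ℂ) := by
        refine integral_congr_ae ?_
        filter_upwards [hm, hp] with x h1 h2
        rw [h2, Complex.ofReal_mul, h1, Real.fourierInv_eq, mul_comm (∫ _, _) _, ← mul_assoc,
          ← integral_const_mul]
        refine integral_congr_ae (ae_of_all _ fun w => ?_)
        simp only [Circle.smul_def, smul_eq_mul]
        ring

theorem weight_two (w : Plane) : weight 2 w = 1 + ‖(2 * Real.pi) • w‖ ^ 2 := by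
  unfold weight; norm_num

theorem one_add_norm_sq_add_le (w l : Plane) : weight 2 (w + l) ≤ 2 * (weight 2 w + weight 2 l) := by
  rw [weight_two, weight_two, weight_two, smul_add]
  have := norm_add_le ((2 * Real.pi) • w) ((2 * Real.pi) • l)
  nlinarith [norm_nonneg ((2 * Real.pi) • w + (2 * Real.pi) • l),
    sq_nonneg (‖(2 * Real.pi) • w‖ - ‖(2 * Real.pi) • l‖)]

theorem weight_eq_rpow (s : ℝ) (w : Plane) : weight s w = weight 2 w ^ (s / 2) := by
  rw [weight_two]; rfl

/-- Peetre-type inequality: for `0 ≤ s ≤ 2`, the weight of a sum exceeds the weight of one summand by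
a factor that grows at most quadratically in the other one, and only where the latter dominates. -/
theorem weight_add_le {s : ℝ} (hs : 0 ≤ s) (hs' : s ≤ 2) (w l : Plane) :
    weight s (w + l) ≤ 2 * weight s l * (1 + weight 2 w * weight (-2) l) := by
  have hX := weight_pos 2 l
  have hW := weight_pos 2 w
  have hN := weight_pos (-2) l
  have hXN : weight 2 l * weight (-2) l = 1 := by
    rw [weight_mul, add_neg_cancel, weight_zero]
  have hY : 1 ≤ 1 + weight 2 w * weight (-2) l := by nlinarith [mul_pos hW hN]
  have h1 : weight 2 (w + l) ≤ 2 * weight 2 l * (1 + weight 2 w * weight (-2) l) := by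
    have := one_add_norm_sq_add_le w l
    nlinarith
  rw [weight_eq_rpow s (w + l), weight_eq_rpow s l]
  calc weight 2 (w + l) ^ (s / 2)
      ≤ (2 * weight 2 l * (1 + weight 2 w * weight (-2) l)) ^ (s / 2) :=
        Real.rpow_le_rpow (weight_pos _ _).le h1 (by linarith)
    _ = 2 ^ (s / 2) * weight 2 l ^ (s / 2) * (1 + weight 2 w * weight (-2) l) ^ (s / 2) := by
        rw [Real.mul_rpow (by positivity) (by positivity), Real.mul_rpow (by positivity) hX.le]
    _ ≤ _ := by
        have a1 : (2 : ℝ) ^ (s / 2) ≤ 2 := by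
          calc (2 : ℝ) ^ (s / 2) ≤ 2 ^ (1 : ℝ) :=
                Real.rpow_le_rpow_of_exponent_le (by norm_num) (by linarith)
            _ = 2 := Real.rpow_one 2
        have a2 : (1 + weight 2 w * weight (-2) l) ^ (s / 2) ≤ 1 + weight 2 w * weight (-2) l := by
          calc _ ≤ (1 + weight 2 w * weight (-2) l) ^ (1 : ℝ) :=
                Real.rpow_le_rpow_of_exponent_le hY (by linarith)
            _ = _ := Real.rpow_one _
        gcongr

theorem weight_one_add_le (w l : Plane) : weight 1 (w + l) ≤ 2 * (weight 1 w + weight 1 l) := by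
  have h := one_add_norm_sq_add_le w l
  have e : ∀ v, weight 2 v = weight 1 v ^ 2 := fun v => by rw [sq, weight_mul]; norm_num
  rw [e, e, e] at h
  nlinarith [weight_pos 1 w, weight_pos 1 l, weight_pos 1 (w + l),
    mul_pos (weight_pos 1 w) (weight_pos 1 l)]

theorem lintegral_sq_ne_top {f : Plane → ℂ} (hf : MemLp f 2 volume) : ∫⁻ w, ‖f w‖ₑ ^ 2 ≠ ⊤ := by
  rw [← eLpNorm_two_sq]; exact ENNReal.pow_ne_top hf.2.ne

theorem enorm_weight (s : ℝ) (w : Plane) : ‖weight s w‖ₑ = ENNReal.ofReal (weight s w) := by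
  rw [Real.enorm_of_nonneg (weight_pos _ _).le]

/-- Membership of a product in a Sobolev space, from a bound on its convolution integral. -/
theorem exists_sobolev_of_conv {t : ℝ≥0} (G : Lp ℂ 1 (volume : Measure Plane)) {m : Plane → ℝ}
    (hm : ∀ᵐ q, (m q : ℂ) = 𝓕⁻ (G : Plane → ℂ) q) (f p : PlaneL2)
    (hp : p =ᵐ[volume] fun q => m q * f q) {a b a' b' : Plane → ℝ≥0∞}
    (ha : Measurable a) (hb : Measurable b) (ha' : Measurable a') (hb' : Measurable b')
    (ia : ∫⁻ w, a w ≠ ⊤) (ib : ∫⁻ w, b w ^ 2 ≠ ⊤) (ia' : ∫⁻ w, a' w ^ 2 ≠ ⊤) (ib' : ∫⁻ w, b' w ≠ ⊤)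
    (h : ∀ w l, ‖weight t (w + l)‖ₑ * (‖G w‖ₑ * ‖fourierReal f l‖ₑ) ≤ a w * b l + a' w * b' l) :
    ∃ g : Sobolev t, Sobolev.toL2 g = p := by
  have h1 := fourierReal_mul_ae_eq G hm f p hp
  have h2 := (memLp_conv (measurable_weight t) (Lp.stronglyMeasurable G)
    (Lp.stronglyMeasurable (fourierReal f)) ha hb ha' hb' ia ib ia' ib' h).2
  refine Sobolev.exists_toL2 ((memLp_congr_ae ?_).1 h2)
  filter_upwards [h1] with k hk
  rw [hk]

theorem Sobolev.lintegral_weight_ne_top {s : ℝ≥0} (f : Sobolev s) :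
    ∫⁻ w, (‖weight s w‖ₑ * ‖fourierReal (toL2 f) w‖ₑ) ^ 2 ≠ ⊤ := by
  simpa only [enorm_smul] using lintegral_sq_ne_top (memLp_weight f)

theorem Sobolev.lintegral_unweight_ne_top {s : ℝ≥0} (f : Sobolev s) {t : ℝ} (ht : 1 < t) :
    ∫⁻ w, ‖weight (-t) w‖ₑ * (‖weight s w‖ₑ * ‖fourierReal (toL2 f) w‖ₑ) ≠ ⊤ := by
  obtain ⟨T, hT⟩ := exists_unweightL1 (memLp_weight_neg ht)
  have h : Integrable (fun w => weight (-t) w • (weight s w • fourierReal (toL2 f) w)) := by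
    refine (L1.integrable_coeFn (T (weightedFourierL s f))).congr ?_
    filter_upwards [hT (weightedFourierL s f), coeFn_weightedFourier f] with w h1 h2
    refine h1.trans ?_
    change weight (-t) w • (weightedFourier s f) w = _
    rw [h2]
  simpa only [enorm_smul] using h.2.ne

/-- Multiplication by the derivatives of `η ∈ 𝒵` preserves `H^s` for `0 ≤ s ≤ 2`. The low-frequency part
of `η` shifts frequencies by a bounded amount; for the high-frequency part, whose derivative has two
square-integrable derivatives, the Peetre inequality `weight_add_le` leaves two convolutions of an
`L¹` function with an `L²` function. -/
theorem ZSpace.exists_mul_planeDeriv {r : ℝ} (hr : r < 1) {s : ℝ≥0} (hs : s ≤ 2) (j : Fin 2)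
    (η : ZSpace r) (f : Sobolev s) (p : PlaneL2)
    (hp : p =ᵐ[volume] fun q => planeDeriv j η q * f q) :
    ∃ g : Sobolev s, Sobolev.toL2 g = p := by
  obtain ⟨T, hT, hT'⟩ := exists_planeDerivL hr j
  set B := freqSet r with hBdef
  have hB := measurableSet_freqSet r
  have hGm := Lp.stronglyMeasurable (T η)
  have hFm := Lp.stronglyMeasurable (fourierReal (Sobolev.toL2 f))
  have hwm := fun s => measurable_weight s
  refine exists_sobolev_of_conv (T η) (ae_of_all _ (hT' η)) (Sobolev.toL2 f) p hp
    (a := fun w => 20 * ‖T η w‖ₑ) (b := fun l => ‖weight s l‖ₑ * ‖fourierReal (Sobolev.toL2 f) l‖ₑ)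
    (a' := Bᶜ.indicator fun w => 2 * (‖weight 2 w‖ₑ * ‖T η w‖ₑ))
    (b' := fun l => ‖weight (-2) l‖ₑ * (‖weight s l‖ₑ * ‖fourierReal (Sobolev.toL2 f) l‖ₑ))
    (by fun_prop) (by fun_prop) (Measurable.indicator (by fun_prop) hB.compl) (by fun_prop) ?_
    (Sobolev.lintegral_weight_ne_top f) ?_ (Sobolev.lintegral_unweight_ne_top f one_lt_two) ?_
  · rw [lintegral_const_mul' _ _ (by norm_num)]
    exact ENNReal.mul_ne_top (by norm_num) (L1.integrable_coeFn (T η)).2.ne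
  · have e : ∀ w, Bᶜ.indicator (fun w => 2 * (‖weight 2 w‖ₑ * ‖T η w‖ₑ)) w ^ 2 =
        Bᶜ.indicator (fun w => 4 * (‖weight 2 w‖ₑ * ‖T η w‖ₑ) ^ 2) w := by
      intro w
      by_cases h : w ∈ Bᶜ
      · rw [Set.indicator_of_mem h, Set.indicator_of_mem h]; ring
      · rw [Set.indicator_of_notMem h, Set.indicator_of_notMem h]; simp
    simp only [e]
    rw [lintegral_indicator hB.compl, lintegral_const_mul' _ _ (by norm_num)]
    refine ENNReal.mul_ne_top (by norm_num) ?_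
    have h3 : ∫⁻ w in Bᶜ, ‖highL r η w‖ₑ ^ 2 ≠ ⊤ := by
      rw [← eLpNorm_two_sq]; exact ENNReal.pow_ne_top (Lp.memLp (highL r η)).2.ne
    refine ne_top_of_le_ne_top h3 (lintegral_mono_ae ?_)
    filter_upwards [coeFn_highL η, ae_restrict_of_ae (hT η)] with w h1 h2
    gcongr
    rw [h1, h2, enorm_smul, enorm_mul, ← mul_assoc]
    gcongr
    rw [← enorm_norm (dSymbol j w), ← enorm_mul, enorm_le_iff_norm_le, norm_mul, norm_norm,
      Real.norm_of_nonneg (weight_pos _ _).le, Real.norm_of_nonneg (weight_pos _ _).le]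
    calc weight 2 w * ‖dSymbol j w‖ ≤ weight 2 w * weight 1 w :=
          mul_le_mul_of_nonneg_left (norm_dSymbol_le_weight j w) (weight_pos _ _).le
      _ = weight 3 w := by rw [weight_mul]; norm_num
  · intro w l
    have h20 : (20 : ℝ≥0∞) = ENNReal.ofReal 20 := by simp
    have h2 : ∀ x : ℝ≥0∞, 2 * x = ENNReal.ofReal 2 * x := fun x => by simp
    have hadd := weight_add_le s.coe_nonneg (by exact_mod_cast hs) w l
    have hp1 := weight_pos s l
    have hp2 := weight_pos 2 w
    have hp3 := weight_pos (-2) l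
    have hle : weight (-2) l ≤ 1 := weight_neg_le_one (by norm_num) l
    -- On `B` the weight is at most `3`, so that `weight 2 w ≤ 9` and the constant is `2 * (1 + 9)`.
    -- Off `B` both summands are needed.
    by_cases hw : w ∈ B
    · have hw2 : weight 2 w ≤ 9 := by
        have h1 := weight_one_le_of_mem_freqSet hr hw
        have h3 : weight 2 w = weight 1 w * weight 1 w := by rw [weight_mul]; norm_num
        nlinarith [weight_pos 1 w]
      have hA : ‖weight s (w + l)‖ₑ ≤ 20 * ‖weight s l‖ₑ := by
        rw [enorm_weight, enorm_weight, h20, ← ENNReal.ofReal_mul (by norm_num)]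
        refine ENNReal.ofReal_le_ofReal (hadd.trans ?_)
        have : weight 2 w * weight (-2) l ≤ 9 * 1 := by gcongr
        nlinarith
      calc _ ≤ 20 * ‖weight s l‖ₑ * (‖T η w‖ₑ * ‖fourierReal (Sobolev.toL2 f) l‖ₑ) := by gcongr
        _ = 20 * ‖T η w‖ₑ * (‖weight s l‖ₑ * ‖fourierReal (Sobolev.toL2 f) l‖ₑ) := by ring
        _ ≤ _ := le_self_add
    · have hA : ‖weight s (w + l)‖ₑ ≤
          20 * ‖weight s l‖ₑ + 2 * ‖weight 2 w‖ₑ * (‖weight (-2) l‖ₑ * ‖weight s l‖ₑ) := by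
        rw [enorm_weight, enorm_weight, enorm_weight, enorm_weight, h20, h2,
          ← ENNReal.ofReal_mul (by norm_num), ← ENNReal.ofReal_mul (by norm_num),
          ← ENNReal.ofReal_mul hp3.le, ← ENNReal.ofReal_mul (by positivity),
          ← ENNReal.ofReal_add (by positivity) (by positivity)]
        refine ENNReal.ofReal_le_ofReal (hadd.trans ?_)
        nlinarith
      rw [Set.indicator_of_mem (show w ∈ Bᶜ from hw)]
      calc _ ≤ (20 * ‖weight s l‖ₑ + 2 * ‖weight 2 w‖ₑ * (‖weight (-2) l‖ₑ * ‖weight s l‖ₑ)) *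
            (‖T η w‖ₑ * ‖fourierReal (Sobolev.toL2 f) l‖ₑ) := by gcongr
        _ = _ := by ring

open BoundedContinuousFunction in
/-- Multiplication by the derivatives of `η ∈ 𝒵` as an operator family on `H^s`, `0 ≤ s ≤ 2`. It is
bounded on `L²` and maps `H^s` into itself, so that the closed graph theorem applies. -/
theorem ZSpace.exists_mulOp {r : ℝ} (hr : r < 1) {s : ℝ≥0} (hs : s ≤ 2) (j : Fin 2) :
    ∃ M : ZSpace r →L[ℝ] Sobolev s →L[ℝ] Sobolev s, ∀ η f,
      Sobolev.toL2 (M η f) =ᵐ[volume] fun q => planeDeriv j η q * f q := by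
  have := ZSpace.completeSpace hr
  obtain ⟨A, hA⟩ := exists_mulL2 (volume : Measure Plane) measurable_id
  obtain ⟨D, hD⟩ := ZSpace.exists_planeDerivB hr j
  let T : ZSpace r →L[ℝ] Sobolev s →L[ℝ] PlaneL2 :=
    (ContinuousLinearMap.compL ℝ (Sobolev s) PlaneL2 PlaneL2).flip (Sobolev.toL2L s) ∘L A ∘L D
  have hT : ∀ η f, T η f =ᵐ[volume] fun q => planeDeriv j η q * f q := by
    intro η f
    filter_upwards [hA (D η) (Sobolev.toL2 f)] with q hq
    rw [id, hD] at hq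
    exact hq
  obtain ⟨M, hM⟩ := exists_lift_family (Sobolev.toL2L s) Sobolev.toL2_injective T fun η f => by
    obtain ⟨g, hg⟩ := ZSpace.exists_mul_planeDeriv hr hs j η f (T η f) (hT η f)
    exact ⟨g, hg⟩
  exact ⟨M, fun η f => by rw [← Sobolev.toL2L_apply, hM]; exact hT η f⟩

/-- For `s > 1` the space `H^s` is continuously embedded in `L^∞`. -/
theorem Sobolev.exists_toLinfty (s : ℝ≥0) (hs : 1 < s) :
    ∃ T : Sobolev s →L[ℝ] Lp ℝ ⊤ (volume : Measure Plane), ∀ f, T f =ᵐ[volume] f := by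
  obtain ⟨C, hC, hb⟩ := Sobolev.exists_sup_bound s hs
  have hm : ∀ f : Sobolev s, MemLp f ⊤ volume := fun f =>
    memLp_top_of_bound (Lp.aestronglyMeasurable _) (C * ‖f‖) (hb f)
  refine ⟨LinearMap.mkContinuous
    { toFun := fun f => (hm f).toLp _
      map_add' := fun f g => ?_
      map_smul' := fun c f => ?_ } C fun f => ?_, fun f => (hm f).coeFn_toLp⟩
  · rw [← MemLp.toLp_add]
    exact MemLp.toLp_congr _ _ (by rw [map_add]; exact Lp.coeFn_add _ _)
  · rw [RingHom.id_apply, ← MemLp.toLp_const_smul]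
    exact MemLp.toLp_congr _ _ (by rw [map_smul]; exact Lp.coeFn_smul _ _)
  · change ‖(hm f).toLp _‖ ≤ _
    rw [Lp.norm_toLp]
    refine ENNReal.toReal_le_of_le_ofReal (by positivity) ?_
    refine (eLpNorm_le_of_ae_bound (hb f)).trans ?_
    simp

/-- The product of two functions in `H^s`, `s > 1`, lies in `H^1`: by `weight_one_add_le` its weighted
transform is bounded by two convolutions of an `L¹` function with an `L²` function. -/
theorem Sobolev.exists_mul {s : ℝ≥0} (hs : 1 < s) (f g : Sobolev s) (p : PlaneL2)
    (hp : p =ᵐ[volume] fun q => f q * g q) : ∃ h : Sobolev 1, toL2 h = p := by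
  obtain ⟨T, hT⟩ := Sobolev.exists_transformL1 s hs
  have hwm := fun s => measurable_weight s
  have hGm := Lp.stronglyMeasurable (T f)
  have hFm := Lp.stronglyMeasurable (fourierReal (Sobolev.toL2 g))
  have hw1 : ∀ v, ‖weight 1 v‖ₑ ≤ ‖weight s v‖ₑ := fun v => by
    rw [enorm_weight, enorm_weight]
    exact ENNReal.ofReal_le_ofReal (weight_mono (by exact_mod_cast hs.le) v)
  refine exists_sobolev_of_conv (T f) (m := f) ?_ (toL2 g) p hp
    (a := fun w => 2 * ‖T f w‖ₑ) (b := fun l => ‖weight s l‖ₑ * ‖fourierReal (toL2 g) l‖ₑ)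
    (a' := fun w => ‖weight s w‖ₑ * ‖T f w‖ₑ) (b' := fun l => 2 * ‖fourierReal (toL2 g) l‖ₑ)
    (by fun_prop) (by fun_prop) (by fun_prop) (by fun_prop) ?_ (lintegral_weight_ne_top g) ?_ ?_ ?_
  · filter_upwards [fourierInv_ae_eq (toL2 f) (integrable_fourier hs f)] with q hq
    rw [hq, Real.fourierInv_congr_ae (hT f) q]
  · rw [lintegral_const_mul' _ _ (by norm_num)]
    exact ENNReal.mul_ne_top (by norm_num) (L1.integrable_coeFn (T f)).2.ne
  · refine ne_of_eq_of_ne (lintegral_congr_ae ?_) (lintegral_weight_ne_top f)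
    filter_upwards [hT f] with w hw
    rw [hw]
  · rw [lintegral_const_mul' _ _ (by norm_num)]
    exact ENNReal.mul_ne_top (by norm_num) (integrable_fourier hs g).2.ne
  · intro w l
    have h2 : ∀ x : ℝ≥0∞, 2 * x = ENNReal.ofReal 2 * x := fun x => by simp
    have hA : ‖weight (1 : ℝ≥0) (w + l)‖ₑ ≤ 2 * ‖weight s w‖ₑ + 2 * ‖weight s l‖ₑ := by
      have h3 : ‖weight (1 : ℝ≥0) (w + l)‖ₑ ≤ 2 * ‖weight 1 w‖ₑ + 2 * ‖weight 1 l‖ₑ := by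
        have := weight_pos 1 w
        have := weight_pos 1 l
        rw [NNReal.coe_one, enorm_weight, enorm_weight, enorm_weight, h2, h2,
          ← ENNReal.ofReal_mul (by norm_num), ← ENNReal.ofReal_mul (by norm_num),
          ← ENNReal.ofReal_add (by positivity) (by positivity)]
        refine ENNReal.ofReal_le_ofReal ((weight_one_add_le w l).trans (by linarith))
      exact h3.trans (by gcongr <;> exact hw1 _)
    calc _ ≤ (2 * ‖weight s w‖ₑ + 2 * ‖weight s l‖ₑ) *
            (‖T f w‖ₑ * ‖fourierReal (Sobolev.toL2 g) l‖ₑ) := by gcongr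
      _ = _ := by ring

/-- Multiplication as a bounded bilinear map `H^s × H^s → H^1`, `s > 1`. -/
theorem Sobolev.exists_mulOp {s : ℝ≥0} (hs : 1 < s) :
    ∃ M : Sobolev s →L[ℝ] Sobolev s →L[ℝ] Sobolev 1, ∀ f g,
      toL2 (M f g) =ᵐ[volume] fun q => f q * g q := by
  obtain ⟨J, hJ⟩ := Sobolev.exists_toLinfty s hs
  let T : Sobolev s →L[ℝ] Sobolev s →L[ℝ] PlaneL2 :=
    (ContinuousLinearMap.compL ℝ (Sobolev s) PlaneL2 PlaneL2).flip (toL2L s) ∘L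
      (ContinuousLinearMap.mul ℝ ℝ).holderL volume ⊤ 2 2 ∘L J
  have hT : ∀ f g, T f g =ᵐ[volume] fun q => f q * g q := by
    intro f g
    have h := (ContinuousLinearMap.mul ℝ ℝ).coeFn_holder (r := 2) (J f) (toL2 g)
    filter_upwards [h, hJ f] with q h1 h2
    refine h1.trans ?_
    rw [h2]
    rfl
  obtain ⟨M, hM⟩ := exists_lift_family (toL2L 1) toL2_injective T fun f g => by
    obtain ⟨h, hh⟩ := exists_mul hs f g (T f g) (hT f g)
    exact ⟨h, hh⟩
  exact ⟨M, fun f g => by rw [← toL2L_apply, hM]; exact hT f g⟩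

/-! ### The embedding of `H³` in `𝒵` -/

/-- The inverse transform of a Hermitian function is real. -/
theorem fourierInv_im_eq_zero {g : Plane → ℂ} (h : ∀ᵐ w, g (-w) = (starRingEnd ℂ) (g w)) (q : Plane) :
    (𝓕⁻ g q).im = 0 := by
  rw [← Complex.conj_eq_iff_im, Real.fourierInv_eq, ← integral_conj, ← integral_neg_eq_self]
  refine integral_congr_ae ?_
  filter_upwards [h] with w hw
  simp [Circle.smul_def, hw]

/-- `H³` is continuously embedded in `𝒵`, the transform of the embedded function being its `L²`
transform: for `f ∈ H³` the transform is integrable and Hermitian, so that it is the transform of an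
element of `𝒵`. -/
theorem Sobolev.exists_embedding {r : ℝ} (hr : r < 1) :
    ∃ ι : Sobolev 3 →L[ℝ] ZSpace r,
      (∀ f, ZSpace.transform (ι f) =ᵐ[volume] fourierReal (toL2 f)) ∧
      ∀ f, (ι f : Plane → ℝ) =ᵐ[volume] (f : Plane → ℝ) := by
  have := ZSpace.completeSpace hr
  have h13 : (1 : ℝ≥0) < 3 := by norm_num
  obtain ⟨T, hT⟩ := Sobolev.exists_transformL1 3 h13
  obtain ⟨π, hπ⟩ := ZSpace.exists_transformL hr
  obtain ⟨ι, hι⟩ := exists_lift_of_range_subset π (fun a b h => ZSpace.transform_injective (by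
    rwa [hπ, hπ] at h)) T fun f => by
    have h1 : ∀ᵐ w, T f (-w) = (starRingEnd ℂ) (T f w) := by
      have q := (Measure.measurePreserving_neg (volume : Measure Plane)).quasiMeasurePreserving
      filter_upwards [hT f, q.ae (hT f), fourierReal_neg_ae (toL2 f)] with w a b c
      rw [a, b, c]
    obtain ⟨η, hη⟩ := ZSpace.exists_of_transform (r := r) (fourierInv_im_eq_zero h1) (by
      refine MemLp.restrict _ ((memLp_congr_ae ?_).1 (memLp_weight f))
      filter_upwards [hT f] with w hw
      rw [hw]; rfl)
    exact ⟨η, by rw [hπ, hη]⟩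
  have h1 : ∀ f, ZSpace.transform (ι f) =ᵐ[volume] fourierReal (toL2 f) := fun f => by
    rw [← hπ, hι]; exact hT f
  refine ⟨ι, h1, fun f => ?_⟩
  filter_upwards [fourierInv_ae_eq (toL2 f) (integrable_fourier h13 f)] with q hq
  apply Complex.ofReal_injective
  rw [hq, ZSpace.coe_eq, Real.fourierInv_congr_ae (h1 f)]

/-- The classical derivatives of the embedded function represent its weak derivatives. -/
theorem Sobolev.planeDeriv_embedding {r : ℝ} (hr : r < 1) {f : Sobolev 3} {η : ZSpace r}
    (hη : ZSpace.transform η =ᵐ[volume] fourierReal (toL2 f)) {j : Fin 2} {g : Sobolev 2}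
    (hg : fourierReal (toL2 g) =ᵐ[volume] fun w => dSymbol j w * fourierReal (toL2 f) w) :
    planeDeriv j η =ᵐ[volume] g := by
  obtain ⟨T, hT, hT'⟩ := ZSpace.exists_planeDerivL hr j
  filter_upwards [fourierInv_ae_eq (toL2 g) (integrable_fourier one_lt_two g)] with q hq
  apply Complex.ofReal_injective
  rw [hq, hT' η q]
  refine Real.fourierInv_congr_ae ?_ q
  filter_upwards [hT η, hη, hg] with w a b c
  rw [a, b, c]

/-! ### Test functions in the plane and their transforms -/

theorem IsTest.planeDeriv {φ : Plane → ℝ} (hφ : IsTest Set.univ φ) (j : Fin 2) :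
    IsTest Set.univ (planeDeriv j φ) :=
  ⟨(hφ.1.fderiv_right (m := ∞) (by simp)).clm_apply contDiff_const,
    (hφ.2.1.fderiv (𝕜 := ℝ)).comp_left (g := fun L : Plane →L[ℝ] ℝ => L (planeDir j)) rfl,
    Set.subset_univ _⟩

theorem IsTest.memLp_plane {φ : Plane → ℝ} (hφ : IsTest Set.univ φ) : MemLp φ 2 volume :=
  hφ.1.continuous.memLp_of_hasCompactSupport hφ.2.1

theorem IsTest.integrable_plane {φ : Plane → ℝ} (hφ : IsTest Set.univ φ) : Integrable φ :=
  hφ.1.continuous.integrable_of_hasCompactSupport hφ.2.1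

theorem testFourier_planeDeriv {φ : Plane → ℝ} (hφ : IsTest Set.univ φ) (j : Fin 2) (k : Plane) :
    testFourier (planeDeriv j φ) k = dSymbol j k * testFourier φ k := by
  have htg : (fun w : Plane => inner ℝ w (planeDir j)).HasTemperateGrowth := by fun_prop
  have e : LineDeriv.lineDerivOp (planeDir j) (testSchwartz hφ) =
      testSchwartz (hφ.planeDeriv j) := by
    ext q
    rw [SchwartzMap.lineDerivOp_apply_eq_fderiv, coe_testSchwartz, coe_testSchwartz]
    have hd : DifferentiableAt ℝ φ q := hφ.1.differentiable (by simp) q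
    have := (Complex.ofRealCLM.hasFDerivAt.comp q hd.hasFDerivAt).fderiv
    have e : (fun q => (φ q : ℂ)) = Complex.ofRealCLM ∘ φ := rfl
    rw [e, this]
    rfl
  rw [testFourier_eq (hφ.planeDeriv j), testFourier_eq hφ, ← e,
    SchwartzMap.fourier_lineDerivOp_eq, _root_.smul_apply, SchwartzMap.smulLeftCLM_apply_apply htg]
  simp [planeDir, dSymbol, EuclideanSpace.inner_single_right]
  ring

theorem fourierReal_test {φ : Plane → ℝ} (hφ : IsTest Set.univ φ) :
    fourierReal (hφ.memLp_plane.toLp φ) =ᵐ[volume] testFourier φ := by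
  have e : ofRealL2 (hφ.memLp_plane.toLp φ) = (testSchwartz hφ).toLp 2 := by
    apply Lp.ext
    filter_upwards [coeFn_ofRealL2 (hφ.memLp_plane.toLp φ), hφ.memLp_plane.coeFn_toLp,
      (testSchwartz hφ).coeFn_toLp 2 volume] with x h1 h2 h3
    rw [h1, h2, h3, coe_testSchwartz]
  have e2 : fourierReal (hφ.memLp_plane.toLp φ) = (𝓕 (testSchwartz hφ) : SchwartzMap Plane ℂ).toLp 2 := by
    rw [← SchwartzMap.toLp_fourier_eq, ← e]; rfl
  rw [e2, testFourier_eq hφ]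
  exact SchwartzMap.coeFn_toLp _ 2 volume

theorem continuous_testFourier {φ : Plane → ℝ} (hφ : IsTest Set.univ φ) :
    Continuous (testFourier φ) := by
  rw [testFourier_eq hφ]; exact SchwartzMap.continuous _

/-- Plancherel's theorem for test functions. -/
theorem lintegral_testFourier {φ : Plane → ℝ} (hφ : IsTest Set.univ φ) :
    ∫⁻ k, ‖testFourier φ k‖ₑ ^ 2 = ∫⁻ q, ‖φ q‖ₑ ^ 2 := by
  have h := norm_fourierReal (hφ.memLp_plane.toLp φ)
  rw [Lp.norm_def, Lp.norm_def, ENNReal.toReal_eq_toReal_iff' (Lp.memLp _).2.ne (Lp.memLp _).2.ne,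
    eLpNorm_congr_ae (fourierReal_test hφ), eLpNorm_congr_ae hφ.memLp_plane.coeFn_toLp] at h
  rw [← eLpNorm_two_sq, ← eLpNorm_two_sq, h]

/-- `φ - Δφ` for functions in the plane. -/
noncomputable def oneSubLaplace (φ : Plane → ℝ) : Plane → ℝ :=
  fun q => φ q - planeDeriv 0 (planeDeriv 0 φ) q - planeDeriv 1 (planeDeriv 1 φ) q

theorem IsTest.sub {φ ψ : Plane → ℝ} (hφ : IsTest Set.univ φ) (hψ : IsTest Set.univ ψ) :
    IsTest Set.univ fun q => φ q - ψ q :=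
  ⟨hφ.1.sub hψ.1, hφ.2.1.sub hψ.2.1, Set.subset_univ _⟩

theorem IsTest.oneSubLaplace {φ : Plane → ℝ} (hφ : IsTest Set.univ φ) :
    IsTest Set.univ (oneSubLaplace φ) :=
  (hφ.sub ((hφ.planeDeriv 0).planeDeriv 0)).sub ((hφ.planeDeriv 1).planeDeriv 1)

theorem testFourier_sub {φ ψ : Plane → ℝ} (hφ : IsTest Set.univ φ) (hψ : IsTest Set.univ ψ)
    (k : Plane) : testFourier (fun q => φ q - ψ q) k = testFourier φ k - testFourier ψ k := by
  have e : testSchwartz (hφ.sub hψ) = testSchwartz hφ - testSchwartz hψ := by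
    ext q; simp [coe_testSchwartz]
  rw [testFourier_eq hφ, testFourier_eq hψ, testFourier_eq (hφ.sub hψ), e, ← SchwartzMap.fourierTransformCLM_apply ℂ,
    map_sub]
  rfl

theorem norm_sq_plane (k : Plane) : ‖(2 * Real.pi) • k‖ ^ 2 =
    (2 * Real.pi * k 0) ^ 2 + (2 * Real.pi * k 1) ^ 2 := by
  rw [EuclideanSpace.norm_eq, Real.sq_sqrt (by positivity), Fin.sum_univ_two]
  simp only [PiLp.smul_apply, smul_eq_mul, Real.norm_eq_abs, sq_abs]

theorem dSymbol_sq_add (k : Plane) :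
    dSymbol 0 k * dSymbol 0 k + dSymbol 1 k * dSymbol 1 k = -(‖(2 * Real.pi) • k‖ ^ 2 : ℝ) := by
  rw [norm_sq_plane]
  simp only [dSymbol]
  push_cast
  linear_combination (((2 * Real.pi * k 0) ^ 2 + (2 * Real.pi * k 1) ^ 2 : ℂ)) * Complex.I_sq

theorem testFourier_oneSubLaplace {φ : Plane → ℝ} (hφ : IsTest Set.univ φ) (k : Plane) :
    testFourier (oneSubLaplace φ) k = weight 2 k * testFourier φ k := by
  have h0 := (hφ.planeDeriv 0).planeDeriv 0
  have h1 := (hφ.planeDeriv 1).planeDeriv 1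
  unfold oneSubLaplace
  rw [testFourier_sub (hφ.sub h0) h1, testFourier_sub hφ h0, testFourier_planeDeriv (hφ.planeDeriv 0),
    testFourier_planeDeriv hφ, testFourier_planeDeriv (hφ.planeDeriv 1), testFourier_planeDeriv hφ,
    weight_two]
  have := dSymbol_sq_add k
  push_cast at this ⊢
  linear_combination (-testFourier φ k) * this

/-- `‖φ‖_{H²} = ‖φ - Δφ‖_{L²}`. -/
theorem lintegral_weight_two {φ : Plane → ℝ} (hφ : IsTest Set.univ φ) :
    ∫⁻ k, (‖weight 2 k‖ₑ * ‖testFourier φ k‖ₑ) ^ 2 = ∫⁻ q, ‖oneSubLaplace φ q‖ₑ ^ 2 := by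
  rw [← lintegral_testFourier hφ.oneSubLaplace]
  simp only [testFourier_oneSubLaplace hφ, enorm_mul]
  congr 1
  funext k
  rw [← enorm_norm (weight 2 k : ℂ), Complex.norm_real, enorm_norm]

/-- `‖φ‖²_{H¹} = ‖φ‖² + ‖∇φ‖²`, the norms on the right being those of `L²`. -/
theorem lintegral_weight_one {φ : Plane → ℝ} (hφ : IsTest Set.univ φ) :
    ∫⁻ k, (‖weight 1 k‖ₑ * ‖testFourier φ k‖ₑ) ^ 2 =
      (∫⁻ q, ‖φ q‖ₑ ^ 2) + (∫⁻ q, ‖planeDeriv 0 φ q‖ₑ ^ 2) + ∫⁻ q, ‖planeDeriv 1 φ q‖ₑ ^ 2 := by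
  have hm : ∀ {χ}, IsTest Set.univ χ → Measurable fun k => ‖testFourier χ k‖ₑ ^ 2 := fun h =>
    (continuous_testFourier h).measurable.enorm.pow_const 2
  rw [← lintegral_testFourier hφ, ← lintegral_testFourier (hφ.planeDeriv 0),
    ← lintegral_testFourier (hφ.planeDeriv 1), ← lintegral_add_left (hm hφ),
    ← lintegral_add_right _ (hm (hφ.planeDeriv 1))]
  refine lintegral_congr fun k => ?_
  rw [testFourier_planeDeriv hφ, testFourier_planeDeriv hφ, enorm_mul, enorm_mul, mul_pow, mul_pow,
    mul_pow]
  have e : ∀ j, ‖dSymbol j k‖ₑ ^ 2 = ENNReal.ofReal ((2 * Real.pi * k j) ^ 2) := fun j => by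
    rw [← ofReal_norm, ← ENNReal.ofReal_pow (norm_nonneg _), norm_dSymbol, sq_abs]
  have e2 : ‖weight 1 k‖ₑ ^ 2 = ENNReal.ofReal (1 + ((2 * Real.pi * k 0) ^ 2 + (2 * Real.pi * k 1) ^ 2)) := by
    rw [enorm_weight, ← ENNReal.ofReal_pow (weight_pos _ _).le, sq, weight_mul, ← norm_sq_plane,
      ← weight_two]
    norm_num
  rw [e, e, e2, ENNReal.ofReal_add (by norm_num) (by positivity),
    ENNReal.ofReal_add (by positivity) (by positivity), ENNReal.ofReal_one]
  ring

/-- Test functions as elements of `H^s`, `s ≤ 2`. -/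
theorem exists_sobolev_test {φ : Plane → ℝ} (hφ : IsTest Set.univ φ) {s : ℝ≥0} (hs : s ≤ 2) :
    ∃ f : Sobolev s, Sobolev.toL2 f = hφ.memLp_plane.toLp φ ∧
      fourierReal (Sobolev.toL2 f) =ᵐ[volume] testFourier φ ∧
      ENNReal.ofReal ‖f‖ ^ 2 = ∫⁻ k, (‖weight s k‖ₑ * ‖testFourier φ k‖ₑ) ^ 2 := by
  have h1 : MemLp (fun k => weight s k • testFourier φ k) 2 volume := by
    have h2 : MemLp (testFourier (oneSubLaplace φ)) 2 volume := by
      rw [testFourier_eq hφ.oneSubLaplace]; exact SchwartzMap.memLp _ 2 volume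
    refine h2.mono ((continuous_weight _).smul (continuous_testFourier hφ)).aestronglyMeasurable
      (ae_of_all _ fun k => ?_)
    rw [testFourier_oneSubLaplace hφ, norm_smul, norm_mul, Complex.norm_real,
      Real.norm_of_nonneg (weight_pos _ _).le, Real.norm_of_nonneg (weight_pos _ _).le]
    exact mul_le_mul_of_nonneg_right (weight_mono (by exact_mod_cast hs) k) (norm_nonneg _)
  have h3 := fourierReal_test hφ
  obtain ⟨f, hf⟩ := Sobolev.exists_toL2 (s := s) (f := hφ.memLp_plane.toLp φ)
    ((memLp_congr_ae (by filter_upwards [h3] with k hk; rw [hk])).1 h1)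
  rw [← hf] at h3
  refine ⟨f, hf, h3, ?_⟩
  rw [Sobolev.norm_def, ENNReal.ofReal_toReal (Sobolev.memLp_weight f).2.ne, eLpNorm_two_sq]
  refine lintegral_congr_ae ?_
  filter_upwards [h3] with k hk
  rw [hk, enorm_smul]

/-! ### Horizontal slices -/

/-- The restriction of a function on `ℝ³` to a horizontal plane. -/
def slice (ψ : Space → ℝ) (y : ℝ) : Plane → ℝ := fun q => ψ (q, y)

/-- The position of the horizontal coordinates among those of space. -/
def horizIdx (j : Fin 2) : Fin 3 := ![0, 2] j

theorem spaceDir_horizIdx (j : Fin 2) : spaceDir (horizIdx j) = (planeDir j, 0) := by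
  fin_cases j <;> rfl

theorem IsTest.slice {ψ : Space → ℝ} (hψ : IsTest Set.univ ψ) (y : ℝ) :
    IsTest Set.univ (slice ψ y) := by
  refine ⟨hψ.1.comp (contDiff_id.prodMk contDiff_const), ?_, Set.subset_univ _⟩
  refine HasCompactSupport.of_support_subset_isCompact (hψ.2.1.isCompact.image continuous_fst) ?_
  intro q hq
  exact ⟨(q, y), subset_tsupport _ hq, rfl⟩

theorem planeDeriv_slice {ψ : Space → ℝ} (hψ : ContDiff ℝ ∞ ψ) (j : Fin 2) (y : ℝ) :
    planeDeriv j (slice ψ y) = slice (spaceDeriv (horizIdx j) ψ) y := by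
  funext q
  have h1 : HasFDerivAt (fun q : Plane => (q, y)) (ContinuousLinearMap.inl ℝ Plane ℝ) q := by
    have := (hasFDerivAt_id (𝕜 := ℝ) q).prodMk (hasFDerivAt_const y q)
    exact this
  have h2 := ((hψ.differentiable (by simp) (q, y)).hasFDerivAt.comp q h1).fderiv
  unfold planeDeriv slice spaceDeriv
  rw [spaceDir_horizIdx]
  have e : (fun q => ψ (q, y)) = ψ ∘ fun q => (q, y) := rfl
  rw [e, h2]
  rfl

theorem hasDerivAt_slice {ψ : Space → ℝ} (hψ : ContDiff ℝ 1 ψ) (q : Plane) (y : ℝ) :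
    HasDerivAt (fun y => ψ (q, y)) (spaceDeriv 1 ψ (q, y)) y := by
  have h1 : HasDerivAt (fun y : ℝ => (q, y)) ((0, 1) : Space) y :=
    (hasDerivAt_const y q).prodMk (hasDerivAt_id y)
  exact (hψ.differentiable one_ne_zero (q, y)).hasFDerivAt.comp_hasDerivAt y h1

theorem lintegral_halfSpace {f : Space → ℝ≥0∞} (hf : Measurable f) :
    ∫⁻ p in halfSpace, f p = ∫⁻ y in Set.Iio (0 : ℝ), ∫⁻ q, f (q, y) := by
  have h : (volume : Measure Space).restrict halfSpace = (volume : Measure Plane).prod (volume.restrict (Set.Iio (0 : ℝ))) := by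
    have : halfSpace = (Set.univ : Set Plane) ×ˢ Set.Iio (0 : ℝ) := by
      ext p; simp [halfSpace]
    rw [this, Measure.volume_eq_prod, ← Measure.prod_restrict, Measure.restrict_univ]
  rw [h, lintegral_prod_symm _ hf.aemeasurable]

/-- The transform of a slice is differentiable in the height of the slice. -/
theorem hasDerivAt_testFourier_slice {ψ : Space → ℝ} (hψ : IsTest Set.univ ψ) (k : Plane) (y : ℝ) :
    HasDerivAt (fun y => testFourier (slice ψ y) k) (testFourier (slice (spaceDeriv 1 ψ) y) k) y := by
  obtain ⟨C, hC⟩ := (hψ.spaceDeriv 1).1.continuous.bounded_above_of_compact_support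
    (hψ.spaceDeriv 1).2.1
  set K : Set Plane := Prod.fst '' tsupport ψ with hK
  have hKc : IsCompact K := hψ.2.1.isCompact.image continuous_fst
  have hcont : ∀ {χ : Space → ℝ}, IsTest Set.univ χ → ∀ y, Continuous fun q : Plane =>
      Real.fourierChar (-inner ℝ q k) • (χ (q, y) : ℂ) := by
    intro χ hχ y
    have h1 : Continuous fun q : Plane => (χ (q, y) : ℂ) :=
      Complex.continuous_ofReal.comp (hχ.slice y).1.continuous
    exact (Real.continuous_fourierChar.comp (by fun_prop)).smul h1
  refine (hasDerivAt_integral_of_dominated_loc_of_deriv_le (μ := (volume : Measure Plane))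
    (F := fun y q => Real.fourierChar (-inner ℝ q k) • (ψ (q, y) : ℂ))
    (F' := fun y q => Real.fourierChar (-inner ℝ q k) • (spaceDeriv 1 ψ (q, y) : ℂ))
    (s := Set.univ) (x₀ := y) (bound := K.indicator fun _ => C) univ_mem
    (Eventually.of_forall fun y => (hcont hψ y).aestronglyMeasurable) ?_
    (hcont (hψ.spaceDeriv 1) y).aestronglyMeasurable (ae_of_all _ fun q y _ => ?_) ?_
    (ae_of_all _ fun q y _ => ?_)).2
  · exact (Real.fourierIntegral_convergent_iff k).2 ((hψ.slice y).integrable_plane.ofReal)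
  · rw [Circle.norm_smul, Complex.norm_real]
    by_cases hq : q ∈ K
    · rw [Set.indicator_of_mem hq]; exact hC _
    · rw [Set.indicator_of_notMem hq]
      have : spaceDeriv 1 ψ (q, y) = 0 := spaceDeriv_eq_zero_of_notMem 1 fun h =>
        hq ⟨(q, y), h, rfl⟩
      rw [this, norm_zero]
  · exact (integrable_indicator_iff hKc.measurableSet).2
      (integrableOn_const hKc.measure_lt_top.ne)
  · exact ((hasDerivAt_slice (hψ.1.of_le (by exact_mod_cast le_top)) q y).ofReal_comp).const_smul _

/-- The slices of a test function vanish far below. -/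
theorem exists_slice_eq_zero {ψ : Space → ℝ} (hψ : IsTest Set.univ ψ) :
    ∃ R : ℝ, ∀ y, y < R → slice ψ y = 0 := by
  obtain ⟨R, hR⟩ := (hψ.2.1.isCompact.image continuous_snd).isBounded.bddBelow
  refine ⟨R, fun y hy => funext fun q => ?_⟩
  by_contra h
  exact absurd (hR ⟨(q, y), subset_tsupport _ h, rfl⟩) (not_le.2 hy)

theorem stronglyMeasurable_testFourier_slice {ψ : Space → ℝ} (hψ : IsTest Set.univ ψ) :
    StronglyMeasurable fun z : Plane × ℝ => testFourier (slice ψ z.2) z.1 := by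
  refine StronglyMeasurable.integral_prod_right'
    (f := fun a : (Plane × ℝ) × Plane =>
      Real.fourierChar (-inner ℝ a.2 a.1.1) • (ψ (a.2, a.1.2) : ℂ)) ?_
  have h1 : Continuous fun a : (Plane × ℝ) × Plane => (ψ (a.2, a.1.2) : ℂ) :=
    Complex.continuous_ofReal.comp (hψ.1.continuous.comp (by fun_prop))
  have h2 : Continuous fun a : (Plane × ℝ) × Plane =>
      Real.fourierChar (-inner ℝ a.2 a.1.1) • (ψ (a.2, a.1.2) : ℂ) :=
    (Real.continuous_fourierChar.comp (by fun_prop)).smul h1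
  exact h2.stronglyMeasurable

/-- At a fixed horizontal wave vector, `κ |ψ̂(k, y₀)|² ≤ ∫_{y < y₀} κ² |ψ̂|² + |∂_y ψ̂|²`. -/
theorem enorm_testFourier_slice_le {ψ : Space → ℝ} (hψ : IsTest Set.univ ψ) (k : Plane) (y₀ : ℝ)
    {κ : ℝ} (hκ : 0 ≤ κ) :
    ENNReal.ofReal κ * ‖testFourier (slice ψ y₀) k‖ₑ ^ 2 ≤
      ∫⁻ y in Set.Iio y₀, (ENNReal.ofReal κ * ‖testFourier (slice ψ y) k‖ₑ) ^ 2 +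
        ‖testFourier (slice (spaceDeriv 1 ψ) y) k‖ₑ ^ 2 := by
  set h : ℝ → ℂ := fun y => testFourier (slice ψ y) k with hh
  set h' : ℝ → ℂ := fun y => testFourier (slice (spaceDeriv 1 ψ) y) k with hh'
  have hd : ∀ y, HasDerivAt h (h' y) y := fun y => hasDerivAt_testFourier_slice hψ k y
  have hc : Continuous h := continuous_iff_continuousAt.2 fun y => (hd y).continuousAt
  have hc' : Continuous h' := continuous_iff_continuousAt.2 fun y =>
    (hasDerivAt_testFourier_slice (hψ.spaceDeriv 1) k y).continuousAt
  obtain ⟨R, hR⟩ := exists_slice_eq_zero hψ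
  obtain ⟨R', hR'⟩ := exists_slice_eq_zero (hψ.spaceDeriv 1)
  have hz : testFourier 0 k = 0 := by simp [testFourier, Real.fourier_eq]
  have h0 : ∀ y, y < min R R' → h y = 0 := fun y hy => by
    simp only [hh, hR y (hy.trans_le (min_le_left _ _)), hz]
  have h0' : ∀ y, y < min R R' → h' y = 0 := fun y hy => by
    simp only [hh', hR' y (hy.trans_le (min_le_right _ _)), hz]
  have hD : ∀ y, HasDerivAt (fun y => ‖h y‖ ^ 2) (2 * inner ℝ (h y) (h' y)) y := fun y =>
    (hd y).norm_sq
  have hint : ∀ {g : ℝ → ℝ}, Continuous g → (∀ y, y < min R R' → g y = 0) →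
      IntegrableOn g (Set.Iic y₀) := by
    intro g hg hg0
    have : IntegrableOn g (Set.Icc (min R R') y₀) := hg.continuousOn.integrableOn_compact isCompact_Icc
    refine this.of_forall_sdiff_eq_zero measurableSet_Iic fun y hy => hg0 y ?_
    by_contra hc
    exact hy.2 ⟨not_lt.1 hc, hy.1⟩
  -- `|ψ̂(k, y₀)|²` is the integral of its derivative `2 ⟨ψ̂, ∂_y ψ̂⟩` over `(-∞, y₀]`.
  have hFTC : ∫ y in Set.Iic y₀, 2 * inner ℝ (h y) (h' y) = ‖h y₀‖ ^ 2 - 0 := by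
    refine integral_Iic_of_hasDerivAt_of_tendsto' (fun y _ => hD y)
      (hint (continuous_const.mul (hc.inner hc')) fun y hy => ?_) ?_
    · rw [h0 y hy]; simp
    · refine tendsto_const_nhds.congr' ?_
      filter_upwards [eventually_lt_atBot (min R R')] with y hy
      rw [h0 y hy]; simp
  have hle : κ * ‖h y₀‖ ^ 2 ≤ ∫ y in Set.Iic y₀, ((κ * ‖h y‖) ^ 2 + ‖h' y‖ ^ 2) := by
    rw [sub_zero] at hFTC
    rw [← hFTC, ← integral_const_mul]
    refine integral_mono (hint (continuous_const.mul (continuous_const.mul (hc.inner hc')))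
      fun y hy => by rw [h0 y hy]; simp) (hint (((continuous_const.mul hc.norm).pow 2).add
        (hc'.norm.pow 2)) fun y hy => by rw [h0 y hy, h0' y hy]; simp) fun y => ?_
    have := real_inner_le_norm (h y) (h' y)
    have h2 := mul_le_mul_of_nonneg_left this hκ
    dsimp only
    -- `2 κ |ψ̂| |∂_y ψ̂| ≤ κ² |ψ̂|² + |∂_y ψ̂|²`.
    nlinarith [sq_nonneg (κ * ‖h y‖ - ‖h' y‖)]
  have hlhs : ENNReal.ofReal κ * ‖h y₀‖ₑ ^ 2 = ENNReal.ofReal (κ * ‖h y₀‖ ^ 2) := by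
    rw [ENNReal.ofReal_mul hκ, ENNReal.ofReal_pow (norm_nonneg _), ofReal_norm]
  rw [hlhs, restrict_Iio_eq_restrict_Iic]
  refine (ENNReal.ofReal_le_ofReal hle).trans_eq ?_
  have hi : IntegrableOn (fun y => (κ * ‖h y‖) ^ 2 + ‖h' y‖ ^ 2) (Set.Iic y₀) :=
    hint (((continuous_const.mul hc.norm).pow 2).add
      (hc'.norm.pow 2)) fun y hy => by rw [h0 y hy, h0' y hy]; simp
  rw [ofReal_integral_eq_lintegral_ofReal hi
    (ae_of_all _ fun y => by positivity)]
  refine lintegral_congr fun y => ?_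
  rw [ENNReal.ofReal_add (by positivity) (by positivity), ENNReal.ofReal_pow (by positivity),
    ENNReal.ofReal_mul hκ, ENNReal.ofReal_pow (norm_nonneg _), ofReal_norm, ofReal_norm]

/-- Integration over the wave vectors, with a weight `ρ`, of an estimate in the vertical variable,
and exchange of the two integrations. -/
theorem lintegral_weighted_swap_le {a : Plane → ℝ≥0∞} {A B : Plane × ℝ → ℝ≥0∞} (hA : Measurable A)
    (hB : Measurable B) {ρ κ : Plane → ℝ≥0∞} (hρ : Measurable ρ) (hκ : Measurable κ)
    (h : ∀ k, κ k * a k ^ 2 ≤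
      ∫⁻ y in Set.Iio (0 : ℝ), (κ k * A (k, y)) ^ 2 + B (k, y) ^ 2) :
    ∫⁻ k, ρ k * (κ k * a k ^ 2) ≤
      (∫⁻ y in Set.Iio (0 : ℝ), ∫⁻ k, ρ k * (κ k * A (k, y)) ^ 2) +
      ∫⁻ y in Set.Iio (0 : ℝ), ∫⁻ k, ρ k * B (k, y) ^ 2 := by
  have m3 : Measurable fun z : Plane × ℝ => ρ z.1 * (κ z.1 * A z) ^ 2 := by fun_prop
  have m4 : Measurable fun z : Plane × ℝ => ρ z.1 * B z ^ 2 := by fun_prop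
  have hpt : ∀ k, ρ k * (κ k * a k ^ 2) ≤
      (∫⁻ y in Set.Iio (0 : ℝ), ρ k * (κ k * A (k, y)) ^ 2) +
      ∫⁻ y in Set.Iio (0 : ℝ), ρ k * B (k, y) ^ 2 := by
    intro k
    have m5 : Measurable fun y => A (k, y) := hA.comp measurable_prodMk_left
    have m6 : Measurable fun y => B (k, y) := hB.comp measurable_prodMk_left
    rw [lintegral_const_mul _ (by fun_prop), lintegral_const_mul _ (by fun_prop), ← mul_add,
      ← lintegral_add_left (by fun_prop)]
    gcongr
    exact h k
  refine (lintegral_mono hpt).trans ?_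
  rw [lintegral_add_left m3.lintegral_prod_right']
  refine add_le_add (le_of_eq ?_) (le_of_eq ?_)
  · exact lintegral_lintegral_swap m3.aemeasurable
  · exact lintegral_lintegral_swap m4.aemeasurable

/-- Weighted `L²` bound for a slice in terms of the part of the function below it. -/
theorem lintegral_testFourier_slice_le {ψ : Space → ℝ} (hψ : IsTest Set.univ ψ) {y₀ : ℝ}
    (hy₀ : y₀ ≤ 0) {ρ : Plane → ℝ≥0∞} (hρ : Measurable ρ) {κ : Plane → ℝ} (hκ : Measurable κ)
    (hκ0 : ∀ k, 0 ≤ κ k) :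
    ∫⁻ k, ρ k * (ENNReal.ofReal (κ k) * ‖testFourier (slice ψ y₀) k‖ₑ ^ 2) ≤
      (∫⁻ y in Set.Iio (0 : ℝ), ∫⁻ k, ρ k * (ENNReal.ofReal (κ k) * ‖testFourier (slice ψ y) k‖ₑ) ^ 2) +
      ∫⁻ y in Set.Iio (0 : ℝ), ∫⁻ k, ρ k * ‖testFourier (slice (spaceDeriv 1 ψ) y) k‖ₑ ^ 2 :=
  lintegral_weighted_swap_le (a := fun k => ‖testFourier (slice ψ y₀) k‖ₑ)
    (κ := fun k => ENNReal.ofReal (κ k))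
    (stronglyMeasurable_testFourier_slice hψ).measurable.enorm
    (stronglyMeasurable_testFourier_slice (hψ.spaceDeriv 1)).measurable.enorm hρ
    hκ.ennreal_ofReal fun k => (enorm_testFourier_slice_le hψ k y₀ (hκ0 k)).trans
      (lintegral_mono_set (Set.Iio_subset_Iio hy₀))

/-! ### Traces -/

/-- A bounded operator defined on a dense set of pairs extends to the closure. -/
theorem exists_extension {E F : Type*} [NormedAddCommGroup E] [NormedSpace ℝ E] [CompleteSpace E]
    [NormedAddCommGroup F] [NormedSpace ℝ F] [CompleteSpace F] (Γ : Submodule ℝ (E × F)) (C : ℝ)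
    (h : ∀ x ∈ Γ, ‖x.2‖ ≤ C * ‖x.1‖) (K : Submodule ℝ E)
    (hd : ∀ u ∈ K, u ∈ closure (Prod.fst '' (Γ : Set (E × F)))) :
    ∃ T : K →L[ℝ] F, ∀ u : K, ((u : E), T u) ∈ closure (Γ : Set (E × F)) := by
  set Γ' := Γ.topologicalClosure with hΓ'
  have hcl : ∀ x ∈ Γ', ‖x.2‖ ≤ C * ‖x.1‖ := fun x hx =>
    closure_minimal (t := {x : E × F | ‖x.2‖ ≤ C * ‖x.1‖}) h
      (isClosed_le continuous_snd.norm (continuous_const.mul continuous_fst.norm)) hx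
  let f : Γ' →L[ℝ] E := ContinuousLinearMap.fst ℝ E F ∘L Γ'.subtypeL
  -- On the closure of the graph the first projection is bounded from below, so that its range is
  -- closed and hence contains `K`.
  have hanti : AntilipschitzWith (max 1 ⟨|C|, abs_nonneg C⟩) f := by
    refine f.antilipschitz_of_bound fun x => ?_
    have h1 := hcl x x.2
    change ‖(x : E × F)‖ ≤ max 1 |C| * ‖(x : E × F).1‖
    rw [Prod.norm_def]
    refine max_le (le_mul_of_one_le_left (norm_nonneg _) (le_max_left _ _)) (h1.trans ?_)
    exact mul_le_mul_of_nonneg_right ((le_abs_self C).trans (le_max_right _ _)) (norm_nonneg _)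
  have : CompleteSpace Γ' := Γ.isClosed_topologicalClosure.completeSpace_coe
  have hr : IsClosed (Set.range f) := hanti.isClosed_range f.uniformContinuous
  have hex : ∀ u : K, ∃ t, ((u : E), t) ∈ Γ' := by
    intro u
    have h1 : (u : E) ∈ Set.range f := by
      refine closure_minimal ?_ hr (hd u u.2)
      rintro _ ⟨x, hx, rfl⟩
      exact ⟨⟨x, Γ.le_topologicalClosure hx⟩, rfl⟩
    obtain ⟨⟨⟨a, t⟩, hx⟩, h2⟩ := h1
    have h2' : a = u := h2
    exact ⟨t, by rw [← h2']; exact hx⟩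
  choose T hT using hex
  have huniq : ∀ (x : E) (s t : F), (x, s) ∈ Γ' → (x, t) ∈ Γ' → s = t := by
    intro x s t hs ht
    have := hcl _ (Γ'.sub_mem hs ht)
    simp only [Prod.mk_sub_mk, sub_self, norm_zero, mul_zero] at this
    exact sub_eq_zero.1 (norm_le_zero_iff.1 this)
  exact ⟨LinearMap.mkContinuous
    { toFun := T
      map_add' := fun a b => huniq _ _ _ (hT (a + b)) (Γ'.add_mem (hT a) (hT b))
      map_smul' := fun c a => huniq _ _ _ (hT (c • a)) (Γ'.smul_mem c (hT a)) } C
    fun u => hcl _ (hT u), hT⟩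

theorem toHalfL2_enorm_sq {ψ : Space → ℝ} (h : MemLp ψ 2 halfVol) :
    ENNReal.ofReal ‖toHalfL2 ψ‖ ^ 2 = ∫⁻ p in halfSpace, ‖ψ p‖ₑ ^ 2 := by
  rw [ofReal_norm, Lp.enorm_def, eLpNorm_congr_ae (coeFn_toHalfL2 h), eLpNorm_two_sq]

/-- The multi-index `(a, b, c)`, of order at most two. -/
def idx (a b c : Fin 3) (h : (a : ℕ) + b + c ≤ 2) : MultiIdx 2 :=
  ⟨![a, b, c], by rw [Fin.sum_univ_three]; exact h⟩

/-- The derivatives of orders one to three of a function are bounded in `L²(Σ)` by the norm of its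
jet. -/
theorem IsJetOf.norm_le {w : JetSpace 2} {ψ : Space → ℝ} (h : IsJetOf w ψ) (i : Fin 3)
    (a b c : Fin 3) (habc : (a : ℕ) + b + c ≤ 2) :
    ‖toHalfL2 ((spaceDeriv 0)^[a] ((spaceDeriv 1)^[b] ((spaceDeriv 2)^[c] (spaceDeriv i ψ))))‖
      ≤ ‖w‖ := by
  have e := h.eq i (idx a b c habc)
  have : ‖w (i, idx a b c habc)‖ ≤ ‖w‖ := PiLp.norm_apply_le w _
  rw [e] at this
  exact this

/-- `∫ ‖v(·, y)‖²_{H²} dy = ‖v - v_xx - v_zz‖²`, the right-hand norm being that of `L²(Σ)`. -/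
theorem lintegral_slice_weight_two {v : Space → ℝ} (hv : IsTest Set.univ v) :
    ∫⁻ y in Set.Iio (0 : ℝ), ∫⁻ k, (‖weight 2 k‖ₑ * ‖testFourier (slice v y) k‖ₑ) ^ 2 =
      ENNReal.ofReal ‖toHalfL2 v - toHalfL2 (spaceDeriv 0 (spaceDeriv 0 v))
        - toHalfL2 (spaceDeriv 2 (spaceDeriv 2 v))‖ ^ 2 := by
  have h0 := ((hv.spaceDeriv 0).spaceDeriv 0)
  have h2 := ((hv.spaceDeriv 2).spaceDeriv 2)
  have e : ∀ y, oneSubLaplace (slice v y) = fun q => (fun p => v p - spaceDeriv 0 (spaceDeriv 0 v) p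
      - spaceDeriv 2 (spaceDeriv 2 v) p) (q, y) := by
    intro y
    funext q
    unfold oneSubLaplace
    rw [planeDeriv_slice hv.1, planeDeriv_slice (hv.spaceDeriv _).1, planeDeriv_slice hv.1,
      planeDeriv_slice (hv.spaceDeriv _).1]
    rfl
  simp only [fun y => lintegral_weight_two (hv.slice y), e]
  rw [← lintegral_halfSpace (f := fun p => ‖v p - spaceDeriv 0 (spaceDeriv 0 v) p
      - spaceDeriv 2 (spaceDeriv 2 v) p‖ₑ ^ 2)
    (((hv.1.continuous.sub h0.1.continuous).sub h2.1.continuous).enorm.measurable.pow_const 2),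
    ofReal_norm, Lp.enorm_def, eLpNorm_two_sq]
  refine lintegral_congr_ae ?_
  filter_upwards [coeFn_toHalfL2 hv.memLp, coeFn_toHalfL2 h0.memLp, coeFn_toHalfL2 h2.memLp,
    Lp.coeFn_sub (toHalfL2 v) (toHalfL2 (spaceDeriv 0 (spaceDeriv 0 v))),
    Lp.coeFn_sub (toHalfL2 v - toHalfL2 (spaceDeriv 0 (spaceDeriv 0 v)))
      (toHalfL2 (spaceDeriv 2 (spaceDeriv 2 v)))] with p a b c d e
  rw [e, Pi.sub_apply, d, Pi.sub_apply, a, b, c]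

/-- `∫ ‖v(·, y)‖²_{H¹} dy = ‖v‖² + ‖v_x‖² + ‖v_z‖²`, the right-hand norms being those of `L²(Σ)`. -/
theorem lintegral_slice_weight_one {v : Space → ℝ} (hv : IsTest Set.univ v) :
    ∫⁻ y in Set.Iio (0 : ℝ), ∫⁻ k, (‖weight 1 k‖ₑ * ‖testFourier (slice v y) k‖ₑ) ^ 2 =
      ENNReal.ofReal ‖toHalfL2 v‖ ^ 2 + ENNReal.ofReal ‖toHalfL2 (spaceDeriv 0 v)‖ ^ 2 +
        ENNReal.ofReal ‖toHalfL2 (spaceDeriv 2 v)‖ ^ 2 := by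
  have hm : ∀ {χ}, IsTest Set.univ χ → Measurable fun p : Space => ‖χ p‖ₑ ^ 2 := fun h =>
    h.1.continuous.enorm.measurable.pow_const 2
  have h0 := hv.spaceDeriv 0
  have h2 := hv.spaceDeriv 2
  rw [toHalfL2_enorm_sq hv.memLp, toHalfL2_enorm_sq h0.memLp, toHalfL2_enorm_sq h2.memLp,
    lintegral_halfSpace (hm hv), lintegral_halfSpace (hm h0), lintegral_halfSpace (hm h2)]
  simp only [fun y => lintegral_weight_one (hv.slice y), planeDeriv_slice hv.1]
  change ∫⁻ y in Set.Iio (0 : ℝ), ((∫⁻ q, ‖v (q, y)‖ₑ ^ 2) +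
    ∫⁻ q, ‖spaceDeriv 0 v (q, y)‖ₑ ^ 2) + ∫⁻ q, ‖spaceDeriv 2 v (q, y)‖ₑ ^ 2 = _
  rw [lintegral_add_right _ (Measurable.lintegral_prod_left' (hm h2)),
    lintegral_add_right _ (Measurable.lintegral_prod_left' (hm h0))]

/-- The slices of a function on `Σ` lie in `H^{3/2}(ℝ²)`, with a bound in terms of two
derivatives. -/
theorem lintegral_slice_trace_le {w : JetSpace 2} {ψ : Space → ℝ} (hψ : IsTest Set.univ ψ)
    (hw : IsJetOf w ψ) (i : Fin 3) {y₀ : ℝ} (hy₀ : y₀ ≤ 0) :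
    ∫⁻ k, (‖weight (3 / 2) k‖ₑ * ‖testFourier (slice (spaceDeriv i ψ) y₀) k‖ₑ) ^ 2 ≤
      ENNReal.ofReal (4 * ‖w‖) ^ 2 := by
  set v := spaceDeriv i ψ with hv'
  have hv : IsTest Set.univ v := hψ.spaceDeriv i
  -- With weights `ρ = ⟨k⟩²` and `κ = ⟨k⟩`, where `⟨k⟩ = weight 1 k`, the left-hand side is the
  -- `H^{3/2}` norm; the terms on the right are `‖v‖²` in `L²(H²)` and `‖∂_y v‖²` in `L²(H¹)`.
  have h := lintegral_testFourier_slice_le hv hy₀ (ρ := fun k => ‖weight 1 k‖ₑ ^ 2)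
    ((measurable_weight 1).enorm.pow_const 2) (measurable_weight 1) (fun k => (weight_pos 1 k).le)
  have e1 : ∀ k, ‖weight (3 / 2) k‖ₑ ^ 2 = ‖weight 1 k‖ₑ ^ 2 * ENNReal.ofReal (weight 1 k) := by
    intro k
    rw [enorm_weight, enorm_weight, ← ENNReal.ofReal_pow (weight_pos _ _).le,
      ← ENNReal.ofReal_pow (weight_pos _ _).le, ← ENNReal.ofReal_mul (by positivity), sq, sq,
      weight_mul, weight_mul, weight_mul]
    norm_num
  have e2 : ∀ k, ‖weight 2 k‖ₑ ^ 2 = ‖weight 1 k‖ₑ ^ 2 * ENNReal.ofReal (weight 1 k) ^ 2 := by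
    intro k
    rw [← enorm_weight, ← mul_pow, ← enorm_mul, weight_mul]
    norm_num
  have l1 : ∀ k, (‖weight (3 / 2) k‖ₑ * ‖testFourier (slice v y₀) k‖ₑ) ^ 2 =
      ‖weight 1 k‖ₑ ^ 2 * (ENNReal.ofReal (weight 1 k) * ‖testFourier (slice v y₀) k‖ₑ ^ 2) :=
    fun k => by rw [mul_pow, e1, mul_assoc]
  have l2 : ∀ y k, ‖weight 1 k‖ₑ ^ 2 * (ENNReal.ofReal (weight 1 k) * ‖testFourier (slice v y) k‖ₑ) ^ 2
      = (‖weight 2 k‖ₑ * ‖testFourier (slice v y) k‖ₑ) ^ 2 :=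
    fun y k => by rw [mul_pow, mul_pow, e2, mul_assoc]
  simp only [l1]
  refine h.trans ?_
  simp only [l2]
  simp only [← mul_pow]
  rw [lintegral_slice_weight_two hv, lintegral_slice_weight_one (hv.spaceDeriv 1)]
  have n0 : ‖toHalfL2 v‖ ≤ ‖w‖ := hw.norm_le i 0 0 0 (by decide)
  have n1 : ‖toHalfL2 (spaceDeriv 0 (spaceDeriv 0 v))‖ ≤ ‖w‖ := hw.norm_le i 2 0 0 (by decide)
  have n2 : ‖toHalfL2 (spaceDeriv 2 (spaceDeriv 2 v))‖ ≤ ‖w‖ := hw.norm_le i 0 0 2 (by decide)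
  have n3 : ‖toHalfL2 (spaceDeriv 1 v)‖ ≤ ‖w‖ := hw.norm_le i 0 1 0 (by decide)
  have n4 : ‖toHalfL2 (spaceDeriv 0 (spaceDeriv 1 v))‖ ≤ ‖w‖ := hw.norm_le i 1 1 0 (by decide)
  have n5 : ‖toHalfL2 (spaceDeriv 2 (spaceDeriv 1 v))‖ ≤ ‖w‖ := by
    rw [spaceDeriv_comm hv.1]
    exact hw.norm_le i 0 1 1 (by decide)
  have n6 := (norm_sub_le (toHalfL2 v - toHalfL2 (spaceDeriv 0 (spaceDeriv 0 v)))
    (toHalfL2 (spaceDeriv 2 (spaceDeriv 2 v)))).trans (add_le_add (norm_sub_le _ _) le_rfl)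
  rw [← ENNReal.ofReal_pow (by positivity), ← ENNReal.ofReal_pow (by positivity),
    ← ENNReal.ofReal_pow (by positivity), ← ENNReal.ofReal_pow (by positivity),
    ← ENNReal.ofReal_pow (by positivity), ← ENNReal.ofReal_add (by positivity) (by positivity),
    ← ENNReal.ofReal_add (by positivity) (by positivity),
    ← ENNReal.ofReal_add (by positivity) (by positivity)]
  refine ENNReal.ofReal_le_ofReal ?_
  have p3 := pow_le_pow_left₀ (norm_nonneg _) n3 2
  have p4 := pow_le_pow_left₀ (norm_nonneg _) n4 2
  have p5 := pow_le_pow_left₀ (norm_nonneg _) n5 2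
  have p6 := pow_le_pow_left₀ (norm_nonneg _) (n6.trans (by linarith : _ ≤ 3 * ‖w‖)) 2
  nlinarith

/-- The horizontal slices of the gradient of a test function as elements of `H^{3/2}(ℝ²)`, bounded
independently of the height. -/
theorem exists_slice_sobolev {w : JetSpace 2} {ψ : Space → ℝ} (hψ : IsTest Set.univ ψ)
    (hw : IsJetOf w ψ) (i : Fin 3) {y₀ : ℝ} (hy₀ : y₀ ≤ 0) :
    ∃ f : Sobolev (3 / 2), (f : Plane → ℝ) =ᵐ[volume] slice (spaceDeriv i ψ) y₀ ∧
      ‖f‖ ≤ 4 * ‖w‖ := by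
  obtain ⟨f, h1, -, h3⟩ := exists_sobolev_test ((hψ.spaceDeriv i).slice y₀) (s := 3 / 2)
    (by rw [← NNReal.coe_le_coe]; norm_num)
  refine ⟨f, ?_, ?_⟩
  · rw [h1]; exact MemLp.coeFn_toLp _
  · have h4 := lintegral_slice_trace_le hψ hw i hy₀
    have e : ((3 / 2 : ℝ≥0) : ℝ) = 3 / 2 := by norm_num
    rw [e] at h3
    rw [← h3, ENNReal.pow_le_pow_left_iff two_ne_zero] at h4
    exact (ENNReal.ofReal_le_ofReal_iff (by positivity)).1 h4

/-- Integration over vertical lines: `∫_Σ μ(x, z) ∂_y g = ∫ μ g(·, 0)`. -/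
theorem integral_vertical {g : Space → ℝ} (hg : ContDiff ℝ 1 g) (hc : HasCompactSupport g)
    {μ : Plane → ℝ} {C : ℝ} (hμ : Measurable μ) (hb : ∀ q, |μ q| ≤ C) :
    ∫ p in halfSpace, μ p.1 * spaceDeriv 1 g p = ∫ q, μ q * g (q, 0) := by
  have hg' : Continuous (spaceDeriv 1 g) := (hg.continuous_fderiv one_ne_zero).clm_apply continuous_const
  have hc' : HasCompactSupport (spaceDeriv 1 g) :=
    (hc.fderiv (𝕜 := ℝ)).comp_left (g := fun L : Space →L[ℝ] ℝ => L (spaceDir 1)) rfl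
  have hint : Integrable (fun p : Space => μ p.1 * spaceDeriv 1 g p) :=
    (hg'.integrable_of_hasCompactSupport hc').bdd_mul (c := C)
      (hμ.comp measurable_fst).aestronglyMeasurable (ae_of_all _ fun p => hb p.1)
  have hvol : (volume : Measure Space).restrict halfSpace =
      (volume : Measure Plane).prod (volume.restrict (Set.Iic (0 : ℝ))) := by
    have : halfSpace = (Set.univ : Set Plane) ×ˢ Set.Iio (0 : ℝ) := by
      ext p; simp [halfSpace]
    rw [← restrict_Iio_eq_restrict_Iic, this, Measure.volume_eq_prod, ← Measure.prod_restrict,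
      Measure.restrict_univ]
  have hint' := hint.integrableOn (s := halfSpace)
  unfold IntegrableOn at hint'
  rw [hvol] at hint' ⊢
  rw [integral_prod _ hint']
  refine integral_congr_ae (ae_of_all _ fun q => ?_)
  dsimp only
  rw [integral_const_mul]
  congr 1
  have hcq : HasCompactSupport fun y => g (q, y) := by
    refine HasCompactSupport.of_support_subset_isCompact (hc.isCompact.image continuous_snd) ?_
    intro y hy
    exact ⟨(q, y), subset_tsupport _ hy, rfl⟩
  have hcq' : HasCompactSupport fun y => spaceDeriv 1 g (q, y) := by
    refine HasCompactSupport.of_support_subset_isCompact (hc'.isCompact.image continuous_snd) ?_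
    intro y hy
    exact ⟨(q, y), subset_tsupport _ hy, rfl⟩
  rw [integral_Iic_of_hasDerivAt_of_tendsto' (m := 0) (fun y _ => hasDerivAt_slice hg q y)
    ((hg'.comp (by fun_prop)).integrable_of_hasCompactSupport hcq').integrableOn, sub_zero]
  exact hcq.is_zero_at_infty.mono_left atBot_le_cocompact

theorem memLp_mul_bounded {X : Type*} [MeasurableSpace X] {ν : Measure X} {f g : X → ℝ} {C : ℝ}
    (hf : MemLp f 2 ν) (hg : AEStronglyMeasurable g ν) (hb : ∀ x, |g x| ≤ C) :
    MemLp (fun x => g x * f x) 2 ν :=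
  hf.of_le_mul (c := C) (hg.mul hf.1) (ae_of_all _ fun x => by
    rw [norm_mul]; exact mul_le_mul_of_nonneg_right (hb x) (norm_nonneg _))

/-- The inner product of `L²(ℝ²)` with a given function. -/
theorem inner_plane (f : PlaneL2) {ψ : Plane → ℝ} (h : MemLp ψ 2 volume) :
    inner ℝ f (h.toLp ψ) = ∫ q, f q * ψ q := by
  rw [L2.inner_def]
  refine integral_congr_ae ?_
  filter_upwards [h.coeFn_toLp] with q hq
  rw [hq]
  simp [mul_comm]

/-- The relation between the boundary values `t` of `u_i`, `u_i` itself and `∂_y u_i`, tested with a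
bounded weight `μ(x, z)` and a compactly supported `C¹` function `ψ`. -/
def TraceRel (f f' : HalfL2) (t : PlaneL2) : Prop :=
  ∀ (μ : Plane → ℝ) (C : ℝ), Measurable μ → (∀ q, |μ q| ≤ C) → ∀ ψ : Space → ℝ, ContDiff ℝ 1 ψ →
    HasCompactSupport ψ →
    (∫ p in halfSpace, f' p * (μ p.1 * ψ p)) + ∫ p in halfSpace, f p * (μ p.1 * spaceDeriv 1 ψ p) =
      ∫ q, t q * (μ q * ψ (q, 0))

theorem memLp_traceRel {μ : Plane → ℝ} {C : ℝ} (hμ : Measurable μ) (hb : ∀ q, |μ q| ≤ C)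
    {ψ : Space → ℝ} (hψ : ContDiff ℝ 1 ψ) (hc : HasCompactSupport ψ) :
    MemLp (fun p : Space => μ p.1 * ψ p) 2 halfVol ∧
      MemLp (fun p : Space => μ p.1 * spaceDeriv 1 ψ p) 2 halfVol ∧
      MemLp (fun q : Plane => μ q * ψ (q, 0)) 2 volume := by
  have hψ' : Continuous (spaceDeriv 1 ψ) :=
    (hψ.continuous_fderiv one_ne_zero).clm_apply continuous_const
  have hc' : HasCompactSupport (spaceDeriv 1 ψ) :=
    (hc.fderiv (𝕜 := ℝ)).comp_left (g := fun L : Space →L[ℝ] ℝ => L (spaceDir 1)) rfl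
  have hμ1 : AEStronglyMeasurable (fun p : Space => μ p.1) halfVol :=
    (hμ.comp measurable_fst).aestronglyMeasurable
  refine ⟨memLp_mul_bounded ((hψ.continuous.memLp_of_hasCompactSupport hc).restrict _) hμ1
      fun p => hb p.1,
    memLp_mul_bounded ((hψ'.memLp_of_hasCompactSupport hc').restrict _) hμ1 fun p => hb p.1, ?_⟩
  refine memLp_mul_bounded (Continuous.memLp_of_hasCompactSupport
    (hψ.continuous.comp (by fun_prop : Continuous fun q : Plane => (q, (0 : ℝ)))) ?_)
    hμ.aestronglyMeasurable hb
  refine HasCompactSupport.of_support_subset_isCompact (hc.isCompact.image continuous_fst) ?_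
  intro q hq
  exact ⟨(q, 0), subset_tsupport _ hq, rfl⟩

/-- The trace relation is stable under `L²` limits, being a family of equations between continuous
functionals. -/
theorem isClosed_traceRel : IsClosed {x : HalfL2 × HalfL2 × PlaneL2 | TraceRel x.1 x.2.1 x.2.2} := by
  simp only [TraceRel, Set.ofPred_forall]
  refine isClosed_iInter fun μ => isClosed_iInter fun C => isClosed_iInter fun hμ =>
    isClosed_iInter fun hb => isClosed_iInter fun ψ => isClosed_iInter fun hψ =>
    isClosed_iInter fun hc => ?_
  obtain ⟨m1, m2, m3⟩ := memLp_traceRel hμ hb hψ hc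
  simp only [← inner_toHalfL2 _ m1, ← inner_toHalfL2 _ m2, ← inner_plane _ m3]
  exact isClosed_eq (by fun_prop) (by fun_prop)

/-- For test functions the trace relation is integration by parts in the vertical direction. -/
theorem traceRel_test {v : Space → ℝ} (hv : IsTest Set.univ v) {t : PlaneL2}
    (ht : t =ᵐ[volume] slice v 0) : TraceRel (toHalfL2 v) (toHalfL2 (spaceDeriv 1 v)) t := by
  intro μ C hμ hb ψ hψ hc
  have hv1 : ContDiff ℝ 1 v := hv.1.of_le (by exact_mod_cast le_top)
  have h := integral_vertical (hv1.mul hψ) hc.mul_left hμ hb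
  have e1 : ∀ p, spaceDeriv 1 (fun p => v p * ψ p) p = spaceDeriv 1 v p * ψ p + v p * spaceDeriv 1 ψ p := by
    intro p
    unfold spaceDeriv
    rw [fderiv_fun_mul (hv1.differentiable one_ne_zero p) (hψ.differentiable one_ne_zero p)]
    simp [mul_comm, add_comm]
  have hψ' : Continuous (spaceDeriv 1 ψ) :=
    (hψ.continuous_fderiv one_ne_zero).clm_apply continuous_const
  have hμ1 : AEStronglyMeasurable (fun p : Space => μ p.1) volume :=
    (hμ.comp measurable_fst).aestronglyMeasurable
  have c1 : HasCompactSupport (fun p => spaceDeriv 1 v p * ψ p) := hc.mul_left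
  have c2 : HasCompactSupport (fun p => v p * spaceDeriv 1 ψ p) := hv.2.1.mul_right
  have i1 : Integrable (fun p : Space => μ p.1 * (spaceDeriv 1 v p * ψ p)) :=
    ((((hv.spaceDeriv 1).1.continuous.mul hψ.continuous).integrable_of_hasCompactSupport
      c1)).bdd_mul (c := C) hμ1 (ae_of_all _ fun p => hb p.1)
  have i2 : Integrable (fun p : Space => μ p.1 * (v p * spaceDeriv 1 ψ p)) :=
    ((hv.1.continuous.mul hψ').integrable_of_hasCompactSupport
      c2).bdd_mul (c := C) hμ1 (ae_of_all _ fun p => hb p.1)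
  calc _ = (∫ p in halfSpace, μ p.1 * (spaceDeriv 1 v p * ψ p)) +
        ∫ p in halfSpace, μ p.1 * (v p * spaceDeriv 1 ψ p) := by
        congr 1 <;> refine integral_congr_ae ?_
        · filter_upwards [coeFn_toHalfL2 (hv.spaceDeriv 1).memLp] with p hp
          rw [hp]; ring
        · filter_upwards [coeFn_toHalfL2 hv.memLp] with p hp
          rw [hp]; ring
    _ = ∫ p in halfSpace, μ p.1 * spaceDeriv 1 (fun p => v p * ψ p) p := by
        rw [← integral_add i1.restrict i2.restrict]
        simp only [e1, mul_add]
    _ = ∫ q, μ q * (v (q, 0) * ψ (q, 0)) := h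
    _ = _ := by
        refine integral_congr_ae ?_
        filter_upwards [ht] with q hq
        rw [hq, slice]; ring

/-- The trace operators `u ↦ u_i|_{y=0}` on `H_⋆³(Σ)`. -/
theorem exists_traceOp (i : Fin 3) : ∃ T : HStar 2 →L[ℝ] Sobolev (3 / 2), ∀ u : HStar 2,
    TraceRel (u.grad i) ((u : JetSpace 2) (i, idx 0 1 0 (by decide))) (Sobolev.toL2 (T u)) := by
  -- The graph of the trace operator on test functions; `exists_slice_sobolev` bounds it.
  let Γ : Submodule ℝ (JetSpace 2 × Sobolev (3 / 2)) :=
    { carrier := {x | ∃ ψ, IsTest Set.univ ψ ∧ IsJetOf x.1 ψ ∧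
        (x.2 : Plane → ℝ) =ᵐ[volume] slice (spaceDeriv i ψ) 0}
      zero_mem' := by
        have h0 : spaceDeriv i (0 : Space → ℝ) = 0 := by
          simpa using spaceDeriv_lin (u := 0) (v := 0) contDiff_const contDiff_const 0 0 i
        refine ⟨0, isTest_zero _, fun j α => ?_, ?_⟩
        · have h0 : spaceDeriv j (0 : Space → ℝ) = 0 := by
            simpa using spaceDeriv_lin (u := 0) (v := 0) contDiff_const contDiff_const 0 0 j
          rw [h0, spaceMultiDeriv_zero]
          exact Lp.coeFn_zero ℝ 2 halfVol
        · rw [h0]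
          change (Sobolev.toL2 (0 : Sobolev (3 / 2)) : Plane → ℝ) =ᵐ[volume] 0
          rw [map_zero]
          exact Lp.coeFn_zero ℝ 2 volume
      add_mem' := by
        rintro ⟨w, s⟩ ⟨w', s'⟩ ⟨ψ, hψ, hw, hs⟩ ⟨ψ', hψ', hw', hs'⟩
        have hl := IsJetOf.lin hψ.isSchwartzOnHalfSpace hψ'.isSchwartzOnHalfSpace hw hw' 1 1
        refine ⟨_, hψ.lin hψ' 1 1, by simpa using hl, ?_⟩
        change (Sobolev.toL2 (s + s') : Plane → ℝ) =ᵐ[volume] _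
        rw [map_add, spaceDeriv_lin hψ.1 hψ'.1]
        filter_upwards [Lp.coeFn_add (Sobolev.toL2 s) (Sobolev.toL2 s'), hs, hs'] with q a b c
        rw [a, Pi.add_apply, b, c]
        simp [slice]
      smul_mem' := by
        rintro c ⟨w, s⟩ ⟨ψ, hψ, hw, hs⟩
        have hl := IsJetOf.lin hψ.isSchwartzOnHalfSpace hψ.isSchwartzOnHalfSpace hw hw c 0
        refine ⟨_, hψ.lin hψ c 0, by simpa using hl, ?_⟩
        change (Sobolev.toL2 (c • s) : Plane → ℝ) =ᵐ[volume] _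
        rw [map_smul, spaceDeriv_lin hψ.1 hψ.1]
        filter_upwards [Lp.coeFn_smul c (Sobolev.toL2 s), hs] with q a b
        rw [a, Pi.smul_apply, b]
        simp [slice] }
  obtain ⟨T, hT⟩ := exists_extension Γ 4 (by
    rintro ⟨w, t⟩ ⟨ψ, hψ, hw, ht⟩
    obtain ⟨f, hf, hf'⟩ := exists_slice_sobolev hψ hw i le_rfl
    have : t = f := Sobolev.toL2_injective (Lp.ext (ht.trans hf.symm))
    rw [this]; exact hf') (smoothJets 2).topologicalClosure (by
    intro u hu
    refine closure_mono ?_ (HStar.mem_closure_testJets ⟨u, hu⟩)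
    rintro w ⟨ψ, hψ, hw⟩
    obtain ⟨f, hf, -⟩ := exists_slice_sobolev hψ hw i le_rfl
    exact ⟨(w, f), ⟨ψ, hψ, hw, hf⟩, rfl⟩)
  refine ⟨T, fun u => ?_⟩
  have hcl : IsClosed {x : JetSpace 2 × Sobolev (3 / 2) | TraceRel (x.1 (i, MultiIdx.zero 2))
      (x.1 (i, idx 0 1 0 (by decide))) (Sobolev.toL2 x.2)} :=
    isClosed_traceRel.preimage (f := fun x : JetSpace 2 × Sobolev (3 / 2) =>
      (x.1 (i, MultiIdx.zero 2), x.1 (i, idx 0 1 0 (by decide)), Sobolev.toL2 x.2)) (by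
      have : Continuous fun x : JetSpace 2 × Sobolev (3 / 2) => Sobolev.toL2 x.2 :=
        (Sobolev.toL2L (3 / 2)).continuous.comp continuous_snd
      fun_prop)
  refine closure_minimal ?_ hcl (hT u)
  rintro ⟨w, t⟩ ⟨ψ, hψ, hw, ht⟩
  have h := traceRel_test (hψ.spaceDeriv i) ht
  have e1 := hw.eq i (MultiIdx.zero 2)
  have e2 := hw.eq i (idx 0 1 0 (by decide))
  change TraceRel (w (i, MultiIdx.zero 2)) (w (i, idx 0 1 0 (by decide))) (Sobolev.toL2 t)
  rw [e1, e2]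
  exact h

/-- The trace relation survives multiplication by a bounded function of the horizontal variables and
implies the weak definition of a trace. -/
theorem TraceRel.hasTrace {f f' : HalfL2} {t : PlaneL2} (h : TraceRel f f' t) {μ : Plane → ℝ}
    {C : ℝ} (hμ : Measurable μ) (hb : ∀ q, |μ q| ≤ C) :
    HasTrace (fun p => μ p.1 * f p) (fun q => μ q * t q) := by
  have hμ1 : AEStronglyMeasurable (fun p : Space => μ p.1) halfVol :=
    (hμ.comp measurable_fst).aestronglyMeasurable
  refine ⟨memLp_mul_bounded (Lp.memLp f) hμ1 fun p => hb p.1,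
    memLp_mul_bounded (Lp.memLp t) hμ.aestronglyMeasurable hb, fun p => μ p.1 * f' p,
    memLp_mul_bounded (Lp.memLp f') hμ1 fun p => hb p.1, fun ψ hψ => ?_⟩
  have := h μ C hμ hb ψ (hψ.1.of_le (by exact_mod_cast le_top)) hψ.2.1
  simp only [mul_comm (μ _), mul_assoc] at this ⊢
  linarith

/-- Every test function in the plane is the restriction to `y = 0` of a test function in space. -/
theorem exists_test_extension {φ : Plane → ℝ} (hφ : IsTest Set.univ φ) :
    ∃ ψ : Space → ℝ, IsTest Set.univ ψ ∧ slice ψ 0 = φ := by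
  let χ : ContDiffBump (0 : ℝ) := ⟨1, 2, one_pos, one_lt_two⟩
  refine ⟨fun p => φ p.1 * χ p.2, ⟨(hφ.1.comp contDiff_fst).mul (χ.contDiff.comp contDiff_snd), ?_,
    Set.subset_univ _⟩, ?_⟩
  · refine HasCompactSupport.of_support_subset_isCompact
      (hφ.2.1.isCompact.prod χ.hasCompactSupport.isCompact) ?_
    intro p hp
    have hp' : φ p.1 * χ p.2 ≠ 0 := hp
    exact ⟨subset_tsupport _ (left_ne_zero_of_mul hp'), subset_tsupport _ (right_ne_zero_of_mul hp')⟩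
  · have hχ : χ (0 : ℝ) = 1 := χ.one_of_mem_closedBall (by simp [χ.rIn_pos.le])
    funext q
    simp [slice, hχ]

theorem isTest_halfSpace_zero {ψ : Space → ℝ} (hψ : IsTest halfSpace ψ) (q : Plane) : ψ (q, 0) = 0 :=
  image_eq_zero_of_notMem_tsupport fun hq => by
    have := hψ.2.2 hq
    simp [halfSpace] at this

/-- Traces are unique: the vertical derivative is determined by test functions supported in `Σ`, the
boundary values by extensions of test functions in the plane. -/
theorem HasTrace.unique {f : Space → ℝ} {g g' : Plane → ℝ} (h : HasTrace f g) (h' : HasTrace f g') :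
    g =ᵐ[volume] g' := by
  obtain ⟨hf, hg, d, hd, e⟩ := h
  obtain ⟨-, hg', d', hd', e'⟩ := h'
  have hdd : hd.toLp d = hd'.toLp d' := by
    refine eq_of_inner_test fun ψ hψ => ?_
    rw [inner_toHalfL2 _ hψ.memLp, inner_toHalfL2 _ hψ.memLp]
    have h0 := isTest_halfSpace_zero hψ
    calc _ = ∫ p in halfSpace, d p * ψ p := integral_congr_ae (by
          filter_upwards [hd.coeFn_toLp] with p hp; rw [hp])
      _ = ∫ p in halfSpace, d' p * ψ p := by
          rw [e ψ (hψ.mono (Set.subset_univ _)), e' ψ (hψ.mono (Set.subset_univ _))]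
          simp [h0]
      _ = _ := integral_congr_ae (by
          filter_upwards [hd'.coeFn_toLp] with p hp; rw [hp])
  have hdd' : d =ᵐ[halfVol] d' := (MemLp.toLp_eq_toLp_iff hd hd').1 hdd
  refine ae_eq_of_integral_test (hg.locallyIntegrable one_le_two)
    (hg'.locallyIntegrable one_le_two) fun φ hφ => ?_
  obtain ⟨ψ, hψ, rfl⟩ := exists_test_extension hφ
  have h1 := e ψ hψ
  rw [integral_congr_ae (g := fun p => d' p * ψ p)
    (hdd'.mono fun p hp => by dsimp only; rw [hp]), e' ψ hψ] at h1
  simp only [smul_eq_mul, mul_comm (slice ψ 0 _)]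
  exact (add_left_cancel h1).symm

/-- An almost everywhere bound for a continuous function holds everywhere. -/
theorem continuous_le_of_ae {g : Plane → ℝ} (hg : Continuous g) {c : ℝ} (h : ∀ᵐ q : Plane, |g q| ≤ c)
    (q : Plane) : |g q| ≤ c := by
  have hcl : IsClosed {q | |g q| ≤ c} := isClosed_le hg.abs continuous_const
  have := hcl.closure_eq ▸ (Measure.dense_of_ae h) q
  exact this

/-- An almost everywhere bound survives `L²` limits. -/
theorem isClosed_ae_le {X : Type*} [MeasurableSpace X] (ν : Measure X) :
    IsClosed {x : Lp ℝ 2 ν × ℝ | ∀ᵐ p ∂ν, |x.1 p| ≤ x.2} := by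
  refine IsSeqClosed.isClosed fun x a hx ha => ?_
  have h1 : Tendsto (fun n => (x n).1) atTop (𝓝 a.1) := (continuous_fst.tendsto a).comp ha
  have h2 : Tendsto (fun n => (x n).2) atTop (𝓝 a.2) := (continuous_snd.tendsto a).comp ha
  obtain ⟨k, hk, hk'⟩ := (tendstoInMeasure_of_tendsto_Lp h1).exists_seq_tendsto_ae
  have h3 : ∀ᵐ p ∂ν, ∀ n, |(x n).1 p| ≤ (x n).2 := ae_all_iff.2 hx
  filter_upwards [hk', h3] with p hp hp'
  exact le_of_tendsto_of_tendsto' hp.abs (h2.comp hk.tendsto_atTop) fun n => hp' _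

/-- Gradients of functions in `H_⋆³(Σ)` are bounded: horizontal slices lie in `H^{3/2}(ℝ²)`, which
is embedded in `L^∞`. -/
theorem HStar.exists_sup_bound : ∃ C : ℝ, 0 ≤ C ∧ ∀ (u : HStar 2) (i : Fin 3),
    ∀ᵐ p ∂halfVol, |u.grad i p| ≤ C * ‖u‖ := by
  obtain ⟨C, hC, h⟩ := Sobolev.exists_sup_bound (3 / 2) (by
    rw [← NNReal.coe_lt_coe]; norm_num)
  refine ⟨C * 4, by positivity, fun u i => ?_⟩
  have hcl : IsClosed {w : JetSpace 2 | ∀ᵐ p ∂halfVol, |w (i, MultiIdx.zero 2) p| ≤ C * 4 * ‖w‖} :=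
    (isClosed_ae_le halfVol).preimage (f := fun w : JetSpace 2 =>
      (w (i, MultiIdx.zero 2), C * 4 * ‖w‖)) (by fun_prop)
  refine HStar.test_induction hcl (fun w ψ hψ hw => ?_) u
  filter_upwards [hw i (MultiIdx.zero 2), ae_restrict_mem measurableSet_halfSpace] with p hp hp'
  rw [hp]
  obtain ⟨f, hf, hf'⟩ := exists_slice_sobolev hψ hw i (y₀ := p.2) (le_of_lt hp')
  have := continuous_le_of_ae (g := slice (spaceDeriv i ψ) p.2)
    ((hψ.spaceDeriv i).slice p.2).1.continuous (c := C * 4 * ‖w‖) (by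
      filter_upwards [h f, hf] with q h1 h2
      rw [← h2]
      refine h1.trans ?_
      rw [mul_assoc]
      exact mul_le_mul_of_nonneg_left hf' hC) p.1
  exact this

/-- Gradients of functions in `H_⋆³(Σ)` tend to zero as `y → -∞`, being uniform limits of compactly
supported functions. -/
theorem HStar.tendsToZeroBelow (u : HStar 2) (i : Fin 3) : TendsToZeroBelow halfSpace (u.grad i) := by
  intro ε hε
  obtain ⟨C, hC, h⟩ := HStar.exists_sup_bound
  obtain ⟨w, ⟨ψ, hψ, hw⟩, hd⟩ := Metric.mem_closure_iff.1 u.mem_closure_testJets (ε / (C + 1))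
    (by positivity)
  have hwm : w ∈ (smoothJets 2).topologicalClosure :=
    Submodule.le_topologicalClosure _ ⟨ψ, hψ.isSchwartzOnHalfSpace, hw⟩
  obtain ⟨R, hR⟩ := (hψ.spaceDeriv i).2.1.isCompact.isBounded.exists_norm_le
  refine ⟨R, ?_⟩
  have e : (u - ⟨w, hwm⟩ : HStar 2).grad i = u.grad i - w (i, MultiIdx.zero 2) := rfl
  have h1 := h (u - ⟨w, hwm⟩) i
  rw [e] at h1
  filter_upwards [h1, Lp.coeFn_sub (u.grad i) (w (i, MultiIdx.zero 2)),
    hw i (MultiIdx.zero 2)] with p a b c hp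
  have hz : w (i, MultiIdx.zero 2) p = 0 := by
    rw [c]
    change spaceDeriv i ψ p = 0
    refine image_eq_zero_of_notMem_tsupport fun hmem => ?_
    have h2 := hR p hmem
    have h3 : |p.2| ≤ ‖p‖ := norm_snd_le p
    have := neg_abs_le p.2
    linarith
  rw [b, Pi.sub_apply, hz, sub_zero] at a
  refine a.trans ?_
  have h4 : ‖u - ⟨w, hwm⟩‖ < ε / (C + 1) := by
    have : ‖u - ⟨w, hwm⟩‖ = dist (u : JetSpace 2) w := (dist_eq_norm _ _).symm
    rw [this]; exact hd
  calc C * ‖u - ⟨w, hwm⟩‖ ≤ (C + 1) * (ε / (C + 1)) :=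
        mul_le_mul (by linarith) h4.le (norm_nonneg _) (by positivity)
    _ = ε := by field_simp

/-! ### Multiplication by functions of the horizontal variables on `Σ` -/

/-- Multiplication of functions on `Σ` by bounded continuous functions of the horizontal variables. -/
noncomputable def halfMul : (Plane →ᵇ ℝ) →L[ℝ] HalfL2 →L[ℝ] HalfL2 :=
  (exists_mulL2 halfVol (measurable_fst : Measurable (Prod.fst : Space → Plane))).choose

theorem coeFn_halfMul (μ : Plane →ᵇ ℝ) (f : HalfL2) :
    halfMul μ f =ᵐ[halfVol] fun p => μ p.1 * f p :=
  (exists_mulL2 halfVol (measurable_fst : Measurable (Prod.fst : Space → Plane))).choose_spec μ f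

/-- Multiplication by `μ` maps `H^s(ℝ²)` to itself for `s ≤ 2`. -/
def IsMultiplier (μ : Plane →ᵇ ℝ) : Prop :=
  ∀ s : ℝ≥0, s ≤ 2 → ∃ M : Sobolev s →L[ℝ] Sobolev s, ∀ f,
    Sobolev.toL2 (M f) =ᵐ[volume] fun q => μ q * f q

theorem IsMultiplier.mul {μ ν : Plane →ᵇ ℝ} (hμ : IsMultiplier μ) (hν : IsMultiplier ν) :
    IsMultiplier (μ * ν) := by
  intro s hs
  obtain ⟨M, hM⟩ := hμ s hs
  obtain ⟨N, hN⟩ := hν s hs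
  refine ⟨M ∘L N, fun f => ?_⟩
  filter_upwards [hM (N f), hN f] with q a b
  rw [ContinuousLinearMap.comp_apply, a, b, BoundedContinuousFunction.mul_apply, mul_assoc]

/-- The transpose of a first derivative on `H¹(ℝ²)`. -/
theorem exists_partial_transpose (a : Fin 2) : ∃ G : Sobolev 1 →L[ℝ] PlaneL2, ∀ f φ,
    IsTest Set.univ φ → ∫ q, f q * planeDeriv a φ q = ∫ q, G f q * φ q := by
  obtain ⟨D, hD⟩ := exists_partial 1 0 (by simp) a
  refine ⟨-(Sobolev.toL2L 0 ∘L D), fun f φ hφ => ?_⟩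
  have h := (hasWeakPartial_of_fourier (hD f)).2.2 φ hφ
  rw [eq_neg_iff_add_eq_zero, add_comm, ← eq_neg_iff_add_eq_zero] at h
  rw [h, ← integral_neg]
  refine integral_congr_ae ?_
  filter_upwards [Lp.coeFn_neg (Sobolev.toL2 (D f))] with q hq
  simp only [neg_apply, ContinuousLinearMap.comp_apply, Sobolev.toL2L_apply]
  rw [hq, Pi.neg_apply, neg_mul]

/-- The transpose of a second derivative on `H²(ℝ²)`. -/
theorem exists_partial_partial_transpose (a b : Fin 2) : ∃ G : Sobolev 2 →L[ℝ] PlaneL2, ∀ f φ,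
    IsTest Set.univ φ → ∫ q, f q * planeDeriv a (planeDeriv b φ) q = ∫ q, G f q * φ q := by
  obtain ⟨D, hD⟩ := exists_partial 2 1 (by norm_num) a
  obtain ⟨G, hG⟩ := exists_partial_transpose b
  refine ⟨-(G ∘L D), fun f φ hφ => ?_⟩
  have h := (hasWeakPartial_of_fourier (hD f)).2.2 _ (hφ.planeDeriv b)
  rw [eq_neg_iff_add_eq_zero, add_comm, ← eq_neg_iff_add_eq_zero] at h
  rw [h, hG _ φ hφ, ← integral_neg]
  refine integral_congr_ae ?_
  filter_upwards [Lp.coeFn_neg (G (D f))] with q hq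
  simp only [neg_apply, ContinuousLinearMap.comp_apply]
  rw [hq, Pi.neg_apply, neg_mul]

/-- Integration over `Σ` by horizontal slices. -/
theorem enorm_integral_halfSpace_le {g : Space → ℝ} (hg : Integrable g) :
    ‖∫ p in halfSpace, g p‖ₑ ≤ ∫⁻ y in Set.Iio (0 : ℝ), ‖∫ q, g (q, y)‖ₑ := by
  have hvol : (volume : Measure Space).restrict halfSpace =
      (volume : Measure Plane).prod (volume.restrict (Set.Iio (0 : ℝ))) := by
    have : halfSpace = (Set.univ : Set Plane) ×ˢ Set.Iio (0 : ℝ) := by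
      ext p; simp [halfSpace]
    rw [this, Measure.volume_eq_prod, ← Measure.prod_restrict, Measure.restrict_univ]
  have hg' := hg.integrableOn (s := halfSpace)
  unfold IntegrableOn at hg'
  rw [hvol] at hg' ⊢
  rw [integral_prod_symm _ hg']
  exact enorm_integral_le_lintegral_enorm _

/-- Multiplication by a multiplier `μ` commutes with taking slices, so a bound for the transpose of
a horizontal differential operator on `H^s(ℝ²)` gives one on `Σ`. -/
theorem abs_inner_halfMul_le {μ : Plane →ᵇ ℝ} {s : ℝ≥0} (hs : s ≤ 2) {M : Sobolev s →L[ℝ] Sobolev s}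
    (hM : ∀ f, Sobolev.toL2 (M f) =ᵐ[volume] fun q => μ q * f q) {G : Sobolev s →L[ℝ] PlaneL2}
    {D : (Plane → ℝ) → Plane → ℝ}
    (hG : ∀ f φ, IsTest Set.univ φ → ∫ q, f q * D φ q = ∫ q, G f q * φ q)
    {v ψ Dψ : Space → ℝ} (hv : IsTest Set.univ v) (hψ : IsTest Set.univ ψ)
    (hDψ : IsTest Set.univ Dψ) (hD : ∀ y, slice Dψ y = D (slice ψ y)) {N : ℝ} (hN0 : 0 ≤ N)
    (hN : ∫⁻ y in Set.Iio (0 : ℝ), ∫⁻ k, (‖weight s k‖ₑ * ‖testFourier (slice v y) k‖ₑ) ^ 2 ≤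
      ENNReal.ofReal N ^ 2) :
    |∫ p in halfSpace, μ p.1 * v p * Dψ p| ≤ ‖G ∘L M‖ * N * ‖toHalfL2 ψ‖ := by
  have hint : Integrable fun p : Space => μ p.1 * v p * Dψ p :=
    (((μ.continuous.comp continuous_fst).mul hv.1.continuous).mul
      hDψ.1.continuous).integrable_of_hasCompactSupport hDψ.2.1.mul_left
  -- The norm of the slice of `v` at height `y` in `H^s`, and that of the slice of `ψ` in `L²`.
  set A : ℝ → ℝ≥0∞ := fun y => (∫⁻ k, (‖weight s k‖ₑ * ‖testFourier (slice v y) k‖ₑ) ^ 2) ^ (1 / 2 : ℝ)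
    with hA
  set B : ℝ → ℝ≥0∞ := fun y => (∫⁻ q, ‖ψ (q, y)‖ₑ ^ 2) ^ (1 / 2 : ℝ) with hB
  have hmA : Measurable A := by
    have h1 := (stronglyMeasurable_testFourier_slice hv).measurable
    have h2 := (measurable_weight s)
    have : Measurable fun z : Plane × ℝ =>
        (‖weight s z.1‖ₑ * ‖testFourier (slice v z.2) z.1‖ₑ) ^ 2 := by fun_prop
    exact this.lintegral_prod_left'.pow_const _
  have hmB : Measurable B := by
    have : Measurable fun z : Plane × ℝ => ‖ψ z‖ₑ ^ 2 := hψ.1.continuous.enorm.measurable.pow_const 2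
    exact this.lintegral_prod_left'.pow_const _
  have hsq : ∀ x : ℝ≥0∞, (x ^ (1 / 2 : ℝ)) ^ (2 : ℝ) = x := fun x => by
    rw [← ENNReal.rpow_mul]; norm_num
  have hsq' : ∀ x : ℝ≥0∞, (x ^ 2) ^ (1 / 2 : ℝ) = x := fun x => by
    rw [← ENNReal.rpow_natCast, ← ENNReal.rpow_mul]; norm_num
  have hslice : ∀ y, ‖∫ q, μ q * v (q, y) * Dψ (q, y)‖ₑ ≤
      ENNReal.ofReal ‖G ∘L M‖ * (A y * B y) := by
    intro y
    obtain ⟨f, hf, -, hfn⟩ := exists_sobolev_test (hv.slice y) hs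
    -- On the slice at height `y` the operator `D` is transposed to `μ v`.
    have e1 : ∫ q, μ q * v (q, y) * Dψ (q, y) = ∫ q, Sobolev.toL2 (M f) q * D (slice ψ y) q := by
      refine integral_congr_ae ?_
      filter_upwards [hM f, hf ▸ (hv.slice y).memLp_plane.coeFn_toLp] with q a b
      rw [a, ← hD]
      have b' : f q = slice v y q := b
      rw [b']
      rfl
    rw [e1, hG _ _ (hψ.slice y), ← inner_plane _ (hψ.slice y).memLp_plane]
    have e2 : ‖(hψ.slice y).memLp_plane.toLp (slice ψ y)‖ₑ = B y := by
      rw [Lp.enorm_def, ← hsq' (eLpNorm _ _ _), eLpNorm_two_sq]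
      refine congrArg (· ^ (1 / 2 : ℝ)) (lintegral_congr_ae ?_)
      filter_upwards [(hψ.slice y).memLp_plane.coeFn_toLp] with q hq
      rw [hq]; rfl
    have e3 : ENNReal.ofReal ‖f‖ = A y := by
      rw [← hsq' (ENNReal.ofReal ‖f‖), hfn]
    calc _ ≤ ENNReal.ofReal (‖G ∘L M‖ * ‖f‖ * ‖(hψ.slice y).memLp_plane.toLp (slice ψ y)‖) := by
          rw [← ofReal_norm]
          refine ENNReal.ofReal_le_ofReal ((norm_inner_le_norm _ _).trans ?_)
          exact mul_le_mul_of_nonneg_right ((G ∘L M).le_opNorm f) (norm_nonneg _)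
      _ = _ := by
          rw [ENNReal.ofReal_mul (by positivity), ENNReal.ofReal_mul (by positivity), e3,
            ofReal_norm (_ : Lp ℝ 2 volume), e2, mul_assoc]
  have hfin : ‖∫ p in halfSpace, μ p.1 * v p * Dψ p‖ₑ ≤
      ENNReal.ofReal (‖G ∘L M‖ * N * ‖toHalfL2 ψ‖) := by
    calc _ ≤ ∫⁻ y in Set.Iio (0 : ℝ), ‖∫ q, μ q * v (q, y) * Dψ (q, y)‖ₑ :=
          enorm_integral_halfSpace_le hint
      _ ≤ ∫⁻ y in Set.Iio (0 : ℝ), ENNReal.ofReal ‖G ∘L M‖ * (A y * B y) :=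
          lintegral_mono fun y => hslice y
      _ = ENNReal.ofReal ‖G ∘L M‖ * ∫⁻ y in Set.Iio (0 : ℝ), A y * B y :=
          lintegral_const_mul _ (hmA.mul hmB)
      _ ≤ ENNReal.ofReal ‖G ∘L M‖ * ((∫⁻ y in Set.Iio (0 : ℝ), A y ^ (2 : ℝ)) ^ (1 / 2 : ℝ) *
            (∫⁻ y in Set.Iio (0 : ℝ), B y ^ (2 : ℝ)) ^ (1 / 2 : ℝ)) := by
          gcongr
          exact ENNReal.lintegral_mul_le_Lp_mul_Lq _ Real.HolderConjugate.two_two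
            hmA.aemeasurable hmB.aemeasurable
      _ ≤ ENNReal.ofReal ‖G ∘L M‖ * (ENNReal.ofReal N * ENNReal.ofReal ‖toHalfL2 ψ‖) := by
          simp only [hA, hB, hsq]
          gcongr
          · rw [← hsq' (ENNReal.ofReal N)]
            exact ENNReal.rpow_le_rpow hN (by norm_num)
          · rw [← hsq' (ENNReal.ofReal ‖toHalfL2 ψ‖), toHalfL2_enorm_sq hψ.memLp,
              lintegral_halfSpace (hψ.1.continuous.enorm.measurable.pow_const 2)]
      _ = _ := by
          rw [ENNReal.ofReal_mul (by positivity), ENNReal.ofReal_mul (by positivity), mul_assoc]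
  rw [← ofReal_norm] at hfin
  exact (ENNReal.ofReal_le_ofReal_iff (by positivity)).1 hfin

/-- Riesz representation of a bounded functional given by its graph on a subspace. -/
theorem exists_riesz {H : Type*} [NormedAddCommGroup H] [InnerProductSpace ℝ H] [CompleteSpace H]
    (Γ : Submodule ℝ (H × ℝ)) (C : ℝ) (h : ∀ x ∈ Γ, ‖x.2‖ ≤ C * ‖x.1‖) :
    ∃ v ∈ (Γ.map (LinearMap.fst ℝ H ℝ)).topologicalClosure, ∀ x ∈ Γ, inner ℝ v x.1 = x.2 := by
  set K := (Γ.map (LinearMap.fst ℝ H ℝ)).topologicalClosure with hK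
  obtain ⟨T, hT⟩ := exists_extension Γ C h K fun u hu => hu
  have : CompleteSpace K := (Submodule.isClosed_topologicalClosure _).completeSpace_coe
  refine ⟨((InnerProductSpace.toDual ℝ K).symm T : K), Subtype.property _, fun x hx => ?_⟩
  have hxK : x.1 ∈ K := Submodule.le_topologicalClosure _ ⟨x, hx, rfl⟩
  have e : inner ℝ (((InnerProductSpace.toDual ℝ K).symm T : K) : H) x.1 = T ⟨x.1, hxK⟩ := by
    rw [← InnerProductSpace.toDual_symm_apply (x := ⟨x.1, hxK⟩) (y := T)]
    rfl
  rw [e]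
  have h1 : (x.1, T ⟨x.1, hxK⟩) - x ∈ Γ.topologicalClosure :=
    Submodule.sub_mem _ (hT ⟨x.1, hxK⟩) (Submodule.le_topologicalClosure _ hx)
  have hcl : IsClosed {x : H × ℝ | ‖x.2‖ ≤ C * ‖x.1‖} := isClosed_le (by fun_prop) (by fun_prop)
  have h2 := closure_minimal (fun x hx => h x hx) hcl h1
  have h3 : ‖T ⟨x.1, hxK⟩ - x.2‖ ≤ C * ‖x.1 - x.1‖ := h2
  rw [sub_self, norm_zero, mul_zero] at h3
  exact sub_eq_zero.1 (norm_le_zero_iff.1 h3)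

/-- If `ψ ↦ ⟨F, D ψ⟩` is bounded in the `L²` norm of the test function `ψ`, then the formal adjoint
of `D` applied to `F` exists in `L²(Σ)`. -/
theorem exists_inner_eq_of_bound (F : HalfL2) {D : (Space → ℝ) → Space → ℝ} {C : ℝ}
    (ht : ∀ ψ, IsTest halfSpace ψ → IsTest halfSpace (D ψ))
    (hl : ∀ ψ φ, IsTest halfSpace ψ → IsTest halfSpace φ → ∀ a b : ℝ,
      D (a • ψ + b • φ) = a • D ψ + b • D φ)
    (hb : ∀ ψ, IsTest halfSpace ψ → |inner ℝ F (toHalfL2 (D ψ))| ≤ C * ‖toHalfL2 ψ‖) :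
    ∃ g : HalfL2, ∀ ψ, IsTest halfSpace ψ →
      inner ℝ g (toHalfL2 ψ) = inner ℝ F (toHalfL2 (D ψ)) := by
  have hlin : ∀ ψ φ, IsTest halfSpace ψ → IsTest halfSpace φ → ∀ a b : ℝ,
      (toHalfL2 (a • ψ + b • φ), inner ℝ F (toHalfL2 (D (a • ψ + b • φ)))) =
        a • (toHalfL2 ψ, inner ℝ F (toHalfL2 (D ψ))) +
          b • (toHalfL2 φ, inner ℝ F (toHalfL2 (D φ))) := by
    intro ψ φ hψ hφ a b
    rw [hl ψ φ hψ hφ, toHalfL2_lin hψ.memLp hφ.memLp, toHalfL2_lin (ht ψ hψ).memLp (ht φ hφ).memLp,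
      inner_add_right, inner_smul_right, inner_smul_right]
    rfl
  let Γ : Submodule ℝ (HalfL2 × ℝ) :=
    { carrier := {x | ∃ ψ, IsTest halfSpace ψ ∧ x = (toHalfL2 ψ, inner ℝ F (toHalfL2 (D ψ)))}
      zero_mem' := ⟨(0 : ℝ) • 0 + (0 : ℝ) • 0, (isTest_zero _).lin (isTest_zero _) 0 0, by
        rw [hlin 0 0 (isTest_zero _) (isTest_zero _)]; simp⟩
      add_mem' := by
        rintro _ _ ⟨ψ, hψ, rfl⟩ ⟨φ, hφ, rfl⟩
        exact ⟨_, hψ.lin hφ 1 1, by rw [hlin ψ φ hψ hφ]; simp⟩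
      smul_mem' := by
        rintro c _ ⟨ψ, hψ, rfl⟩
        exact ⟨_, hψ.lin hψ c 0, by rw [hlin ψ ψ hψ hψ]; simp⟩ }
  obtain ⟨g, -, hg⟩ := exists_riesz Γ C (by rintro _ ⟨ψ, hψ, rfl⟩; exact hb ψ hψ)
  exact ⟨g, fun ψ hψ => hg _ ⟨ψ, hψ, rfl⟩⟩

theorem inner_halfMul_test (μ : Plane →ᵇ ℝ) {v ψ : Space → ℝ} (hv : MemLp v 2 halfVol)
    (hψ : MemLp ψ 2 halfVol) : inner ℝ (halfMul μ (toHalfL2 v)) (toHalfL2 ψ) =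
      ∫ p in halfSpace, μ p.1 * v p * ψ p := by
  rw [inner_toHalfL2 _ hψ]
  refine integral_congr_ae ?_
  filter_upwards [coeFn_halfMul μ (toHalfL2 v), coeFn_toHalfL2 hv] with p a b
  rw [a, b]

/-- The vertical derivative commutes with multiplication by functions of the horizontal
variables. -/
theorem weakD_halfMul (μ : Plane →ᵇ ℝ) {f f' : HalfL2}
    (hcl : (f, f') ∈ closure {x : HalfL2 × HalfL2 | ∃ v, IsTest Set.univ v ∧ x.1 = toHalfL2 v ∧
      x.2 = toHalfL2 (spaceDeriv 1 v)}) : WeakD 1 (halfMul μ f) (halfMul μ f') := by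
  intro ψ hψ
  have hc : IsClosed {x : HalfL2 × HalfL2 | inner ℝ (halfMul μ x.2) (toHalfL2 ψ) =
      -inner ℝ (halfMul μ x.1) (toHalfL2 (spaceDeriv 1 ψ))} :=
    isClosed_eq (by fun_prop) (by fun_prop)
  refine closure_minimal ?_ hc hcl
  rintro ⟨_, _⟩ ⟨v, hv, rfl, rfl⟩
  rw [Set.mem_ofPred_eq]
  dsimp only
  rw [inner_halfMul_test μ (hv.spaceDeriv 1).memLp hψ.memLp,
    inner_halfMul_test μ hv.memLp (hψ.spaceDeriv 1).memLp]
  have hv1 : ContDiff ℝ 1 v := hv.1.of_le (by exact_mod_cast le_top)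
  have hψ1 : ContDiff ℝ 1 ψ := hψ.1.of_le (by exact_mod_cast le_top)
  have h := integral_vertical (hv1.mul hψ1) hψ.2.1.mul_left μ.continuous.measurable
    (fun q => μ.norm_coe_le_norm q)
  have e1 : ∀ p, spaceDeriv 1 (fun p => v p * ψ p) p =
      spaceDeriv 1 v p * ψ p + v p * spaceDeriv 1 ψ p := by
    intro p
    unfold spaceDeriv
    rw [fderiv_fun_mul (hv1.differentiable one_ne_zero p) (hψ1.differentiable one_ne_zero p)]
    simp [mul_comm, add_comm]
  have h0 := isTest_halfSpace_zero hψ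
  have i1 : Integrable (fun p : Space => μ p.1 * spaceDeriv 1 v p * ψ p) :=
    (((μ.continuous.comp continuous_fst).mul (hv.spaceDeriv 1).1.continuous).mul
      hψ.1.continuous).integrable_of_hasCompactSupport hψ.2.1.mul_left
  have i2 : Integrable (fun p : Space => μ p.1 * v p * spaceDeriv 1 ψ p) :=
    (((μ.continuous.comp continuous_fst).mul hv.1.continuous).mul
      (hψ.spaceDeriv 1).1.continuous).integrable_of_hasCompactSupport (hψ.spaceDeriv 1).2.1.mul_left
  rw [eq_neg_iff_add_eq_zero, ← integral_add i1.restrict i2.restrict]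
  simp only [h0, mul_zero, integral_zero] at h
  rw [← h]
  refine integral_congr_ae (ae_of_all _ fun p => ?_)
  change _ = μ p.1 * spaceDeriv 1 (fun p => v p * ψ p) p
  rw [e1]
  ring

theorem IsJetOf.iterate_one_eq {w : JetSpace 2} {ψ : Space → ℝ} (h : IsJetOf w ψ) (i b : Fin 3) :
    w (i, idx 0 b 0 (by simp; omega)) = toHalfL2 ((spaceDeriv 1)^[b] (spaceDeriv i ψ)) :=
  h.eq i (idx 0 b 0 (by simp; omega))

/-- The vertical derivative of `μ ∂_y^b u_i` is `μ ∂_y^{b+1} u_i`. -/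
theorem HStar.weakD_halfMul (μ : Plane →ᵇ ℝ) (u : HStar 2) (i b c : Fin 3) (hbc : (c : ℕ) = b + 1) :
    WeakD 1 (halfMul μ ((u : JetSpace 2) (i, idx 0 b 0 (by simp; omega))))
      (halfMul μ ((u : JetSpace 2) (i, idx 0 c 0 (by simp; omega)))) := by
  refine WaterWave.weakD_halfMul μ ?_
  have hc : Continuous fun w : JetSpace 2 => (w (i, idx 0 b 0 (by simp; omega)),
    w (i, idx 0 c 0 (by simp; omega))) := by fun_prop
  refine closure_mono ?_ (image_closure_subset_closure_image hc
    ⟨_, HStar.mem_closure_testJets u, rfl⟩)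
  rintro _ ⟨w, ⟨ψ, hψ, hw⟩, rfl⟩
  refine ⟨_, (hψ.spaceDeriv i).spaceDeriv_iterate 1 b, hw.iterate_one_eq i b, ?_⟩
  dsimp only
  rw [hw.iterate_one_eq i c, hbc, Function.iterate_succ_apply']

/-- The horizontal derivatives of `μ f` exist weakly when `μ` is a multiplier. -/
theorem HStar.exists_weakD_halfMul {μ : Plane →ᵇ ℝ} (hμ : IsMultiplier μ) (u : HStar 2) (i b : Fin 3)
    (hb : (b : ℕ) ≤ 1) (a : Fin 2) :
    ∃ g, WeakD (horizIdx a) (halfMul μ ((u : JetSpace 2) (i, idx 0 b 0 (by simp; omega)))) g := by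
  obtain ⟨M, hM⟩ := hμ 1 (by norm_num)
  obtain ⟨G, hG⟩ := exists_partial_transpose a
  have key : ∀ ψ, IsTest halfSpace ψ →
      |inner ℝ (halfMul μ ((u : JetSpace 2) (i, idx 0 b 0 (by simp; omega))))
        (toHalfL2 (spaceDeriv (horizIdx a) ψ))| ≤
          ‖G ∘L M‖ * (2 * ‖(u : JetSpace 2)‖) * ‖toHalfL2 ψ‖ := by
    intro ψ hψ
    have hcl : IsClosed {w : JetSpace 2 | |inner ℝ (halfMul μ (w (i, idx 0 b 0 (by simp; omega))))
        (toHalfL2 (spaceDeriv (horizIdx a) ψ))| ≤ ‖G ∘L M‖ * (2 * ‖w‖) * ‖toHalfL2 ψ‖} :=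
      isClosed_le (by fun_prop) (by fun_prop)
    refine HStar.test_induction hcl (fun w φ hφ hw => ?_) u
    have hv := (hφ.spaceDeriv i).spaceDeriv_iterate 1 b
    rw [hw.iterate_one_eq i b, inner_halfMul_test μ hv.memLp (hψ.spaceDeriv _).memLp]
    have hψ' := hψ.mono (Set.subset_univ _)
    refine abs_inner_halfMul_le (by norm_num) hM hG hv hψ' (hψ'.spaceDeriv _)
      (fun y => (planeDeriv_slice hψ.1 a y).symm) (by positivity) ?_
    have e := lintegral_slice_weight_one hv
    have n0 := hw.norm_le i 0 b 0 (by simp; omega)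
    have n1 := hw.norm_le i 1 b 0 (by simp; omega)
    have n2 := hw.norm_le i 0 b 1 (by simp; omega)
    have e2 : (spaceDeriv 1)^[b] ((spaceDeriv 2)^[1] (spaceDeriv i φ)) =
        spaceDeriv 2 ((spaceDeriv 1)^[b] (spaceDeriv i φ)) := by
      rcases Nat.le_one_iff_eq_zero_or_eq_one.1 hb with h | h <;> rw [h]
      · rfl
      · exact spaceDeriv_comm (hφ.spaceDeriv i).1 1 2
    simp only [Fin.val_zero, Fin.val_one, Function.iterate_zero_apply] at n0 n1 n2
    rw [e2] at n2
    simp only [Function.iterate_one] at n1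
    refine (le_of_eq e).trans ?_
    rw [← ENNReal.ofReal_pow (norm_nonneg _), ← ENNReal.ofReal_pow (norm_nonneg _),
      ← ENNReal.ofReal_pow (norm_nonneg _), ← ENNReal.ofReal_pow (by positivity),
      ← ENNReal.ofReal_add (by positivity) (by positivity),
      ← ENNReal.ofReal_add (by positivity) (by positivity)]
    refine ENNReal.ofReal_le_ofReal ?_
    have s0 := pow_le_pow_left₀ (norm_nonneg _) n0 2
    have s1 := pow_le_pow_left₀ (norm_nonneg _) n1 2
    have s2 := pow_le_pow_left₀ (norm_nonneg _) n2 2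
    nlinarith [sq_nonneg ‖w‖]
  obtain ⟨g, hg⟩ := exists_inner_eq_of_bound _ (fun ψ hψ => hψ.spaceDeriv (horizIdx a))
    (fun ψ φ hψ hφ a' b' => spaceDeriv_lin hψ.1 hφ.1 a' b' _) key
  refine ⟨-g, fun ψ hψ => ?_⟩
  rw [inner_neg_left, hg ψ hψ]

/-- The second horizontal derivatives of `μ u_i` exist weakly when `μ` is a multiplier. They are
obtained from a bound on `H²(ℝ²)` for the slices, since the first derivatives of `μ u_i` are not
known to be products. -/
theorem HStar.exists_weakD_weakD_halfMul {μ : Plane →ᵇ ℝ} (hμ : IsMultiplier μ) (u : HStar 2)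
    (i : Fin 3) (a b : Fin 2) : ∃ g : HalfL2, ∀ ψ, IsTest halfSpace ψ → inner ℝ g (toHalfL2 ψ) =
      inner ℝ (halfMul μ (u.grad i))
        (toHalfL2 (spaceDeriv (horizIdx a) (spaceDeriv (horizIdx b) ψ))) := by
  obtain ⟨M, hM⟩ := hμ 2 le_rfl
  obtain ⟨G, hG⟩ := exists_partial_partial_transpose a b
  have key : ∀ ψ, IsTest halfSpace ψ → |inner ℝ (halfMul μ (u.grad i))
        (toHalfL2 (spaceDeriv (horizIdx a) (spaceDeriv (horizIdx b) ψ)))| ≤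
          ‖G ∘L M‖ * (3 * ‖(u : JetSpace 2)‖) * ‖toHalfL2 ψ‖ := by
    intro ψ hψ
    have hcl : IsClosed {w : JetSpace 2 | |inner ℝ (halfMul μ (w (i, MultiIdx.zero 2)))
        (toHalfL2 (spaceDeriv (horizIdx a) (spaceDeriv (horizIdx b) ψ)))| ≤
          ‖G ∘L M‖ * (3 * ‖w‖) * ‖toHalfL2 ψ‖} :=
      isClosed_le (by fun_prop) (by fun_prop)
    refine HStar.test_induction hcl (fun w φ hφ hw => ?_) u
    have hv := hφ.spaceDeriv i
    have hw0 : w (i, MultiIdx.zero 2) = toHalfL2 (spaceDeriv i φ) := hw.eq i (MultiIdx.zero 2)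
    have hψ' := hψ.mono (Set.subset_univ _)
    rw [hw0, inner_halfMul_test μ hv.memLp ((hψ.spaceDeriv _).spaceDeriv _).memLp]
    refine abs_inner_halfMul_le le_rfl hM hG hv hψ' ((hψ'.spaceDeriv _).spaceDeriv _)
      (fun y => ?_) (by positivity) ?_
    · rw [planeDeriv_slice hψ.1, planeDeriv_slice (hψ.spaceDeriv _).1]
    refine (le_of_eq (lintegral_slice_weight_two hv)).trans ?_
    have n0 : ‖toHalfL2 (spaceDeriv i φ)‖ ≤ ‖w‖ := hw.norm_le i 0 0 0 (by simp)
    have n1 : ‖toHalfL2 (spaceDeriv 0 (spaceDeriv 0 (spaceDeriv i φ)))‖ ≤ ‖w‖ :=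
      hw.norm_le i 2 0 0 (by simp)
    have n2 : ‖toHalfL2 (spaceDeriv 2 (spaceDeriv 2 (spaceDeriv i φ)))‖ ≤ ‖w‖ :=
      hw.norm_le i 0 0 2 (by simp)
    gcongr
    refine (norm_sub_le _ _).trans ?_
    have := norm_sub_le (toHalfL2 (spaceDeriv i φ))
      (toHalfL2 (spaceDeriv 0 (spaceDeriv 0 (spaceDeriv i φ))))
    linarith
  exact exists_inner_eq_of_bound _ (fun ψ hψ => (hψ.spaceDeriv _).spaceDeriv _)
    (fun ψ φ hψ hφ a' b' => by
      rw [spaceDeriv_lin hψ.1 hφ.1, spaceDeriv_lin (hψ.spaceDeriv _).1 (hφ.spaceDeriv _).1]) key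

theorem idx_zero : idx 0 0 0 (by simp) = MultiIdx.zero 2 := by
  apply Subtype.ext
  funext k
  fin_cases k <;> rfl

theorem HStar.grad_eq_idx (u : HStar 2) (i : Fin 3) :
    (u : JetSpace 2) (i, idx 0 0 0 (by simp)) = u.grad i := by
  rw [idx_zero]
  rfl

/-- A coordinate direction is vertical or horizontal. -/
theorem horizIdx_cases (i : Fin 3) : i = 1 ∨ ∃ a, i = horizIdx a := by
  fin_cases i
  · exact Or.inr ⟨0, rfl⟩
  · exact Or.inl rfl
  · exact Or.inr ⟨1, rfl⟩

/-- Multipliers preserve the regularity of the gradients of functions in `H_⋆³(Σ)`. -/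
theorem HStar.hasWeakOrder_halfMul {μ : Plane →ᵇ ℝ} (hμ : IsMultiplier μ) (u : HStar 2) (i : Fin 3) :
    HasWeakOrder 2 (halfMul μ (u.grad i)) := by
  have d0 : WeakD 1 (halfMul μ (u.grad i)) (halfMul μ ((u : JetSpace 2) (i, idx 0 1 0 (by simp)))) :=
    u.grad_eq_idx i ▸ HStar.weakD_halfMul μ u i 0 1 rfl
  intro j
  rcases horizIdx_cases j with rfl | ⟨a, rfl⟩
  · refine ⟨_, d0, fun k => ?_⟩
    rcases horizIdx_cases k with rfl | ⟨b, rfl⟩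
    · exact ⟨_, HStar.weakD_halfMul μ u i 1 2 rfl, trivial⟩
    · obtain ⟨g, hg⟩ := HStar.exists_weakD_halfMul hμ u i 1 le_rfl b
      exact ⟨g, hg, trivial⟩
  · obtain ⟨g, hg⟩ := HStar.exists_weakD_halfMul hμ u i 0 (by simp) a
    have hg' : WeakD (horizIdx a) (halfMul μ (u.grad i)) g := u.grad_eq_idx i ▸ hg
    refine ⟨g, hg', fun k => ?_⟩
    rcases horizIdx_cases k with rfl | ⟨b, rfl⟩
    -- The vertical derivative of the horizontal derivative is the horizontal derivative of the
    -- vertical one, which exists.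
    · obtain ⟨h, hh⟩ := HStar.exists_weakD_halfMul hμ u i 1 le_rfl a
      refine ⟨h, fun ψ hψ => ?_, trivial⟩
      rw [hh ψ hψ, hg' _ (hψ.spaceDeriv 1), neg_neg, spaceDeriv_comm hψ.1,
        eq_neg_of_add_eq_zero_left (a := inner ℝ (halfMul μ ((u : JetSpace 2) (i, idx 0 1 0 (by simp))))
          (toHalfL2 (spaceDeriv (horizIdx a) ψ))) (by rw [d0 _ (hψ.spaceDeriv _), neg_add_cancel]),
        neg_neg]
    · obtain ⟨h, hh⟩ := HStar.exists_weakD_weakD_halfMul hμ u i a b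
      refine ⟨h, fun ψ hψ => ?_, trivial⟩
      rw [hh ψ hψ, hg' _ (hψ.spaceDeriv _), neg_neg]

/-! ### The inhomogeneous Neumann datum -/

/-- Parseval's formula for real functions in the plane. -/
theorem inner_eq_integral_fourier (f g : PlaneL2) :
    ((inner ℝ f g : ℝ) : ℂ) = ∫ k, inner ℂ (fourierReal f k) (fourierReal g k) := by
  have h : inner ℂ (fourierReal f) (fourierReal g) = inner ℂ (ofRealL2 f) (ofRealL2 g) :=
    (Lp.fourierTransformₗᵢ Plane ℂ).inner_map_map (ofRealL2 f) (ofRealL2 g)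
  rw [← L2.inner_def, h, L2.inner_def, L2.inner_def, ← integral_complex_ofReal]
  refine integral_congr_ae ?_
  filter_upwards [coeFn_ofRealL2 f, coeFn_ofRealL2 g] with q a b
  rw [a, b]
  simp

/-- The horizontal part of the Dirichlet integral controls `|k| |ψ̂|²` at `y = 0`. -/
theorem lintegral_norm_mul_testFourier_le {ψ : Space → ℝ} (hψ : IsTest Set.univ ψ) :
    ∫⁻ k : Plane, ENNReal.ofReal (2 * Real.pi * ‖k‖) * ‖testFourier (slice ψ 0) k‖ₑ ^ 2 ≤
      ENNReal.ofReal ‖gradTest ψ‖ ^ 2 := by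
  have h := lintegral_testFourier_slice_le hψ le_rfl (ρ := fun _ => 1) measurable_const
    (κ := fun k => 2 * Real.pi * ‖k‖) (by fun_prop) (fun k => by positivity)
  simp only [one_mul] at h
  refine h.trans (le_of_eq ?_)
  have hm : ∀ {χ}, IsTest Set.univ χ → Measurable fun p : Space => ‖χ p‖ₑ ^ 2 := fun h =>
    h.1.continuous.enorm.measurable.pow_const 2
  have e : ∀ y (k : Plane), (ENNReal.ofReal (2 * Real.pi * ‖k‖) * ‖testFourier (slice ψ y) k‖ₑ) ^ 2 =
      ‖testFourier (slice (spaceDeriv 0 ψ) y) k‖ₑ ^ 2 +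
        ‖testFourier (slice (spaceDeriv 2 ψ) y) k‖ₑ ^ 2 := by
    intro y k
    have e0 : slice (spaceDeriv 0 ψ) y = planeDeriv 0 (slice ψ y) := (planeDeriv_slice hψ.1 0 y).symm
    have e2 : slice (spaceDeriv 2 ψ) y = planeDeriv 1 (slice ψ y) := (planeDeriv_slice hψ.1 1 y).symm
    rw [e0, e2, testFourier_planeDeriv (hψ.slice y), testFourier_planeDeriv (hψ.slice y)]
    simp only [enorm_mul, mul_pow]
    rw [← add_mul, ← ofReal_norm (dSymbol 0 k), ← ofReal_norm (dSymbol 1 k),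
      ← ENNReal.ofReal_pow (by positivity), ← ENNReal.ofReal_pow (by positivity),
      ← ENNReal.ofReal_pow (by positivity), ← ENNReal.ofReal_add (by positivity) (by positivity)]
    congr 2
    rw [norm_dSymbol, norm_dSymbol, sq_abs, sq_abs, mul_pow, mul_pow (_ * _) (k 0),
      mul_pow (_ * _) (k 1), EuclideanSpace.real_norm_sq_eq, Fin.sum_univ_two]
    ring
  have e3 : ENNReal.ofReal ‖gradTest ψ‖ ^ 2 = ENNReal.ofReal ‖toHalfL2 (spaceDeriv 0 ψ)‖ ^ 2 +
      ENNReal.ofReal ‖toHalfL2 (spaceDeriv 2 ψ)‖ ^ 2 +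
      ENNReal.ofReal ‖toHalfL2 (spaceDeriv 1 ψ)‖ ^ 2 := by
    simp only [← ENNReal.ofReal_pow (norm_nonneg _)]
    rw [← ENNReal.ofReal_add (by positivity) (by positivity),
      ← ENNReal.ofReal_add (by positivity) (by positivity), PiLp.norm_sq_eq_of_L2,
      Fin.sum_univ_three]
    congr 1
    change ‖toHalfL2 _‖ ^ 2 + ‖toHalfL2 _‖ ^ 2 + ‖toHalfL2 _‖ ^ 2 = _
    ring
  rw [e3, toHalfL2_enorm_sq (hψ.spaceDeriv 0).memLp, toHalfL2_enorm_sq (hψ.spaceDeriv 1).memLp,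
    toHalfL2_enorm_sq (hψ.spaceDeriv 2).memLp, lintegral_halfSpace (hm (hψ.spaceDeriv 0)),
    lintegral_halfSpace (hm (hψ.spaceDeriv 1)), lintegral_halfSpace (hm (hψ.spaceDeriv 2))]
  simp only [e]
  have hF : ∀ j y, ∫⁻ k, ‖testFourier (slice (spaceDeriv j ψ) y) k‖ₑ ^ 2 =
      ∫⁻ q, ‖spaceDeriv j ψ (q, y)‖ₑ ^ 2 := fun j y =>
    lintegral_testFourier ((hψ.spaceDeriv j).slice y)
  have hm2 : ∀ y, Measurable fun k => ‖testFourier (slice (spaceDeriv 2 ψ) y) k‖ₑ ^ 2 := fun y =>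
    (continuous_testFourier ((hψ.spaceDeriv 2).slice y)).enorm.measurable.pow_const 2
  simp only [fun y => lintegral_add_right (μ := volume)
    (fun k => ‖testFourier (slice (spaceDeriv 0 ψ) y) k‖ₑ ^ 2) (hm2 y), hF]
  rw [lintegral_add_right _ (Measurable.lintegral_prod_left' (hm (hψ.spaceDeriv 2)))]

/-- The boundary pairing `∫ ξ ψ_x(·, 0)` is bounded by the Dirichlet norm of `ψ`. -/
theorem abs_boundary_le (ξ : Sobolev (1 / 2)) {ψ : Space → ℝ} (hψ : IsTest Set.univ ψ) :
    |∫ q, ξ q * spaceDeriv 0 ψ (q, 0)| ≤ ‖ξ‖ * ‖gradTest ψ‖ := by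
  set φ := slice ψ 0 with hφ'
  have hφ : IsTest Set.univ φ := hψ.slice 0
  have e0 : ∀ q, spaceDeriv 0 ψ (q, 0) = planeDeriv 0 φ q := fun q =>
    (congrFun (planeDeriv_slice hψ.1 0 0) q).symm
  have hφ1 := hφ.planeDeriv 0
  simp only [e0]
  rw [← inner_plane (Sobolev.toL2 ξ) hφ1.memLp_plane]
  have hsq' : ∀ x : ℝ≥0∞, (x ^ 2) ^ (1 / 2 : ℝ) = x := fun x => by
    rw [← ENNReal.rpow_natCast, ← ENNReal.rpow_mul]; norm_num
  have key : ‖((inner ℝ (Sobolev.toL2 ξ) (hφ1.memLp_plane.toLp (planeDeriv 0 φ)) : ℝ) : ℂ)‖ₑ ≤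
      ENNReal.ofReal (‖ξ‖ * ‖gradTest ψ‖) := by
    rw [inner_eq_integral_fourier]
    have hw := ((continuous_weight (1 / 2)).aestronglyMeasurable (μ := volume)).aemeasurable.enorm
    have hξ := (Lp.aestronglyMeasurable (fourierReal (Sobolev.toL2 ξ))).enorm
    have hτ := (continuous_testFourier hφ).enorm.measurable
    calc _ ≤ ∫⁻ k, ‖inner ℂ (fourierReal (Sobolev.toL2 ξ) k)
          (fourierReal (hφ1.memLp_plane.toLp (planeDeriv 0 φ)) k)‖ₑ :=
          enorm_integral_le_lintegral_enorm _
      _ ≤ ∫⁻ k, (‖weight (1 / 2) k‖ₑ * ‖fourierReal (Sobolev.toL2 ξ) k‖ₑ) *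
            (ENNReal.ofReal (Real.sqrt (2 * Real.pi * ‖k‖)) * ‖testFourier φ k‖ₑ) := by
          refine lintegral_mono_ae ?_
          filter_upwards [fourierReal_test hφ1] with k hk
          rw [hk, testFourier_planeDeriv hφ, enorm_weight, ← ofReal_norm, ← ofReal_norm,
            ← ofReal_norm, ← ENNReal.ofReal_mul (weight_pos _ _).le,
            ← ENNReal.ofReal_mul (by positivity), ← ENNReal.ofReal_mul
              (mul_nonneg (weight_pos _ _).le (norm_nonneg _))]
          refine ENNReal.ofReal_le_ofReal ((norm_inner_le_norm _ _).trans ?_)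
          rw [norm_mul]
          -- `|k₁| ≤ |k|^{1/2} |k|^{1/2}`: one factor is absorbed by the `H^{1/2}` norm of `ξ`, the
          -- other by the Dirichlet norm of `ψ`.
          have hd : ‖dSymbol 0 k‖ ≤ weight (1 / 2) k * Real.sqrt (2 * Real.pi * ‖k‖) := by
            have h1 : ‖dSymbol 0 k‖ ≤ 2 * Real.pi * ‖k‖ := by
              rw [norm_dSymbol, abs_mul, abs_of_pos (by positivity : 0 < 2 * Real.pi)]
              exact mul_le_mul_of_nonneg_left (PiLp.norm_apply_le k 0) (by positivity)
            have h2 : Real.sqrt (2 * Real.pi * ‖k‖) ≤ weight (1 / 2) k := by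
              unfold weight
              rw [norm_smul, Real.norm_of_nonneg (by positivity : 0 ≤ 2 * Real.pi)]
              have hx : 0 ≤ 2 * Real.pi * ‖k‖ := by positivity
              calc Real.sqrt (2 * Real.pi * ‖k‖) =
                    ((2 * Real.pi * ‖k‖) ^ 2) ^ ((1 / 2 : ℝ) / 2) := by
                    rw [Real.sqrt_eq_rpow, ← Real.rpow_natCast, ← Real.rpow_mul hx]
                    norm_num
                _ ≤ _ := Real.rpow_le_rpow (by positivity) (by linarith) (by norm_num)
            calc _ ≤ 2 * Real.pi * ‖k‖ := h1
              _ = Real.sqrt (2 * Real.pi * ‖k‖) * Real.sqrt (2 * Real.pi * ‖k‖) :=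
                (Real.mul_self_sqrt (by positivity)).symm
              _ ≤ _ := mul_le_mul_of_nonneg_right h2 (Real.sqrt_nonneg _)
          calc _ ≤ ‖fourierReal (Sobolev.toL2 ξ) k‖ *
                ((weight (1 / 2) k * Real.sqrt (2 * Real.pi * ‖k‖)) * ‖testFourier φ k‖) := by gcongr
            _ = _ := by ring
      _ ≤ (∫⁻ k, (‖weight (1 / 2) k‖ₑ * ‖fourierReal (Sobolev.toL2 ξ) k‖ₑ) ^ (2 : ℝ)) ^ (1 / 2 : ℝ) *
            (∫⁻ k, (ENNReal.ofReal (Real.sqrt (2 * Real.pi * ‖k‖)) *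
              ‖testFourier φ k‖ₑ) ^ (2 : ℝ)) ^ (1 / 2 : ℝ) := by
          refine ENNReal.lintegral_mul_le_Lp_mul_Lq _ Real.HolderConjugate.two_two
            (hw.mul hξ) ?_
          exact Measurable.aemeasurable (by fun_prop)
      _ ≤ ENNReal.ofReal ‖ξ‖ * ENNReal.ofReal ‖gradTest ψ‖ := by
          simp only [ENNReal.rpow_two]
          gcongr
          · rw [← hsq' (ENNReal.ofReal ‖ξ‖), ← Sobolev.norm_weightedFourier, ofReal_norm,
              Lp.enorm_def, eLpNorm_two_sq]
            refine ENNReal.rpow_le_rpow (le_of_eq ?_) (by norm_num)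
            refine lintegral_congr_ae ?_
            filter_upwards [Sobolev.coeFn_weightedFourier ξ] with k hk
            rw [hk, enorm_smul]
            norm_num
          · rw [← hsq' (ENNReal.ofReal ‖gradTest ψ‖)]
            refine ENNReal.rpow_le_rpow (le_trans (le_of_eq ?_)
              (lintegral_norm_mul_testFourier_le hψ)) (by norm_num)
            refine lintegral_congr fun k => ?_
            rw [mul_pow, ← ENNReal.ofReal_pow (Real.sqrt_nonneg _),
              Real.sq_sqrt (by positivity)]
      _ = _ := (ENNReal.ofReal_mul (norm_nonneg _)).symm
  rw [← ofReal_norm, Complex.norm_real] at key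
  exact (ENNReal.ofReal_le_ofReal_iff (by positivity)).1 key

/-- The elements of `gradSpace` are determined by their pairings with gradients of test functions. -/
theorem eq_of_inner_gradTest {v w : VField} (hv : v ∈ gradSpace) (hw : w ∈ gradSpace)
    (h : ∀ ψ, IsTest Set.univ ψ → inner ℝ v (gradTest ψ) = inner ℝ w (gradTest ψ)) : v = w := by
  have h1 : ∀ Z ∈ gradSpace, inner ℝ v Z = inner ℝ w Z := fun Z hZ =>
    gradSpace_induction (p := fun Z => inner ℝ v Z = inner ℝ w Z)
      (isClosed_eq (by fun_prop) (by fun_prop)) h hZ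
  have h2 := h1 (v - w) (Submodule.sub_mem _ hv hw)
  rw [← sub_eq_zero, ← inner_sub_left] at h2
  exact sub_eq_zero.1 (inner_self_eq_zero.1 h2)

/-- The gradient field `∇u` of the solution of `Δu = 0`, `u_y = ξ_x` at `y = 0`. -/
theorem exists_neumann : ∃ G : Sobolev (1 / 2) →L[ℝ] VField, ∀ ξ, G ξ ∈ gradSpace ∧
    ∀ ψ, IsTest Set.univ ψ → inner ℝ (G ξ) (gradTest ψ) = -∫ q, ξ q * spaceDeriv 0 ψ (q, 0) := by
  have hb : ∀ {ψ : Space → ℝ}, IsTest Set.univ ψ →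
      MemLp (fun q : Plane => spaceDeriv 0 ψ (q, 0)) 2 volume := fun hψ =>
    ((hψ.spaceDeriv 0).slice 0).memLp_plane
  have hex : ∀ ξ : Sobolev (1 / 2), ∃ v ∈ gradSpace, ∀ ψ, IsTest Set.univ ψ →
      inner ℝ v (gradTest ψ) = -∫ q, ξ q * spaceDeriv 0 ψ (q, 0) := by
    intro ξ
    have hlin : ∀ ψ φ, IsTest Set.univ ψ → IsTest Set.univ φ → ∀ a b : ℝ,
        (gradTest (a • ψ + b • φ), -∫ q, ξ q * spaceDeriv 0 (a • ψ + b • φ) (q, 0)) =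
          a • (gradTest ψ, -∫ q, ξ q * spaceDeriv 0 ψ (q, 0)) +
            b • (gradTest φ, -∫ q, ξ q * spaceDeriv 0 φ (q, 0)) := by
      intro ψ φ hψ hφ a b
      rw [gradTest_lin hψ hφ, spaceDeriv_lin hψ.1 hφ.1]
      refine Prod.ext rfl ?_
      change -∫ q, ξ q * (a * spaceDeriv 0 ψ (q, 0) + b * spaceDeriv 0 φ (q, 0)) =
        a * (-∫ q, ξ q * spaceDeriv 0 ψ (q, 0)) + b * (-∫ q, ξ q * spaceDeriv 0 φ (q, 0))
      have i1 := ((Lp.memLp (Sobolev.toL2 ξ)).integrable_mul (hb hψ)).const_mul a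
      have i2 := ((Lp.memLp (Sobolev.toL2 ξ)).integrable_mul (hb hφ)).const_mul b
      have := integral_add i1 i2
      rw [integral_const_mul, integral_const_mul] at this
      simp only [Pi.mul_apply] at this
      rw [mul_neg, mul_neg, ← neg_add, ← this]
      congr 1
      refine integral_congr_ae (ae_of_all _ fun q => ?_)
      ring
    -- The boundary functional as a relation between gradients and numbers, so that it need not be
    -- shown to depend on `∇ψ` alone: the bound implies this.
    let Γ : Submodule ℝ (VField × ℝ) :=
      { carrier := {x | ∃ ψ, IsTest Set.univ ψ ∧
          x = (gradTest ψ, -∫ q, ξ q * spaceDeriv 0 ψ (q, 0))}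
        zero_mem' := ⟨(0 : ℝ) • 0 + (0 : ℝ) • 0, (isTest_zero _).lin (isTest_zero _) 0 0, by
          rw [hlin 0 0 (isTest_zero _) (isTest_zero _)]; simp⟩
        add_mem' := by
          rintro _ _ ⟨ψ, hψ, rfl⟩ ⟨φ, hφ, rfl⟩
          exact ⟨_, hψ.lin hφ 1 1, by rw [hlin ψ φ hψ hφ]; simp⟩
        smul_mem' := by
          rintro c _ ⟨ψ, hψ, rfl⟩
          exact ⟨_, hψ.lin hψ c 0, by rw [hlin ψ ψ hψ hψ]; simp⟩ }
    obtain ⟨v, hv, h⟩ := exists_riesz Γ ‖ξ‖ (by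
      rintro _ ⟨ψ, hψ, rfl⟩
      dsimp only
      rw [norm_neg, Real.norm_eq_abs]
      exact abs_boundary_le ξ hψ)
    refine ⟨v, ?_, fun ψ hψ => h _ ⟨ψ, hψ, rfl⟩⟩
    refine closure_mono ?_ hv
    rintro _ ⟨_, ⟨ψ, hψ, rfl⟩, rfl⟩
    exact ⟨ψ, hψ, rfl⟩
  choose g hg hg' using hex
  have hadd : ∀ (ξ ζ : Sobolev (1 / 2)) {ψ : Space → ℝ}, IsTest Set.univ ψ →
      ∫ q, (ξ + ζ) q * spaceDeriv 0 ψ (q, 0) =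
        (∫ q, ξ q * spaceDeriv 0 ψ (q, 0)) + ∫ q, ζ q * spaceDeriv 0 ψ (q, 0) := by
    intro ξ ζ ψ hψ
    rw [← inner_plane _ (hb hψ), ← inner_plane _ (hb hψ), ← inner_plane _ (hb hψ), map_add,
      inner_add_left]
  have hsmul : ∀ (c : ℝ) (ξ : Sobolev (1 / 2)) {ψ : Space → ℝ}, IsTest Set.univ ψ →
      ∫ q, (c • ξ) q * spaceDeriv 0 ψ (q, 0) = c * ∫ q, ξ q * spaceDeriv 0 ψ (q, 0) := by
    intro c ξ ψ hψ
    rw [← inner_plane _ (hb hψ), ← inner_plane _ (hb hψ), map_smul, real_inner_smul_left]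
  let G : Sobolev (1 / 2) →ₗ[ℝ] VField :=
    { toFun := g
      map_add' := fun ξ ζ => eq_of_inner_gradTest (hg _) (Submodule.add_mem _ (hg _) (hg _))
        fun ψ hψ => by
          rw [inner_add_left, hg' _ ψ hψ, hg' _ ψ hψ, hg' _ ψ hψ, hadd ξ ζ hψ, neg_add]
      map_smul' := fun c ξ => eq_of_inner_gradTest (hg _) (Submodule.smul_mem _ _ (hg _))
        fun ψ hψ => by
          rw [RingHom.id_apply, real_inner_smul_left, hg' _ ψ hψ, hg' _ ψ hψ, hsmul c ξ hψ, mul_neg] }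
  refine ⟨G.mkContinuous 1 fun ξ => ?_, fun ξ => ⟨hg ξ, hg' ξ⟩⟩
  have h1 : inner ℝ (g ξ) (g ξ) ≤ ‖ξ‖ * ‖g ξ‖ :=
    gradSpace_induction (p := fun Z => inner ℝ (g ξ) Z ≤ ‖ξ‖ * ‖Z‖)
      (isClosed_le (by fun_prop) (by fun_prop)) (fun ψ hψ => by
        rw [hg' ξ ψ hψ]
        exact (neg_le_abs _).trans (abs_boundary_le ξ hψ)) (hg ξ)
  rw [real_inner_self_eq_norm_sq, sq] at h1
  rw [one_mul]
  change ‖g ξ‖ ≤ _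
  rcases (norm_nonneg (g ξ)).eq_or_lt with h | h
  · rw [← h]; exact norm_nonneg _
  · exact le_of_mul_le_mul_right h1 h

/-- Tangential differentiation of the Neumann datum differentiates the solution. -/
theorem weakD_neumann {a : Fin 2} {v v' : VField} (hv : v ∈ gradSpace) (hv' : v' ∈ gradSpace)
    {ξ ξ' : PlaneL2} (hξ : HasWeakPartial a ξ ξ')
    (h : ∀ ψ, IsTest Set.univ ψ → inner ℝ v (gradTest ψ) = -∫ q, ξ q * spaceDeriv 0 ψ (q, 0))
    (h' : ∀ ψ, IsTest Set.univ ψ → inner ℝ v' (gradTest ψ) = -∫ q, ξ' q * spaceDeriv 0 ψ (q, 0))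
    (j : Fin 3) : WeakD (horizIdx a) (v j) (v' j) := by
  refine weakD_of_inner_vshift (planeDir a) (spaceDir_horizIdx a) hv hv' (fun Z hZ t => ?_) j
  have hcont : ∀ g : VField, Continuous fun q : VField × ℝ =>
      inner ℝ g (vshift (q.2 • planeDir a) q.1) :=
    fun g => continuous_const.inner (continuous_vshift (by fun_prop) continuous_fst)
  have hc1 : Continuous fun Z : VField => inner ℝ v (vshift (t • planeDir a) Z) - inner ℝ v Z :=
    ((hcont v).comp (by fun_prop : Continuous fun Z : VField => (Z, t))).sub
      (continuous_const.inner continuous_id)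
  have hc2 : Continuous fun Z : VField =>
      ∫ s in (0 : ℝ)..t, inner ℝ v' (vshift (s • planeDir a) Z) :=
    intervalIntegral.continuous_parametric_intervalIntegral_of_continuous' (hcont v') 0 t
  -- By density it suffices to consider gradients of test functions, for which both sides are
  -- boundary integrals with translated test functions.
  refine gradSpace_induction (p := fun Z => inner ℝ v (vshift (t • planeDir a) Z) - inner ℝ v Z =
    ∫ s in (0 : ℝ)..t, inner ℝ v' (vshift (s • planeDir a) Z)) (isClosed_eq hc1 hc2)
    (fun ψ hψ => ?_) hZ
  set φ : Plane → ℝ := slice (spaceDeriv 0 ψ) 0 with hφ'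
  have hφ : IsTest Set.univ φ := (hψ.spaceDeriv 0).slice 0
  have hpair : ∀ {w : VField} {ζ : PlaneL2}, (∀ ψ, IsTest Set.univ ψ →
      inner ℝ w (gradTest ψ) = -∫ q, ζ q * spaceDeriv 0 ψ (q, 0)) → ∀ s : ℝ,
      inner ℝ w (vshift (s • planeDir a) (gradTest ψ)) =
        -∫ q, ζ q * φ (q - s • planeDir a) := by
    intro w ζ hw s
    rw [vshift_gradTest _ hψ, hw _ (hψ.comp_shiftMap _ fun _ _ => trivial),
      spaceDeriv_comp_shiftMap]
    rfl
  have hd : ∀ s : ℝ, HasDerivAt (fun s => inner ℝ v (vshift (s • planeDir a) (gradTest ψ)))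
      (inner ℝ v' (vshift (s • planeDir a) (gradTest ψ))) s := by
    intro s
    simp_rw [hpair h, hpair h']
    have h1 := (hasDerivAt_integral_translate hξ.1 (hφ.1.of_le (by exact_mod_cast le_top)) hφ.2.1
      (planeDir a) s).neg
    have hs : IsTest Set.univ fun q => φ (q - s • planeDir a) := by
      have := hφ.comp_add_right (-(s • planeDir a))
      simpa [sub_eq_add_neg] using this
    have h2 := hξ.2.2 _ hs
    have h3 : ∀ q, planeDeriv a (fun q => φ (q - s • planeDir a)) q =
        fderiv ℝ φ (q - s • planeDir a) (planeDir a) := by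
      intro q
      unfold planeDeriv
      rw [fderiv_comp_sub]
    rw [h2]
    simp only [h3]
    exact h1
  have h1 := intervalIntegral.integral_eq_sub_of_hasDerivAt (a := 0) (b := t)
    (fun s _ => hd s)
    (((hcont v').comp (by fun_prop : Continuous fun s : ℝ => (gradTest ψ, s))).intervalIntegrable _ _)
  have h0 : vshift ((0 : ℝ) • planeDir a) (gradTest ψ) = gradTest ψ := by
    ext1 i
    change shift _ (gradTest ψ i) = gradTest ψ i
    rw [zero_smul, shift_zero]
  rw [h0] at h1
  exact h1.symm

/-- If the datum lies in `H^{n+1/2}(ℝ²)`, then the solution of the Neumann problem has `n`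
horizontal derivatives, each of which solves the problem with the differentiated datum. -/
theorem horizOrder_neumann {G : Sobolev (1 / 2) →L[ℝ] VField} (hG : ∀ ξ, G ξ ∈ gradSpace ∧
    ∀ ψ, IsTest Set.univ ψ → inner ℝ (G ξ) (gradTest ψ) = -∫ q, ξ q * spaceDeriv 0 ψ (q, 0)) :
    ∀ (n : ℕ) (s : ℝ≥0), 1 / 2 + n ≤ s → ∀ (ξ : Sobolev s) (ξ' : Sobolev (1 / 2)),
      Sobolev.toL2 ξ' = Sobolev.toL2 ξ → HorizOrder n (G ξ')
  | 0, _, _, _, ξ', _ => (hG ξ').1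
  | n + 1, s, hs, ξ, ξ', e => by
    refine ⟨(hG ξ').1, fun i hi => ?_⟩
    rcases horizIdx_cases i with rfl | ⟨a, rfl⟩
    · exact absurd rfl hi
    have hs' : (1 / 2 + n : ℝ≥0) + 1 ≤ s := by
      rw [add_assoc]; exact_mod_cast hs
    obtain ⟨D, hD⟩ := exists_partial s (1 / 2 + n) hs' a
    obtain ⟨I, hI⟩ := exists_incl (1 / 2 + n) (1 / 2) le_self_add
    refine ⟨G (I (D ξ)), weakD_neumann (hG _).1 (hG _).1 (ξ := Sobolev.toL2 ξ')
      (ξ' := Sobolev.toL2 (I (D ξ))) ?_ (hG _).2 (hG _).2,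
      horizOrder_neumann hG n _ le_rfl (D ξ) _ (hI _)⟩
    rw [hI, e]
    exact hasWeakPartial_of_fourier (hD ξ)

/-- The solution operator of the problem with `η = 0`. -/
theorem exists_neumannSolution : ∃ G : Sobolev (5 / 2) →L[ℝ] HStar 2, ∀ ξ : Sobolev (5 / 2),
    ∀ ψ, IsTest Set.univ ψ →
      inner ℝ (gradField 2 (G ξ)) (gradTest ψ) = -∫ q, ξ q * spaceDeriv 0 ψ (q, 0) := by
  obtain ⟨G, hG⟩ := exists_neumann
  obtain ⟨I, hI⟩ := exists_incl (5 / 2) (1 / 2) (by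
    rw [← NNReal.coe_le_coe]; norm_num)
  obtain ⟨L, hL⟩ := exists_lift_of_range_subset (gradField 2) (gradField_injective 2) (G ∘L I)
    (fun ξ => exists_hstar_of_hasWeakOrder (hG _).1 (by
      -- Horizontal regularity and harmonicity in `Σ` give full regularity.
      refine (horizOrder_neumann hG 2 (5 / 2) ?_ ξ (I ξ) (hI ξ)).hasWeakOrder (F := 0) ?_ ?_
      · rw [← NNReal.coe_le_coe]; norm_num
      · intro ψ hψ
        rw [ContinuousLinearMap.comp_apply, (hG _).2 ψ (hψ.mono (Set.subset_univ _)), inner_zero_left]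
        simp [isTest_halfSpace_zero (hψ.spaceDeriv 0)]
      · intro j
        have := HasWeakOrder.smul (n := 2) 0 (HStar.hasWeakOrder_grad (0 : HStar 2) j)
        rw [zero_smul] at this
        exact this))
  refine ⟨L, fun ξ ψ hψ => ?_⟩
  rw [hL ξ, ContinuousLinearMap.comp_apply, (hG _).2 ψ hψ, hI]

/-! ### The solution operator -/

/-- The slopes `η_x`, `η_z` as bounded continuous functions. -/
noncomputable def slope {r : ℝ} (hr : r < 1) (j : Fin 2) : ZSpace r →L[ℝ] (Plane →ᵇ ℝ) :=
  (ZSpace.exists_planeDerivB hr j).choose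

theorem slope_apply {r : ℝ} (hr : r < 1) (j : Fin 2) (η : ZSpace r) (q : Plane) :
    slope hr j η q = planeDeriv j η q :=
  (ZSpace.exists_planeDerivB hr j).choose_spec η q

/-- The slopes of `η ∈ 𝒵` are multipliers of `H^s(ℝ²)` for `s ≤ 2`. -/
theorem isMultiplier_slope {r : ℝ} (hr : r < 1) (j : Fin 2) (η : ZSpace r) :
    IsMultiplier (slope hr j η) := by
  intro s hs
  obtain ⟨M, hM⟩ := ZSpace.exists_mulOp hr hs j
  refine ⟨M η, fun f => ?_⟩
  simp only [slope_apply]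
  exact hM η f

/-- The operator matrix whose only nonzero entry is `X` in row `i` and column `j`. -/
noncomputable def entry (i j : Fin 3) : (HalfL2 →L[ℝ] HalfL2) →L[ℝ] VField →L[ℝ] VField :=
  (ContinuousLinearMap.compL ℝ VField HalfL2 VField
      ((PiLp.continuousLinearEquiv 2 ℝ (fun _ : Fin 3 => HalfL2)).symm.toContinuousLinearMap ∘L
        ContinuousLinearMap.single ℝ (fun _ : Fin 3 => HalfL2) i)) ∘L
    (ContinuousLinearMap.compL ℝ VField HalfL2 HalfL2).flip
      (PiLp.proj 2 (fun _ : Fin 3 => HalfL2) j)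

theorem entry_apply (i j : Fin 3) (X : HalfL2 →L[ℝ] HalfL2) (v : VField) (k : Fin 3) :
    entry i j X v k = if k = i then X (v j) else 0 := by
  change (Pi.single i (X (v j)) : Fin 3 → HalfL2) k = _
  rw [Pi.single_apply]

/-- The part of `u ↦ (F₁, F₂, F₃)` that is linear in `η`. -/
noncomputable def forcingLin (hr : r < 1) : ZSpace r →L[ℝ] VField →L[ℝ] VField :=
  (entry 0 1 + entry 1 0) ∘L halfMul ∘L slope hr 0 + (entry 1 2 + entry 2 1) ∘L halfMul ∘L slope hr 1

/-- The part of `u ↦ (F₁, F₂, F₃)` that is quadratic in `η`, as a bilinear map. -/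
noncomputable def forcingQuad (hr : r < 1) : ZSpace r →L[ℝ] ZSpace r →L[ℝ] VField →L[ℝ] VField :=
  -∑ j, ContinuousLinearMap.compL ℝ (ZSpace r) _ _ (entry 1 1) ∘L
    (ContinuousLinearMap.compL ℝ HalfL2 HalfL2 HalfL2).bilinearComp
      (halfMul ∘L slope hr j) (halfMul ∘L slope hr j)

/-- The operator `∇u ↦ (F₁, F₂, F₃)`. -/
noncomputable def forcing (hr : r < 1) (η : ZSpace r) : VField →L[ℝ] VField :=
  forcingLin hr η + forcingQuad hr η η

theorem forcingLin_apply (hr : r < 1) (η : ZSpace r) (v : VField) (i : Fin 3) :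
    forcingLin hr η v i = ![halfMul (slope hr 0 η) (v 1),
      halfMul (slope hr 0 η) (v 0) + halfMul (slope hr 1 η) (v 2),
      halfMul (slope hr 1 η) (v 1)] i := by
  have : forcingLin hr η v i = (entry 0 1 (halfMul (slope hr 0 η)) v i +
      entry 1 0 (halfMul (slope hr 0 η)) v i) + (entry 1 2 (halfMul (slope hr 1 η)) v i +
      entry 2 1 (halfMul (slope hr 1 η)) v i) := rfl
  rw [this]
  simp only [entry_apply]
  fin_cases i <;> simp

theorem forcingQuad_apply (hr : r < 1) (η ζ : ZSpace r) (v : VField) (i : Fin 3) :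
    forcingQuad hr η ζ v i = ![0, -(halfMul (slope hr 0 η) (halfMul (slope hr 0 ζ) (v 1)) +
      halfMul (slope hr 1 η) (halfMul (slope hr 1 ζ) (v 1))), 0] i := by
  have : forcingQuad hr η ζ v i =
      -(entry 1 1 (halfMul (slope hr 0 η) ∘L halfMul (slope hr 0 ζ)) v i +
        entry 1 1 (halfMul (slope hr 1 η) ∘L halfMul (slope hr 1 ζ)) v i) := by
    unfold forcingQuad
    rw [Fin.sum_univ_two]
    rfl
  rw [this]
  simp only [entry_apply]
  fin_cases i <;> simp

theorem halfMul_mul (μ ν : Plane →ᵇ ℝ) (f : HalfL2) : halfMul μ (halfMul ν f) = halfMul (μ * ν) f := by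
  apply Lp.ext
  filter_upwards [coeFn_halfMul μ (halfMul ν f), coeFn_halfMul ν f, coeFn_halfMul (μ * ν) f]
    with p a b c
  rw [a, b, c, BoundedContinuousFunction.mul_apply, mul_assoc]

/-- `forcing` represents `(F₁, F₂, F₃)`. -/
theorem forcing_ae (hr : r < 1) (η : ZSpace r) (u : HStar 2) (i : Fin 3) :
    forcing hr η (gradField 2 u) i =ᵐ[halfVol] flatForcing η u i := by
  have e : forcing hr η (gradField 2 u) i = forcingLin hr η (gradField 2 u) i +
      forcingQuad hr η η (gradField 2 u) i := rfl
  rw [e, forcingLin_apply, forcingQuad_apply]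
  simp only [gradField_apply, halfMul_mul]
  have h : ∀ j k, halfMul (slope hr j η) (u.grad k) =ᵐ[halfVol]
      fun p => planeDeriv j η p.1 * u.grad k p := fun j k => by
    simpa only [slope_apply] using coeFn_halfMul (slope hr j η) (u.grad k)
  have h2 : ∀ j k, halfMul (slope hr j η * slope hr j η) (u.grad k) =ᵐ[halfVol]
      fun p => planeDeriv j η p.1 ^ 2 * u.grad k p := fun j k => by
    filter_upwards [coeFn_halfMul (slope hr j η * slope hr j η) (u.grad k)] with p hp
    rw [hp, BoundedContinuousFunction.mul_apply, slope_apply, sq]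
  fin_cases i
  · simpa [flatForcing] using h 0 1
  · change (((halfMul (slope hr 0 η) (u.grad 0) + halfMul (slope hr 1 η) (u.grad 2)) +
      -(halfMul (slope hr 0 η * slope hr 0 η) (u.grad 1) +
        halfMul (slope hr 1 η * slope hr 1 η) (u.grad 1)) : HalfL2) : Space → ℝ) =ᵐ[halfVol] _
    filter_upwards [Lp.coeFn_add (halfMul (slope hr 0 η) (u.grad 0) +
        halfMul (slope hr 1 η) (u.grad 2)) (-(halfMul (slope hr 0 η * slope hr 0 η) (u.grad 1) +
        halfMul (slope hr 1 η * slope hr 1 η) (u.grad 1))),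
      Lp.coeFn_add (halfMul (slope hr 0 η) (u.grad 0)) (halfMul (slope hr 1 η) (u.grad 2)),
      Lp.coeFn_neg (halfMul (slope hr 0 η * slope hr 0 η) (u.grad 1) +
        halfMul (slope hr 1 η * slope hr 1 η) (u.grad 1)),
      Lp.coeFn_add (halfMul (slope hr 0 η * slope hr 0 η) (u.grad 1))
        (halfMul (slope hr 1 η * slope hr 1 η) (u.grad 1)), h 0 0, h 1 2, h2 0 1, h2 1 1]
      with p a b c d e f g k
    rw [a, Pi.add_apply, b, Pi.add_apply, c, Pi.neg_apply, d, Pi.add_apply, e, f, g, k]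
    simp only [flatForcing, Fin.mk_one, Matrix.cons_val_one, Matrix.cons_val_zero]
    ring
  · simpa [flatForcing] using h 1 1

theorem hasWeakOrder_zero (n : ℕ) : HasWeakOrder n 0 := by
  have := HasWeakOrder.smul (n := n) 0 (HStar.hasWeakOrder_grad (0 : HStar n) 0)
  rwa [zero_smul] at this

/-- The part of `(F₁, F₂, F₃)` linear in `η` is as regular as the gradient of `u`. -/
theorem hasWeakOrder_forcingLin (hr : r < 1) (η : ZSpace r) (u : HStar 2) (i : Fin 3) :
    HasWeakOrder 2 (forcingLin hr η (gradField 2 u) i) := by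
  rw [forcingLin_apply]
  have h : ∀ j k, HasWeakOrder 2 (halfMul (slope hr j η) (u.grad k)) := fun j k =>
    HStar.hasWeakOrder_halfMul (isMultiplier_slope hr j η) u k
  fin_cases i
  · exact h 0 1
  · exact (h 0 0).add (h 1 2)
  · exact h 1 1

/-- The part of `(F₁, F₂, F₃)` quadratic in `η` is as regular as the gradient of `u`. -/
theorem hasWeakOrder_forcingQuad (hr : r < 1) (η ζ : ZSpace r) (u : HStar 2) (i : Fin 3) :
    HasWeakOrder 2 (forcingQuad hr η ζ (gradField 2 u) i) := by
  rw [forcingQuad_apply]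
  simp only [halfMul_mul]
  have h : ∀ j k, HasWeakOrder 2 (halfMul (slope hr j η * slope hr j ζ) (u.grad k)) := fun j k =>
    HStar.hasWeakOrder_halfMul ((isMultiplier_slope hr j η).mul (isMultiplier_slope hr j ζ)) u k
  fin_cases i
  · exact hasWeakOrder_zero 2
  · have := ((h 0 1).add (h 1 1)).smul (-1)
    rw [neg_one_smul] at this
    exact this
  · exact hasWeakOrder_zero 2

/-- The weak formulation of the flattened problem. -/
def IsWeakSol (hr : r < 1) (η : ZSpace r) (ξ : Plane → ℝ) (u : HStar 2) : Prop :=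
  ∀ ψ, IsTest Set.univ ψ → inner ℝ (gradField 2 u - forcing hr η (gradField 2 u)) (gradTest ψ) =
    -∫ q, ξ q * spaceDeriv 0 ψ (q, 0)

/-- The fixed-point equation `u = T(η) u + G ξ` with `T(0) = 0` is solved for small `η` by a Neumann
series, which depends analytically on `η`. -/
theorem exists_fixedPoint_operator {Z X Y : Type*} [NormedAddCommGroup Z] [NormedSpace ℝ Z]
    [NormedAddCommGroup X] [NormedSpace ℝ X] [CompleteSpace X] [NormedAddCommGroup Y]
    [NormedSpace ℝ Y] {T : Z → X →L[ℝ] X} (hT : AnalyticAt ℝ T 0) (hT0 : T 0 = 0)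
    (G : Y →L[ℝ] X) :
    ∃ M : ℝ, 0 < M ∧ ∃ S : Z → Y →L[ℝ] X, AnalyticAt ℝ S 0 ∧
      ∀ η, ‖η‖ < M → ∀ ξ u, u = T η u + G ξ ↔ u = S η ξ := by
  obtain ⟨M, hM, hball⟩ := Metric.continuousAt_iff.1 hT.continuousAt 1 one_pos
  refine ⟨M, hM, fun η => Ring.inverse (1 - T η) ∘L G, ?_, fun η hη ξ u => ?_⟩
  · have h1 : AnalyticAt ℝ (Ring.inverse : (X →L[ℝ] X) → _) (1 - T 0) := by
      rw [hT0, sub_zero]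
      exact analyticAt_inverse (1 : (X →L[ℝ] X)ˣ)
    have h2 : AnalyticAt ℝ (fun η => Ring.inverse (1 - T η)) 0 :=
      AnalyticAt.fun_comp (f := fun η => 1 - T η) h1 (analyticAt_const.sub hT)
    exact AnalyticAt.fun_comp (f := fun η => Ring.inverse (1 - T η))
      (((ContinuousLinearMap.compL ℝ Y X X).flip G).analyticAt _) h2
  · have hn : ‖T η‖ < 1 := by
      have := hball (x := η) (by rwa [dist_zero_right])
      rwa [hT0, dist_zero_right] at this
    have hu : IsUnit (1 - T η) := isUnit_one_sub_of_norm_lt_one hn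
    rw [← sub_eq_iff_eq_add']
    change (1 - T η) u = G ξ ↔ _
    constructor
    · intro h
      change u = Ring.inverse (1 - T η) (G ξ)
      rw [← h]
      change u = (Ring.inverse (1 - T η) * (1 - T η)) u
      rw [Ring.inverse_mul_cancel _ hu]
      rfl
    · rintro rfl
      change ((1 - T η) * Ring.inverse (1 - T η)) (G ξ) = G ξ
      rw [Ring.mul_inverse_cancel _ hu]
      rfl

theorem analyticAt_linear_add_quadratic {Z R : Type*} [NormedAddCommGroup Z] [NormedSpace ℝ Z]
    [NormedAddCommGroup R] [NormedSpace ℝ R] (A : Z →L[ℝ] R) (B : Z →L[ℝ] Z →L[ℝ] R) (z : Z) :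
    AnalyticAt ℝ (fun η => A η + B η η) z := by
  refine (A.analyticAt z).add ?_
  have h1 : AnalyticAt ℝ (fun x : Z × Z => B x.1 x.2) (z, z) := B.analyticAt_bilinear (z, z)
  exact AnalyticAt.fun_comp (f := fun η : Z => (η, η)) h1 (analyticAt_id.prod analyticAt_id)

/-- A quadratic polynomial of operators with values in the range of an injective operator `π` lifts
through `π`. -/
theorem exists_lift_quadratic {Z A C : Type*} [NormedAddCommGroup Z] [NormedSpace ℝ Z]
    [CompleteSpace Z] [NormedAddCommGroup A] [NormedSpace ℝ A] [CompleteSpace A]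
    [NormedAddCommGroup C] [NormedSpace ℝ C] (π : A →L[ℝ] C) (hπ : Function.Injective π)
    (P : C →L[ℝ] C) (T₁ : Z →L[ℝ] C →L[ℝ] C) (T₂ : Z →L[ℝ] Z →L[ℝ] C →L[ℝ] C)
    (h₁ : ∀ z a, ∃ b, π b = P (T₁ z (π a))) (h₂ : ∀ y z a, ∃ b, π b = P (T₂ y z (π a))) :
    ∃ T : Z → A →L[ℝ] A, AnalyticAt ℝ T 0 ∧ T 0 = 0 ∧
      ∀ z a, π (T z a) = P (T₁ z (π a) + T₂ z z (π a)) := by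
  obtain ⟨Q, hQ⟩ : ∃ Q : (C →L[ℝ] C) →L[ℝ] A →L[ℝ] C, ∀ Y a, Q Y a = P (Y (π a)) :=
    ⟨(ContinuousLinearMap.compL ℝ A C C P) ∘L ((ContinuousLinearMap.compL ℝ A C C).flip π),
      fun _ _ => rfl⟩
  obtain ⟨L₁, hL₁⟩ := exists_lift_family π hπ (Q ∘L T₁) (by
    simpa only [ContinuousLinearMap.comp_apply, hQ] using h₁)
  obtain ⟨L₂, hL₂⟩ := exists_lift_family₂ π hπ
    (ContinuousLinearMap.compL ℝ Z (C →L[ℝ] C) (A →L[ℝ] C) Q ∘L T₂) (by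
    simpa only [ContinuousLinearMap.comp_apply, ContinuousLinearMap.compL_apply, hQ] using h₂)
  refine ⟨fun z => L₁ z + L₂ z z, analyticAt_linear_add_quadratic L₁ L₂ 0, by simp, fun z a => ?_⟩
  rw [add_apply, map_add, hL₁, hL₂, map_add]
  simp only [ContinuousLinearMap.comp_apply, ContinuousLinearMap.compL_apply, hQ]

/-- The solution operator. Projected onto the gradient fields, the weak formulation is the fixed-point
equation `u = T(η) u + G ξ`, where `G` solves the problem for `η = 0` and `T` is a quadratic polynomial
with `T(0) = 0`. -/
theorem exists_solutionOperator (hr : r < 1) : ∃ M : ℝ, 0 < M ∧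
    ∃ S : ZSpace r → Sobolev (5 / 2) →L[ℝ] HStar 2, AnalyticAt ℝ S 0 ∧
      ∀ η : ZSpace r, ‖η‖ < M → ∀ (ξ : Sobolev (5 / 2)) (u : HStar 2),
        IsWeakSol hr η ξ u ↔ u = S η ξ := by
  have := ZSpace.completeSpace hr
  obtain ⟨T, hT, hT0, hT'⟩ := exists_lift_quadratic (gradField 2) (gradField_injective 2) gradProj
    (forcingLin hr) (forcingQuad hr)
    (fun η u => exists_hstar_of_hasWeakOrder (gradProj_mem _)
      fun i => hasWeakOrder_gradProj (fun j => hasWeakOrder_forcingLin hr η u j) i)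
    (fun η ζ u => exists_hstar_of_hasWeakOrder (gradProj_mem _)
      fun i => hasWeakOrder_gradProj (fun j => hasWeakOrder_forcingQuad hr η ζ u j) i)
  obtain ⟨G, hG⟩ := exists_neumannSolution
  obtain ⟨M, hM, S, hS, h⟩ := exists_fixedPoint_operator hT hT0 G
  refine ⟨M, hM, S, hS, fun η hη ξ u => ?_⟩
  -- The fixed-point equation in terms of gradient fields.
  have e : gradField 2 (T η u + G ξ) =
      gradProj (forcing hr η (gradField 2 u)) + gradField 2 (G ξ) := by
    rw [map_add, hT']
    rfl
  rw [← h η hη ξ u, ← (gradField_injective 2).eq_iff, e]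
  constructor
  · intro h
    refine eq_of_inner_gradTest (gradField_mem u)
      (Submodule.add_mem _ (gradProj_mem _) (gradField_mem _)) fun ψ hψ => ?_
    rw [inner_add_left, inner_gradProj _ (gradTest_mem hψ), hG ξ ψ hψ, ← h ψ hψ, inner_sub_left]
    ring
  · intro h ψ hψ
    have h1 := congrArg (fun v => inner ℝ v (gradTest ψ)) h
    simp only [inner_add_left] at h1
    rw [inner_gradProj _ (gradTest_mem hψ), hG ξ ψ hψ] at h1
    rw [inner_sub_left, h1]
    ring

/-! ### The flattened problem and its weak formulation -/

/-- Multiplication by bounded continuous functions on `L²(ℝ²)`. -/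
noncomputable def planeMul : (Plane →ᵇ ℝ) →L[ℝ] PlaneL2 →L[ℝ] PlaneL2 :=
  (exists_mulL2 (volume : Measure Plane) measurable_id).choose

theorem coeFn_planeMul (μ : Plane →ᵇ ℝ) (f : PlaneL2) :
    planeMul μ f =ᵐ[volume] fun q => μ q * f q :=
  (exists_mulL2 (volume : Measure Plane) measurable_id).choose_spec μ f

/-- Multiplication by a bounded continuous function of the horizontal variables commutes with
traces. -/
theorem TraceRel.mul {f f' : HalfL2} {t : PlaneL2} (h : TraceRel f f' t) (ν : Plane →ᵇ ℝ) :
    TraceRel (halfMul ν f) (halfMul ν f') (planeMul ν t) := by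
  intro μ C hμ hb ψ hψ hc
  have := h (fun q => ν q * μ q) (‖ν‖ * C) (ν.continuous.measurable.mul hμ)
    (fun q => by
      rw [abs_mul]
      exact mul_le_mul (ν.norm_coe_le_norm q) (hb q) (abs_nonneg _) (norm_nonneg _)) ψ hψ hc
  convert this using 1
  · congr 1 <;> refine integral_congr_ae ?_
    · filter_upwards [coeFn_halfMul ν f'] with p hp
      rw [hp]; ring
    · filter_upwards [coeFn_halfMul ν f] with p hp
      rw [hp]; ring
  · refine integral_congr_ae ?_
    filter_upwards [coeFn_planeMul ν t] with p hp
    rw [hp]; ring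

theorem TraceRel.sub {f f' g g' : HalfL2} {t s : PlaneL2} (h : TraceRel f f' t)
    (h' : TraceRel g g' s) : TraceRel (f - g) (f' - g') (t - s) := by
  intro μ C hμ hb ψ hψ hc
  have e1 := h μ C hμ hb ψ hψ hc
  have e2 := h' μ C hμ hb ψ hψ hc
  obtain ⟨m1, m2, m3⟩ := memLp_traceRel hμ hb hψ hc
  simp only [← inner_toHalfL2 _ m1, ← inner_toHalfL2 _ m2, ← inner_plane _ m3] at e1 e2 ⊢
  simp only [inner_sub_left]
  linarith

/-- If `W` is divergence-free in `Σ` and its vertical component has a `y`-derivative in `L²(Σ)`,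
then the flux of `W` through `y = 0` is the trace of its vertical component. -/
theorem inner_gradTest_eq_trace {W : VField} {W' : HalfL2} {t : PlaneL2} (ht : TraceRel (W 1) W' t)
    (hW : ∀ ψ, IsTest halfSpace ψ → inner ℝ W (gradTest ψ) = 0) {ψ : Space → ℝ}
    (hψ : IsTest Set.univ ψ) : inner ℝ W (gradTest ψ) = ∫ q, t q * ψ (q, 0) := by
  -- the difference of the two sides involves no vertical derivative of `ψ`
  have key : ∀ φ, IsTest Set.univ φ → inner ℝ W (gradTest φ) - ∫ q, t q * φ (q, 0) =
      inner ℝ (W 0) (toHalfL2 (spaceDeriv 0 φ)) + inner ℝ (W 2) (toHalfL2 (spaceDeriv 2 φ)) -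
        inner ℝ W' (toHalfL2 φ) := by
    intro φ hφ
    have h := ht (fun _ => 1) 1 measurable_const (by simp) φ
      (hφ.1.of_le (by exact_mod_cast le_top)) hφ.2.1
    simp only [one_mul] at h
    rw [← h, inner_toHalfL2 W' hφ.memLp, ← inner_toHalfL2 (W 1) (hφ.spaceDeriv 1).memLp,
      inner_vfield, Fin.sum_univ_three]
    change (inner ℝ (W 0) (toHalfL2 (spaceDeriv 0 φ)) + inner ℝ (W 1) (toHalfL2 (spaceDeriv 1 φ)) +
      inner ℝ (W 2) (toHalfL2 (spaceDeriv 2 φ))) - _ = _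
    ring
  -- Cut-off functions of the height that vanish near `y = 0` and tend to one in `Σ`.
  set θ : ℕ → ℝ → ℝ := fun n y => Real.smoothTransition (-(n * y) - 1) with hθ
  have hθs : ∀ n, ContDiff ℝ ∞ fun p : Space => θ n p.2 := fun n =>
    Real.smoothTransition.contDiff.comp (by fun_prop)
  have hθd : ∀ n i, i ≠ 1 → ∀ p, spaceDeriv i (fun p => ψ p * θ n p.2) p =
      θ n p.2 * spaceDeriv i ψ p := by
    intro n i hi p
    have hz : fderiv ℝ (fun p : Space => θ n p.2) p (spaceDir i) = 0 := by
      have hd : DifferentiableAt ℝ (θ n) p.2 :=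
        (Real.smoothTransition.contDiff (n := 1)).differentiable one_ne_zero |>.comp
          (by fun_prop : Differentiable ℝ fun y : ℝ => -(n * y) - 1) p.2
      have h1 : HasFDerivAt (fun p : Space => θ n p.2) _ p :=
        hd.hasFDerivAt.comp p (hasFDerivAt_snd (𝕜 := ℝ) (p := p))
      rw [h1.fderiv]
      rcases horizIdx_cases i with rfl | ⟨a, rfl⟩
      · exact absurd rfl hi
      · rw [spaceDir_horizIdx]
        simp
    unfold spaceDeriv
    rw [fderiv_fun_mul (hψ.1.differentiable (by simp) p) ((hθs n).differentiable (by simp) p)]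
    simp [hz]
  have htest : ∀ n : ℕ, IsTest halfSpace fun p => ψ p * θ (n + 1) p.2 := by
    intro n
    refine ⟨hψ.1.mul (hθs _), hψ.2.1.mul_right, ?_⟩
    have hn : (0 : ℝ) < n + 1 := by positivity
    have hsub : Function.support (fun p : Space => ψ p * θ (n + 1) p.2) ⊆
        {p | p.2 ≤ -(1 / (n + 1))} := by
      intro p hp
      by_contra hcon
      have h1 : -(1 / ((n : ℝ) + 1)) < p.2 := not_le.1 hcon
      have h2 : -(((n + 1 : ℕ) : ℝ) * p.2) - 1 ≤ 0 := by
        have := mul_lt_mul_of_pos_left h1 hn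
        rw [mul_neg, mul_one_div_cancel hn.ne'] at this
        push_cast
        linarith
      exact hp (by
        change ψ p * Real.smoothTransition _ = 0
        rw [Real.smoothTransition.zero_of_nonpos h2, mul_zero])
    have hcl : IsClosed {p : Space | p.2 ≤ -(1 / ((n : ℝ) + 1))} :=
      isClosed_le continuous_snd continuous_const
    intro p hp
    have h3 : p.2 ≤ -(1 / ((n : ℝ) + 1)) := closure_minimal hsub hcl hp
    have h4 : (0 : ℝ) < 1 / (n + 1) := by positivity
    change p.2 < 0
    linarith
  -- The difference vanishes for `ψ` multiplied by a cut-off function.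
  have h0 : ∀ n : ℕ, inner ℝ (W 0) (toHalfL2 fun p => θ (n + 1) p.2 * spaceDeriv 0 ψ p) +
      inner ℝ (W 2) (toHalfL2 fun p => θ (n + 1) p.2 * spaceDeriv 2 ψ p) -
        inner ℝ W' (toHalfL2 fun p => θ (n + 1) p.2 * ψ p) = 0 := by
    intro n
    have h1 := key _ ((htest n).mono (Set.subset_univ _))
    have hz : ∀ q : Plane, ψ (q, 0) * θ (n + 1) 0 = 0 := fun q => by
      change ψ (q, 0) * Real.smoothTransition _ = 0
      rw [Real.smoothTransition.zero_of_nonpos (by simp), mul_zero]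
    rw [hW _ (htest n)] at h1
    simp only [hz, mul_zero, integral_zero, sub_zero] at h1
    rw [h1, funext (hθd (n + 1) 0 (by decide)), funext (hθd (n + 1) 2 (by decide))]
    simp only [mul_comm (ψ _)]
  have hlim : ∀ {g : Space → ℝ}, IsTest Set.univ g →
      Tendsto (fun n : ℕ => toHalfL2 fun p => θ (n + 1) p.2 * g p) atTop (𝓝 (toHalfL2 g)) := by
    intro g hg
    have hb : ∀ n y, |θ n y| ≤ 1 := fun n y => by
      rw [abs_of_nonneg (Real.smoothTransition.nonneg _)]
      exact Real.smoothTransition.le_one _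
    refine tendsto_toHalfL2 (fun n => memLp_mul_bounded hg.memLp
      (hθs _).continuous.aestronglyMeasurable fun p => hb _ _) hg.memLp (b := fun p => g p ^ 2)
      hg.memLp.integrable_sq (fun n p _ => ?_) (fun p hp => ?_)
    · have h1 := Real.smoothTransition.nonneg (-(((n + 1 : ℕ) : ℝ) * p.2) - 1)
      have h2 := Real.smoothTransition.le_one (-(((n + 1 : ℕ) : ℝ) * p.2) - 1)
      change (Real.smoothTransition _ * g p - g p) ^ 2 ≤ g p ^ 2
      have : (1 - Real.smoothTransition (-(((n + 1 : ℕ) : ℝ) * p.2) - 1)) ^ 2 ≤ 1 := by nlinarith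
      nlinarith [mul_le_mul_of_nonneg_right this (sq_nonneg (g p))]
    · refine tendsto_const_nhds.congr' ?_
      have hp' : p.2 < 0 := hp
      obtain ⟨N, hN⟩ := exists_nat_ge (2 / -p.2)
      filter_upwards [eventually_ge_atTop N] with n hn
      have h1 : 2 / -p.2 ≤ ((n + 1 : ℕ) : ℝ) := by
        refine hN.trans ?_
        exact_mod_cast hn.trans (Nat.le_succ n)
      rw [div_le_iff₀ (by linarith)] at h1
      change g p = Real.smoothTransition _ * g p
      rw [Real.smoothTransition.one_of_one_le (by linarith), one_mul]
  have h1 : Tendsto (fun n : ℕ => inner ℝ (W 0) (toHalfL2 fun p => θ (n + 1) p.2 * spaceDeriv 0 ψ p) +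
      inner ℝ (W 2) (toHalfL2 fun p => θ (n + 1) p.2 * spaceDeriv 2 ψ p) -
        inner ℝ W' (toHalfL2 fun p => θ (n + 1) p.2 * ψ p)) atTop
      (𝓝 (inner ℝ W (gradTest ψ) - ∫ q, t q * ψ (q, 0))) := by
    rw [key ψ hψ]
    exact ((tendsto_const_nhds.inner (hlim (hψ.spaceDeriv 0))).add
      (tendsto_const_nhds.inner (hlim (hψ.spaceDeriv 2)))).sub
      (tendsto_const_nhds.inner (hlim hψ))
  simp only [h0] at h1
  exact (sub_eq_zero.1 (tendsto_nhds_unique h1 tendsto_const_nhds))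

/-- The trace operators on `H_⋆³(Σ)`. -/
noncomputable def traceOp (i : Fin 3) : HStar 2 →L[ℝ] Sobolev (3 / 2) := (exists_traceOp i).choose

theorem traceRel_traceOp (i : Fin 3) (u : HStar 2) : TraceRel (u.grad i)
    ((u : JetSpace 2) (i, idx 0 1 0 (by decide))) (Sobolev.toL2 (traceOp i u)) :=
  (exists_traceOp i).choose_spec u

theorem hasTrace_grad (i : Fin 3) (u : HStar 2) : HasTrace (u.grad i) (traceOp i u) := by
  simpa using (traceRel_traceOp i u).hasTrace (μ := fun _ => 1) (C := 1) measurable_const (by simp)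

/-- The conormal derivative `u_y - F₂` at `y = 0`. -/
noncomputable def conormal (η : ZSpace r) (a b c : Plane → ℝ) : Plane → ℝ :=
  fun q => b q - (planeDeriv 0 η q * a q + planeDeriv 1 η q * c q
      - (planeDeriv 0 η q ^ 2 + planeDeriv 1 η q ^ 2) * b q)

/-- The vertical component `u_y - F₂` of the flux has the conormal derivative as its trace. -/
theorem exists_traceRel_flux (hr : r < 1) (η : ZSpace r) (u : HStar 2) :
    ∃ (W' : HalfL2) (t : PlaneL2),
      TraceRel ((gradField 2 u - forcing hr η (gradField 2 u)) 1) W' t ∧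
      t =ᵐ[volume] conormal η (traceOp 0 u) (traceOp 1 u) (traceOp 2 u) := by
  set m := slope hr 0 η
  set n := slope hr 1 η
  have h0 := traceRel_traceOp 0 u
  have h1 := traceRel_traceOp 1 u
  have h2 := traceRel_traceOp 2 u
  have h := (((h1.sub (h0.mul m)).sub (h2.mul n)).sub (h1.mul (-(m * m + n * n))))
  have hW : (gradField 2 u - forcing hr η (gradField 2 u)) 1 =
      u.grad 1 - halfMul m (u.grad 0) - halfMul n (u.grad 2) -
        halfMul (-(m * m + n * n)) (u.grad 1) := by
    change u.grad 1 - (forcingLin hr η (gradField 2 u) 1 + forcingQuad hr η η (gradField 2 u) 1) = _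
    rw [forcingLin_apply, forcingQuad_apply]
    simp only [gradField_apply, halfMul_mul, Matrix.cons_val_one, Matrix.cons_val_zero]
    rw [map_neg, map_add, neg_apply, add_apply]
    abel
  rw [hW]
  refine ⟨_, _, h, ?_⟩
  · have e : ∀ (x y : PlaneL2), ((x - y : PlaneL2) : Plane → ℝ) =ᵐ[volume] fun q => x q - y q :=
      fun x y => Lp.coeFn_sub x y
    set b := Sobolev.toL2 (traceOp 1 u)
    set a := Sobolev.toL2 (traceOp 0 u)
    set c := Sobolev.toL2 (traceOp 2 u)
    filter_upwards [e (b - planeMul m a - planeMul n c) (planeMul (-(m * m + n * n)) b),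
      e (b - planeMul m a) (planeMul n c), e b (planeMul m a), coeFn_planeMul m a,
      coeFn_planeMul n c, coeFn_planeMul (-(m * m + n * n)) b] with q e1 e2 e3 e4 e5 e6
    rw [e1, e2, e3, e4, e5, e6]
    simp only [conormal, BoundedContinuousFunction.neg_apply, BoundedContinuousFunction.add_apply,
      BoundedContinuousFunction.mul_apply, m, n, slope_apply]
    ring

theorem inner_vfield_gradTest (v : VField) {ψ : Space → ℝ} (hψ : IsTest Set.univ ψ) :
    inner ℝ v (gradTest ψ) = ∫ p in halfSpace, ∑ i, v i p * spaceDeriv i ψ p := by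
  have hi : ∀ i, Integrable (fun p => v i p * spaceDeriv i ψ p) halfVol := fun i =>
    (Lp.memLp (v i)).integrable_mul (hψ.spaceDeriv i).memLp
  rw [inner_vfield, integral_finsetSum _ fun i _ => hi i]
  exact Finset.sum_congr rfl fun i _ => inner_toHalfL2 _ (hψ.spaceDeriv i).memLp

/-- The weak form in terms of integrals. -/
theorem inner_gradField_sub_forcing (hr : r < 1) (η : ZSpace r) (u : HStar 2) {ψ : Space → ℝ}
    (hψ : IsTest Set.univ ψ) :
    inner ℝ (gradField 2 u - forcing hr η (gradField 2 u)) (gradTest ψ) =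
      (∫ p in halfSpace, ∑ i, u.grad i p * spaceDeriv i ψ p) -
        ∫ p in halfSpace, ∑ i, flatForcing η u i p * spaceDeriv i ψ p := by
  rw [inner_sub_left, inner_vfield_gradTest _ hψ, inner_vfield_gradTest _ hψ]
  congr 1
  refine integral_congr_ae ?_
  filter_upwards [forcing_ae hr η u 0, forcing_ae hr η u 1, forcing_ae hr η u 2] with p a b c
  simp only [Fin.sum_univ_three, a, b, c]

/-- The flattened problem in its weak form: an equation in `Σ` and the conormal derivative. -/
theorem isWeakSol_iff (hr : r < 1) (η : ZSpace r) (ξ : PlaneL2) (u : HStar 2) :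
    IsWeakSol hr η ξ u ↔ (∀ ψ, IsTest halfSpace ψ →
        inner ℝ (gradField 2 u - forcing hr η (gradField 2 u)) (gradTest ψ) = 0) ∧
      HasWeakPartial 0 ξ (conormal η (traceOp 0 u) (traceOp 1 u) (traceOp 2 u)) := by
  obtain ⟨W', t, ht, hte⟩ := exists_traceRel_flux hr η u
  constructor
  · intro h
    have h1 : ∀ ψ, IsTest halfSpace ψ →
        inner ℝ (gradField 2 u - forcing hr η (gradField 2 u)) (gradTest ψ) = 0 := by
      intro ψ hψ
      rw [h ψ (hψ.mono (Set.subset_univ _))]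
      simp [isTest_halfSpace_zero (hψ.spaceDeriv 0)]
    refine ⟨h1, (Lp.memLp ξ).locallyIntegrable one_le_two,
      ((Lp.memLp t).ae_eq hte).locallyIntegrable one_le_two, fun φ hφ => ?_⟩
    obtain ⟨ψ, hψ, rfl⟩ := exists_test_extension hφ
    have h2 := inner_gradTest_eq_trace ht h1 hψ
    rw [h ψ hψ] at h2
    rw [planeDeriv_slice hψ.1 0 0]
    rw [integral_congr_ae (g := fun q => t q * ψ (q, 0)) (hte.mono fun q hq => by
      dsimp only; rw [hq]; rfl), ← h2]
    rfl
  · rintro ⟨h1, h2⟩ ψ hψ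
    rw [inner_gradTest_eq_trace ht h1 hψ]
    have h3 := h2.2.2 _ (hψ.slice 0)
    rw [planeDeriv_slice hψ.1 0 0] at h3
    rw [integral_congr_ae (g := fun q => conormal η (traceOp 0 u) (traceOp 1 u) (traceOp 2 u) q *
      slice ψ 0 q) (hte.mono fun q hq => by
      dsimp only; rw [hq]; rfl), h3]
    rfl

theorem HasWeakPartial.congr {j : Fin 2} {f g g' : Plane → ℝ} (h : HasWeakPartial j f g)
    (e : g =ᵐ[volume] g') : HasWeakPartial j f g' :=
  ⟨h.1, h.2.1.congr e, fun ψ hψ => by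
    rw [← h.2.2 ψ hψ]
    exact integral_congr_ae (e.mono fun q hq => by dsimp only; rw [hq])⟩

/-- The flattened problem is equivalent to its weak formulation. The condition as `y → -∞` is
satisfied by all elements of `H_⋆³(Σ)`, and traces are unique. -/
theorem solvesFlat_iff (hr : r < 1) (η : ZSpace r) (ξ : PlaneL2) (u : HStar 2) :
    SolvesFlat η ξ u ↔ IsWeakSol hr η ξ u := by
  rw [isWeakSol_iff]
  have h1 : (∀ ψ : Space → ℝ, IsTest halfSpace ψ →
      ∫ p in halfSpace, ∑ i, u.grad i p * spaceDeriv i ψ p =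
        ∫ p in halfSpace, ∑ i, flatForcing η u i p * spaceDeriv i ψ p) ↔
      ∀ ψ, IsTest halfSpace ψ →
        inner ℝ (gradField 2 u - forcing hr η (gradField 2 u)) (gradTest ψ) = 0 := by
    refine forall₂_congr fun ψ hψ => ?_
    rw [inner_gradField_sub_forcing hr η u (hψ.mono (Set.subset_univ _)), sub_eq_zero]
  unfold SolvesFlat
  rw [h1]
  refine and_congr_right fun _ => ⟨?_, fun h => ?_⟩
  · rintro ⟨-, a, b, c, ha, hb, hc, h⟩
    refine h.congr ?_
    filter_upwards [ha.unique (hasTrace_grad 0 u), hb.unique (hasTrace_grad 1 u),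
      hc.unique (hasTrace_grad 2 u)] with q e0 e1 e2
    rw [conormal, e0, e1, e2]
  · exact ⟨u.tendsToZeroBelow 1, _, _, _, hasTrace_grad 0 u, hasTrace_grad 1 u, hasTrace_grad 2 u, h⟩

/-! ### The problem in the fluid domain -/

/-- A compactly supported `C¹` function is a limit in `C¹` of test functions with supports in a
fixed compact set. -/
theorem exists_test_approx {Ω : Set Space} (hΩ : IsOpen Ω) {Ψ : Space → ℝ} (hΨ : ContDiff ℝ 1 Ψ)
    (hc : HasCompactSupport Ψ) (hs : tsupport Ψ ⊆ Ω) :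
    ∃ K, IsCompact K ∧ K ⊆ Ω ∧ tsupport Ψ ⊆ K ∧ ∀ ε > 0, ∃ ψ, IsTest Ω ψ ∧ tsupport ψ ⊆ K ∧
      ∀ i p, |spaceDeriv i ψ p - spaceDeriv i Ψ p| ≤ ε := by
  obtain ⟨δ₀, hδ₀, hK⟩ := hc.isCompact.exists_cthickening_subset_open hΩ hs
  refine ⟨_, hc.isCompact.cthickening, hK, Metric.self_subset_cthickening _, fun ε hε => ?_⟩
  have hd : ∀ i, Continuous (spaceDeriv i Ψ) := fun i =>
    (hΨ.continuous_fderiv one_ne_zero).clm_apply continuous_const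
  have hdc : ∀ i, HasCompactSupport (spaceDeriv i Ψ) := fun i =>
    (hc.fderiv (𝕜 := ℝ)).comp_left (g := fun L : Space →L[ℝ] ℝ => L (spaceDir i)) rfl
  have hu : ∀ i, ∃ δ > 0, ∀ p q, dist p q < δ →
      dist (spaceDeriv i Ψ p) (spaceDeriv i Ψ q) < ε := fun i =>
    let ⟨δ, hδ, h⟩ := Metric.uniformContinuous_iff.1
      ((hdc i).uniformContinuous_of_continuous (hd i)) ε hε
    ⟨δ, hδ, fun _ _ hpq => h hpq⟩
  choose δ hδ hδ' using hu
  set ρ := min δ₀ (min (δ 0) (min (δ 1) (δ 2))) with hρ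
  have hρ0 : 0 < ρ := lt_min hδ₀ (lt_min (hδ 0) (lt_min (hδ 1) (hδ 2)))
  have hρi : ∀ i, ρ ≤ δ i := by
    intro i
    fin_cases i
    · exact (min_le_right _ _).trans (min_le_left _ _)
    · exact (min_le_right _ _).trans ((min_le_right _ _).trans (min_le_left _ _))
    · exact (min_le_right _ _).trans ((min_le_right _ _).trans (min_le_right _ _))
  -- Mollification at scale `ρ`.
  let φ : ContDiffBump (0 : Space) := ⟨ρ / 2, ρ, by positivity, by linarith⟩
  have hφint : LocallyIntegrable (φ.normed volume) (volume : Measure Space) :=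
    φ.continuous_normed.locallyIntegrable
  set ψ : Space → ℝ := convolution (φ.normed volume) Ψ (ContinuousLinearMap.lsmul ℝ ℝ) volume with hψ
  have hsupp : tsupport ψ ⊆ Metric.cthickening δ₀ (tsupport Ψ) := by
    refine closure_minimal ?_ Metric.isClosed_cthickening
    refine (support_convolution_subset _).trans ?_
    rintro _ ⟨a, ha, b, hb, rfl⟩
    rw [φ.support_normed_eq] at ha
    refine Metric.mem_cthickening_of_dist_le _ b _ _ (subset_tsupport _ hb) ?_
    rw [dist_eq_norm, add_sub_cancel_right]
    have : ‖a‖ < ρ := by simpa using ha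
    exact this.le.trans (min_le_left _ _)
  have hψc : HasCompactSupport ψ := hc.isCompact.cthickening.of_isClosed_subset
    (isClosed_tsupport _) hsupp
  refine ⟨ψ, ⟨?_, hψc, hsupp.trans hK⟩, hsupp, fun i p => ?_⟩
  · exact φ.hasCompactSupport_normed.contDiff_convolution_left _ φ.contDiff_normed
      hΨ.continuous.locallyIntegrable
  · have e : spaceDeriv i ψ p =
        convolution (φ.normed volume) (spaceDeriv i Ψ) (ContinuousLinearMap.lsmul ℝ ℝ) volume p := by
      unfold spaceDeriv
      rw [(hc.hasFDerivAt_convolution_right (ContinuousLinearMap.lsmul ℝ ℝ) hφint hΨ p).fderiv,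
        convolution_precompR_apply _ hφint (hc.fderiv (𝕜 := ℝ)) (hΨ.continuous_fderiv one_ne_zero)]
    rw [e, ← Real.dist_eq]
    refine φ.dist_normed_convolution_le (hd i).aestronglyMeasurable fun x hx => ?_
    exact (hδ' i x p (lt_of_lt_of_le hx (hρi i))).le

/-- A vector field that is divergence-free in the sense of distributions annihilates the gradients
of compactly supported `C¹` functions. -/
theorem integral_eq_zero_of_test {Ω : Set Space} (hΩ : IsOpen Ω) {V : Fin 3 → Space → ℝ}
    (hV : ∀ K, IsCompact K → K ⊆ Ω → ∀ i, IntegrableOn (V i) K)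
    (h : ∀ ψ, IsTest Ω ψ → ∫ p in Ω, ∑ i, V i p * spaceDeriv i ψ p = 0) {Ψ : Space → ℝ}
    (hΨ : ContDiff ℝ 1 Ψ) (hc : HasCompactSupport Ψ) (hs : tsupport Ψ ⊆ Ω) :
    ∫ p in Ω, ∑ i, V i p * spaceDeriv i Ψ p = 0 := by
  obtain ⟨K, hK, hKΩ, hΨK, happ⟩ := exists_test_approx hΩ hΨ hc hs
  have hred : ∀ {g : Space → ℝ}, tsupport g ⊆ K → ∫ p in Ω, ∑ i, V i p * spaceDeriv i g p =
      ∫ p in K, ∑ i, V i p * spaceDeriv i g p := by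
    intro g hg
    refine setIntegral_eq_of_subset_of_forall_sdiff_eq_zero hΩ.measurableSet hKΩ fun p hp => ?_
    refine Finset.sum_eq_zero fun i _ => ?_
    rw [spaceDeriv_eq_zero_of_notMem _ fun hp' => hp.2 (hg hp'), mul_zero]
  have hint : ∀ {g : Space → ℝ}, ContDiff ℝ 1 g → ∀ i, IntegrableOn (fun p => V i p * spaceDeriv i g p) K := by
    intro g hg i
    have hgc : Continuous (spaceDeriv i g) :=
      (hg.continuous_fderiv one_ne_zero).clm_apply continuous_const
    exact (hV K hK hKΩ i).mul_continuousOn hgc.continuousOn hK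
  refine abs_nonpos_iff.1 (le_of_forall_pos_le_add fun ε hε => ?_)
  set B := ∑ i, ∫ p in K, |V i p| with hB
  have hB0 : 0 ≤ B := Finset.sum_nonneg fun i _ => integral_nonneg fun p => abs_nonneg _
  obtain ⟨ψ, hψ, hψK, hle⟩ := happ (ε / (B + 1)) (by positivity)
  have hψ1 : ContDiff ℝ 1 ψ := hψ.1.of_le (by exact_mod_cast le_top)
  have h0 := h ψ hψ
  rw [hred hψK] at h0
  have hsub : ∫ p in K, ∑ i, V i p * spaceDeriv i Ψ p =
      (∫ p in K, ∑ i, V i p * spaceDeriv i Ψ p) - ∫ p in K, ∑ i, V i p * spaceDeriv i ψ p := by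
    rw [h0, sub_zero]
  rw [zero_add, hred hΨK, hsub, integral_finsetSum _ fun i _ => hint hΨ i,
    integral_finsetSum _ fun i _ => hint hψ1 i, ← Finset.sum_sub_distrib]
  refine (Finset.abs_sum_le_sum_abs _ _).trans ?_
  calc _ ≤ ∑ i, ε / (B + 1) * ∫ p in K, |V i p| := by
        refine Finset.sum_le_sum fun i _ => ?_
        rw [← integral_sub (hint hΨ i) (hint hψ1 i), ← integral_const_mul]
        refine (abs_integral_le_integral_abs).trans (integral_mono_ae
          ((hint hΨ i).sub (hint hψ1 i)).abs ((hV K hK hKΩ i).abs.const_mul _)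
          (ae_of_all _ fun p => ?_))
        dsimp only
        rw [← mul_sub, abs_mul, abs_sub_comm, mul_comm]
        exact mul_le_mul_of_nonneg_right (hle i p) (abs_nonneg _)
    _ = ε / (B + 1) * B := by rw [← Finset.mul_sum]
    _ ≤ ε := by
        rw [div_mul_eq_mul_div, div_le_iff₀ (by positivity)]
        nlinarith

/-- The flattening map `(x, y, z) ↦ (x, y + η(x, z), z)`. -/
def shear {η : Plane → ℝ} (hη : Continuous η) : Space ≃ₜ Space where
  toFun p := (p.1, p.2 + η p.1)
  invFun p := (p.1, p.2 - η p.1)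
  left_inv p := by simp
  right_inv p := by simp
  continuous_toFun := by fun_prop
  continuous_invFun := by fun_prop

variable {η : Plane → ℝ}

theorem measurePreserving_shear (hη : Continuous η) :
    MeasurePreserving (shear hη) (volume : Measure Space) volume := by
  refine (MeasurePreserving.id (volume : Measure Plane)).skew_product
    (g := fun q y => y + η q) ?_ (ae_of_all _ fun q => ?_)
  · exact (continuous_snd.add (hη.comp continuous_fst)).measurable
  · exact (measurePreserving_add_right volume (η q)).map_eq

theorem shear_preimage_fluidDomain (hη : Continuous η) :
    shear hη ⁻¹' fluidDomain η = halfSpace := by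
  ext p
  simp [shear, fluidDomain, halfSpace]

theorem setIntegral_fluidDomain (hη : Continuous η) (f : Space → ℝ) :
    ∫ p in fluidDomain η, f p = ∫ p in halfSpace, f (shear hη p) := by
  rw [← shear_preimage_fluidDomain hη]
  exact ((measurePreserving_shear hη).setIntegral_preimage_emb
    (shear hη).measurableEmbedding f _).symm

theorem isOpen_fluidDomain (hη : Continuous η) : IsOpen (fluidDomain η) :=
  isOpen_lt continuous_snd (hη.comp continuous_fst)

theorem hasFDerivAt_shear (h : ContDiff ℝ 1 η) (p : Space) :
    HasFDerivAt (shear h.continuous)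
      ((ContinuousLinearMap.fst ℝ Plane ℝ).prod (ContinuousLinearMap.snd ℝ Plane ℝ +
        fderiv ℝ η p.1 ∘L ContinuousLinearMap.fst ℝ Plane ℝ)) p := by
  refine HasFDerivAt.prodMk hasFDerivAt_fst (hasFDerivAt_snd.add ?_)
  exact ((h.differentiable one_ne_zero p.1).hasFDerivAt).comp p hasFDerivAt_fst

theorem contDiff_shear (h : ContDiff ℝ 1 η) : ContDiff ℝ 1 (shear h.continuous) :=
  contDiff_fst.prodMk (contDiff_snd.add (h.comp contDiff_fst))

theorem contDiff_shear_symm (h : ContDiff ℝ 1 η) : ContDiff ℝ 1 (shear h.continuous).symm :=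
  contDiff_fst.prodMk (contDiff_snd.sub (h.comp contDiff_fst))

/-- The chain rule for the flattening map. -/
theorem spaceDeriv_comp_shear (h : ContDiff ℝ 1 η) {ψ : Space → ℝ} (hψ : ContDiff ℝ 1 ψ) (p : Space) :
    spaceDeriv 1 (ψ ∘ shear h.continuous) p = spaceDeriv 1 ψ (shear h.continuous p) ∧
    ∀ j, spaceDeriv (horizIdx j) (ψ ∘ shear h.continuous) p =
      spaceDeriv (horizIdx j) ψ (shear h.continuous p) +
        planeDeriv j η p.1 * spaceDeriv 1 ψ (shear h.continuous p) := by
  have hd := ((hψ.differentiable one_ne_zero (shear h.continuous p)).hasFDerivAt).comp p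
    (hasFDerivAt_shear h p)
  unfold spaceDeriv
  rw [hd.fderiv]
  constructor
  · change fderiv ℝ ψ _ ((0 : Plane), (1 : ℝ) + fderiv ℝ η p.1 0) = fderiv ℝ ψ _ ((0 : Plane), (1 : ℝ))
    rw [map_zero, add_zero]
  · intro j
    rw [spaceDir_horizIdx]
    change fderiv ℝ ψ _ (planeDir j, 0 + fderiv ℝ η p.1 (planeDir j)) = _
    have : (planeDir j, 0 + fderiv ℝ η p.1 (planeDir j)) =
        (planeDir j, (0 : ℝ)) + planeDeriv j η p.1 • ((0 : Plane), (1 : ℝ)) := by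
      refine Prod.ext ?_ ?_ <;> simp [planeDeriv]
    rw [this, map_add, map_smul]
    rfl

/-- The Dirichlet form in the fluid domain in flattened variables. -/
theorem setIntegral_fluidGrad (h : ContDiff ℝ 1 η) (u : HStar 2) {ψ : Space → ℝ}
    (hψ : ContDiff ℝ 1 ψ) :
    ∫ p in fluidDomain η, ∑ i, fluidGrad η u i p * spaceDeriv i ψ p =
      ∫ p in halfSpace, ∑ i, (u.grad i p - flatForcing η u i p) *
        spaceDeriv i (ψ ∘ shear h.continuous) p := by
  rw [setIntegral_fluidDomain h.continuous]
  refine integral_congr_ae (ae_of_all _ fun p => ?_)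
  obtain ⟨h1, hj⟩ := spaceDeriv_comp_shear h hψ p
  have h0 := hj 0
  have h2 := hj 1
  simp only [horizIdx, Matrix.cons_val_zero, Matrix.cons_val_one] at h0 h2
  have e : (shear h.continuous p).2 - η p.1 = p.2 := by simp [shear]
  have e1 : (shear h.continuous p).1 = p.1 := rfl
  simp only [Fin.sum_univ_three, h0, h1, h2, fluidGrad, flatForcing, e1, e, Matrix.cons_val_zero,
    Matrix.cons_val_one, Matrix.cons_val]
  ring

theorem HasTrace.congr {f f' : Space → ℝ} {g g' : Plane → ℝ} (h : HasTrace f g)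
    (hf : f =ᵐ[halfVol] f') (hg : g =ᵐ[volume] g') : HasTrace f' g' := by
  obtain ⟨h1, h2, d, hd, e⟩ := h
  refine ⟨h1.ae_eq hf, h2.ae_eq hg, d, hd, fun ψ hψ => ?_⟩
  rw [e ψ hψ]
  congr 1
  · exact congrArg _ (integral_congr_ae (hf.mono fun p hp => by dsimp only; rw [hp]))
  · exact integral_congr_ae (hg.mono fun p hp => by dsimp only; rw [hp])

/-- Elements of `𝒵` are bounded since their transforms are integrable. -/
theorem ZSpace.exists_bound (η : ZSpace r) : ∃ C : ℝ, ∀ q, |η q| ≤ C := by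
  refine ⟨∫ w, ‖ZSpace.transform η w‖, fun q => ?_⟩
  rw [← Real.norm_eq_abs, ← Complex.norm_real, ZSpace.coe_eq, Real.fourierInv_eq]
  refine (norm_integral_le_integral_norm _).trans (le_of_eq ?_)
  simp only [Circle.norm_smul]

/-- The boundary values of the horizontal velocity components at the surface. -/
theorem hasTrace_fluidGrad (hr : r < 1) (η : ZSpace r) (u : HStar 2) (i : Fin 3) (j : Fin 2) :
    HasTrace (fun p => u.grad i p - planeDeriv j η p.1 * u.grad 1 p)
      (fun q => traceOp i u q - planeDeriv j η q * traceOp 1 u q) := by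
  have h := ((traceRel_traceOp i u).sub ((traceRel_traceOp 1 u).mul (slope hr j η))).hasTrace
    (μ := fun _ => 1) (C := 1) measurable_const (by simp)
  refine h.congr ?_ ?_
  · filter_upwards [Lp.coeFn_sub (u.grad i) (halfMul (slope hr j η) (u.grad 1)),
      coeFn_halfMul (slope hr j η) (u.grad 1)] with p a b
    rw [one_mul, a, Pi.sub_apply, b, slope_apply]
  · filter_upwards [Lp.coeFn_sub (Sobolev.toL2 (traceOp i u))
        (planeMul (slope hr j η) (Sobolev.toL2 (traceOp 1 u))),
      coeFn_planeMul (slope hr j η) (Sobolev.toL2 (traceOp 1 u))] with p a b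
    rw [one_mul, a, Pi.sub_apply, b, slope_apply]

theorem integrableOn_of_halfL2 (f : HalfL2) {K : Set Space} (hK : IsCompact K) (hs : K ⊆ halfSpace) :
    IntegrableOn f K := by
  have h := ((Lp.memLp f).locallyIntegrable one_le_two).integrableOn_isCompact hK
  unfold IntegrableOn at h ⊢
  rwa [Measure.restrict_restrict_of_subset hs] at h

/-- The problem in the fluid domain is equivalent to the flattened one: the flattening map preserves
the measure and transforms the Dirichlet form of the fluid domain into that of the flattened
problem, and the conormal derivatives agree. -/
theorem solvesFluid_iff (hr : r < 1) (η : ZSpace r) (ξ : PlaneL2) (u : HStar 2) :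
    SolvesFluid η ξ u ↔ SolvesFlat η ξ u := by
  have hη := ZSpace.contDiff_one hr η
  have hm : ∀ j, Continuous (planeDeriv j η) := fun j =>
    (hη.continuous_fderiv one_ne_zero).clm_apply continuous_const
  set Φ := shear hη.continuous with hΦ
  have hgrad : ∀ i, (fun p : Space => fluidGrad η u i (p.1, p.2 + η p.1)) =
      ![fun p => u.grad 0 p - planeDeriv 0 η p.1 * u.grad 1 p, fun p => u.grad 1 p,
        fun p => u.grad 2 p - planeDeriv 1 η p.1 * u.grad 1 p] i := by
    intro i
    funext p
    fin_cases i <;> simp [fluidGrad]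
  rw [solvesFlat_iff hr, isWeakSol_iff]
  set W := gradField 2 u - forcing hr η (gradField 2 u) with hW
  have hWae : ∀ i, (fun p => u.grad i p - flatForcing η u i p) =ᵐ[halfVol] W i := by
    intro i
    filter_upwards [forcing_ae hr η u i, Lp.coeFn_sub (gradField 2 u i)
      (forcing hr η (gradField 2 u) i)] with p a b
    rw [← a]
    exact b.symm
  have hWint : ∀ {ψ : Space → ℝ}, IsTest Set.univ ψ → inner ℝ W (gradTest ψ) =
      ∫ p in halfSpace, ∑ i, (u.grad i p - flatForcing η u i p) * spaceDeriv i ψ p := by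
    intro ψ hψ
    rw [inner_vfield_gradTest _ hψ]
    refine integral_congr_ae ?_
    filter_upwards [hWae 0, hWae 1, hWae 2] with p a b c
    simp only [Fin.sum_univ_three, a, b, c]
  have h1 : (∀ ψ : Space → ℝ, IsTest (fluidDomain η) ψ →
      ∫ p in fluidDomain η, ∑ i, fluidGrad η u i p * spaceDeriv i ψ p = 0) ↔
      ∀ ψ, IsTest halfSpace ψ → inner ℝ W (gradTest ψ) = 0 := by
    constructor
    · intro h ψ hψ
      have hψ1 : ContDiff ℝ 1 ψ := hψ.1.of_le (by exact_mod_cast le_top)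
      -- `ψ ∘ Φ⁻¹` is only of class `C¹`, which is why `integral_eq_zero_of_test` is needed.
      have hcomp : (ψ ∘ Φ.symm) ∘ Φ = ψ := by funext p; simp
      have h2 : ContDiff ℝ 1 (ψ ∘ Φ.symm) := hψ1.comp (contDiff_shear_symm hη)
      rw [hWint (hψ.mono (Set.subset_univ _)), ← hcomp, ← setIntegral_fluidGrad hη u h2]
      refine integral_eq_zero_of_test (isOpen_fluidDomain hη.continuous) (fun K hK hKs i => ?_) h h2
        (hψ.2.1.comp_homeomorph Φ.symm) ?_
      · have hpre : IsCompact (Φ ⁻¹' K) := Φ.isCompact_preimage.2 hK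
        have hpre' : Φ ⁻¹' K ⊆ halfSpace := by
          rw [← shear_preimage_fluidDomain hη.continuous]
          exact Set.preimage_mono hKs
        rw [← (measurePreserving_shear hη.continuous).integrableOn_comp_preimage
          Φ.measurableEmbedding]
        have hu := fun k => integrableOn_of_halfL2 (u.grad k) hpre hpre'
        have hmu : ∀ j, IntegrableOn (fun p => planeDeriv j η p.1 * u.grad 1 p) (Φ ⁻¹' K) :=
          fun j => (hu 1).continuousOn_mul ((hm j).comp continuous_fst).continuousOn hpre
        change IntegrableOn (fun p : Space => fluidGrad η u i (p.1, p.2 + η p.1)) _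
        rw [hgrad]
        fin_cases i
        · exact (hu 0).sub (hmu 0)
        · exact hu 1
        · exact (hu 2).sub (hmu 1)
      · rw [tsupport_comp_eq_preimage]
        intro p hp
        have h3 : Φ.symm p ∈ halfSpace := hψ.2.2 hp
        rw [← shear_preimage_fluidDomain hη.continuous] at h3
        have h4 : Φ (Φ.symm p) ∈ fluidDomain η := h3
        rwa [Φ.apply_symm_apply] at h4
    · intro h ψ hψ
      have hψ1 : ContDiff ℝ 1 ψ := hψ.1.of_le (by exact_mod_cast le_top)
      rw [setIntegral_fluidGrad hη u hψ1]
      refine integral_eq_zero_of_test isOpen_halfSpace (fun K hK hKs i => ?_) (fun φ hφ => ?_)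
        (hψ1.comp (contDiff_shear hη)) (hψ.2.1.comp_homeomorph Φ) ?_
      · refine (integrableOn_of_halfL2 (W i) hK hKs).congr ?_
        have h3 : (fun p => u.grad i p - flatForcing η u i p) =ᵐ[volume.restrict K] W i :=
          ae_restrict_of_ae_restrict_of_subset hKs (hWae i)
        exact h3.symm
      · rw [← hWint (hφ.mono (Set.subset_univ _)), h φ hφ]
      · rw [tsupport_comp_eq_preimage, ← shear_preimage_fluidDomain hη.continuous]
        exact Set.preimage_mono hψ.2.2
  have t0 := hasTrace_fluidGrad hr η u 0 0
  have t1 := hasTrace_grad 1 u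
  have t2 := hasTrace_fluidGrad hr η u 2 1
  unfold SolvesFluid HasTraceAtSurface
  rw [h1, hgrad 0, hgrad 1, hgrad 2]
  simp only [Matrix.cons_val_zero, Matrix.cons_val_one, Matrix.cons_val]
  have hcon : ∀ q, traceOp 1 u q - planeDeriv 0 η q * (traceOp 0 u q - planeDeriv 0 η q * traceOp 1 u q) -
      planeDeriv 1 η q * (traceOp 2 u q - planeDeriv 1 η q * traceOp 1 u q) =
      conormal η (traceOp 0 u) (traceOp 1 u) (traceOp 2 u) q := by
    intro q
    rw [conormal]
    ring
  refine and_congr_right fun _ => ⟨?_, fun h => ⟨?_, _, _, _, t0, t1, t2, ?_⟩⟩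
  · rintro ⟨-, a, b, c, ha, hb, hc, h⟩
    refine h.congr ?_
    filter_upwards [ha.unique t0, hb.unique t1, hc.unique t2] with q e0 e1 e2
    rw [e0, e1, e2, hcon]
  · intro ε hε
    obtain ⟨R, hR⟩ := u.tendsToZeroBelow 1 ε hε
    -- Since `η` is bounded, points far below in the fluid domain are images of points far below in
    -- `Σ`.
    obtain ⟨C, hC⟩ := ZSpace.exists_bound η
    refine ⟨R + C, ?_⟩
    have hmp : MeasurePreserving Φ.symm ((volume : Measure Space).restrict (fluidDomain η)) halfVol := by
      have h3 := ((measurePreserving_shear hη.continuous).symm Φ.toMeasurableEquiv).restrict_preimage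
        measurableSet_halfSpace
      have h4 : (Φ.toMeasurableEquiv.symm) ⁻¹' halfSpace = fluidDomain η := by
        ext p
        change p.2 - η p.1 < 0 ↔ p.2 < η p.1
        rw [sub_neg]
      rw [h4] at h3
      exact h3
    filter_upwards [hmp.quasiMeasurePreserving.ae hR] with p hp hpR
    refine hp ?_
    change p.2 - η p.1 < -R
    have := (abs_le.1 (hC p.1)).1
    linarith
  · simpa only [hcon] using h

/-! ### Multiplication by powers of `1 + η_x² + η_z²` -/

/-- The binomial series defines `x ↦ (1 + x) ^ a` near the origin of every Banach algebra. -/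
theorem exists_binomial (A : Type*) [NormedRing A] [NormedAlgebra ℝ A] [CompleteSpace A] (a : ℝ) :
    ∃ F : A → A, AnalyticAt ℝ F 0 ∧
      ∀ x : A, ‖x‖ < 1 → HasSum (fun n => Ring.choose a n • x ^ n) (F x) := by
  -- The coefficients are those of the scalar series, which has radius of convergence at least one.
  have hrad : 1 ≤ (binomialSeries A a).radius := by
    refine ENNReal.le_of_forall_nnreal_lt fun ρ hρ => ?_
    obtain ⟨C, hC, h⟩ := (binomialSeries ℝ a).norm_mul_pow_le_of_lt_radius
      (hρ.trans_le binomialSeries_radius_ge_one)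
    refine FormalMultilinearSeries.le_radius_of_eventually_le _ C ?_
    filter_upwards [eventually_gt_atTop 0] with n hn
    refine le_trans (mul_le_mul_of_nonneg_right ?_ (by positivity)) (h n)
    unfold binomialSeries
    rw [FormalMultilinearSeries.ofScalars_norm (E := ℝ)]
    exact FormalMultilinearSeries.ofScalars_norm_le A _ n hn
  have h := (binomialSeries A a).hasFPowerSeriesOnBall (zero_lt_one.trans_le hrad)
  refine ⟨(binomialSeries A a).sum, h.analyticAt, fun x hx => ?_⟩
  have h1 := h.hasSum (y := x) (by
    refine Metric.eball_subset_eball hrad ?_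
    rw [← ENNReal.ofReal_one, Metric.eball_ofReal]
    simpa using hx)
  simpa using h1

/-- The real binomial series. -/
theorem one_add_rpow_hasSum (a : ℝ) {x : ℝ} (hx : ‖x‖ < 1) :
    HasSum (fun n => Ring.choose a n • x ^ n) ((1 + x) ^ a) := by
  have h1 := (Real.one_add_rpow_hasFPowerSeriesOnBall_zero (a := a)).hasSum (y := x) (by
    rw [← ENNReal.ofReal_one, Metric.eball_ofReal]
    simpa using hx)
  simpa only [binomialSeries_apply, zero_add, List.ofFn_const, List.prod_replicate] using h1

/-- Multiplication by `(1 + η_x² + η_z²) ^ a` on `H^s(ℝ²)`, `s ≤ 2`, is an analytic function of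
`η ∈ 𝒵` near the origin. -/
theorem exists_rpowOp {r : ℝ} (hr : r < 1) {s : ℝ≥0} (hs : s ≤ 2) (a : ℝ) :
    ∃ M > 0, ∃ B : ZSpace r → Sobolev s →L[ℝ] Sobolev s, AnalyticAt ℝ B 0 ∧
      ∀ η, ‖η‖ < M → ∀ f : Sobolev s, Sobolev.toL2 (B η f) =ᵐ[volume] fun q =>
        (1 + planeDeriv 0 η q ^ 2 + planeDeriv 1 η q ^ 2) ^ a * f q := by
  obtain ⟨M0, hM0⟩ := ZSpace.exists_mulOp hr hs 0
  obtain ⟨M1, hM1⟩ := ZSpace.exists_mulOp hr hs 1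
  -- Multiplication by `η_x² + η_z²`, as an operator on `H^s` and as a bounded function. The
  -- binomial series of `Q η` is identified after embedding `H^s` in `L²`, where it is
  -- multiplication by the series of `b η`.
  let Q : ZSpace r → Sobolev s →L[ℝ] Sobolev s := fun η => M0 η * M0 η + M1 η * M1 η
  let b : ZSpace r → Plane →ᵇ ℝ := fun η =>
    slope hr 0 η * slope hr 0 η + slope hr 1 η * slope hr 1 η
  have hQ : AnalyticAt ℝ Q 0 := ((M0.analyticAt 0).mul (M0.analyticAt 0)).add
    ((M1.analyticAt 0).mul (M1.analyticAt 0))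
  have hQ0 : Q 0 = 0 := by simp [Q]
  have hb0 : b 0 = 0 := by simp [b]
  have hb : Continuous b := by fun_prop
  have hsmall : ∀ᶠ η in 𝓝 (0 : ZSpace r), ‖Q η‖ < 1 ∧ ‖b η‖ < 1 :=
    (hQ.continuousAt.norm.eventually_lt_const (by simp [hQ0])).and
      (hb.continuousAt.norm.eventually_lt_const (by simp [hb0]))
  obtain ⟨M, hM, hball⟩ := Metric.eventually_nhds_iff.1 hsmall
  obtain ⟨F, hF, hFs⟩ := exists_binomial (Sobolev s →L[ℝ] Sobolev s) a
  obtain ⟨G, -, hG⟩ := exists_binomial (Plane →ᵇ ℝ) a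
  refine ⟨M, hM, fun η => F (Q η), AnalyticAt.fun_comp (f := Q) (by rwa [hQ0]) hQ, fun η hη f => ?_⟩
  obtain ⟨h1, h2⟩ := hball (y := η) (by simpa using hη)
  have hQf : ∀ g : Sobolev s, Sobolev.toL2 (Q η g) = planeMul (b η) (Sobolev.toL2 g) := by
    intro g
    apply Lp.ext
    change Sobolev.toL2 (M0 η (M0 η g) + M1 η (M1 η g)) =ᵐ[volume] _
    rw [map_add]
    filter_upwards [hM0 η (M0 η g), hM0 η g, hM1 η (M1 η g), hM1 η g,
      coeFn_planeMul (b η) (Sobolev.toL2 g),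
      Lp.coeFn_add (Sobolev.toL2 (M0 η (M0 η g))) (Sobolev.toL2 (M1 η (M1 η g)))]
      with q e1 e2 e3 e4 e5 e6
    rw [e6, Pi.add_apply, e1, e2, e3, e4, e5]
    simp only [b, BoundedContinuousFunction.coe_add, BoundedContinuousFunction.coe_mul,
      Pi.add_apply, Pi.mul_apply, slope_apply]
    ring
  have hmul : ∀ μ ν : Plane →ᵇ ℝ, ∀ g, planeMul μ (planeMul ν g) = planeMul (μ * ν) g := by
    intro μ ν g
    apply Lp.ext
    filter_upwards [coeFn_planeMul μ (planeMul ν g), coeFn_planeMul ν g,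
      coeFn_planeMul (μ * ν) g] with q e1 e2 e3
    rw [e1, e2, e3, BoundedContinuousFunction.mul_apply, mul_assoc]
  have hpow : ∀ n, Sobolev.toL2 ((Q η ^ n) f) = planeMul (b η ^ n) (Sobolev.toL2 f) := by
    intro n
    induction n with
    | zero =>
      apply Lp.ext
      filter_upwards [coeFn_planeMul (b η ^ 0) (Sobolev.toL2 f)] with q e
      rw [e]
      simp
    | succ n ih => rw [pow_succ', pow_succ', ← hmul, ← ih, ← hQf]; rfl
  have hs1 := ((hFs _ h1).mapL (ContinuousLinearMap.apply ℝ (Sobolev s) f)).mapL (Sobolev.toL2L s)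
  have hs2 := (hG _ h2).mapL (planeMul.flip (Sobolev.toL2 f))
  simp only [map_smul, ContinuousLinearMap.apply_apply, Sobolev.toL2L_apply, hpow,
    ContinuousLinearMap.flip_apply] at hs1 hs2
  rw [hs1.unique hs2]
  filter_upwards [coeFn_planeMul (G (b η)) (Sobolev.toL2 f)] with q e
  rw [e]
  congr 1
  have hs3 := (hG _ h2).mapL (BoundedContinuousFunction.evalCLM ℝ q)
  simp only [map_smul, BoundedContinuousFunction.evalCLM_apply,
    BoundedContinuousFunction.coe_pow, Pi.pow_apply] at hs3
  rw [hs3.unique (one_add_rpow_hasSum a (((b η).norm_coe_le_norm q).trans_lt h2)), add_assoc]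
  simp only [b, BoundedContinuousFunction.coe_add, BoundedContinuousFunction.coe_mul,
    Pi.add_apply, Pi.mul_apply, slope_apply, sq]

/-! ### The boundary operators and the functionals -/

theorem analyticAt_clm_apply {E F G : Type*} [NormedAddCommGroup E] [NormedSpace ℝ E]
    [NormedAddCommGroup F] [NormedSpace ℝ F] [NormedAddCommGroup G] [NormedSpace ℝ G]
    {A : E → F →L[ℝ] G} {f : E → F} {x : E} (hA : AnalyticAt ℝ A x) (hf : AnalyticAt ℝ f x) :
    AnalyticAt ℝ (fun y => A y (f y)) x :=
  ((ContinuousLinearMap.id ℝ (F →L[ℝ] G)).analyticAt_bilinear (A x, f x)).comp₂ hA hf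

theorem analyticAt_clm_comp {E F G : Type*} [NormedAddCommGroup E] [NormedSpace ℝ E]
    [NormedAddCommGroup F] [NormedSpace ℝ F] [NormedAddCommGroup G] [NormedSpace ℝ G]
    (T : F →L[ℝ] G) {f : E → F} {x : E} (hf : AnalyticAt ℝ f x) :
    AnalyticAt ℝ (fun y => T (f y)) x :=
  (T.analyticAt (f x)).fun_comp (f := f) hf

/-- The analytic dependence of an expression of the form of `ℒ'`: quadratic in `k`, `l` and `w` up
to a linear operator `B`. -/
theorem analyticAt_quadratic {E F G : Type*} [NormedAddCommGroup E] [NormedSpace ℝ E]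
    [NormedAddCommGroup F] [NormedSpace ℝ F] [NormedAddCommGroup G] [NormedSpace ℝ G]
    (P : F →L[ℝ] F →L[ℝ] G) (J : F →L[ℝ] G) {B : E → G →L[ℝ] G} {k l w : E → F} {x : E}
    (hB : AnalyticAt ℝ B x) (hk : AnalyticAt ℝ k x) (hl : AnalyticAt ℝ l x)
    (hw : AnalyticAt ℝ w x) (a b c : ℝ) :
    AnalyticAt ℝ (fun y => a • P (k y) (k y) - b • P (l y) (l y) + c • B y (P (w y) (w y)) +
      J (k y)) x := by
  have hsq : ∀ {f : E → F}, AnalyticAt ℝ f x → AnalyticAt ℝ (fun y => P (f y) (f y)) x :=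
    fun hf => analyticAt_clm_apply (analyticAt_clm_comp P hf) hf
  exact (((analyticAt_const.smul (hsq hk)).sub (analyticAt_const.smul (hsq hl))).add
    (analyticAt_const.smul (analyticAt_clm_apply hB (hsq hw)))).add (analyticAt_clm_comp J hk)

theorem HasWeakPartial.congr_left {j : Fin 2} {f f' g : Plane → ℝ} (h : HasWeakPartial j f g)
    (e : f =ᵐ[volume] f') : HasWeakPartial j f' g :=
  ⟨h.1.congr e, h.2.1, fun ψ hψ => by
    rw [h.2.2 ψ hψ]
    exact congrArg _ (integral_congr_ae (e.mono fun q hq => by dsimp only; rw [hq]))⟩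

/-- `𝒦'(η) = η - ∂_x (B η_x) - ∂_z (B η_z)`, where `B` is multiplication by `(1 + η_x² + η_z²) ^
(-1/2)` on `H²(ℝ²)`. -/
theorem exists_kPrime (hr : r < 1) {ι : Sobolev 3 →L[ℝ] ZSpace r}
    (hι : ∀ f, ZSpace.transform (ι f) =ᵐ[volume] fourierReal (Sobolev.toL2 f))
    (hι' : ∀ f, (ι f : Plane → ℝ) =ᵐ[volume] f) :
    ∃ M > 0, ∃ KK : Sobolev 3 → Sobolev 1, AnalyticAt ℝ KK 0 ∧ KK 0 = 0 ∧
      ∀ η, ‖ι η‖ < M → IsKPrime (ι η) (KK η) := by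
  obtain ⟨M, hM, B, hB, hBf⟩ := exists_rpowOp hr (le_refl (2 : ℝ≥0)) (-(1 / 2))
  obtain ⟨J, hJ⟩ := exists_incl 3 1 (by norm_num)
  choose D hD using exists_partial 3 2 (by norm_num)
  choose D' hD' using exists_partial 2 1 (by norm_num)
  have hBι : AnalyticAt ℝ (fun η => B (ι η)) 0 :=
    AnalyticAt.fun_comp (f := ι) (by rwa [map_zero]) (ι.analyticAt 0)
  have hT : ∀ j, AnalyticAt ℝ (fun η => D' j (B (ι η) (D j η))) 0 := fun j =>
    analyticAt_clm_comp (D' j) (analyticAt_clm_apply hBι ((D j).analyticAt 0))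
  refine ⟨M, hM, fun η => J η - D' 0 (B (ι η) (D 0 η)) - D' 1 (B (ι η) (D 1 η)),
    ((J.analyticAt 0).sub (hT 0)).sub (hT 1), by simp, fun η hη => ?_⟩
  have hw : ∀ j, HasWeakPartial j (fun q => planeDeriv j (ι η) q /
      Real.sqrt (1 + planeDeriv 0 (ι η) q ^ 2 + planeDeriv 1 (ι η) q ^ 2))
      (D' j (B (ι η) (D j η))) := by
    intro j
    refine (hasWeakPartial_of_fourier (hD' j (B (ι η) (D j η)))).congr_left ?_
    filter_upwards [hBf (ι η) hη (D j η), Sobolev.planeDeriv_embedding hr (hι η) (hD j η)]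
      with q e1 e2
    rw [e1, ← e2, Real.rpow_neg (by positivity), ← Real.sqrt_eq_rpow, div_eq_inv_mul]
  refine ⟨_, _, hw 0, hw 1, ?_⟩
  rw [map_sub, map_sub, hJ]
  filter_upwards [hι' η, Lp.coeFn_sub (Sobolev.toL2 η) (Sobolev.toL2 (D' 0 (B (ι η) (D 0 η)))),
    Lp.coeFn_sub (Sobolev.toL2 η - Sobolev.toL2 (D' 0 (B (ι η) (D 0 η))))
      (Sobolev.toL2 (D' 1 (B (ι η) (D 1 η))))] with q e1 e2 e3
  rw [e3, Pi.sub_apply, e2, Pi.sub_apply, e1]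

/-- `ℒ'(η) = -k²/2 - l²/2 + B w² / 2 + k`, where `k = K(η) η`, `l = L(η) η` and `w = η_x - η_x k -
η_z l` lie in `H^{3/2}(ℝ²)`, their squares in `H¹(ℝ²)`, and `B` is multiplication by `(1 + η_x² +
η_z²)⁻¹` on `H¹(ℝ²)`. -/
theorem exists_lPrime (hr : r < 1) {ι : Sobolev 3 →L[ℝ] ZSpace r}
    (hι : ∀ f, ZSpace.transform (ι f) =ᵐ[volume] fourierReal (Sobolev.toL2 f))
    {K L : ZSpace r → Sobolev (5 / 2) →L[ℝ] Sobolev (3 / 2)} (hK : AnalyticAt ℝ K 0)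
    (hL : AnalyticAt ℝ L 0) :
    ∃ M > 0, ∃ LL : Sobolev 3 → Sobolev 1, AnalyticAt ℝ LL 0 ∧ LL 0 = 0 ∧
      ∀ η, ‖ι η‖ < M → (LL η : Plane → ℝ) =ᵐ[volume]
        lPrimeFormula (ι η) (K (ι η) (Sobolev.incl five_halves_le_three η))
          (L (ι η) (Sobolev.incl five_halves_le_three η)) := by
  have h1 : (1 : ℝ≥0) < 3 / 2 := by rw [← NNReal.coe_lt_coe]; norm_num
  have h2 : (3 / 2 : ℝ≥0) ≤ 2 := by rw [← NNReal.coe_le_coe]; norm_num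
  obtain ⟨M, hM, B, hB, hBf⟩ := exists_rpowOp hr (s := 1) (by norm_num) (-1)
  obtain ⟨P, hP⟩ := Sobolev.exists_mulOp h1
  obtain ⟨I, hI⟩ := exists_incl 3 (5 / 2) five_halves_le_three
  obtain ⟨J, hJ⟩ := exists_incl 2 (3 / 2) h2
  obtain ⟨J', hJ'⟩ := exists_incl (3 / 2) 1 h1.le
  choose D hD using exists_partial 3 2 (by norm_num)
  choose m hm using fun j => ZSpace.exists_mulOp hr h2 j
  have hII : ∀ η, Sobolev.incl five_halves_le_three η = I η := fun η =>
    Sobolev.toL2_injective (hI η).symm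
  have hι0 := ι.analyticAt 0
  let k : Sobolev 3 → Sobolev (3 / 2) := fun η => K (ι η) (I η)
  let l : Sobolev 3 → Sobolev (3 / 2) := fun η => L (ι η) (I η)
  let w : Sobolev 3 → Sobolev (3 / 2) := fun η => J (D 0 η) - m 0 (ι η) (k η) - m 1 (ι η) (l η)
  have hk : AnalyticAt ℝ k 0 :=
    analyticAt_clm_apply (AnalyticAt.fun_comp (f := ι) (by rwa [map_zero]) hι0) (I.analyticAt 0)
  have hl : AnalyticAt ℝ l 0 :=
    analyticAt_clm_apply (AnalyticAt.fun_comp (f := ι) (by rwa [map_zero]) hι0) (I.analyticAt 0)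
  have hw : AnalyticAt ℝ w 0 :=
    (((J ∘L D 0).analyticAt 0).sub (analyticAt_clm_apply ((m 0 ∘L ι).analyticAt 0) hk)).sub
      (analyticAt_clm_apply ((m 1 ∘L ι).analyticAt 0) hl)
  have hBι : AnalyticAt ℝ (fun η => B (ι η)) 0 :=
    AnalyticAt.fun_comp (f := ι) (by rwa [map_zero]) hι0
  refine ⟨M, hM, fun η => (-(1 / 2) : ℝ) • P (k η) (k η) - (1 / 2 : ℝ) • P (l η) (l η) +
    (1 / 2 : ℝ) • B (ι η) (P (w η) (w η)) + J' (k η), ?_, ?_, fun η hη => ?_⟩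
  · exact analyticAt_quadratic P J' hBι hk hl hw _ _ _
  · simp [k, l, w]
  · have hwae : w η =ᵐ[volume] fun q => planeDeriv 0 (ι η) q - planeDeriv 0 (ι η) q * k η q -
        planeDeriv 1 (ι η) q * l η q := by
      simp only [w, map_sub, hJ]
      filter_upwards [Sobolev.planeDeriv_embedding hr (hι η) (hD 0 η), hm 0 (ι η) (k η),
        hm 1 (ι η) (l η), Lp.coeFn_sub (Sobolev.toL2 (D 0 η)) (Sobolev.toL2 (m 0 (ι η) (k η))),
        Lp.coeFn_sub (Sobolev.toL2 (D 0 η) - Sobolev.toL2 (m 0 (ι η) (k η)))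
          (Sobolev.toL2 (m 1 (ι η) (l η)))] with q e1 e2 e3 e4 e5
      rw [e5, Pi.sub_apply, e4, Pi.sub_apply, ← e1, e2, e3]
    simp only [hII, map_add, map_sub, map_smul, hJ']
    set a := Sobolev.toL2 (P (k η) (k η))
    set b := Sobolev.toL2 (P (l η) (l η))
    set c := Sobolev.toL2 (B (ι η) (P (w η) (w η)))
    filter_upwards [hwae, hP (k η) (k η), hP (l η) (l η), hP (w η) (w η),
      hBf (ι η) hη (P (w η) (w η)),
      Lp.coeFn_add ((-(1 / 2) : ℝ) • a - (1 / 2 : ℝ) • b + (1 / 2 : ℝ) • c) (Sobolev.toL2 (k η)),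
      Lp.coeFn_add ((-(1 / 2) : ℝ) • a - (1 / 2 : ℝ) • b) ((1 / 2 : ℝ) • c),
      Lp.coeFn_sub ((-(1 / 2) : ℝ) • a) ((1 / 2 : ℝ) • b),
      Lp.coeFn_smul (-(1 / 2) : ℝ) a, Lp.coeFn_smul (1 / 2 : ℝ) b, Lp.coeFn_smul (1 / 2 : ℝ) c]
      with q e1 e2 e3 e4 e5 e6 e7 e8 e9 e10 e11
    have hpos : 0 < 1 + planeDeriv 0 (ι η) q ^ 2 + planeDeriv 1 (ι η) q ^ 2 := by positivity
    rw [e6, Pi.add_apply, e7, Pi.add_apply, e8, Pi.sub_apply, e9, e10, e11]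
    simp only [Pi.smul_apply, smul_eq_mul, a, b, c, e2, e3, e5, e4, e1, lPrimeFormula,
      Real.rpow_neg_one]
    change _ = -(1 / 2) * k η q ^ 2 - 1 / 2 * l η q ^ 2 + (planeDeriv 0 (ι η) q -
      planeDeriv 0 (ι η) q * k η q - planeDeriv 1 (ι η) q * l η q) ^ 2 / _ + k η q
    field_simp

end WaterWave

open WaterWave in
theorem mainTheorem4 (r : ℝ) (hr : 0 < r) (hr' : r < 1 / 5) :
    ∃ M : ℝ, 0 < M ∧
      (∀ η : ZSpace r, ‖η‖ < M → ∀ ξ : Sobolev (5 / 2), ∃! u : HStar 2, SolvesFlat η ξ u) ∧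
      (∀ η : ZSpace r, ‖η‖ < M → ∀ ξ : Sobolev (5 / 2), ∃! u : HStar 2, SolvesFluid η ξ u) ∧
      ∃ (S : ZSpace r → Sobolev (5 / 2) →L[ℝ] HStar 2)
        (K L : ZSpace r → Sobolev (5 / 2) →L[ℝ] Sobolev (3 / 2)),
        (∀ η : ZSpace r, ‖η‖ < M → ∀ ξ : Sobolev (5 / 2),
          SolvesFlat η ξ (S η ξ) ∧ SolvesFluid η ξ (S η ξ) ∧
          HasTrace ((S η ξ).grad 0) (fun q => -(K η ξ) q) ∧
          HasTrace ((S η ξ).grad 2) (fun q => -(L η ξ) q)) ∧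
        AnalyticAt ℝ S 0 ∧ AnalyticAt ℝ K 0 ∧ AnalyticAt ℝ L 0 ∧
        ∃ (ι : Sobolev 3 →L[ℝ] ZSpace r) (KK LL : Sobolev 3 → Sobolev 1),
          (∀ η : Sobolev 3, (ι η : Plane → ℝ) =ᵐ[MeasureTheory.volume] (η : Plane → ℝ)) ∧
          (∀ η : Sobolev 3, ‖ι η‖ < M →
            IsKPrime (ι η) (KK η) ∧
            (LL η : Plane → ℝ) =ᵐ[MeasureTheory.volume]
              lPrimeFormula (ι η) (K (ι η) (Sobolev.incl five_halves_le_three η))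
                (L (ι η) (Sobolev.incl five_halves_le_three η))) ∧
          AnalyticAt ℝ KK 0 ∧ AnalyticAt ℝ LL 0 ∧ KK 0 = 0 ∧ LL 0 = 0 := by
  have hr1 : r < 1 := by linarith
  obtain ⟨M₀, hM₀, S, hS, hSol⟩ := exists_solutionOperator hr1
  let T : Fin 3 → ZSpace r → Sobolev (5 / 2) →L[ℝ] Sobolev (3 / 2) := fun i η =>
    -(traceOp i ∘L S η)
  have hT : ∀ i, AnalyticAt ℝ (T i) 0 := fun i =>
    (analyticAt_clm_comp (ContinuousLinearMap.compL ℝ (Sobolev (5 / 2)) (HStar 2) (Sobolev (3 / 2))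
      (traceOp i)) hS).neg
  have htrace : ∀ i η ξ, HasTrace ((S η ξ).grad i) (fun q => -(T i η ξ) q) := by
    intro i η ξ
    refine (hasTrace_grad i (S η ξ)).congr (Filter.EventuallyEq.refl _ _) ?_
    have e : Sobolev.toL2 (T i η ξ) = -Sobolev.toL2 (traceOp i (S η ξ)) := by
      rw [← map_neg]
      rfl
    rw [e]
    filter_upwards [MeasureTheory.Lp.coeFn_neg (Sobolev.toL2 (traceOp i (S η ξ)))] with q hq
    rw [hq, Pi.neg_apply, neg_neg]
  obtain ⟨ι, hι, hι'⟩ := Sobolev.exists_embedding hr1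
  obtain ⟨M₁, hM₁, KK, hKK, hKK0, hKP⟩ := exists_kPrime hr1 hι hι'
  obtain ⟨M₂, hM₂, LL, hLL, hLL0, hLP⟩ := exists_lPrime hr1 hι (hT 0) (hT 2)
  have hflat : ∀ η : ZSpace r, ‖η‖ < M₀ → ∀ (ξ : Sobolev (5 / 2)) (u : HStar 2),
      SolvesFlat η ξ u ↔ u = S η ξ := fun η hη ξ u =>
    (solvesFlat_iff hr1 η (Sobolev.toL2 ξ) u).trans (hSol η hη ξ u)
  have hfluid : ∀ η : ZSpace r, ‖η‖ < M₀ → ∀ (ξ : Sobolev (5 / 2)) (u : HStar 2),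
      SolvesFluid η ξ u ↔ u = S η ξ := fun η hη ξ u =>
    (solvesFluid_iff hr1 η (Sobolev.toL2 ξ) u).trans (hflat η hη ξ u)
  have hM : ∀ {x : ℝ}, x < min M₀ (min M₁ M₂) → x < M₀ ∧ x < M₁ ∧ x < M₂ := fun hx =>
    ⟨(lt_min_iff.1 hx).1, lt_min_iff.1 (lt_min_iff.1 hx).2⟩
  refine ⟨min M₀ (min M₁ M₂), lt_min hM₀ (lt_min hM₁ hM₂),
    fun η hη ξ => ⟨S η ξ, (hflat η (hM hη).1 ξ _).2 rfl, fun u => (hflat η (hM hη).1 ξ u).1⟩,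
    fun η hη ξ => ⟨S η ξ, (hfluid η (hM hη).1 ξ _).2 rfl, fun u => (hfluid η (hM hη).1 ξ u).1⟩,
    S, T 0, T 2, fun η hη ξ => ⟨(hflat η (hM hη).1 ξ _).2 rfl, (hfluid η (hM hη).1 ξ _).2 rfl,
      htrace 0 η ξ, htrace 2 η ξ⟩, hS, hT 0, hT 2, ι, KK, LL, hι',
    fun η hη => ⟨hKP η (hM hη).2.1, hLP η (hM hη).2.2⟩, hKK, hLL, hKK0, hLL0⟩
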